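/- Let $0<q<1$, let $a,b,c\in\mathbb C$ and $d,\alpha\in\mathbb R$ satisfy $$\max\big(|a|,|b|,|c|,|q/d|\big)<1,\qquad \alpha^2<1,\qquad \alpha d>0,$$ where $a,b,c$ are all real, or two of them are complex conjugates of each other and the third is real. Assume also $(abc/\alpha;q)_\infty\neq0$. Put $(x;q)_n=\prod_{k=0}^{n-1}(1-xq^k)$ for $0\le n\le\infty$, $(x_1,\dots,x_r;q)_n=\prod_i (x_i;q)_n$, $\eta=\frac12(\alpha+\alpha^{-1})$ and, for real $\nu$, $$v_\nu(\eta;a,b,c;d)=\frac{\left(\frac{q\alpha}{d},\frac{q^{1-\nu}}{\alpha d},\frac{abcq^{\nu}}{\alpha};q\right)_\infty}{\left(\frac{abc}{\alpha};q\right)_\infty}\sum_{m=0}^\infty \frac{\left(1-\frac{abc}{\alpha}q^{2m-1}\right)\left(\frac{abc}{q\alpha},q^{-\nu},abcdq^{\nu-1},\frac a\alpha,\frac b\alpha,\frac c\alpha;q\right)_m}{\left(1-\frac{abc}{q\alpha}\right)\left(q,\frac{abcq^{\nu}}{\alpha},\frac{q^{1-\nu}}{\alpha d},ab,ac,bc;q\right)_m}\left(\frac{q\alpha}{d}\right)^m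 ,$$ the removable singularities, where a denominator vanishes, being removed: the quotients $(x;q)_\infty/(x;q)_m$ with $x=q^{1-\nu}/(\alpha d)$ or $x=abcq^\nu/\alpha$ are read as $(xq^m;q)_\infty$, and $(A;q)_m/(1-A)$ with $A=abc/(q\alpha)$ is read as $(qA;q)_{m-1}$ for $m\ge1$ (the $m=0$ summand being $1$). The sum is the very-well-poised series ${}_8\varphi_7$. Then the positive zeros of $\nu\mapsto v_\nu(\eta;a,b,c;d)$ form an infinite set that can be arranged in a sequence $\nu_1<\nu_2<\nu_3<\cdots$ in ascending order, and there is an integer $k$ such that $$\nu_n=n+k-\frac{\log(\alpha d)}{\log q}+o(1)\qquad(n\to\infty).$$ If moreover $q^{1/2}<|\alpha|$ and $\alpha d>q$, then this holds with $k=0$: $$\nu_n=n-\frac{\log(\alpha d)}{\log q}+o(1)\qquad(n\to\infty).$$ -/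

import Mathlib

/-- The finite `q`-shifted factorial `(x; q)_n = ∏_{k=0}^{n-1} (1 - x q^k)`. -/
noncomputable def qPoch (q : ℝ) (x : ℂ) (n : ℕ) : ℂ :=
  ∏ k ∈ Finset.range n, (1 - x * (q : ℂ) ^ k)

/-- The infinite `q`-shifted factorial `(x; q)_∞ = ∏_{k=0}^∞ (1 - x q^k)`, for `0 < q < 1`. -/
noncomputable def qPochInf (q : ℝ) (x : ℂ) : ℂ :=
  ∏' k : ℕ, (1 - x * (q : ℂ) ^ k)

/-- The basic hypergeometric series `_{r+1}φ_r` with upper parameters `as` (a list of length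
`r + 1`), lower parameters `bs` (a list of length `r`), base `q` and argument `z`. -/
noncomputable def basicHypergeometric (as bs : List ℂ) (q : ℝ) (z : ℂ) : ℂ :=
  ∑' m : ℕ, (as.map fun x => qPoch q x m).prod /
    ((((q : ℂ) :: bs).map fun x => qPoch q x m).prod) * z ^ m

/-- The very-well-poised factor `(1 - A q^{2m}) (A; q)_m / (1 - A)` with `A = B / q`, written so
that it is also correct for `A = 1`. -/
noncomputable def vwpFactor (q : ℝ) (B : ℂ) (m : ℕ) : ℂ :=
  if m = 0 then 1 else (1 - B * (q : ℂ) ^ (2 * m - 1)) * qPoch q B (m - 1)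

/-- The boundary function `ν ↦ v_ν(η; a, b, c; d)`, `η = (α + α⁻¹) / 2`, as a function of the
real variable `ν`.  With `B = a b c / α` it is
`(qα/d, q^{1-ν}/(αd), B q^ν; q)_∞ / (B; q)_∞` times the very-well-poised series
`₈φ₇` with upper parameters
`B/q, q√(B/q), -q√(B/q), q^{-ν}, abcd q^{ν-1}, a/α, b/α, c/α`, lower parameters
`√(B/q), -√(B/q), B q^ν, q^{1-ν}/(αd), ab, ac, bc`, base `q` and argument `qα/d`.
The quotients `(x; q)_∞ / (x; q)_m` for `x = q^{1-ν}/(αd)` and `x = B q^ν` are written as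
`(x q^m; q)_∞`, which is their value wherever `(x; q)_m ≠ 0` and removes the removable
singularities at the other `ν`; compare `boundaryFun_eq`. -/
noncomputable def boundaryFun (q : ℝ) (a b c : ℂ) (d α ν : ℝ) : ℂ :=
  qPochInf q ((q * α / d : ℝ) : ℂ) / qPochInf q (a * b * c / α) *
    ∑' m : ℕ,
      vwpFactor q (a * b * c / α) m
        * (qPoch q ((q ^ (-ν) : ℝ) : ℂ) m
          * qPoch q (a * b * c * d * ((q ^ (ν - 1) : ℝ) : ℂ)) m
          * qPoch q (a / α) m * qPoch q (b / α) m * qPoch q (c / α) m)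
        / (qPoch q (q : ℂ) m * qPoch q (a * b) m * qPoch q (a * c) m * qPoch q (b * c) m)
        * qPochInf q (((q ^ (1 - ν) / (α * d) : ℝ) : ℂ) * (q : ℂ) ^ m)
        * qPochInf q (a * b * c / α * ((q ^ ν : ℝ) : ℂ) * (q : ℂ) ^ m)
        * ((q * α / d : ℝ) : ℂ) ^ m

theorem qPoch_ne_zero {q : ℝ} {x : ℂ} (h : ∀ k : ℕ, x * (q : ℂ) ^ k ≠ 1) (m : ℕ) :
    qPoch q x m ≠ 0 := by
  unfold qPoch
  exact Finset.prod_ne_zero_iff.mpr fun k _ => sub_ne_zero.mpr (h k).symm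

theorem qPochInf_eq_mul {q : ℝ} (hq0 : 0 < q) (hq1 : q < 1) (x : ℂ) (m : ℕ) :
    qPochInf q x = qPoch q x m * qPochInf q (x * (q : ℂ) ^ m) := by
  have hs : ∀ y : ℂ, Multipliable fun k : ℕ => 1 - y * (q : ℂ) ^ k := by
    intro y
    have h1 : Summable fun k : ℕ => ‖-(y * (q : ℂ) ^ k)‖ := by
      have : (fun k : ℕ => ‖-(y * (q : ℂ) ^ k)‖) = fun k => ‖y‖ * q ^ k := by
        funext k
        simp [abs_of_pos hq0]
      rw [this]
      exact (summable_geometric_of_lt_one hq0.le hq1).mul_left _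
    simpa [sub_eq_add_neg] using multipliable_one_add_of_summable h1
  induction m with
  | zero => simp [qPoch]
  | succ m ih =>
    have h2 : qPochInf q (x * (q : ℂ) ^ m)
        = (1 - x * (q : ℂ) ^ m) * qPochInf q (x * (q : ℂ) ^ (m + 1)) := by
      have h3 : Multipliable fun k : ℕ => 1 - x * (q : ℂ) ^ m * (q : ℂ) ^ (k + 1) := by
        have he : (fun k : ℕ => 1 - x * (q : ℂ) ^ m * (q : ℂ) ^ (k + 1))
            = fun k : ℕ => 1 - x * (q : ℂ) ^ (m + 1) * (q : ℂ) ^ k := by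
          funext k
          ring
        rw [he]
        exact hs _
      unfold qPochInf
      rw [tprod_eq_zero_mul' (f := fun k : ℕ => 1 - x * (q : ℂ) ^ m * (q : ℂ) ^ k) h3,
        pow_zero, mul_one]
      refine congrArg _ (tprod_congr fun k => ?_)
      ring
    have h4 : qPoch q x (m + 1) = qPoch q x m * (1 - x * (q : ℂ) ^ m) :=
      Finset.prod_range_succ _ _
    rw [ih, h2, h4, mul_assoc]

theorem vwpFactor_eq {q : ℝ} {A s : ℂ} (hs : s ^ 2 = A)
    (hA : ∀ k : ℕ, A * (q : ℂ) ^ k ≠ 1) (m : ℕ) :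
    qPoch q A m * qPoch q (q * s) m * qPoch q (-(q * s)) m / (qPoch q s m * qPoch q (-s) m)
      = vwpFactor q (A * q) m := by
  have hsq : ∀ k : ℕ, (1 - s * (q : ℂ) ^ k) * (1 - -s * (q : ℂ) ^ k) ≠ 0 := by
    intro k h
    apply hA (2 * k)
    rw [← hs]
    linear_combination -h
  have hs1 : qPoch q s m ≠ 0 := by
    refine qPoch_ne_zero (fun k h => hsq k ?_) m
    rw [h]; ring
  have hs2 : qPoch q (-s) m ≠ 0 := by
    refine qPoch_ne_zero (fun k h => hsq k ?_) m
    rw [h]; ring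
  rw [div_eq_iff (mul_ne_zero hs1 hs2)]
  clear hs1 hs2
  rcases m with _ | m
  · simp [qPoch, vwpFactor]
  have key : ∀ n : ℕ, (1 - A) * (qPoch q (q * s) n * qPoch q (-(q * s)) n)
      = (1 - A * (q : ℂ) ^ (2 * n)) * (qPoch q s n * qPoch q (-s) n) := by
    intro n
    induction n with
    | zero => simp [qPoch]
    | succ n ih =>
      simp only [qPoch, Finset.prod_range_succ] at ih ⊢
      rw [← hs] at ih ⊢
      linear_combination
        (1 - q * s * (q : ℂ) ^ n) * (1 - -(q * s) * (q : ℂ) ^ n) * ih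
  have hshift : qPoch q A (m + 1) = (1 - A) * qPoch q (A * q) m := by
    unfold qPoch
    rw [Finset.prod_range_succ', mul_comm]
    congr 1
    · simp
    · refine Finset.prod_congr rfl fun k _ => ?_
      ring
  have h := key (m + 1)
  rw [hshift]
  have he : A * (q : ℂ) * (q : ℂ) ^ (2 * (m + 1) - 1) = A * (q : ℂ) ^ (2 * (m + 1)) := by
    have : 2 * (m + 1) - 1 = 2 * m + 1 := by omega
    rw [this]; ring
  simp only [vwpFactor, Nat.succ_ne_zero, if_false, Nat.add_sub_cancel, he]
  linear_combination qPoch q (A * q) m * h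

/-- Wherever no denominator vanishes, `boundaryFun` is literally the product of infinite
`q`-shifted factorials with the very-well-poised `₈φ₇` series. -/
theorem boundaryFun_eq {q : ℝ} (hq0 : 0 < q) (hq1 : q < 1) (a b c : ℂ) (d α ν : ℝ) (s : ℂ)
    (hs : s ^ 2 = a * b * c / (q * α))
    (h1 : ∀ k : ℕ, a * b * c / (q * α) * (q : ℂ) ^ k ≠ 1)
    (h2 : ∀ k : ℕ, a * b * c / α * ((q ^ ν : ℝ) : ℂ) * (q : ℂ) ^ k ≠ 1)
    (h3 : ∀ k : ℕ, ((q ^ (1 - ν) / (α * d) : ℝ) : ℂ) * (q : ℂ) ^ k ≠ 1) :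
    boundaryFun q a b c d α ν =
      qPochInf q ((q * α / d : ℝ) : ℂ) * qPochInf q ((q ^ (1 - ν) / (α * d) : ℝ) : ℂ)
        * qPochInf q (a * b * c / α * ((q ^ ν : ℝ) : ℂ)) / qPochInf q (a * b * c / α)
      * basicHypergeometric
          [a * b * c / (q * α), q * s, -(q * s), ((q ^ (-ν) : ℝ) : ℂ),
            a * b * c * d * ((q ^ (ν - 1) : ℝ) : ℂ), a / α, b / α, c / α]
          [s, -s, a * b * c / α * ((q ^ ν : ℝ) : ℂ), ((q ^ (1 - ν) / (α * d) : ℝ) : ℂ),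
            a * b, a * c, b * c]
          q ((q * α / d : ℝ) : ℂ) := by
  have hq : (q : ℂ) ≠ 0 := by exact_mod_cast hq0.ne'
  have hB : a * b * c / (q * α) * (q : ℂ) = a * b * c / α := by
    rw [div_mul_eq_mul_div, mul_comm (q : ℂ) (α : ℂ), mul_div_mul_right _ _ hq]
  have hquot : ∀ x : ℂ, (∀ k : ℕ, x * (q : ℂ) ^ k ≠ 1) → ∀ m : ℕ,
      qPochInf q (x * (q : ℂ) ^ m) = qPochInf q x / qPoch q x m := fun x hx m =>
    (eq_div_iff (qPoch_ne_zero hx m)).mpr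
      ((mul_comm _ _).trans (qPochInf_eq_mul hq0 hq1 x m).symm)
  have hC : ∀ C P Q D S : ℂ, C * P * Q / D * S = C / D * (P * Q * S) := by
    intros; ring
  rw [hC]
  unfold boundaryFun basicHypergeometric
  rw [← tsum_mul_left (a := qPochInf q ((q ^ (1 - ν) / (α * d) : ℝ) : ℂ) * _)]
  refine congrArg _ (tsum_congr fun m => ?_)
  rw [hquot _ h3, hquot _ h2, ← hB, ← vwpFactor_eq hs h1 m, hB]
  simp only [List.map_cons, List.map_nil, List.prod_cons, List.prod_nil, mul_one]
  simp only [div_eq_mul_inv, mul_inv]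
  ring

open Filter Topology Complex

/-! ### Products with geometrically decaying factors -/

/-! Put t = q^{-ν}, e = q/d, κ = abc. The ν-dependent factors pair up: (1 - t q^k)(e - κ q^k/t) = (1
- q^k)(e - κ q^k) - q^k Y with Y = (t - 1)(e - κ/t), and the two infinite products combine in the
same way. Up to a nonzero constant the boundary function is thus H(Y) with H entire
(`boundaryFun_eq_spectralFun`, `differentiable_spectralFun`), and Y is an eventually increasing
function of ν, asymptotic to e q^{-ν}. Reversing the signs of a, b, c, d, α together changes
nothing, so α and d may be taken positive.

Large zeros. At Y = s q^{-N} each factor with k < N is dominated by its Y-term. After division by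
these N dominant terms, H(s q^{-N}) converges, locally uniformly in s ≠ 0, to S · (s/α, qα/s; q)_∞,
where S is the sum of a very-well-poised ₆φ₅ series (`tendsto_spectralFun_div_scale`). S is nonzero,
since a contiguous relation shifts the parameters a, b, c to zero one after the other and leaves ∑
α^{2m}/(q; q)_m (`sixPhiFive_ne_zero`). On α√q ≤ |s| ≤ α/√q, a fundamental domain of s ↦ qs, the
theta function has the simple zero s = α and no other. Since H is real on the real axis, a real form
of Hurwitz's theorem (`eventually_existsUnique_real_zero`) gives exactly one real zero of H in each
window q^{-N} [α√q, α/√q] with N large, and it is asymptotic to α q^{-N}; in terms of ν this is N -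
log(α/e)/log q + o(1). Only finitely many positive zeros ν remain, and their number fixes the
integer k (`exists_zero_enumeration`).

The value k = 0. Let √q < α and e < α. Then H(Y) is a nonzero constant times U_Y(α), where U_Y(z) =
∑ F_n(Y) Q_n(z + 1/z), F_n(Y) = ∏_{k<n} ((1 - q^k)(e - κ q^k) - q^k Y), and Q_n are continuous dual
q-Hahn polynomials (`spectralFun_eq_dualSeries`). For |e| < q the function U_Y is an eigenfunction,
with eigenvalue Y, of a second order q-difference operator (`dualSeries_qDifference`). With a
suitable positive weight W on the unit circle the operator is symmetric up to a contour shift from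
|z| = 1 to |z| = q^{-1/2}; the only pole met is 1/α, and it is cancelled when the test function
vanishes at α (`weighted_bilinear_form`). Hence Y ∫ W U_Y (U_{Y'} - U_{Y'}(α)) is symmetric in Y and
Y', and analytic continuation in e extends this to |e| < α (`dualSeries_symmetry`). The zeros of Y ↦
U_Y(α) therefore behave like Sturm-Liouville eigenvalues: they are real, simple, and also positive
(`ConjInvariant.dualSeries_zero_real`, `ConjInvariant.deriv_dualSeries_ne_zero`,
`ConjInvariant.dualSeries_zero_pos`).

So all complex zeros of H are positive and correspond to the positive zeros ν. The mean of log|H|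
over |Y| = α q^{-N-1/2} is -log q (N²/2 + N) + O(1) by the asymptotics above. Jensen's formula
expresses the same mean through the zeros y_n ~ α q^{-(n+k)}; a nonzero k would produce an error
growing linearly in N (`index_eq_zero_of_counting`). -/

theorem sum_geometric_le {q M : ℝ} (hq0 : 0 < q) (hq1 : q < 1) (hM : 0 ≤ M) (n : ℕ) :
    ∑ k ∈ Finset.range n, M * q ^ k ≤ M / (1 - q) := by
  rw [← Finset.mul_sum, div_eq_mul_inv, ← tsum_geometric_of_lt_one hq0.le hq1]
  exact mul_le_mul_of_nonneg_left
    ((summable_geometric_of_lt_one hq0.le hq1).sum_le_tsum _ fun i _ => by positivity) hM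

theorem norm_prod_le_exp_sum {β : Type*} (s : Finset β) (f : β → ℂ) (u : β → ℝ)
    (h : ∀ i ∈ s, ‖f i‖ ≤ 1 + u i) : ‖∏ i ∈ s, f i‖ ≤ Real.exp (∑ i ∈ s, u i) := by
  rw [Real.exp_sum, norm_prod]
  refine Finset.prod_le_prod (fun i _ => norm_nonneg _) fun i hi => (h i hi).trans ?_
  rw [add_comm]; exact Real.add_one_le_exp _

theorem norm_le_of_norm_sub_one_le {x : ℂ} {u : ℝ} (h : ‖x - 1‖ ≤ u) : ‖x‖ ≤ 1 + u := by
  have := norm_add_le (x - 1) 1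
  simp only [sub_add_cancel, norm_one] at this
  linarith

theorem multipliable_of_geometric {q M : ℝ} (hq0 : 0 < q) (hq1 : q < 1) {f : ℕ → ℂ}
    (h : ∀ k, ‖f k - 1‖ ≤ M * q ^ k) : Multipliable f := by
  have h1 : Summable fun k => ‖f k - 1‖ :=
    ((summable_geometric_of_lt_one hq0.le hq1).mul_left M).of_nonneg_of_le
      (fun _ => norm_nonneg _) h
  simpa using multipliable_one_add_of_summable h1

theorem norm_prod_range_le_of_geometric {q M : ℝ} (hq0 : 0 < q) (hq1 : q < 1) {f : ℕ → ℂ}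
    (h : ∀ k, ‖f k - 1‖ ≤ M * q ^ k) (n : ℕ) :
    ‖∏ k ∈ Finset.range n, f k‖ ≤ Real.exp (M / (1 - q)) := by
  have hM : 0 ≤ M := by simpa using (norm_nonneg _).trans (h 0)
  refine (norm_prod_le_exp_sum _ f (fun k => M * q ^ k)
    fun k _ => norm_le_of_norm_sub_one_le (h k)).trans ?_
  exact Real.exp_le_exp.mpr (sum_geometric_le hq0 hq1 hM n)

theorem norm_tprod_le_of_geometric {q M : ℝ} (hq0 : 0 < q) (hq1 : q < 1) {f : ℕ → ℂ}
    (h : ∀ k, ‖f k - 1‖ ≤ M * q ^ k) : ‖∏' k, f k‖ ≤ Real.exp (M / (1 - q)) :=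
  le_of_tendsto (multipliable_of_geometric hq0 hq1 h).hasProd.tendsto_prod_nat.norm
    (Eventually.of_forall fun n => norm_prod_range_le_of_geometric hq0 hq1 h n)

theorem tprod_ne_zero_of_geometric {q M : ℝ} (hq0 : 0 < q) (hq1 : q < 1) {f : ℕ → ℂ}
    (h : ∀ k, ‖f k - 1‖ ≤ M * q ^ k) (h0 : ∀ k, f k ≠ 0) : ∏' k, f k ≠ 0 := by
  have h1 : Summable fun k => ‖f k - 1‖ :=
    ((summable_geometric_of_lt_one hq0.le hq1).mul_left M).of_nonneg_of_le
      (fun _ => norm_nonneg _) h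
  simpa using tprod_one_add_ne_zero_of_summable (f := fun k => f k - 1) (by simpa using h0) h1

/-- Tannery's theorem for products. The filter is arbitrary, so that limits in (N, s) jointly, and
with them locally uniform limits, are covered. -/
theorem tendsto_tprod_of_geometric {α : Type*} {𝓕 : Filter α} {q M : ℝ} (hq0 : 0 < q)
    (hq1 : q < 1) {f : α → ℕ → ℂ} {g : ℕ → ℂ} (hlim : ∀ k, Tendsto (fun a => f a k) 𝓕 (𝓝 (g k)))
    (h : ∀ᶠ a in 𝓕, ∀ k, ‖f a k - 1‖ ≤ M * q ^ k) :
    Tendsto (fun a => ∏' k, f a k) 𝓕 (𝓝 (∏' k, g k)) := by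
  have := tendsto_tprod_one_add_of_dominated_convergence (𝓕 := 𝓕)
    (f := fun a k => f a k - 1) (g := fun k => g k - 1)
    ((summable_geometric_of_lt_one hq0.le hq1).mul_left M)
    (fun k => (hlim k).sub_const 1) h
  simpa using this

theorem continuousAt_tprod_of_geometric {X : Type*} [TopologicalSpace X] {q M : ℝ} (hq0 : 0 < q)
    (hq1 : q < 1) {f : ℕ → X → ℂ} {x : X} (hc : ∀ k, ContinuousAt (f k) x)
    (h : ∀ᶠ y in 𝓝 x, ∀ k, ‖f k y - 1‖ ≤ M * q ^ k) :
    ContinuousAt (fun y => ∏' k, f k y) x :=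
  tendsto_tprod_of_geometric hq0 hq1 (fun k => hc k) h

/-- The partial products tend to a nonzero limit, so all but finitely many exceed half its modulus,
and the remaining ones are nonzero. -/
theorem exists_pos_le_norm_prod_of_geometric {q M : ℝ} (hq0 : 0 < q) (hq1 : q < 1) {f : ℕ → ℂ}
    (h : ∀ k, ‖f k - 1‖ ≤ M * q ^ k) (h0 : ∀ k, f k ≠ 0) :
    ∃ c > 0, ∀ n, c ≤ ‖∏ k ∈ Finset.range n, f k‖ := by
  have hne := tprod_ne_zero_of_geometric hq0 hq1 h h0
  have ht := (multipliable_of_geometric hq0 hq1 h).hasProd.tendsto_prod_nat.norm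
  set P := ‖∏' k, f k‖ with hP
  have hPpos : 0 < P := norm_pos_iff.mpr hne
  obtain ⟨N, hN⟩ := eventually_atTop.mp (ht.eventually (lt_mem_nhds (half_lt_self hPpos)))
  have hfin : ∃ c > 0, ∀ n < N, c ≤ ‖∏ k ∈ Finset.range n, f k‖ := by
    clear hN
    induction N with
    | zero => exact ⟨1, one_pos, by simp⟩
    | succ N ih =>
      obtain ⟨c, hc, hcN⟩ := ih
      have hp : 0 < ‖∏ k ∈ Finset.range N, f k‖ :=
        norm_pos_iff.mpr (Finset.prod_ne_zero_iff.mpr fun k _ => h0 k)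
      refine ⟨min c _, lt_min hc hp, fun n hn => ?_⟩
      rcases Nat.lt_succ_iff_lt_or_eq.mp hn with h | rfl
      · exact (min_le_left _ _).trans (hcN n h)
      · exact min_le_right _ _
  obtain ⟨c, hc, hcN⟩ := hfin
  refine ⟨min c (P / 2), lt_min hc (half_pos hPpos), fun n => ?_⟩
  rcases lt_or_ge n N with h | h
  · exact (min_le_left _ _).trans (hcN n h)
  · exact (min_le_right _ _).trans (hN n h).le

theorem differentiableOn_tprod_of_geometric {q : ℝ} (hq0 : 0 < q)
    (hq1 : q < 1) {U : Set ℂ} (hU : IsOpen U) {f : ℕ → ℂ → ℂ}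
    (hd : ∀ k, DifferentiableOn ℂ (f k) U)
    (h : ∀ x ∈ U, ∃ M, ∀ᶠ y in 𝓝 x, ∀ k, ‖f k y - 1‖ ≤ M * q ^ k) :
    DifferentiableOn ℂ (fun y => ∏' k, f k y) U := by
  have key : TendstoLocallyUniformlyOn (fun n y => ∏ k ∈ Finset.range n, f k y)
      (fun y => ∏' k, f k y) atTop U := by
    rw [hU.tendstoLocallyUniformlyOn_iff_forall_tendsto]
    intro x hx
    obtain ⟨M, hM⟩ := h x hx
    have hcont : ∀ k, ContinuousAt (f k) x := fun k =>
      ((hd k).differentiableAt (hU.mem_nhds hx)).continuousAt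
    have h1 : Tendsto (fun y : ℕ × ℂ => ∏' k, f k y.2) (atTop ×ˢ 𝓝 x) (𝓝 (∏' k, f k x)) :=
      (continuousAt_tprod_of_geometric hq0 hq1 hcont hM).tendsto.comp tendsto_snd
    have h2 : Tendsto (fun y : ℕ × ℂ => ∏ k ∈ Finset.range y.1, f k y.2) (atTop ×ˢ 𝓝 x)
        (𝓝 (∏' k, f k x)) := by
      -- A partial product is an infinite product with trailing ones, so the same dominated limit
      -- applies to it with n and y moving together.
      have he : ∀ y : ℕ × ℂ, ∏ k ∈ Finset.range y.1, f k y.2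
          = ∏' k, (if k < y.1 then f k y.2 else 1) := by
        intro y
        rw [tprod_eq_prod (s := Finset.range y.1)]
        · refine Finset.prod_congr rfl fun k hk => ?_
          rw [if_pos (Finset.mem_range.mp hk)]
        · intro k hk
          rw [if_neg (by simpa using hk)]
      simp only [he]
      refine tendsto_tprod_of_geometric (M := M) hq0 hq1 ?_ ?_
      · intro k
        refine ((hcont k).tendsto.comp tendsto_snd).congr' ?_
        filter_upwards [(eventually_gt_atTop k).prod_inl (𝓝 x)] with y hy
        simp [hy]
      · filter_upwards [hM.prod_inr atTop] with y hy k
        split_ifs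
        · exact hy k
        · simpa using (norm_nonneg _).trans (hy k)
    exact (h1.prodMk_nhds h2).mono_right (nhds_le_uniformity _)
  exact key.differentiableOn (Eventually.of_forall fun n =>
    DifferentiableOn.fun_finsetProd fun k _ => hd k) hU

/-- Local version of `differentiableOn_tsum_of_summable_norm`. -/
theorem differentiableOn_tsum_of_locally_summable {U : Set ℂ} (hU : IsOpen U) {f : ℕ → ℂ → ℂ}
    (hd : ∀ k, DifferentiableOn ℂ (f k) U)
    (h : ∀ x ∈ U, ∃ u : ℕ → ℝ, Summable u ∧ ∀ᶠ y in 𝓝 x, ∀ k, ‖f k y‖ ≤ u k) :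
    DifferentiableOn ℂ (fun y => ∑' k, f k y) U := by
  intro x hx
  obtain ⟨u, hu, hb⟩ := h x hx
  obtain ⟨V, hV, hVo, hxV⟩ := eventually_nhds_iff.mp hb
  have := differentiableOn_tsum_of_summable_norm hu
    (fun k => (hd k).mono (Set.inter_subset_left (t := V))) (hU.inter hVo)
    fun k w hw => hV w hw.2 k
  exact ((this x ⟨hx, hxV⟩).differentiableAt
    ((hU.inter hVo).mem_nhds ⟨hx, hxV⟩)).differentiableWithinAt

/-! ### `q`-shifted factorials -/

theorem norm_qfactor_sub_one {q : ℝ} (hq0 : 0 < q) (x : ℂ) (k : ℕ) :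
    ‖(1 - x * (q : ℂ) ^ k) - 1‖ ≤ ‖x‖ * q ^ k := by
  simp [abs_of_pos hq0]

theorem qPoch_zero (q : ℝ) (x : ℂ) : qPoch q x 0 = 1 := by simp [qPoch]

theorem qPoch_succ (q : ℝ) (x : ℂ) (n : ℕ) :
    qPoch q x (n + 1) = qPoch q x n * (1 - x * (q : ℂ) ^ n) :=
  Finset.prod_range_succ _ _

theorem qPoch_succ' (q : ℝ) (x : ℂ) (n : ℕ) :
    qPoch q x (n + 1) = (1 - x) * qPoch q (x * q) n := by
  unfold qPoch
  rw [Finset.prod_range_succ', mul_comm]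
  congr 1
  · simp
  · exact Finset.prod_congr rfl fun k _ => by ring

theorem qPochInf_succ {q : ℝ} (hq0 : 0 < q) (hq1 : q < 1) (x : ℂ) :
    qPochInf q x = (1 - x) * qPochInf q (x * q) := by
  simpa [qPoch] using qPochInf_eq_mul hq0 hq1 x 1

theorem qPochInf_zero (q : ℝ) : qPochInf q 0 = 1 := by simp [qPochInf]

theorem qPoch_zero_left (q : ℝ) (n : ℕ) : qPoch q 0 n = 1 := by simp [qPoch]

theorem norm_qPoch_le {q : ℝ} (hq0 : 0 < q) (hq1 : q < 1) (x : ℂ) (n : ℕ) :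
    ‖qPoch q x n‖ ≤ Real.exp (‖x‖ / (1 - q)) :=
  norm_prod_range_le_of_geometric hq0 hq1 (norm_qfactor_sub_one hq0 x) n

theorem norm_qPochInf_le {q : ℝ} (hq0 : 0 < q) (hq1 : q < 1) (x : ℂ) :
    ‖qPochInf q x‖ ≤ Real.exp (‖x‖ / (1 - q)) :=
  norm_tprod_le_of_geometric hq0 hq1 (norm_qfactor_sub_one hq0 x)

theorem exists_pos_le_norm_qPoch {q : ℝ} (hq0 : 0 < q) (hq1 : q < 1) {x : ℂ}
    (hx : ∀ k : ℕ, x * (q : ℂ) ^ k ≠ 1) : ∃ c > 0, ∀ n, c ≤ ‖qPoch q x n‖ :=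
  exists_pos_le_norm_prod_of_geometric hq0 hq1 (norm_qfactor_sub_one hq0 x)
    fun k => sub_ne_zero.mpr (hx k).symm

theorem qPochInf_ne_zero {q : ℝ} (hq0 : 0 < q) (hq1 : q < 1) {x : ℂ}
    (hx : ∀ k : ℕ, x * (q : ℂ) ^ k ≠ 1) : qPochInf q x ≠ 0 :=
  tprod_ne_zero_of_geometric hq0 hq1 (norm_qfactor_sub_one hq0 x)
    fun k => sub_ne_zero.mpr (hx k).symm

theorem mul_pow_ne_one_of_norm_lt_one {q : ℝ} (hq0 : 0 < q) (hq1 : q < 1) {x : ℂ} (hx : ‖x‖ < 1)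
    (k : ℕ) : x * (q : ℂ) ^ k ≠ 1 := by
  intro h
  have h1 : ‖x‖ * q ^ k = 1 := by simpa [abs_of_pos hq0] using congrArg norm h
  have h2 : q ^ k ≤ 1 := pow_le_one₀ hq0.le hq1.le
  nlinarith [norm_nonneg x]

theorem qPochInf_ne_zero_of_norm_lt_one {q : ℝ} (hq0 : 0 < q) (hq1 : q < 1) {x : ℂ}
    (hx : ‖x‖ < 1) : qPochInf q x ≠ 0 :=
  qPochInf_ne_zero hq0 hq1 (mul_pow_ne_one_of_norm_lt_one hq0 hq1 hx)

theorem qPoch_ne_zero_of_norm_lt_one {q : ℝ} (hq0 : 0 < q) (hq1 : q < 1) {x : ℂ}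
    (hx : ‖x‖ < 1) (n : ℕ) : qPoch q x n ≠ 0 :=
  qPoch_ne_zero (mul_pow_ne_one_of_norm_lt_one hq0 hq1 hx) n

theorem tendsto_qPoch {q : ℝ} (hq0 : 0 < q) (hq1 : q < 1) (x : ℂ) :
    Tendsto (qPoch q x) atTop (𝓝 (qPochInf q x)) :=
  (multipliable_of_geometric hq0 hq1 (norm_qfactor_sub_one hq0 x)).hasProd.tendsto_prod_nat

theorem differentiable_qPochInf {q : ℝ} (hq0 : 0 < q) (hq1 : q < 1) :
    Differentiable ℂ (qPochInf q) := by
  rw [← differentiableOn_univ]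
  refine differentiableOn_tprod_of_geometric hq0 hq1 isOpen_univ (fun k => by fun_prop) ?_
  intro x _
  refine ⟨‖x‖ + 1, ?_⟩
  filter_upwards [Metric.ball_mem_nhds x one_pos] with y hy k
  refine (norm_qfactor_sub_one hq0 y k).trans ?_
  gcongr
  have := norm_sub_norm_le y x
  rw [Metric.mem_ball, dist_eq_norm] at hy
  linarith

theorem continuous_qPochInf {q : ℝ} (hq0 : 0 < q) (hq1 : q < 1) : Continuous (qPochInf q) :=
  (differentiable_qPochInf hq0 hq1).continuous

theorem conj_qPoch (q : ℝ) (x : ℂ) (n : ℕ) :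
    starRingEnd ℂ (qPoch q x n) = qPoch q (starRingEnd ℂ x) n := by
  simp [qPoch, map_prod]

theorem conj_qPochInf {q : ℝ} (hq0 : 0 < q) (hq1 : q < 1) (x : ℂ) :
    starRingEnd ℂ (qPochInf q x) = qPochInf q (starRingEnd ℂ x) := by
  have h1 := (continuous_conj.tendsto _).comp (tendsto_qPoch hq0 hq1 x)
  have h2 := tendsto_qPoch hq0 hq1 (starRingEnd ℂ x)
  refine tendsto_nhds_unique h1 (h2.congr fun n => ?_)
  simp [conj_qPoch]

theorem norm_qPoch_le_of_norm_le {q M : ℝ} (hq0 : 0 < q) (hq1 : q < 1) {x : ℂ} (hx : ‖x‖ ≤ M)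
    (n : ℕ) : ‖qPoch q x n‖ ≤ Real.exp (M / (1 - q)) :=
  (norm_qPoch_le hq0 hq1 x n).trans (Real.exp_le_exp.mpr (by
    have : 0 < 1 - q := by linarith
    gcongr))

theorem norm_qPochInf_le_of_norm_le {q M : ℝ} (hq0 : 0 < q) (hq1 : q < 1) {x : ℂ} (hx : ‖x‖ ≤ M) :
    ‖qPochInf q x‖ ≤ Real.exp (M / (1 - q)) :=
  (norm_qPochInf_le hq0 hq1 x).trans (Real.exp_le_exp.mpr (by
    have : 0 < 1 - q := by linarith
    gcongr))

/-- A lower bound for `|(x; q)_n|`, uniform over `|x| ≤ r < 1`. -/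
theorem exists_pos_le_norm_qPoch_of_norm_le {q r : ℝ} (hq0 : 0 < q) (hq1 : q < 1) (hr0 : 0 ≤ r)
    (hr : r < 1) : ∃ c > 0, ∀ (x : ℂ), ‖x‖ ≤ r → ∀ n, c ≤ ‖qPoch q x n‖ := by
  have hr' : ‖(r : ℂ)‖ < 1 := by simpa [abs_of_nonneg hr0] using hr
  obtain ⟨c, hc, h⟩ := exists_pos_le_norm_qPoch hq0 hq1
    (mul_pow_ne_one_of_norm_lt_one hq0 hq1 hr')
  refine ⟨c, hc, fun x hx n => (h n).trans ?_⟩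
  unfold qPoch
  rw [norm_prod, norm_prod]
  refine Finset.prod_le_prod (fun _ _ => norm_nonneg _) fun k _ => ?_
  have h1 : ‖(1 : ℂ) - r * (q : ℂ) ^ k‖ = 1 - r * q ^ k := by
    have : (1 : ℂ) - r * (q : ℂ) ^ k = ((1 - r * q ^ k : ℝ) : ℂ) := by push_cast; ring
    rw [this, Complex.norm_real, Real.norm_eq_abs, abs_of_nonneg]
    nlinarith [pow_le_one₀ (n := k) hq0.le hq1.le, pow_pos hq0 k]
  rw [h1]
  have h2 := norm_sub_norm_le (1 : ℂ) (x * (q : ℂ) ^ k)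
  have h3 : ‖x * (q : ℂ) ^ k‖ = ‖x‖ * q ^ k := by simp [abs_of_pos hq0]
  rw [h3, norm_one] at h2
  have : ‖x‖ * q ^ k ≤ r * q ^ k := by gcongr
  linarith

/-! ### Very-well-poised coefficients and the sum of the `₆φ₅` series -/

/-- The coefficient `(1 - B q^{2m-1}) (B/q, a/z, b/z, c/z; q)_m / ((1 - B/q) (q, ab, ac, bc; q)_m)`
with `B = abc/z`. -/
noncomputable def vwpCoeff (q : ℝ) (a b c z : ℂ) (m : ℕ) : ℂ :=
  vwpFactor q (a * b * c / z) m * (qPoch q (a / z) m * qPoch q (b / z) m * qPoch q (c / z) m)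
    / (qPoch q (q : ℂ) m * qPoch q (a * b) m * qPoch q (a * c) m * qPoch q (b * c) m)

theorem vwpFactor_zero (q : ℝ) (B : ℂ) : vwpFactor q B 0 = 1 := by simp [vwpFactor]

theorem vwpFactor_succ (q : ℝ) (B : ℂ) (m : ℕ) :
    vwpFactor q B (m + 1) = (1 - B * (q : ℂ) ^ (2 * m + 1)) * qPoch q B m := by
  have : 2 * (m + 1) - 1 = 2 * m + 1 := by omega
  simp [vwpFactor, this]

theorem vwpCoeff_zero (q : ℝ) (a b c z : ℂ) : vwpCoeff q a b c z 0 = 1 := by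
  simp [vwpCoeff, vwpFactor_zero, qPoch_zero]

theorem vwpCoeff_swap_left (q : ℝ) (a b c z : ℂ) (m : ℕ) :
    vwpCoeff q a b c z m = vwpCoeff q b a c z m := by
  unfold vwpCoeff
  rw [mul_comm a b]
  congr 1 <;> ring

theorem vwpCoeff_swap_outer (q : ℝ) (a b c z : ℂ) (m : ℕ) :
    vwpCoeff q a b c z m = vwpCoeff q c b a z m := by
  unfold vwpCoeff
  rw [show c * b * a = a * b * c by ring, mul_comm c b, mul_comm c a, mul_comm b a]
  congr 1 <;> ring

theorem norm_vwpFactor_le {q M : ℝ} (hq0 : 0 < q) (hq1 : q < 1) {B : ℂ} (hB : ‖B‖ ≤ M) (m : ℕ) :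
    ‖vwpFactor q B m‖ ≤ (1 + M) * Real.exp (M / (1 - q)) := by
  have hM : 0 ≤ M := (norm_nonneg _).trans hB
  have h1q : 0 < 1 - q := by linarith
  have he : 1 ≤ Real.exp (M / (1 - q)) := Real.one_le_exp (by positivity)
  rcases m with _ | m
  · rw [vwpFactor_zero, norm_one]; nlinarith
  · rw [vwpFactor_succ, norm_mul]
    refine mul_le_mul ?_ (norm_qPoch_le_of_norm_le hq0 hq1 hB m) (norm_nonneg _) (by linarith)
    refine (norm_sub_le _ _).trans ?_
    have : ‖B * (q : ℂ) ^ (2 * m + 1)‖ ≤ M * 1 := by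
      rw [norm_mul, norm_pow, Complex.norm_real, Real.norm_eq_abs, abs_of_pos hq0]
      exact mul_le_mul hB (pow_le_one₀ hq0.le hq1.le) (by positivity) hM
    rw [norm_one]; linarith

/-- One constant serves all lower parameters in a disc of radius less than 1 and all upper
parameters in a bounded set; the radius is enlarged to contain q, because (q; q)_m also stands in
the denominator. -/
theorem exists_vwp_bound {q r M : ℝ} (hq0 : 0 < q) (hq1 : q < 1) (hr0 : 0 ≤ r) (hr : r < 1) :
    ∃ C, 0 < C ∧ ∀ B x y w u v s : ℂ, ‖B‖ ≤ M → ‖x‖ ≤ M → ‖y‖ ≤ M → ‖w‖ ≤ M →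
      ‖u‖ ≤ r → ‖v‖ ≤ r → ‖s‖ ≤ r → ∀ m : ℕ,
      ‖vwpFactor q B m * (qPoch q x m * qPoch q y m * qPoch q w m)
        / (qPoch q (q : ℂ) m * qPoch q u m * qPoch q v m * qPoch q s m)‖ ≤ C := by
  set r' := max r q
  have hr' : r' < 1 := max_lt hr hq1
  obtain ⟨c, hc, hlow⟩ := exists_pos_le_norm_qPoch_of_norm_le hq0 hq1
    (hr0.trans (le_max_left r q)) hr'
  have hq : ‖(q : ℂ)‖ ≤ r' := by
    rw [Complex.norm_real, Real.norm_eq_abs, abs_of_pos hq0]; exact le_max_right _ _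
  set E := Real.exp (M / (1 - q))
  refine ⟨(1 + |M|) * E * (E * E * E) / (c * c * c * c), by positivity, ?_⟩
  intro B x y w u v s hB hx hy hw hu hv hs m
  have hM : 0 ≤ M := (norm_nonneg _).trans hB
  have hl : r ≤ r' := le_max_left _ _
  rw [norm_div, norm_mul, norm_mul, norm_mul, norm_mul, norm_mul, norm_mul, abs_of_nonneg hM]
  refine div_le_div₀ (by positivity) ?_ (by positivity) ?_
  · exact mul_le_mul (norm_vwpFactor_le hq0 hq1 hB m)
      (mul_le_mul (mul_le_mul (norm_qPoch_le_of_norm_le hq0 hq1 hx m)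
        (norm_qPoch_le_of_norm_le hq0 hq1 hy m) (norm_nonneg _) (by positivity))
        (norm_qPoch_le_of_norm_le hq0 hq1 hw m) (norm_nonneg _) (by positivity))
      (by positivity) (by positivity)
  · exact mul_le_mul (mul_le_mul (mul_le_mul (hlow _ hq m) (hlow _ (hu.trans hl) m) hc.le
      (norm_nonneg _)) (hlow _ (hv.trans hl) m) hc.le (by positivity))
      (hlow _ (hs.trans hl) m) hc.le (by positivity)

theorem norm_mul_lt_one {a b : ℂ} (ha : ‖a‖ < 1) (hb : ‖b‖ < 1) : ‖a * b‖ < 1 := by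
  rw [norm_mul]; nlinarith [norm_nonneg a, norm_nonneg b]

/-- The extra factor p makes the bound uniform along a, aq, aq², …, which dominates the limit a q^n
→ 0. Uniformity in z serves the growth estimate of the polynomials. -/
theorem exists_vwpCoeff_bound {q : ℝ} (hq0 : 0 < q) (hq1 : q < 1) {a b c : ℂ}
    (ha : ‖a‖ < 1) (hb : ‖b‖ < 1) (hc : ‖c‖ < 1) (δ : ℝ) (hδ : 0 < δ) :
    ∃ C, 0 < C ∧ ∀ (p : ℂ), ‖p‖ ≤ 1 → ∀ z : ℂ, δ ≤ ‖z‖ → ∀ m : ℕ,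
      ‖vwpCoeff q (a * p) b c z m‖ ≤ C := by
  have hr1 := norm_mul_lt_one ha hb
  have hr2 := norm_mul_lt_one ha hc
  have hr3 := norm_mul_lt_one hb hc
  obtain ⟨C, hC, h⟩ := exists_vwp_bound (r := max ‖a * b‖ (max ‖a * c‖ ‖b * c‖)) (M := 1 / δ)
    hq0 hq1 ((norm_nonneg _).trans (le_max_left _ _)) (max_lt hr1 (max_lt hr2 hr3))
  refine ⟨C, hC, fun p hp z hz m => ?_⟩
  have hdiv : ∀ x : ℂ, ‖x‖ ≤ 1 → ‖x / z‖ ≤ 1 / δ := fun x hx => by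
    rw [norm_div]; gcongr
  have hap : ‖a * p‖ ≤ 1 := by rw [norm_mul]; nlinarith [norm_nonneg a, norm_nonneg p]
  have hshift : ∀ x : ℂ, ‖a * p * x‖ ≤ ‖a * x‖ := fun x => by
    rw [norm_mul, norm_mul, norm_mul]
    nlinarith [norm_nonneg a, norm_nonneg p, norm_nonneg x, mul_nonneg (norm_nonneg a) (norm_nonneg x)]
  refine h _ _ _ _ _ _ _ (hdiv _ ?_) (hdiv _ hap) (hdiv _ hb.le) (hdiv _ hc.le)
    ((hshift b).trans (le_max_left _ _))
    ((hshift c).trans ((le_max_left _ _).trans (le_max_right _ _)))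
    ((le_max_right _ _).trans (le_max_right _ _)) m
  rw [norm_mul, norm_mul]
  have : ‖a * p‖ * ‖b‖ ≤ 1 * 1 := mul_le_mul hap hb.le (norm_nonneg _) one_pos.le
  nlinarith [norm_nonneg c, norm_nonneg (a * p), norm_nonneg b,
    mul_nonneg (norm_nonneg (a * p)) (norm_nonneg b)]

theorem one_sub_ne_zero_of_norm_lt_one {x : ℂ} (hx : ‖x‖ < 1) : 1 - x ≠ 0 := by
  intro h
  rw [← sub_eq_zero.mp h, norm_one] at hx
  exact lt_irrefl _ hx

theorem norm_mul_ofReal_pow_lt_one {q : ℝ} (hq0 : 0 < q) (hq1 : q < 1) {x : ℂ} (hx : ‖x‖ < 1)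
    (k : ℕ) : ‖x * (q : ℂ) ^ k‖ < 1 := by
  rw [norm_mul, norm_pow, Complex.norm_real, Real.norm_eq_abs, abs_of_pos hq0]
  have : q ^ k ≤ 1 := pow_le_one₀ hq0.le hq1.le
  nlinarith [norm_nonneg x, pow_pos hq0 k]

theorem norm_ofReal_lt_one {q : ℝ} (hq0 : 0 < q) (hq1 : q < 1) : ‖(q : ℂ)‖ < 1 := by
  rwa [Complex.norm_real, Real.norm_eq_abs, abs_of_pos hq0]

/-- A Gosper type certificate: this combination of the summands for a and for aq telescopes, and the
closed form of its partial sums carries z^{2M+2}, so it vanishes in the limit when |z| < 1. -/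
theorem sixPhiFive_partial_sum {q : ℝ} (hq0 : 0 < q) (hq1 : q < 1) {a b c z : ℂ}
    (ha : ‖a‖ < 1) (hb : ‖b‖ < 1) (hc : ‖c‖ < 1) (hz : z ≠ 0) (M : ℕ) :
    ∑ m ∈ Finset.range (M + 1), ((1 - a * b) * (1 - a * c) * (vwpCoeff q a b c z m * z ^ (2 * m))
      - (1 - a * b * c / z) * (1 - a * z) * (vwpCoeff q (a * q) b c z m * z ^ (2 * m)))
    = a / z * (qPoch q (a * b * c / z) M * qPoch q (a * q / z) M * qPoch q (b / z) (M + 1)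
        * qPoch q (c / z) (M + 1) * z ^ (2 * M + 2))
      / (qPoch q (q : ℂ) M * qPoch q (b * c) M * qPoch q (a * q * b) M * qPoch q (a * q * c) M) := by
  induction M with
  | zero =>
    simp [vwpCoeff_zero, qPoch]
    field_simp
    ring
  | succ k ih =>
    rw [Finset.sum_range_succ, ih]
    have hab := norm_mul_lt_one ha hb
    have hac := norm_mul_lt_one ha hc
    have hbc := norm_mul_lt_one hb hc
    have hq := norm_ofReal_lt_one hq0 hq1
    have haq : ‖a * (q : ℂ)‖ < 1 := norm_mul_lt_one ha hq
    unfold vwpCoeff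
    rw [vwpFactor_succ, vwpFactor_succ, qPoch_succ' q (a / z) k, qPoch_succ' q (a * b) k,
      qPoch_succ' q (a * c) k, show a / z * (q : ℂ) = a * q / z by ring,
      show a * b * (q : ℂ) = a * q * b by ring, show a * c * (q : ℂ) = a * q * c by ring,
      show a * q * b * c / z = a * b * c / z * (q : ℂ) by ring]
    have hB : (1 - a * b * c / z) * qPoch q (a * b * c / z * q) k
        = qPoch q (a * b * c / z) k * (1 - a * b * c / z * (q : ℂ) ^ k) := by
      rw [← qPoch_succ', qPoch_succ]
    rw [qPoch_succ q (a * b * c / z), qPoch_succ q (a * q / z), qPoch_succ q (a * q * b),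
      qPoch_succ q (a * q * c), qPoch_succ q (b * c), qPoch_succ q (q : ℂ),
      qPoch_succ q (b / z) (k + 1), qPoch_succ q (c / z) (k + 1)]
    have n1 := qPoch_ne_zero_of_norm_lt_one hq0 hq1 hq k
    have n2 := qPoch_ne_zero_of_norm_lt_one hq0 hq1 hbc k
    have n3 := qPoch_ne_zero_of_norm_lt_one hq0 hq1 (norm_mul_lt_one haq hb) k
    have n4 := qPoch_ne_zero_of_norm_lt_one hq0 hq1 (norm_mul_lt_one haq hc) k
    have m1 := one_sub_ne_zero_of_norm_lt_one (norm_mul_ofReal_pow_lt_one hq0 hq1 hq k)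
    have m2 := one_sub_ne_zero_of_norm_lt_one (norm_mul_ofReal_pow_lt_one hq0 hq1 hbc k)
    have m3 := one_sub_ne_zero_of_norm_lt_one
      (norm_mul_ofReal_pow_lt_one hq0 hq1 (norm_mul_lt_one haq hb) k)
    have m4 := one_sub_ne_zero_of_norm_lt_one
      (norm_mul_ofReal_pow_lt_one hq0 hq1 (norm_mul_lt_one haq hc) k)
    have m5 := one_sub_ne_zero_of_norm_lt_one hab
    have m6 := one_sub_ne_zero_of_norm_lt_one hac
    have e1 : (q : ℂ) ^ (2 * k + 1) = q * (q : ℂ) ^ k * (q : ℂ) ^ k := by ring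
    have e2 : (q : ℂ) ^ (k + 1) = q * (q : ℂ) ^ k := by ring
    have e3 : z ^ (2 * (k + 1) + 2) = z ^ (2 * k + 2) * z ^ 2 := by ring
    have e4 : z ^ (2 * (k + 1)) = z ^ (2 * k + 2) := by ring
    rw [e1, e2, e3, e4]
    generalize qPoch q (a * b * c / z) k = P0 at *
    generalize qPoch q (a * b * c / z * q) k = P0' at *
    generalize qPoch q (a * q / z) k = P1 at *
    generalize qPoch q (b / z) (k + 1) = P2 at *
    generalize qPoch q (c / z) (k + 1) = P3 at *
    generalize qPoch q (q : ℂ) k = R1 at *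
    generalize qPoch q (b * c) k = R2 at *
    generalize qPoch q (a * q * b) k = R3 at *
    generalize qPoch q (a * q * c) k = R4 at *
    generalize z ^ (2 * k + 2) = Z at *
    generalize (q : ℂ) ^ k = x at *
    generalize (q : ℂ) = q' at *
    -- The series with aq has B q in place of B = abc/z. The relation (1 - B)(Bq; q)_k = (B; q)_k (1
    -- - B q^k) brings both series to common symbols; afterwards only a rational identity remains.
    have key : (1 - a * b * c / z) * (1 - a * z)
        * ((1 - a * b * c / z * q' * (q' * x * x)) * P0' * (P1 * (1 - a * q' / z * x) * P2 * P3)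
          / (R1 * (1 - q' * x) * (R3 * (1 - a * q' * b * x)) * (R4 * (1 - a * q' * c * x))
            * (R2 * (1 - b * c * x))) * Z)
        = (1 - a * z) * ((1 - a * b * c / z * q' * (q' * x * x)) * (P0 * (1 - a * b * c / z * x))
          * (P1 * (1 - a * q' / z * x) * P2 * P3)
          / (R1 * (1 - q' * x) * (R3 * (1 - a * q' * b * x)) * (R4 * (1 - a * q' * c * x))
            * (R2 * (1 - b * c * x))) * Z) := by
      rw [← hB]; ring
    rw [key]
    clear key hB ih e1 e2 e3 e4
    generalize h3 : 1 - a * q' * b * x = D3 at *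
    generalize h4 : 1 - a * q' * c * x = D4 at *
    generalize h2 : 1 - b * c * x = D2 at *
    generalize h1 : 1 - q' * x = D1 at *
    field_simp
    subst h1 h2 h3 h4
    ring

/-- The `₆φ₅` series `∑ V_m z^{2m}`. -/
noncomputable def sixPhiFive (q : ℝ) (a b c z : ℂ) : ℂ :=
  ∑' m : ℕ, vwpCoeff q a b c z m * z ^ (2 * m)

theorem summable_geometric_sq {z : ℂ} (hz : ‖z‖ < 1) (C : ℝ) :
    Summable fun m : ℕ => C * ‖z‖ ^ (2 * m) := by
  simp only [pow_mul]
  exact (summable_geometric_of_lt_one (by positivity)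
    (by nlinarith [norm_nonneg z])).mul_left C

theorem summable_sixPhiFive {q : ℝ} (hq0 : 0 < q) (hq1 : q < 1) {a b c z : ℂ}
    (ha : ‖a‖ < 1) (hb : ‖b‖ < 1) (hc : ‖c‖ < 1) (hz0 : z ≠ 0) (hz : ‖z‖ < 1) :
    Summable fun m : ℕ => vwpCoeff q a b c z m * z ^ (2 * m) := by
  obtain ⟨C, hC, h⟩ := exists_vwpCoeff_bound hq0 hq1 ha hb hc ‖z‖ (norm_pos_iff.mpr hz0)
  refine Summable.of_norm_bounded (summable_geometric_sq hz C) fun m => ?_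
  rw [norm_mul, norm_pow]
  have := h 1 (by simp) z le_rfl m
  rw [mul_one] at this
  gcongr

theorem sixPhiFive_shift {q : ℝ} (hq0 : 0 < q) (hq1 : q < 1) {a b c z : ℂ}
    (ha : ‖a‖ < 1) (hb : ‖b‖ < 1) (hc : ‖c‖ < 1) (hz0 : z ≠ 0) (hz : ‖z‖ < 1) :
    (1 - a * b) * (1 - a * c) * sixPhiFive q a b c z
      = (1 - a * b * c / z) * (1 - a * z) * sixPhiFive q (a * q) b c z := by
  have hq := norm_ofReal_lt_one hq0 hq1
  have haq : ‖a * (q : ℂ)‖ < 1 := norm_mul_lt_one ha hq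
  have h1 := ((summable_sixPhiFive hq0 hq1 ha hb hc hz0 hz).hasSum.mul_left
    ((1 - a * b) * (1 - a * c))).sub
    ((summable_sixPhiFive hq0 hq1 haq hb hc hz0 hz).hasSum.mul_left
      ((1 - a * b * c / z) * (1 - a * z)))
  have h2 := (h1.tendsto_sum_nat.comp (tendsto_add_atTop_nat 1))
  have h3 : Tendsto (fun M : ℕ => a / z * (qPoch q (a * b * c / z) M * qPoch q (a * q / z) M
      * qPoch q (b / z) (M + 1) * qPoch q (c / z) (M + 1) * z ^ (2 * M + 2))
      / (qPoch q (q : ℂ) M * qPoch q (b * c) M * qPoch q (a * q * b) M * qPoch q (a * q * c) M))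
      atTop (𝓝 0) := by
    have hz2 : Tendsto (fun M : ℕ => z ^ (2 * M + 2)) atTop (𝓝 0) := by
      have : (fun M : ℕ => z ^ (2 * M + 2)) = fun M => z ^ 2 * (z ^ 2) ^ M := by
        funext M; ring
      rw [this]
      have h := (tendsto_pow_atTop_nhds_zero_of_norm_lt_one (x := z ^ 2)
        (by rw [norm_pow]; nlinarith [norm_nonneg z])).const_mul (z ^ 2)
      simpa using h
    have hbc := norm_mul_lt_one hb hc
    have t := ((((((tendsto_qPoch hq0 hq1 (a * b * c / z)).mul
      (tendsto_qPoch hq0 hq1 (a * q / z))).mul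
      ((tendsto_qPoch hq0 hq1 (b / z)).comp (tendsto_add_atTop_nat 1))).mul
      ((tendsto_qPoch hq0 hq1 (c / z)).comp (tendsto_add_atTop_nat 1))).mul hz2).const_mul
      (a / z)).div ((((tendsto_qPoch hq0 hq1 (q : ℂ)).mul (tendsto_qPoch hq0 hq1 (b * c))).mul
      (tendsto_qPoch hq0 hq1 (a * q * b))).mul (tendsto_qPoch hq0 hq1 (a * q * c)))
      (mul_ne_zero (mul_ne_zero (mul_ne_zero (qPochInf_ne_zero_of_norm_lt_one hq0 hq1 hq)
        (qPochInf_ne_zero_of_norm_lt_one hq0 hq1 hbc))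
        (qPochInf_ne_zero_of_norm_lt_one hq0 hq1 (norm_mul_lt_one haq hb)))
        (qPochInf_ne_zero_of_norm_lt_one hq0 hq1 (norm_mul_lt_one haq hc)))
    simpa [Pi.div_def] using t
  have h4 := tendsto_nhds_unique h2
    (h3.congr fun M => (sixPhiFive_partial_sum hq0 hq1 ha hb hc hz0 M).symm)
  exact sub_eq_zero.mp h4

theorem sixPhiFive_shift_iterate {q : ℝ} (hq0 : 0 < q) (hq1 : q < 1) {a b c z : ℂ}
    (ha : ‖a‖ < 1) (hb : ‖b‖ < 1) (hc : ‖c‖ < 1) (hz0 : z ≠ 0) (hz : ‖z‖ < 1) (n : ℕ) :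
    qPoch q (a * b) n * qPoch q (a * c) n * sixPhiFive q a b c z
      = qPoch q (a * b * c / z) n * qPoch q (a * z) n * sixPhiFive q (a * (q : ℂ) ^ n) b c z := by
  induction n with
  | zero => simp [qPoch_zero]
  | succ n ih =>
    have h := sixPhiFive_shift hq0 hq1 (norm_mul_ofReal_pow_lt_one hq0 hq1 ha n) hb hc hz0 hz
    simp only [qPoch_succ]
    rw [show a * (q : ℂ) ^ n * q = a * (q : ℂ) ^ (n + 1) by ring] at h
    linear_combination (1 - a * (q : ℂ) ^ n * b) * (1 - a * (q : ℂ) ^ n * c) * ih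
      + qPoch q (a * b * c / z) n * qPoch q (a * z) n * h

theorem continuous_qPoch (q : ℝ) (n : ℕ) : Continuous fun x => qPoch q x n := by
  unfold qPoch
  fun_prop

theorem tendsto_vwpFactor (q : ℝ) {f : ℕ → ℂ} {B : ℂ} (hf : Tendsto f atTop (𝓝 B)) (m : ℕ) :
    Tendsto (fun n => vwpFactor q (f n) m) atTop (𝓝 (vwpFactor q B m)) := by
  rcases m with _ | m
  · simp [vwpFactor_zero]
  · simp only [vwpFactor_succ]
    exact (tendsto_const_nhds.sub (hf.mul_const _)).mul
      (((continuous_qPoch q m).tendsto B).comp hf)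

/-- The contiguous relation a → aq is iterated infinitely often, with a dominated limit a q^n → 0.
The outcome strips one parameter off the series at the price of explicit infinite products. -/
theorem sixPhiFive_eq {q : ℝ} (hq0 : 0 < q) (hq1 : q < 1) {a b c z : ℂ}
    (ha : ‖a‖ < 1) (hb : ‖b‖ < 1) (hc : ‖c‖ < 1) (hz0 : z ≠ 0) (hz : ‖z‖ < 1) :
    qPochInf q (a * b) * qPochInf q (a * c) * sixPhiFive q a b c z
      = qPochInf q (a * b * c / z) * qPochInf q (a * z) * sixPhiFive q 0 b c z := by
  have hq := norm_ofReal_lt_one hq0 hq1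
  have hbc := norm_mul_lt_one hb hc
  have haq : Tendsto (fun n : ℕ => a * (q : ℂ) ^ n) atTop (𝓝 0) := by
    simpa using (tendsto_pow_atTop_nhds_zero_of_norm_lt_one hq).const_mul a
  have hlim : Tendsto (fun n : ℕ => sixPhiFive q (a * (q : ℂ) ^ n) b c z) atTop
      (𝓝 (sixPhiFive q 0 b c z)) := by
    obtain ⟨C, hC, h⟩ := exists_vwpCoeff_bound hq0 hq1 ha hb hc ‖z‖ (norm_pos_iff.mpr hz0)
    refine tendsto_tsum_of_dominated_convergence (summable_geometric_sq hz C) ?_ ?_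
    · intro m
      refine Tendsto.mul_const _ ?_
      unfold vwpCoeff
      have cp : ∀ {f : ℕ → ℂ} {x : ℂ}, Tendsto f atTop (𝓝 x) →
          Tendsto (fun n => qPoch q (f n) m) atTop (𝓝 (qPoch q x m)) :=
        fun hf => ((continuous_qPoch q m).tendsto _).comp hf
      refine Tendsto.div ?_ ?_ ?_
      · exact (tendsto_vwpFactor q (((haq.mul_const b).mul_const c).div_const z) m).mul
          (((cp (haq.div_const z)).mul tendsto_const_nhds).mul tendsto_const_nhds)
      · exact ((tendsto_const_nhds.mul (cp (haq.mul_const b))).mul (cp (haq.mul_const c))).mul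
          tendsto_const_nhds
      · exact mul_ne_zero (mul_ne_zero (mul_ne_zero (qPoch_ne_zero_of_norm_lt_one hq0 hq1 hq m)
          (qPoch_ne_zero_of_norm_lt_one hq0 hq1 (by simp) m))
          (qPoch_ne_zero_of_norm_lt_one hq0 hq1 (by simp) m))
          (qPoch_ne_zero_of_norm_lt_one hq0 hq1 hbc m)
    · refine Eventually.of_forall fun n m => ?_
      rw [norm_mul, norm_pow]
      have := h ((q : ℂ) ^ n) (by
        rw [norm_pow]; exact pow_le_one₀ (norm_nonneg _) hq.le) z le_rfl m
      gcongr
  have l1 := ((tendsto_qPoch hq0 hq1 (a * b)).mul (tendsto_qPoch hq0 hq1 (a * c))).mul_const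
    (sixPhiFive q a b c z)
  have l2 := ((tendsto_qPoch hq0 hq1 (a * b * c / z)).mul (tendsto_qPoch hq0 hq1 (a * z))).mul hlim
  exact tendsto_nhds_unique l1 (l2.congr fun n =>
    (sixPhiFive_shift_iterate hq0 hq1 ha hb hc hz0 hz n).symm)

/-- The sum ψ satisfies (1 - x) ψ(x) = ψ(qx). A zero at w would propagate to all w q^n, whereas ψ(w
q^n) → ψ(0) = 1. -/
theorem tsum_pow_div_qPoch_ne_zero {q : ℝ} (hq0 : 0 < q) (hq1 : q < 1) {w : ℂ} (hw : ‖w‖ < 1) :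
    ∑' m : ℕ, w ^ m / qPoch q (q : ℂ) m ≠ 0 := by
  have hq := norm_ofReal_lt_one hq0 hq1
  obtain ⟨c, hc, hlow⟩ := exists_pos_le_norm_qPoch hq0 hq1
    (mul_pow_ne_one_of_norm_lt_one hq0 hq1 hq)
  set ψ : ℂ → ℂ := fun w => ∑' m : ℕ, w ^ m / qPoch q (q : ℂ) m with hψ
  have hb : ∀ (x : ℂ) (r : ℝ), ‖x‖ ≤ r → ∀ m : ℕ, ‖x ^ m / qPoch q (q : ℂ) m‖ ≤ r ^ m / c := by
    intro x r hx m
    rw [norm_div, norm_pow]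
    exact div_le_div₀ (pow_nonneg ((norm_nonneg x).trans hx) m)
      (pow_le_pow_left₀ (norm_nonneg x) hx m) hc (hlow m)
  have hs : ∀ x : ℂ, ‖x‖ < 1 → Summable fun m : ℕ => x ^ m / qPoch q (q : ℂ) m := fun x hx =>
    Summable.of_norm_bounded ((summable_geometric_of_lt_one (norm_nonneg x) hx).div_const c)
      (hb x _ le_rfl)
  have hshift : ∀ x : ℂ, ‖x‖ < 1 → (1 - x) * ψ x = ψ (x * q) := by
    intro x hx
    have h1 := hs x hx
    have h2 := hs (x * q) (norm_mul_lt_one hx hq)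
    have h3 : ψ x - ψ (x * q) = x * ψ x := by
      rw [hψ]
      simp only
      rw [← h1.tsum_sub h2, (h1.sub h2).tsum_eq_zero_add, ← tsum_mul_left]
      simp only [pow_zero, sub_self, zero_add]
      refine tsum_congr fun m => ?_
      rw [qPoch_succ]
      have n1 := qPoch_ne_zero_of_norm_lt_one hq0 hq1 hq m
      have n2 := one_sub_ne_zero_of_norm_lt_one (norm_mul_ofReal_pow_lt_one hq0 hq1 hq m)
      rw [mul_pow]
      field_simp
      ring
    linear_combination h3
  have hit : ∀ n : ℕ, qPoch q w n * ψ w = ψ (w * (q : ℂ) ^ n) := by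
    intro n
    induction n with
    | zero => simp [qPoch_zero]
    | succ n ih =>
      have := hshift _ (norm_mul_ofReal_pow_lt_one hq0 hq1 hw n)
      rw [qPoch_succ, pow_succ, ← mul_assoc w, ← this, ← ih]
      ring
  have hlim : Tendsto (fun n : ℕ => ψ (w * (q : ℂ) ^ n)) atTop (𝓝 1) := by
    have h0 : ψ 0 = 1 := by
      rw [hψ]
      simp only
      rw [tsum_eq_single 0 (fun m hm => by simp [hm])]
      simp [qPoch_zero]
    rw [← h0]
    refine tendsto_tsum_of_dominated_convergence
      ((summable_geometric_of_lt_one (norm_nonneg w) hw).div_const c) ?_ ?_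
    · intro m
      have : Tendsto (fun n : ℕ => w * (q : ℂ) ^ n) atTop (𝓝 0) := by
        simpa using (tendsto_pow_atTop_nhds_zero_of_norm_lt_one hq).const_mul w
      exact (this.pow m).div_const _
    · refine Eventually.of_forall fun n m => hb _ _ ?_ m
      rw [norm_mul, norm_pow]
      exact mul_le_of_le_one_right (norm_nonneg _) (pow_le_one₀ (norm_nonneg _) hq.le)
  intro h0
  have : ∀ n : ℕ, ψ (w * (q : ℂ) ^ n) = 0 := fun n => by
    rw [← hit n, show ψ w = 0 from h0, mul_zero]
  simp only [this] at hlim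
  exact zero_ne_one (tendsto_nhds_unique tendsto_const_nhds hlim)

/-- The sum of the very-well-poised `₆φ₅` series does not vanish. -/
theorem sixPhiFive_ne_zero {q : ℝ} (hq0 : 0 < q) (hq1 : q < 1) {a b c z : ℂ}
    (ha : ‖a‖ < 1) (hb : ‖b‖ < 1) (hc : ‖c‖ < 1) (hz0 : z ≠ 0) (hz : ‖z‖ < 1)
    (hB : ∀ k : ℕ, a * b * c / z * (q : ℂ) ^ k ≠ 1) : sixPhiFive q a b c z ≠ 0 := by
  have h00 : ‖(0 : ℂ)‖ < 1 := by simp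
  have step : ∀ {a b c : ℂ}, ‖a‖ < 1 → ‖b‖ < 1 → ‖c‖ < 1 →
      (∀ k : ℕ, a * b * c / z * (q : ℂ) ^ k ≠ 1) → sixPhiFive q 0 b c z ≠ 0 →
      sixPhiFive q a b c z ≠ 0 := by
    intro a b c ha hb hc hB h0 hcon
    have h := sixPhiFive_eq hq0 hq1 ha hb hc hz0 hz
    rw [hcon, mul_zero] at h
    exact mul_ne_zero (mul_ne_zero (qPochInf_ne_zero hq0 hq1 hB)
      (qPochInf_ne_zero_of_norm_lt_one hq0 hq1 (norm_mul_lt_one ha hz))) h0 h.symm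
  have s1 : sixPhiFive q 0 b c z = sixPhiFive q b 0 c z :=
    tsum_congr fun m => by rw [vwpCoeff_swap_left]
  have s2 : sixPhiFive q 0 0 c z = sixPhiFive q c 0 0 z :=
    tsum_congr fun m => by rw [vwpCoeff_swap_outer]
  -- The parameters are removed one at a time, each being first moved to the leading slot by
  -- symmetry. Once one of them is 0, B = 0 and the condition on B is void.
  refine step ha hb hc hB ?_
  rw [s1]
  refine step hb h00 hc (by simp) ?_
  rw [s2]
  refine step hc h00 h00 (by simp) ?_
  have hq := tsum_pow_div_qPoch_ne_zero hq0 hq1 (w := z ^ 2)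
    (by rw [norm_pow]; nlinarith [norm_nonneg z])
  convert hq using 1
  refine tsum_congr fun m => ?_
  have : vwpFactor q 0 m = 1 := by
    rcases m with _ | m
    · simp [vwpFactor_zero]
    · simp [vwpFactor_succ, qPoch_zero_left]
  simp [vwpCoeff, this, qPoch_zero_left, pow_mul]
  ring

/-! ### The boundary function as an entire function of the spectral parameter -/

/-- The factor `(1 - q^k) (e - κ q^k) - q^k Y`. -/
noncomputable def numFactor (q : ℝ) (e κ Y : ℂ) (k : ℕ) : ℂ :=
  (1 - (q : ℂ) ^ k) * (e - κ * (q : ℂ) ^ k) - (q : ℂ) ^ k * Y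

/-- The factor `(1 - q^k e / z) (1 - q^k κ / z) - q^k Y / z`. -/
noncomputable def denFactor (q : ℝ) (e κ z Y : ℂ) (k : ℕ) : ℂ :=
  (1 - (q : ℂ) ^ k * e / z) * (1 - (q : ℂ) ^ k * κ / z) - (q : ℂ) ^ k * Y / z

/-- The boundary function, up to a constant factor, as a function of the spectral parameter
`Y = (t - 1) (e - abc / t)`, where `t = q^{-ν}` and `e = q / d`. -/
noncomputable def spectralFun (q : ℝ) (a b c e z Y : ℂ) : ℂ :=
  ∑' m : ℕ, vwpCoeff q a b c z m * ((∏ k ∈ Finset.range m, z * numFactor q e (a * b * c) Y k)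
    * ∏' k : ℕ, denFactor q e (a * b * c) z Y (m + k))

/-- Multiplying the factor in t with the one in κ/t leaves t + κ/(e t) as the only dependence on t,
and this is an affine function of Y. The argument (qα/d)^m is distributed over the m numerator
factors. -/
theorem boundaryFun_eq_spectralFun {q : ℝ} (hq0 : 0 < q) (hq1 : q < 1) (a b c : ℂ) {d α : ℝ}
    (hd : d ≠ 0) (hα : α ≠ 0) (ν : ℝ) :
    boundaryFun q a b c d α ν = qPochInf q ((q * α / d : ℝ) : ℂ) / qPochInf q (a * b * c / α)
      * spectralFun q a b c ((q / d : ℝ) : ℂ) α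
        ((((q ^ (-ν) : ℝ) : ℂ) - 1) * (((q / d : ℝ) : ℂ) - a * b * c / ((q ^ (-ν) : ℝ) : ℂ))) := by
  unfold boundaryFun spectralFun
  congr 1
  refine tsum_congr fun m => ?_
  set t : ℝ := q ^ (-ν) with ht
  have ht0 : t ≠ 0 := (Real.rpow_pos_of_pos hq0 _).ne'
  have e1 : q ^ ν = t⁻¹ := by rw [ht, Real.rpow_neg hq0.le, inv_inv]
  have e2 : q ^ (ν - 1) = t⁻¹ / q := by rw [Real.rpow_sub hq0, e1, Real.rpow_one]
  have e3 : q ^ (1 - ν) = q * t := by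
    rw [sub_eq_add_neg, Real.rpow_add hq0, Real.rpow_one]
  rw [e1, e2, e3]
  have hqc : (q : ℂ) ≠ 0 := by exact_mod_cast hq0.ne'
  have hdc : (d : ℂ) ≠ 0 := by exact_mod_cast hd
  have hαc : (α : ℂ) ≠ 0 := by exact_mod_cast hα
  have htc : (t : ℂ) ≠ 0 := by exact_mod_cast ht0
  have h1 : ∏ k ∈ Finset.range m, (α : ℂ) * numFactor q ((q / d : ℝ) : ℂ) (a * b * c)
      (((t : ℂ) - 1) * (((q / d : ℝ) : ℂ) - a * b * c / (t : ℂ))) k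
      = qPoch q (t : ℂ) m * qPoch q (a * b * c * d * ((t⁻¹ / q : ℝ) : ℂ)) m
        * ((q * α / d : ℝ) : ℂ) ^ m := by
    unfold qPoch
    have hpow : ((q * α / d : ℝ) : ℂ) ^ m = ∏ _k ∈ Finset.range m, ((q * α / d : ℝ) : ℂ) := by
      simp [div_pow]
    rw [hpow, ← Finset.prod_mul_distrib, ← Finset.prod_mul_distrib]
    refine Finset.prod_congr rfl fun k _ => ?_
    unfold numFactor
    push_cast
    field_simp
    ring
  have hmul : ∀ x : ℂ, Multipliable fun k : ℕ => 1 - x * (q : ℂ) ^ k := fun x =>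
    multipliable_of_geometric hq0 hq1 (norm_qfactor_sub_one hq0 x)
  have h2 : ∏' k : ℕ, denFactor q ((q / d : ℝ) : ℂ) (a * b * c) α
      (((t : ℂ) - 1) * (((q / d : ℝ) : ℂ) - a * b * c / (t : ℂ))) (m + k)
      = qPochInf q (((q * t / (α * d) : ℝ) : ℂ) * (q : ℂ) ^ m)
        * qPochInf q (a * b * c / α * ((t⁻¹ : ℝ) : ℂ) * (q : ℂ) ^ m) := by
    unfold qPochInf
    rw [← (hmul _).tprod_mul (hmul _)]
    refine tprod_congr fun k => ?_
    unfold denFactor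
    push_cast
    rw [pow_add]
    field_simp
    ring
  rw [h1, h2]
  unfold vwpCoeff
  ring

/-! ### Normalized factors -/

/-- In truncated subtraction (N - k) + (k - N) is |N - k|, so two geometric series start at k = N,
one in each direction. The bound is independent of N, which gives uniformity of the asymptotics. -/
theorem sum_pow_dist_le {q : ℝ} (hq0 : 0 < q) (hq1 : q < 1) (N n : ℕ) :
    ∑ k ∈ Finset.range n, q ^ ((N - k) + (k - N)) ≤ 2 / (1 - q) := by
  have h1 : ∑ k ∈ Finset.range n, q ^ ((N - k) + (k - N))
      ≤ ∑ k ∈ Finset.range (N + n), q ^ ((N - k) + (k - N)) :=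
    Finset.sum_le_sum_of_subset_of_nonneg
      (Finset.range_mono (Nat.le_add_left n N)) fun _ _ _ => by positivity
  refine h1.trans ?_
  rw [Finset.sum_range_add, ← Finset.sum_range_reflect]
  have h2 : ∑ j ∈ Finset.range N, q ^ (N - (N - 1 - j) + (N - 1 - j - N))
      ≤ ∑ j ∈ Finset.range N, 1 * q ^ j := by
    refine Finset.sum_le_sum fun j hj => ?_
    rw [one_mul]
    exact pow_le_pow_of_le_one hq0.le hq1.le (by have := Finset.mem_range.mp hj; omega)
  have h3 : ∑ j ∈ Finset.range n, q ^ (N - (N + j) + (N + j - N))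
      = ∑ j ∈ Finset.range n, 1 * q ^ j :=
    Finset.sum_congr rfl fun j _ => by rw [one_mul]; congr 1; omega
  rw [h3]
  have h4 := sum_geometric_le hq0 hq1 zero_le_one N
  have h5 := sum_geometric_le hq0 hq1 zero_le_one n
  have : (2 : ℝ) / (1 - q) = 1 / (1 - q) + 1 / (1 - q) := by ring
  linarith

/-- The normalizing factor `-q^{k-N} s / z` for `k < N`, and `1` for `k ≥ N`. -/
noncomputable def scaleFactor (q : ℝ) (z s : ℂ) (N k : ℕ) : ℂ :=
  if k < N then -((q : ℂ) ^ k * (s / (q : ℂ) ^ N)) / z else 1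

theorem scaleFactor_of_ge (q : ℝ) (z s : ℂ) {N k : ℕ} (h : N ≤ k) : scaleFactor q z s N k = 1 :=
  if_neg (not_lt.mpr h)

theorem scaleFactor_ne_zero {q : ℝ} (hq0 : 0 < q) {z s : ℂ} (hz : z ≠ 0) {N : ℕ}
    (hs : N ≠ 0 → s ≠ 0) (k : ℕ) : scaleFactor q z s N k ≠ 0 := by
  unfold scaleFactor
  split_ifs with h
  · have hq : (q : ℂ) ≠ 0 := by exact_mod_cast hq0.ne'
    have := hs (by omega)
    exact div_ne_zero (neg_ne_zero.mpr (mul_ne_zero (pow_ne_zero _ hq)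
      (div_ne_zero this (pow_ne_zero _ hq)))) hz
  · exact one_ne_zero

/-- For k < N the term q^k Y/z is the dominant one, of size q^{k-N}; dividing by it leaves 1 +
O(q^{N-k}). For k ≥ N the factor is already 1 + O(q^{k-N}). The companion statements treat the
remaining cases in the same way. -/
theorem denFactor_div_scale_of_lt {q : ℝ} (hq0 : 0 < q) {e κ z s : ℂ} (hz : z ≠ 0) (hs : s ≠ 0)
    {N k : ℕ} (h : k < N) :
    denFactor q e κ z (s / (q : ℂ) ^ N) k / scaleFactor q z s N k
      = 1 - z * (1 - (q : ℂ) ^ k * e / z) * (1 - (q : ℂ) ^ k * κ / z) * (q : ℂ) ^ (N - k) / s := by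
  have hq : (q : ℂ) ≠ 0 := by exact_mod_cast hq0.ne'
  rw [scaleFactor, if_pos h, denFactor]
  obtain ⟨i, rfl⟩ := Nat.exists_eq_add_of_lt h
  rw [show k + i + 1 - k = i + 1 by omega, show k + i + 1 = k + (i + 1) by ring, pow_add]
  field_simp
  ring

theorem denFactor_div_scale_of_ge {q : ℝ} (hq0 : 0 < q) {e κ z s : ℂ}
    {N k : ℕ} (h : N ≤ k) :
    denFactor q e κ z (s / (q : ℂ) ^ N) k / scaleFactor q z s N k
      = (1 - (q : ℂ) ^ k * e / z) * (1 - (q : ℂ) ^ k * κ / z) - (q : ℂ) ^ (k - N) * s / z := by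
  have hq : (q : ℂ) ≠ 0 := by exact_mod_cast hq0.ne'
  rw [scaleFactor_of_ge _ _ _ h, denFactor, div_one]
  obtain ⟨i, rfl⟩ := Nat.exists_eq_add_of_le h
  rw [show N + i - N = i by omega, pow_add]
  field_simp

theorem numFactor_div_scale_of_lt {q : ℝ} (hq0 : 0 < q) {e κ z s : ℂ} (hz : z ≠ 0) (hs : s ≠ 0)
    {N k : ℕ} (h : k < N) :
    z * numFactor q e κ (s / (q : ℂ) ^ N) k / scaleFactor q z s N k
      = z ^ 2 - z ^ 2 * (1 - (q : ℂ) ^ k) * (e - κ * (q : ℂ) ^ k) * (q : ℂ) ^ (N - k) / s := by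
  have hq : (q : ℂ) ≠ 0 := by exact_mod_cast hq0.ne'
  rw [scaleFactor, if_pos h, numFactor]
  obtain ⟨i, rfl⟩ := Nat.exists_eq_add_of_lt h
  rw [show k + i + 1 - k = i + 1 by omega, show k + i + 1 = k + (i + 1) by ring, pow_add]
  field_simp
  ring

theorem numFactor_div_scale_of_ge {q : ℝ} (hq0 : 0 < q) {e κ z s : ℂ}
    {N k : ℕ} (h : N ≤ k) :
    z * numFactor q e κ (s / (q : ℂ) ^ N) k / scaleFactor q z s N k
      = z * ((1 - (q : ℂ) ^ k) * (e - κ * (q : ℂ) ^ k) - (q : ℂ) ^ (k - N) * s) := by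
  have hq : (q : ℂ) ≠ 0 := by exact_mod_cast hq0.ne'
  rw [scaleFactor_of_ge _ _ _ h, numFactor, div_one]
  obtain ⟨i, rfl⟩ := Nat.exists_eq_add_of_le h
  rw [show N + i - N = i by omega, pow_add]
  field_simp

/-- A bound for the deviation of the normalized factors from their limits. -/
noncomputable def factorBound (e κ z : ℂ) (ρ δ R : ℝ) : ℝ :=
  (‖z‖ + ‖e‖ + ‖κ‖ + ‖e‖ * ‖κ‖ / ‖z‖) / δ + (‖e‖ + ‖κ‖) / δ
    + (‖e‖ / ‖z‖ + ‖κ‖ / ‖z‖ + ‖e‖ / ‖z‖ * (‖κ‖ / ‖z‖) + R / ‖z‖) + ‖z‖ * (‖κ‖ + R) / ρ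

section Bounds

variable {q : ℝ} {e κ z s : ℂ} {ρ δ R : ℝ} {N : ℕ}

theorem norm_ofReal_pow (hq0 : 0 < q) (k : ℕ) : ‖(q : ℂ) ^ k‖ = q ^ k := by
  simp [abs_of_pos hq0]

/-- The lower bound on |s| is only demanded for N ≠ 0: the case N = 0 has no scaling and must allow
every s in a disc, including 0, since it yields the estimates behind the entireness of the spectral
function. -/
theorem norm_denFactor_div_scale_sub_one_le (hq0 : 0 < q) (hq1 : q < 1) (hz : z ≠ 0) (hρ : 0 < ρ)
    (hδ : 0 < δ) (hsδ : N ≠ 0 → δ ≤ ‖s‖) (hsR : ‖s‖ ≤ R) (k : ℕ) :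
    ‖denFactor q e κ z (s / (q : ℂ) ^ N) k / scaleFactor q z s N k - 1‖
      ≤ factorBound e κ z ρ δ R * q ^ ((N - k) + (k - N)) := by
  have hz0 : 0 < ‖z‖ := norm_pos_iff.mpr hz
  have hR : 0 ≤ R := (norm_nonneg _).trans hsR
  have hqk : q ^ k ≤ 1 := pow_le_one₀ hq0.le hq1.le
  have hqk0 : 0 < q ^ k := pow_pos hq0 k
  rcases lt_or_ge k N with h | h
  · have hs' := hsδ (by omega)
    have hs0 : s ≠ 0 := norm_pos_iff.mp (hδ.trans_le hs')
    rw [denFactor_div_scale_of_lt hq0 hz hs0 h, show k - N = 0 by omega, add_zero]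
    have e1 : (1 - z * (1 - (q : ℂ) ^ k * e / z) * (1 - (q : ℂ) ^ k * κ / z) * (q : ℂ) ^ (N - k) / s
        - 1) = -((z - (q : ℂ) ^ k * e - (q : ℂ) ^ k * κ + (q : ℂ) ^ k * (q : ℂ) ^ k * (e * κ / z)) / s
          * (q : ℂ) ^ (N - k)) := by
      field_simp
      ring
    rw [e1, norm_neg, norm_mul, norm_ofReal_pow hq0, norm_div]
    refine mul_le_mul_of_nonneg_right ?_ (by positivity)
    have h1 : ‖z - (q : ℂ) ^ k * e - (q : ℂ) ^ k * κ + (q : ℂ) ^ k * (q : ℂ) ^ k * (e * κ / z)‖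
        ≤ ‖z‖ + ‖e‖ + ‖κ‖ + ‖e‖ * ‖κ‖ / ‖z‖ := by
      refine (norm_add_le _ _).trans (add_le_add ((norm_sub_le _ _).trans
        (add_le_add ((norm_sub_le _ _).trans (add_le_add le_rfl ?_)) ?_)) ?_)
      · rw [norm_mul, norm_ofReal_pow hq0]; nlinarith [norm_nonneg e]
      · rw [norm_mul, norm_ofReal_pow hq0]; nlinarith [norm_nonneg κ]
      · rw [norm_mul, norm_mul, norm_ofReal_pow hq0, norm_div, norm_mul]
        have : 0 ≤ ‖e‖ * ‖κ‖ / ‖z‖ := by positivity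
        have h2 : q ^ k * q ^ k ≤ 1 := by nlinarith
        nlinarith
    have h2 : ‖z - (q : ℂ) ^ k * e - (q : ℂ) ^ k * κ + (q : ℂ) ^ k * (q : ℂ) ^ k * (e * κ / z)‖ / ‖s‖
        ≤ (‖z‖ + ‖e‖ + ‖κ‖ + ‖e‖ * ‖κ‖ / ‖z‖) / δ := div_le_div₀ (by positivity) h1 hδ hs'
    refine h2.trans ?_
    unfold factorBound
    have : 0 ≤ (‖e‖ + ‖κ‖) / δ
      + (‖e‖ / ‖z‖ + ‖κ‖ / ‖z‖ + ‖e‖ / ‖z‖ * (‖κ‖ / ‖z‖) + R / ‖z‖) + ‖z‖ * (‖κ‖ + R) / ρ := by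
      positivity
    linarith
  · rw [denFactor_div_scale_of_ge hq0 h, show N - k = 0 by omega, zero_add]
    have e1 : (1 - (q : ℂ) ^ k * e / z) * (1 - (q : ℂ) ^ k * κ / z) - (q : ℂ) ^ (k - N) * s / z - 1
        = (q : ℂ) ^ k * (-(e / z) - κ / z + (q : ℂ) ^ k * (e / z * (κ / z)))
          - (q : ℂ) ^ (k - N) * (s / z) := by ring
    rw [e1]
    have hqq : q ^ k ≤ q ^ (k - N) := pow_le_pow_of_le_one hq0.le hq1.le (Nat.sub_le _ _)
    have h1 : ‖-(e / z) - κ / z + (q : ℂ) ^ k * (e / z * (κ / z))‖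
        ≤ ‖e‖ / ‖z‖ + ‖κ‖ / ‖z‖ + ‖e‖ / ‖z‖ * (‖κ‖ / ‖z‖) := by
      refine (norm_add_le _ _).trans (add_le_add ((norm_sub_le _ _).trans (by simp)) ?_)
      rw [norm_mul, norm_ofReal_pow hq0, norm_mul, norm_div, norm_div]
      have : 0 ≤ ‖e‖ / ‖z‖ * (‖κ‖ / ‖z‖) := by positivity
      nlinarith
    have h2 : ‖(q : ℂ) ^ k * (-(e / z) - κ / z + (q : ℂ) ^ k * (e / z * (κ / z)))
        - (q : ℂ) ^ (k - N) * (s / z)‖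
        ≤ (‖e‖ / ‖z‖ + ‖κ‖ / ‖z‖ + ‖e‖ / ‖z‖ * (‖κ‖ / ‖z‖) + R / ‖z‖) * q ^ (k - N) := by
      refine (norm_sub_le _ _).trans ?_
      rw [norm_mul, norm_mul, norm_ofReal_pow hq0, norm_ofReal_pow hq0, norm_div, add_mul,
        mul_comm (q ^ (k - N)) (‖s‖ / ‖z‖)]
      refine add_le_add ?_ (by gcongr)
      rw [mul_comm]
      exact mul_le_mul h1 hqq hqk0.le (by positivity)
    refine h2.trans (mul_le_mul_of_nonneg_right ?_ (by positivity))
    unfold factorBound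
    have : 0 ≤ (‖z‖ + ‖e‖ + ‖κ‖ + ‖e‖ * ‖κ‖ / ‖z‖) / δ + (‖e‖ + ‖κ‖) / δ
      + ‖z‖ * (‖κ‖ + R) / ρ := by positivity
    linarith

/-- The normalized numerators are close to z² for k < N and close to z e for large k - N; this is
why ρ has to dominate both numbers. The choice ρ = |z| is admissible. -/
theorem norm_numFactor_div_scale_le (hq0 : 0 < q) (hq1 : q < 1) (hz : z ≠ 0) (hρ : 0 < ρ)
    (hρ1 : ‖z‖ ^ 2 ≤ ρ) (hρ2 : ‖z‖ * ‖e‖ ≤ ρ)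
    (hδ : 0 < δ) (hsδ : N ≠ 0 → δ ≤ ‖s‖) (hsR : ‖s‖ ≤ R) (k : ℕ) :
    ‖z * numFactor q e κ (s / (q : ℂ) ^ N) k / scaleFactor q z s N k‖
      ≤ ρ * (1 + factorBound e κ z ρ δ R * q ^ ((N - k) + (k - N))) := by
  have hz0 : 0 < ‖z‖ := norm_pos_iff.mpr hz
  have hR : 0 ≤ R := (norm_nonneg _).trans hsR
  have hqk : q ^ k ≤ 1 := pow_le_one₀ hq0.le hq1.le
  have hqk0 : 0 < q ^ k := pow_pos hq0 k
  have hfac : ‖(1 - (q : ℂ) ^ k) * (e - κ * (q : ℂ) ^ k)‖ ≤ ‖e‖ + ‖κ‖ * q ^ k := by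
    rw [norm_mul]
    have h1 : ‖1 - (q : ℂ) ^ k‖ ≤ 1 := by
      have : (1 : ℂ) - (q : ℂ) ^ k = ((1 - q ^ k : ℝ) : ℂ) := by push_cast; ring
      rw [this, Complex.norm_real, Real.norm_eq_abs, abs_le]
      constructor <;> linarith
    have h2 : ‖e - κ * (q : ℂ) ^ k‖ ≤ ‖e‖ + ‖κ‖ * q ^ k := by
      refine (norm_sub_le _ _).trans ?_
      rw [norm_mul, norm_ofReal_pow hq0]
    nlinarith [norm_nonneg (e - κ * (q : ℂ) ^ k), norm_nonneg (1 - (q : ℂ) ^ k)]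
  rcases lt_or_ge k N with h | h
  · have hs' := hsδ (by omega)
    have hs0 : s ≠ 0 := norm_pos_iff.mp (hδ.trans_le hs')
    rw [numFactor_div_scale_of_lt hq0 hz hs0 h, show k - N = 0 by omega, add_zero]
    have e1 : z ^ 2 - z ^ 2 * (1 - (q : ℂ) ^ k) * (e - κ * (q : ℂ) ^ k) * (q : ℂ) ^ (N - k) / s
        = z ^ 2 * (1 - (1 - (q : ℂ) ^ k) * (e - κ * (q : ℂ) ^ k) / s * (q : ℂ) ^ (N - k)) := by ring
    rw [e1, norm_mul, norm_pow]
    refine mul_le_mul hρ1 ((norm_sub_le _ _).trans ?_) (norm_nonneg _) hρ.le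
    rw [norm_one, norm_mul, norm_ofReal_pow hq0, norm_div]
    refine add_le_add le_rfl (mul_le_mul_of_nonneg_right ?_ (by positivity))
    have h3 : ‖(1 - (q : ℂ) ^ k) * (e - κ * (q : ℂ) ^ k)‖ / ‖s‖ ≤ (‖e‖ + ‖κ‖) / δ :=
      div_le_div₀ (by positivity) (hfac.trans (by nlinarith [norm_nonneg κ])) hδ hs'
    refine h3.trans ?_
    unfold factorBound
    have : 0 ≤ (‖z‖ + ‖e‖ + ‖κ‖ + ‖e‖ * ‖κ‖ / ‖z‖) / δ
      + (‖e‖ / ‖z‖ + ‖κ‖ / ‖z‖ + ‖e‖ / ‖z‖ * (‖κ‖ / ‖z‖) + R / ‖z‖) + ‖z‖ * (‖κ‖ + R) / ρ := by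
      positivity
    linarith
  · rw [numFactor_div_scale_of_ge hq0 h, show N - k = 0 by omega, zero_add, norm_mul]
    have hqq : q ^ k ≤ q ^ (k - N) := pow_le_pow_of_le_one hq0.le hq1.le (Nat.sub_le _ _)
    have h1 : ‖(1 - (q : ℂ) ^ k) * (e - κ * (q : ℂ) ^ k) - (q : ℂ) ^ (k - N) * s‖
        ≤ ‖e‖ + (‖κ‖ + R) * q ^ (k - N) := by
      refine (norm_sub_le _ _).trans ?_
      rw [norm_mul ((q : ℂ) ^ (k - N)), norm_ofReal_pow hq0]
      have h2 : ‖κ‖ * q ^ k ≤ ‖κ‖ * q ^ (k - N) := by gcongr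
      have h3 : q ^ (k - N) * ‖s‖ ≤ R * q ^ (k - N) := by rw [mul_comm]; gcongr
      linarith
    have h4 : ‖z‖ * (‖κ‖ + R) ≤ ρ * factorBound e κ z ρ δ R := by
      unfold factorBound
      have h5 : ‖z‖ * (‖κ‖ + R) = ρ * (‖z‖ * (‖κ‖ + R) / ρ) := by field_simp
      rw [mul_add ρ, ← h5]
      have : 0 ≤ ρ * ((‖z‖ + ‖e‖ + ‖κ‖ + ‖e‖ * ‖κ‖ / ‖z‖) / δ + (‖e‖ + ‖κ‖) / δ
        + (‖e‖ / ‖z‖ + ‖κ‖ / ‖z‖ + ‖e‖ / ‖z‖ * (‖κ‖ / ‖z‖) + R / ‖z‖)) := by positivity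
      linarith
    calc ‖z‖ * ‖(1 - (q : ℂ) ^ k) * (e - κ * (q : ℂ) ^ k) - (q : ℂ) ^ (k - N) * s‖
        ≤ ‖z‖ * (‖e‖ + (‖κ‖ + R) * q ^ (k - N)) := by gcongr
      _ = ‖z‖ * ‖e‖ + ‖z‖ * (‖κ‖ + R) * q ^ (k - N) := by ring
      _ ≤ ρ + ρ * factorBound e κ z ρ δ R * q ^ (k - N) := by gcongr
      _ = _ := by ring

theorem summable_pow_dist (hq0 : 0 < q) (hq1 : q < 1) (N m : ℕ) :
    Summable fun k : ℕ => q ^ ((N - (m + k)) + (m + k - N)) := by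
  refine ((summable_geometric_of_lt_one hq0.le hq1).mul_left (q ^ N)⁻¹).of_nonneg_of_le
    (fun _ => by positivity) fun k => ?_
  rw [inv_mul_eq_div, le_div_iff₀ (pow_pos hq0 N), ← pow_add]
  exact pow_le_pow_of_le_one hq0.le hq1.le (by omega)

theorem multipliable_denFactor_div_scale (hq0 : 0 < q) (hq1 : q < 1) (hz : z ≠ 0) (hρ : 0 < ρ)
    (hδ : 0 < δ) (hsδ : N ≠ 0 → δ ≤ ‖s‖) (hsR : ‖s‖ ≤ R) (m : ℕ) :
    Multipliable fun k => denFactor q e κ z (s / (q : ℂ) ^ N) (m + k)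
      / scaleFactor q z s N (m + k) := by
  have h1 : Summable fun k => ‖denFactor q e κ z (s / (q : ℂ) ^ N) (m + k)
      / scaleFactor q z s N (m + k) - 1‖ :=
    ((summable_pow_dist hq0 hq1 N m).mul_left (factorBound e κ z ρ δ R)).of_nonneg_of_le
      (fun _ => norm_nonneg _) fun k =>
      norm_denFactor_div_scale_sub_one_le hq0 hq1 hz hρ hδ hsδ hsR (m + k)
  simpa using multipliable_one_add_of_summable h1

/-- The product of the normalized factors in the `m`-th summand is `O(ρ^m)`, uniformly. -/
theorem norm_scaled_product_le (hq0 : 0 < q) (hq1 : q < 1) (hz : z ≠ 0) (hρ : 0 < ρ)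
    (hρ1 : ‖z‖ ^ 2 ≤ ρ) (hρ2 : ‖z‖ * ‖e‖ ≤ ρ)
    (hδ : 0 < δ) (hsδ : N ≠ 0 → δ ≤ ‖s‖) (hsR : ‖s‖ ≤ R) (m : ℕ) :
    ‖(∏ k ∈ Finset.range m, z * numFactor q e κ (s / (q : ℂ) ^ N) k / scaleFactor q z s N k)
      * ∏' k : ℕ, denFactor q e κ z (s / (q : ℂ) ^ N) (m + k) / scaleFactor q z s N (m + k)‖
      ≤ ρ ^ m * Real.exp (factorBound e κ z ρ δ R * (2 / (1 - q))) := by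
  have hM : 0 ≤ factorBound e κ z ρ δ R := by
    have hR : 0 ≤ R := (norm_nonneg _).trans hsR
    unfold factorBound
    positivity
  have ht := ((multipliable_denFactor_div_scale (e := e) (κ := κ) hq0 hq1 hz hρ hδ hsδ hsR
    m).hasProd.tendsto_prod_nat.const_mul
    (∏ k ∈ Finset.range m, z * numFactor q e κ (s / (q : ℂ) ^ N) k / scaleFactor q z s N k)).norm
  refine le_of_tendsto ht (Eventually.of_forall fun n => ?_)
  set M := factorBound e κ z ρ δ R
  have h1 : ‖∏ k ∈ Finset.range m,
      z * numFactor q e κ (s / (q : ℂ) ^ N) k / scaleFactor q z s N k‖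
      ≤ ρ ^ m * Real.exp (∑ k ∈ Finset.range m, M * q ^ ((N - k) + (k - N))) := by
    have : ∏ k ∈ Finset.range m, z * numFactor q e κ (s / (q : ℂ) ^ N) k / scaleFactor q z s N k
        = (ρ : ℂ) ^ m * ∏ k ∈ Finset.range m,
          (z * numFactor q e κ (s / (q : ℂ) ^ N) k / scaleFactor q z s N k / ρ) := by
      have hρc : (ρ : ℂ) ≠ 0 := by exact_mod_cast hρ.ne'
      have hpow : (ρ : ℂ) ^ m = ∏ _k ∈ Finset.range m, (ρ : ℂ) := by simp
      rw [hpow, ← Finset.prod_mul_distrib]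
      exact Finset.prod_congr rfl fun k _ => by field_simp
    rw [this, norm_mul, norm_pow, Complex.norm_real, Real.norm_eq_abs, abs_of_pos hρ]
    refine mul_le_mul_of_nonneg_left ?_ (by positivity)
    refine norm_prod_le_exp_sum _ _ _ fun k _ => ?_
    rw [norm_div, Complex.norm_real, Real.norm_eq_abs, abs_of_pos hρ, div_le_iff₀ hρ, mul_comm _ ρ]
    exact norm_numFactor_div_scale_le hq0 hq1 hz hρ hρ1 hρ2 hδ hsδ hsR k
  have h2 : ‖∏ k ∈ Finset.range n, denFactor q e κ z (s / (q : ℂ) ^ N) (m + k)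
      / scaleFactor q z s N (m + k)‖
      ≤ Real.exp (∑ k ∈ Finset.range n, M * q ^ ((N - (m + k)) + (m + k - N))) :=
    norm_prod_le_exp_sum _ _ _ fun k _ => norm_le_of_norm_sub_one_le
      (norm_denFactor_div_scale_sub_one_le hq0 hq1 hz hρ hδ hsδ hsR (m + k))
  rw [norm_mul]
  refine (mul_le_mul h1 h2 (norm_nonneg _) (by positivity)).trans ?_
  rw [mul_assoc, ← Real.exp_add]
  refine mul_le_mul_of_nonneg_left (Real.exp_le_exp.mpr ?_) (by positivity)
  have h3 := Finset.sum_range_add (fun k => M * q ^ ((N - k) + (k - N))) m n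
  rw [← h3, ← Finset.mul_sum]
  exact mul_le_mul_of_nonneg_left (sum_pow_dist_le hq0 hq1 N _) hM

end Bounds

/-! ### Asymptotics of the spectral function -/

theorem spectralFun_div_scale {q : ℝ} (hq0 : 0 < q) (hq1 : q < 1) {a b c e z s : ℂ} (hz : z ≠ 0)
    (hs : s ≠ 0) (N : ℕ) :
    spectralFun q a b c e z (s / (q : ℂ) ^ N) / ∏ k ∈ Finset.range N, scaleFactor q z s N k
      = ∑' m : ℕ, vwpCoeff q a b c z m * ((∏ k ∈ Finset.range m,
          z * numFactor q e (a * b * c) (s / (q : ℂ) ^ N) k / scaleFactor q z s N k)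
        * ∏' k : ℕ, denFactor q e (a * b * c) z (s / (q : ℂ) ^ N) (m + k)
          / scaleFactor q z s N (m + k)) := by
  unfold spectralFun
  rw [← tsum_div_const]
  refine tsum_congr fun m => ?_
  have hne := fun k => scaleFactor_ne_zero (N := N) hq0 hz (fun _ => hs) k
  have hsc : Multipliable fun k => scaleFactor q z s N (m + k) :=
    multipliable_of_hasFiniteMulSupport ((Set.finite_lt_nat N).subset fun k hk => by
      by_contra h
      exact hk (scaleFactor_of_ge _ _ _ (by simp only [Set.mem_ofPred_eq] at h; omega)))
  have hdv : Multipliable fun k => denFactor q e (a * b * c) z (s / (q : ℂ) ^ N) (m + k)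
      / scaleFactor q z s N (m + k) :=
    multipliable_denFactor_div_scale (R := ‖s‖) hq0 hq1 hz one_pos (norm_pos_iff.mpr hs)
      (fun _ => le_rfl) le_rfl m
  have h1 : ∏' k : ℕ, denFactor q e (a * b * c) z (s / (q : ℂ) ^ N) (m + k)
      = (∏' k : ℕ, denFactor q e (a * b * c) z (s / (q : ℂ) ^ N) (m + k)
          / scaleFactor q z s N (m + k)) * ∏' k : ℕ, scaleFactor q z s N (m + k) := by
    rw [← hdv.tprod_mul hsc]
    exact tprod_congr fun k => by rw [div_mul_cancel₀ _ (hne _)]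
  -- The normalizing product is cut at m. This holds for m > N as well, because the scale factors
  -- beyond N are 1.
  have h2 : ∏ k ∈ Finset.range N, scaleFactor q z s N k
      = (∏ k ∈ Finset.range m, scaleFactor q z s N k) * ∏' k : ℕ, scaleFactor q z s N (m + k) := by
    have h3 : ∏' k : ℕ, scaleFactor q z s N (m + k)
        = ∏ k ∈ Finset.range N, scaleFactor q z s N (m + k) :=
      tprod_eq_prod fun k hk => scaleFactor_of_ge _ _ _ (by simp at hk; omega)
    rw [h3, ← Finset.prod_range_add, add_comm, Finset.prod_range_add]
    have : ∏ k ∈ Finset.range m, scaleFactor q z s N (N + k) = 1 :=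
      Finset.prod_eq_one fun k _ => scaleFactor_of_ge _ _ _ (by omega)
    rw [this, mul_one]
  rw [h1, h2, Finset.prod_div_distrib]
  have n1 : ∏ k ∈ Finset.range m, scaleFactor q z s N k ≠ 0 :=
    Finset.prod_ne_zero_iff.mpr fun k _ => hne k
  have n2 : ∏' k : ℕ, scaleFactor q z s N (m + k) ≠ 0 := by
    intro h
    rw [h, mul_zero] at h2
    exact Finset.prod_ne_zero_iff.mpr (fun k _ => hne k) h2
  field_simp

theorem tendsto_pow_coe {q : ℝ} (hq0 : 0 < q) (hq1 : q < 1) :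
    Tendsto (fun n : ℕ => (q : ℂ) ^ n) atTop (𝓝 0) :=
  tendsto_pow_atTop_nhds_zero_of_norm_lt_one (norm_ofReal_lt_one hq0 hq1)

/-- The product is cut at k = N. Read backwards from N, the factors tend to 1 - z q^{i+1}/s; read
forwards, they tend to 1 - q^j s/z. The two halves give the two products of the theta function,
whatever the starting index m is. -/
theorem tendsto_tprod_denFactor_div_scale {q : ℝ} (hq0 : 0 < q) (hq1 : q < 1) {e κ z s₀ : ℂ}
    (hz : z ≠ 0) (hs : s₀ ≠ 0) (m : ℕ) :
    Tendsto (fun y : ℕ × ℂ => ∏' k : ℕ, denFactor q e κ z (y.2 / (q : ℂ) ^ y.1) (m + k)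
        / scaleFactor q z y.2 y.1 (m + k)) (atTop ×ˢ 𝓝 s₀)
      (𝓝 (qPochInf q (z * q / s₀) * qPochInf q (s₀ / z))) := by
  have hδ : 0 < ‖s₀‖ / 2 := by positivity
  have hev : ∀ᶠ y : ℕ × ℂ in atTop ×ˢ 𝓝 s₀,
      (m ≤ y.1) ∧ ‖s₀‖ / 2 ≤ ‖y.2‖ ∧ ‖y.2‖ ≤ ‖s₀‖ + 1 := by
    have h1 := (eventually_ge_atTop m).prod_inl (𝓝 s₀)
    have hc : Tendsto (fun s : ℂ => ‖s‖) (𝓝 s₀) (𝓝 ‖s₀‖) := continuous_norm.tendsto s₀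
    have h2 := ((hc.eventually (le_mem_nhds (by linarith : ‖s₀‖ / 2 < ‖s₀‖))).and
      (hc.eventually_le_const (by linarith : ‖s₀‖ < ‖s₀‖ + 1))).prod_inr (atTop : Filter ℕ)
    filter_upwards [h1, h2] with y h1 h2 using ⟨h1, h2⟩
  set M := factorBound e κ z 1 (‖s₀‖ / 2) (‖s₀‖ + 1)
  have hb : ∀ y : ℕ × ℂ, ‖s₀‖ / 2 ≤ ‖y.2‖ ∧ ‖y.2‖ ≤ ‖s₀‖ + 1 → ∀ k,
      ‖denFactor q e κ z (y.2 / (q : ℂ) ^ y.1) k / scaleFactor q z y.2 y.1 k - 1‖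
      ≤ M * q ^ ((y.1 - k) + (k - y.1)) := fun y hy k =>
    norm_denFactor_div_scale_sub_one_le hq0 hq1 hz one_pos hδ (fun _ => hy.1) hy.2 k
  have hM : 0 ≤ M := by
    have h : ‖s₀‖ / 2 ≤ ‖s₀‖ ∧ ‖s₀‖ ≤ ‖s₀‖ + 1 := by
      constructor <;> linarith [norm_nonneg s₀]
    have := (norm_nonneg _).trans (hb (0, s₀) h 0)
    simpa using this
  -- The lower half is reversed by k = N - 1 - i and padded with ones, so that each index i has a
  -- limit factor of its own.
  have hsplit : ∀ᶠ y : ℕ × ℂ in atTop ×ˢ 𝓝 s₀,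
      (∏' i : ℕ, if i < y.1 - m then
        denFactor q e κ z (y.2 / (q : ℂ) ^ y.1) (y.1 - 1 - i) / scaleFactor q z y.2 y.1 (y.1 - 1 - i)
        else 1) * ∏' j : ℕ, denFactor q e κ z (y.2 / (q : ℂ) ^ y.1) (y.1 + j)
          / scaleFactor q z y.2 y.1 (y.1 + j)
      = ∏' k : ℕ, denFactor q e κ z (y.2 / (q : ℂ) ^ y.1) (m + k)
        / scaleFactor q z y.2 y.1 (m + k) := by
    filter_upwards [hev] with y hy
    have hmul := multipliable_denFactor_div_scale (e := e) (κ := κ) hq0 hq1 hz one_pos hδ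
      (fun _ => hy.2.1) hy.2.2 y.1 (N := y.1)
    obtain ⟨p, hp⟩ := Nat.exists_eq_add_of_le hy.1
    have h1 : ∏' k : ℕ, denFactor q e κ z (y.2 / (q : ℂ) ^ y.1) (m + k)
        / scaleFactor q z y.2 y.1 (m + k)
        = (∏ k ∈ Finset.range p, denFactor q e κ z (y.2 / (q : ℂ) ^ y.1) (m + k)
          / scaleFactor q z y.2 y.1 (m + k)) *
          ∏' j : ℕ, denFactor q e κ z (y.2 / (q : ℂ) ^ y.1) (y.1 + j)
          / scaleFactor q z y.2 y.1 (y.1 + j) := by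
      have h2 : ∀ j, m + (j + p) = y.1 + j := fun j => by omega
      rw [← Multipliable.prod_mul_tprod_nat_mul' (k := p)]
      · simp only [h2]
      · simpa only [h2] using hmul
    rw [h1]
    congr 1
    rw [tprod_eq_prod (s := Finset.range p), ← Finset.prod_range_reflect]
    · refine Finset.prod_congr rfl fun k hk => ?_
      have := Finset.mem_range.mp hk
      rw [if_pos (by omega), show y.1 - 1 - (p - 1 - k) = m + k by omega]
    · intro i hi
      rw [if_neg (by simp at hi; omega)]
  refine Tendsto.congr' hsplit ?_
  refine Tendsto.mul ?_ ?_
  · unfold qPochInf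
    refine tendsto_tprod_of_geometric (M := M) hq0 hq1 (fun i => ?_) ?_
    · have h1 : ∀ᶠ y : ℕ × ℂ in atTop ×ˢ 𝓝 s₀,
          1 - z * (1 - (q : ℂ) ^ (y.1 - 1 - i) * e / z) * (1 - (q : ℂ) ^ (y.1 - 1 - i) * κ / z)
            * (q : ℂ) ^ (i + 1) / y.2
          = if i < y.1 - m then denFactor q e κ z (y.2 / (q : ℂ) ^ y.1) (y.1 - 1 - i)
            / scaleFactor q z y.2 y.1 (y.1 - 1 - i) else 1 := by
        filter_upwards [hev, (eventually_gt_atTop (i + m)).prod_inl (𝓝 s₀)] with y hy hi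
        rw [if_pos (by omega), denFactor_div_scale_of_lt hq0 hz
          (norm_pos_iff.mp (hδ.trans_le hy.2.1)) (by omega),
          show y.1 - (y.1 - 1 - i) = i + 1 by omega]
      refine Tendsto.congr' h1 ?_
      have hp : Tendsto (fun y : ℕ × ℂ => (q : ℂ) ^ (y.1 - 1 - i)) (atTop ×ˢ 𝓝 s₀) (𝓝 0) := by
        exact (tendsto_pow_coe hq0 hq1).comp ((tendsto_sub_atTop_nat i).comp
          ((tendsto_sub_atTop_nat 1).comp (tendsto_fst (f := (atTop : Filter ℕ)) (g := 𝓝 s₀))))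
      have h2 : Tendsto (fun y : ℕ × ℂ => 1 - z * (1 - (q : ℂ) ^ (y.1 - 1 - i) * e / z)
          * (1 - (q : ℂ) ^ (y.1 - 1 - i) * κ / z) * (q : ℂ) ^ (i + 1) / y.2) (atTop ×ˢ 𝓝 s₀)
          (𝓝 (1 - z * (1 - 0 * e / z) * (1 - 0 * κ / z) * (q : ℂ) ^ (i + 1) / s₀)) :=
        tendsto_const_nhds.sub ((((tendsto_const_nhds.mul
          (tendsto_const_nhds.sub ((hp.mul_const e).div_const z))).mul
          (tendsto_const_nhds.sub ((hp.mul_const κ).div_const z))).mul_const _).div tendsto_snd hs)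
      convert h2 using 2
      ring
    · filter_upwards [hev] with y hy i
      split_ifs with hi
      · refine (hb y hy.2 _).trans (mul_le_mul_of_nonneg_left ?_ hM)
        exact pow_le_pow_of_le_one hq0.le hq1.le (by omega)
      · rw [sub_self, norm_zero]; positivity
  · unfold qPochInf
    refine tendsto_tprod_of_geometric (M := M) hq0 hq1 (fun j => ?_) ?_
    · have h1 : ∀ y : ℕ × ℂ,
          (1 - (q : ℂ) ^ (y.1 + j) * e / z) * (1 - (q : ℂ) ^ (y.1 + j) * κ / z)
            - (q : ℂ) ^ j * y.2 / z
          = denFactor q e κ z (y.2 / (q : ℂ) ^ y.1) (y.1 + j)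
            / scaleFactor q z y.2 y.1 (y.1 + j) := by
        intro y
        rw [denFactor_div_scale_of_ge hq0 (by omega), show y.1 + j - y.1 = j by omega]
      refine Tendsto.congr h1 ?_
      have hp : Tendsto (fun y : ℕ × ℂ => (q : ℂ) ^ (y.1 + j)) (atTop ×ˢ 𝓝 s₀) (𝓝 0) :=
        (tendsto_pow_coe hq0 hq1).comp ((tendsto_add_atTop_nat j).comp
          (tendsto_fst (f := (atTop : Filter ℕ)) (g := 𝓝 s₀)))
      have h2 : Tendsto (fun y : ℕ × ℂ => (1 - (q : ℂ) ^ (y.1 + j) * e / z)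
          * (1 - (q : ℂ) ^ (y.1 + j) * κ / z) - (q : ℂ) ^ j * y.2 / z) (atTop ×ˢ 𝓝 s₀)
          (𝓝 ((1 - 0 * e / z) * (1 - 0 * κ / z) - (q : ℂ) ^ j * s₀ / z)) :=
        ((tendsto_const_nhds.sub ((hp.mul_const e).div_const z)).mul
          (tendsto_const_nhds.sub ((hp.mul_const κ).div_const z))).sub
          ((tendsto_const_nhds.mul tendsto_snd).div_const z)
      convert h2 using 2
      ring
    · filter_upwards [hev] with y hy j
      refine (hb y hy.2 _).trans (mul_le_mul_of_nonneg_left ?_ hM)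
      exact pow_le_pow_of_le_one hq0.le hq1.le (by omega)

theorem tendsto_numFactor_div_scale {q : ℝ} (hq0 : 0 < q) (hq1 : q < 1) {e κ z s₀ : ℂ}
    (hz : z ≠ 0) (hs : s₀ ≠ 0) (k : ℕ) :
    Tendsto (fun y : ℕ × ℂ => z * numFactor q e κ (y.2 / (q : ℂ) ^ y.1) k
      / scaleFactor q z y.2 y.1 k) (atTop ×ˢ 𝓝 s₀) (𝓝 (z ^ 2)) := by
  have h1 : ∀ᶠ y : ℕ × ℂ in atTop ×ˢ 𝓝 s₀,
      z ^ 2 - z ^ 2 * (1 - (q : ℂ) ^ k) * (e - κ * (q : ℂ) ^ k) * (q : ℂ) ^ (y.1 - k) / y.2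
      = z * numFactor q e κ (y.2 / (q : ℂ) ^ y.1) k / scaleFactor q z y.2 y.1 k := by
    filter_upwards [(eventually_gt_atTop k).prod_inl (𝓝 s₀),
      (eventually_ne_nhds hs).prod_inr atTop] with y h1 h2
    rw [numFactor_div_scale_of_lt hq0 hz h2 h1]
  refine Tendsto.congr' h1 ?_
  have hp : Tendsto (fun y : ℕ × ℂ => (q : ℂ) ^ (y.1 - k)) (atTop ×ˢ 𝓝 s₀) (𝓝 0) :=
    (tendsto_pow_coe hq0 hq1).comp ((tendsto_sub_atTop_nat k).comp
      (tendsto_fst (f := (atTop : Filter ℕ)) (g := 𝓝 s₀)))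
  have h2 := (tendsto_const_nhds (x := z ^ 2)).sub ((hp.const_mul
    (z ^ 2 * (1 - (q : ℂ) ^ k) * (e - κ * (q : ℂ) ^ k))).div tendsto_snd hs)
  simpa using h2

theorem exists_vwpCoeff_bound_at {q : ℝ} (hq0 : 0 < q) (hq1 : q < 1) {a b c z : ℂ}
    (ha : ‖a‖ < 1) (hb : ‖b‖ < 1) (hc : ‖c‖ < 1) (hz : z ≠ 0) :
    ∃ C, 0 < C ∧ ∀ m : ℕ, ‖vwpCoeff q a b c z m‖ ≤ C := by
  obtain ⟨C, hC, h⟩ := exists_vwpCoeff_bound hq0 hq1 ha hb hc ‖z‖ (norm_pos_iff.mpr hz)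
  exact ⟨C, hC, fun m => by simpa using h 1 (by simp) z le_rfl m⟩

theorem exists_decay_rate {e z : ℂ} (hz : z ≠ 0) (hz1 : ‖z‖ < 1) (he : ‖e‖ < 1) :
    ∃ ρ : ℝ, 0 < ρ ∧ ρ < 1 ∧ ‖z‖ ^ 2 ≤ ρ ∧ ‖z‖ * ‖e‖ ≤ ρ := by
  have hz0 : 0 < ‖z‖ := norm_pos_iff.mpr hz
  exact ⟨‖z‖, hz0, hz1, by nlinarith, by nlinarith⟩

/-- The limit function `(s/z, qz/s; q)_∞`. -/
noncomputable def qTheta (q : ℝ) (z s : ℂ) : ℂ := qPochInf q (z * q / s) * qPochInf q (s / z)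

/-- In the m-th summand the numerators contribute z^{2m} and the tail product contributes the theta
function, the latter independently of m. Hence the limit factors into a ₆φ₅ sum and a theta
function; the bound O(ρ^m), uniform in N, justifies the exchange. -/
theorem tendsto_spectralFun_div_scale {q : ℝ} (hq0 : 0 < q) (hq1 : q < 1) {a b c e z s₀ : ℂ}
    (ha : ‖a‖ < 1) (hb : ‖b‖ < 1) (hc : ‖c‖ < 1) (he : ‖e‖ < 1) (hz : z ≠ 0) (hz1 : ‖z‖ < 1)
    (hs : s₀ ≠ 0) :
    Tendsto (fun y : ℕ × ℂ => spectralFun q a b c e z (y.2 / (q : ℂ) ^ y.1)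
        / ∏ k ∈ Finset.range y.1, scaleFactor q z y.2 y.1 k) (atTop ×ˢ 𝓝 s₀)
      (𝓝 (sixPhiFive q a b c z * qTheta q z s₀)) := by
  obtain ⟨ρ, hρ0, hρ, hρ1, hρ2⟩ := exists_decay_rate hz hz1 he
  obtain ⟨C, hC, hV⟩ := exists_vwpCoeff_bound_at hq0 hq1 ha hb hc hz
  have hδ : 0 < ‖s₀‖ / 2 := by positivity
  have hev : ∀ᶠ y : ℕ × ℂ in atTop ×ˢ 𝓝 s₀, ‖s₀‖ / 2 ≤ ‖y.2‖ ∧ ‖y.2‖ ≤ ‖s₀‖ + 1 := by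
    have hc : Tendsto (fun s : ℂ => ‖s‖) (𝓝 s₀) (𝓝 ‖s₀‖) := continuous_norm.tendsto s₀
    exact ((hc.eventually (le_mem_nhds (by linarith : ‖s₀‖ / 2 < ‖s₀‖))).and
      (hc.eventually_le_const (by linarith : ‖s₀‖ < ‖s₀‖ + 1))).prod_inr (atTop : Filter ℕ)
  have hcongr : ∀ᶠ y : ℕ × ℂ in atTop ×ˢ 𝓝 s₀, ∑' m : ℕ, vwpCoeff q a b c z m *
      ((∏ k ∈ Finset.range m, z * numFactor q e (a * b * c) (y.2 / (q : ℂ) ^ y.1) k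
        / scaleFactor q z y.2 y.1 k)
      * ∏' k : ℕ, denFactor q e (a * b * c) z (y.2 / (q : ℂ) ^ y.1) (m + k)
        / scaleFactor q z y.2 y.1 (m + k))
      = spectralFun q a b c e z (y.2 / (q : ℂ) ^ y.1)
        / ∏ k ∈ Finset.range y.1, scaleFactor q z y.2 y.1 k := by
    filter_upwards [hev] with y hy
    rw [spectralFun_div_scale hq0 hq1 hz (norm_pos_iff.mp (hδ.trans_le hy.1))]
  refine Tendsto.congr' hcongr ?_
  have hlim : sixPhiFive q a b c z * qTheta q z s₀
      = ∑' m : ℕ, vwpCoeff q a b c z m * ((z ^ 2) ^ m * qTheta q z s₀) := by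
    rw [sixPhiFive, ← tsum_mul_right]
    exact tsum_congr fun m => by rw [pow_mul]; ring
  rw [hlim]
  set M := factorBound e (a * b * c) z ρ (‖s₀‖ / 2) (‖s₀‖ + 1)
  refine tendsto_tsum_of_dominated_convergence
    (bound := fun m => C * (ρ ^ m * Real.exp (M * (2 / (1 - q)))))
    (((summable_geometric_of_lt_one hρ0.le hρ).mul_right _).mul_left C) (fun m => ?_) ?_
  · refine tendsto_const_nhds.mul (Tendsto.mul ?_
      (tendsto_tprod_denFactor_div_scale hq0 hq1 hz hs m))
    have := tendsto_finsetProd (Finset.range m) fun k _ =>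
      tendsto_numFactor_div_scale (e := e) (κ := a * b * c) hq0 hq1 hz hs k
    simpa using this
  · filter_upwards [hev] with y hy m
    rw [norm_mul]
    exact mul_le_mul (hV m) (norm_scaled_product_le hq0 hq1 hz hρ0 hρ1 hρ2 hδ (fun _ => hy.1) hy.2 m)
      (norm_nonneg _) hC.le

theorem norm_spectralFun_term_le {q : ℝ} (hq0 : 0 < q) (hq1 : q < 1) {e κ z Y : ℂ} {ρ R : ℝ}
    (hz : z ≠ 0) (hρ : 0 < ρ) (hρ1 : ‖z‖ ^ 2 ≤ ρ) (hρ2 : ‖z‖ * ‖e‖ ≤ ρ) (hY : ‖Y‖ ≤ R) (m : ℕ) :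
    ‖(∏ k ∈ Finset.range m, z * numFactor q e κ Y k) * ∏' k : ℕ, denFactor q e κ z Y (m + k)‖
      ≤ ρ ^ m * Real.exp (factorBound e κ z ρ 1 R * (2 / (1 - q))) := by
  have := norm_scaled_product_le (e := e) (κ := κ) (s := Y) (N := 0) hq0 hq1 hz hρ hρ1 hρ2 one_pos
    (by simp) hY m
  simpa [scaleFactor] using this

theorem norm_denFactor_sub_one_le {q : ℝ} (hq0 : 0 < q) (hq1 : q < 1) {e κ z Y : ℂ} {R : ℝ}
    (hz : z ≠ 0) (hY : ‖Y‖ ≤ R) (k : ℕ) :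
    ‖denFactor q e κ z Y k - 1‖ ≤ factorBound e κ z 1 1 R * q ^ k := by
  have := norm_denFactor_div_scale_sub_one_le (e := e) (κ := κ) (s := Y) (N := 0) hq0 hq1 hz
    one_pos one_pos (by simp) hY k
  simpa [scaleFactor] using this

theorem summable_spectralFun {q : ℝ} (hq0 : 0 < q) (hq1 : q < 1) {a b c e z : ℂ}
    (ha : ‖a‖ < 1) (hb : ‖b‖ < 1) (hc : ‖c‖ < 1) (he : ‖e‖ < 1) (hz : z ≠ 0) (hz1 : ‖z‖ < 1)
    (R : ℝ) : ∃ u : ℕ → ℝ, Summable u ∧ ∀ Y : ℂ, ‖Y‖ ≤ R → ∀ m,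
      ‖vwpCoeff q a b c z m * ((∏ k ∈ Finset.range m, z * numFactor q e (a * b * c) Y k)
    * ∏' k : ℕ, denFactor q e (a * b * c) z Y (m + k))‖ ≤ u m := by
  obtain ⟨ρ, hρ0, hρ, hρ1, hρ2⟩ := exists_decay_rate hz hz1 he
  obtain ⟨C, hC, hV⟩ := exists_vwpCoeff_bound_at hq0 hq1 ha hb hc hz
  refine ⟨fun m => C * (ρ ^ m * Real.exp (factorBound e (a * b * c) z ρ 1 R * (2 / (1 - q)))),
    ((summable_geometric_of_lt_one hρ0.le hρ).mul_right _).mul_left C, fun Y hY m => ?_⟩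
  rw [norm_mul]
  exact mul_le_mul (hV m) (norm_spectralFun_term_le hq0 hq1 hz hρ0 hρ1 hρ2 hY m)
    (norm_nonneg _) hC.le

theorem eventually_norm_le_add_one (x : ℂ) : ∀ᶠ y in 𝓝 x, ‖y‖ ≤ ‖x‖ + 1 :=
  (continuous_norm.tendsto x).eventually_le_const (by linarith)

theorem differentiable_spectralFun {q : ℝ} (hq0 : 0 < q) (hq1 : q < 1) {a b c e z : ℂ}
    (ha : ‖a‖ < 1) (hb : ‖b‖ < 1) (hc : ‖c‖ < 1) (he : ‖e‖ < 1) (hz : z ≠ 0) (hz1 : ‖z‖ < 1) :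
    Differentiable ℂ (spectralFun q a b c e z) := by
  rw [← differentiableOn_univ]
  refine differentiableOn_tsum_of_locally_summable isOpen_univ (fun m => ?_) fun x _ => ?_
  · refine (differentiableOn_const _).mul (DifferentiableOn.mul ?_ ?_)
    · refine DifferentiableOn.fun_finsetProd fun k _ => ?_
      unfold numFactor
      fun_prop
    · refine differentiableOn_tprod_of_geometric hq0 hq1 isOpen_univ (fun k => ?_) fun x _ => ?_
      · unfold denFactor
        fun_prop
      · refine ⟨factorBound e (a * b * c) z 1 1 (‖x‖ + 1), ?_⟩
        filter_upwards [eventually_norm_le_add_one x] with y hy k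
        have h := norm_denFactor_sub_one_le (e := e) (κ := a * b * c) hq0 hq1 hz hy (m + k)
        refine h.trans (mul_le_mul_of_nonneg_left ?_ ?_)
        · exact pow_le_pow_of_le_one hq0.le hq1.le (by omega)
        · unfold factorBound; positivity
  · obtain ⟨u, hu, hb⟩ := summable_spectralFun hq0 hq1 ha hb hc he hz hz1 (‖x‖ + 1)
    exact ⟨u, hu, (eventually_norm_le_add_one x).mono hb⟩

/-! ### Real zeros under locally uniform convergence -/

/-- Mean value inequality for f(w) - c w. With half of |c| as error it gives both the sign change of
the limit function and the injectivity of the approximating functions. -/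
theorem norm_sub_sub_mul_le_of_deriv {f : ℂ → ℂ} {z₀ c : ℂ} {δ : ℝ}
    (hf : DifferentiableOn ℂ f (Metric.ball z₀ δ))
    (hd : ∀ y ∈ Metric.ball z₀ δ, ‖deriv f y - c‖ ≤ ‖c‖ / 2) {y y' : ℂ}
    (hy : y ∈ Metric.ball z₀ δ) (hy' : y' ∈ Metric.ball z₀ δ) :
    ‖f y' - f y - c * (y' - y)‖ ≤ ‖c‖ / 2 * ‖y' - y‖ := by
  have h := (convex_ball z₀ δ).norm_image_sub_le_of_norm_hasDerivWithin_le
    (f := fun w => f w - c * w) (f' := fun w => deriv f w - c) (C := ‖c‖ / 2)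
    (fun w hw => ?_) hd hy hy'
  · have e : f y' - f y - c * (y' - y) = f y' - c * y' - (f y - c * y) := by ring
    rw [e]
    exact h
  · have h1 : HasDerivAt f (deriv f w) w :=
      (hf.differentiableAt (Metric.isOpen_ball.mem_nhds hw)).hasDerivAt
    have h2 := h1.sub ((hasDerivAt_id w).const_mul c)
    simp only [mul_one] at h2
    exact h2.hasDerivWithinAt

theorem im_deriv_eq_zero_of_real {g : ℂ → ℂ} {x : ℝ} (hg : DifferentiableAt ℂ g x)
    (hre : ∀ᶠ y : ℝ in 𝓝 x, (g y).im = 0) : (deriv g x).im = 0 := by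
  have h1 : HasDerivAt (fun y : ℝ => g y) (deriv g x) x := hg.hasDerivAt.comp_ofReal
  have h2 : HasDerivAt (fun y : ℝ => (g y).im) (deriv g x).im x :=
    (Complex.imCLM.hasFDerivAt (x := g x)).comp_hasDerivAt (f := fun y : ℝ => g y) x h1
  have h3 : HasDerivAt (fun y : ℝ => (g y).im) 0 x :=
    (hasDerivAt_const x (0 : ℝ)).congr_of_eventuallyEq hre
  exact h2.unique h3

/-- On the compact set of points of the interval at distance at least ε from x₀ the limit is bounded
away from 0, and uniform convergence keeps the approximants nonzero there. -/
theorem eventually_zero_near {F : ℕ → ℂ → ℂ} {g : ℂ → ℂ} {U : Set ℂ} (hU : IsOpen U)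
    (hF : TendstoLocallyUniformlyOn F g atTop U) (hgc : ContinuousOn g U) {x₁ x₂ x₀ : ℝ}
    (hI : ∀ x ∈ Set.Icc x₁ x₂, (x : ℂ) ∈ U)
    (hne : ∀ x ∈ Set.Icc x₁ x₂, g x = 0 → x = x₀) {ε : ℝ} (hε : 0 < ε) :
    ∀ᶠ N in atTop, ∀ s ∈ Set.Icc x₁ x₂, F N s = 0 → |s - x₀| < ε := by
  set K : Set ℝ := Set.Icc x₁ x₂ ∩ {s | ε ≤ |s - x₀|}
  have hK : IsCompact K := isCompact_Icc.inter_right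
    (isClosed_le continuous_const (by fun_prop))
  have hKU : ((↑) '' K : Set ℂ) ⊆ U := by
    rintro _ ⟨x, hx, rfl⟩
    exact hI x hx.1
  have hKc : IsCompact ((↑) '' K : Set ℂ) := hK.image continuous_ofReal
  obtain ⟨m, hm, hmK⟩ := hKc.exists_forall_le' (a := 0) (f := fun z => ‖g z‖)
    ((hgc.mono hKU).norm) (by
      rintro _ ⟨x, hx, rfl⟩
      refine norm_pos_iff.mpr fun h => ?_
      have := hne x hx.1 h
      have h2 := hx.2
      simp only [Set.mem_ofPred_eq, this, sub_self, abs_zero] at h2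
      linarith)
  have hu := (tendstoLocallyUniformlyOn_iff_forall_isCompact hU).mp hF _ hKU hKc
  filter_upwards [Metric.tendstoUniformlyOn_iff.mp hu m hm] with N hN s hs h0
  by_contra hcon
  have hsK : (s : ℂ) ∈ ((↑) '' K : Set ℂ) := ⟨s, ⟨hs, not_lt.mp hcon⟩, rfl⟩
  have h1 := hN s hsK
  rw [h0, dist_zero_right] at h1
  exact absurd (hmK s hsK) (not_le.mpr h1)

/-- Hurwitz's theorem on the real line. Existence comes from a sign change at a simple zero,
uniqueness from derivatives close to the nonzero constant g'(x₀). Real values are essential: the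
zero found is real. -/
theorem eventually_existsUnique_real_zero {F : ℕ → ℂ → ℂ} {g : ℂ → ℂ} {U : Set ℂ} (hU : IsOpen U)
    (hF : TendstoLocallyUniformlyOn F g atTop U) (hd : ∀ N, DifferentiableOn ℂ (F N) U)
    (hre : ∀ N, ∀ x : ℝ, (F N x).im = 0) {x₁ x₂ x₀ : ℝ} (h1 : x₁ < x₀) (h2 : x₀ < x₂)
    (hI : ∀ x ∈ Set.Icc x₁ x₂, (x : ℂ) ∈ U) (h0 : g x₀ = 0) (hg' : deriv g x₀ ≠ 0)
    (hne : ∀ x ∈ Set.Icc x₁ x₂, g x = 0 → x = x₀) :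
    ∀ᶠ N in atTop, ∃ s ∈ Set.Ioo x₁ x₂, F N s = 0 ∧ ∀ s' ∈ Set.Icc x₁ x₂, F N s' = 0 → s' = s := by
  have hgd : DifferentiableOn ℂ g U := hF.differentiableOn (Eventually.of_forall hd) hU
  have hU0 : (x₀ : ℂ) ∈ U := hI x₀ ⟨h1.le, h2.le⟩
  have hgre : ∀ x ∈ Set.Icc x₁ x₂, (g x).im = 0 := fun x hx => by
    have h := (continuous_im.tendsto _).comp (hF.tendsto_at (hI x hx))
    refine tendsto_nhds_unique h ?_
    exact tendsto_const_nhds.congr fun N => (hre N x).symm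
  set c := deriv g x₀ with hc
  have hcpos : 0 < ‖c‖ := norm_pos_iff.mpr hg'
  have hcim : c.im = 0 := im_deriv_eq_zero_of_real (hgd.differentiableAt (hU.mem_nhds hU0))
    (by filter_upwards [Icc_mem_nhds h1 h2] with x hx using hgre x hx)
  have hcre : |c.re| = ‖c‖ := by
    rw [← Complex.re_add_im c, hcim]
    simp [Complex.norm_real]
  have hdc : ContinuousAt (deriv g) x₀ :=
    ((hgd.deriv hU).differentiableAt (hU.mem_nhds hU0)).continuousAt
  -- A quarter of |c| is allowed for g' - c and another quarter for F_N' - g', which together give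
  -- the half required by the mean value inequality.
  have hev1 : ∀ᶠ y in 𝓝 (x₀ : ℂ), ‖deriv g y - c‖ < ‖c‖ / 4 := by
    simpa [dist_eq_norm] using Metric.tendsto_nhds.mp hdc (‖c‖ / 4) (by positivity)
  obtain ⟨t, ht, htN⟩ := Metric.tendstoLocallyUniformlyOn_iff.mp
    (hF.deriv (Eventually.of_forall hd) hU) (‖c‖ / 4) (by positivity) x₀ hU0
  rw [hU.nhdsWithin_eq hU0] at ht
  have hev2 : ∀ᶠ y in 𝓝 (x₀ : ℂ), y ∈ U := hU.mem_nhds hU0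
  have hev3 : ∀ᶠ y in 𝓝 (x₀ : ℂ), y ∈ t := ht
  obtain ⟨δ, hδ, hball⟩ := Metric.eventually_nhds_iff_ball.mp (hev1.and (hev2.and hev3))
  have hsub : Metric.ball (x₀ : ℂ) δ ⊆ U := fun y hy => (hball y hy).2.1
  set r := min δ (min (x₀ - x₁) (x₂ - x₀)) / 2 with hr
  have hm : 0 < min δ (min (x₀ - x₁) (x₂ - x₀)) :=
    lt_min hδ (lt_min (by linarith) (by linarith))
  have hr0 : 0 < r := by positivity
  have hrδ : r < δ := by
    have := min_le_left δ (min (x₀ - x₁) (x₂ - x₀))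
    linarith
  have hr1 : r < x₀ - x₁ := by
    have := (min_le_right δ (min (x₀ - x₁) (x₂ - x₀))).trans (min_le_left _ _)
    linarith
  have hr2 : r < x₂ - x₀ := by
    have := (min_le_right δ (min (x₀ - x₁) (x₂ - x₀))).trans (min_le_right _ _)
    linarith
  have hmem : ∀ x : ℝ, |x - x₀| < δ → (x : ℂ) ∈ Metric.ball (x₀ : ℂ) δ := fun x hx => by
    rw [Metric.mem_ball, dist_eq_norm, ← ofReal_sub, norm_real]
    exact hx
  have hsgn : ∀ y : ℝ, |y| = r → |(g ((x₀ + y : ℝ) : ℂ)).re - c.re * y| ≤ |c.re| / 2 * r := by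
    intro y hy
    have h := norm_sub_sub_mul_le_of_deriv (hgd.mono hsub)
      (fun z hz => (hball z hz).1.le.trans (by linarith)) (Metric.mem_ball_self hδ)
      (hmem (x₀ + y) (by simpa [hy] using hrδ))
    rw [h0, sub_zero, ← ofReal_sub, add_sub_cancel_left, norm_real, Real.norm_eq_abs, hy, ← hcre] at h
    refine le_trans ?_ h
    have := abs_re_le_norm (g ((x₀ + y : ℝ) : ℂ) - c * y)
    simpa using this
  have hp : 0 < (g ((x₀ + r : ℝ) : ℂ)).re * c.re := by
    have h := abs_le.mp (hsgn r (abs_of_pos hr0))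
    rcases lt_trichotomy c.re 0 with h3 | h3 | h3
    · rw [abs_of_neg h3] at h
      have : (g ((x₀ + r : ℝ) : ℂ)).re < 0 := by nlinarith
      nlinarith
    · rw [h3, abs_zero] at hcre; linarith
    · rw [abs_of_pos h3] at h
      have : 0 < (g ((x₀ + r : ℝ) : ℂ)).re := by nlinarith
      positivity
  have hn : (g ((x₀ + -r : ℝ) : ℂ)).re * c.re < 0 := by
    have h := abs_le.mp (hsgn (-r) (by rw [abs_neg, abs_of_pos hr0]))
    rcases lt_trichotomy c.re 0 with h3 | h3 | h3
    · rw [abs_of_neg h3] at h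
      have : 0 < (g ((x₀ + -r : ℝ) : ℂ)).re := by nlinarith
      nlinarith
    · rw [h3, abs_zero] at hcre; linarith
    · rw [abs_of_pos h3] at h
      have : (g ((x₀ + -r : ℝ) : ℂ)).re < 0 := by nlinarith
      nlinarith
  have hlim : ∀ x : ℝ, x ∈ Set.Icc x₁ x₂ →
      Tendsto (fun N => (F N x).re * c.re) atTop (𝓝 ((g x).re * c.re)) := fun x hx =>
    ((continuous_re.tendsto _).comp (hF.tendsto_at (hI x hx))).mul_const _
  filter_upwards [htN, (hlim (x₀ + r) ⟨by linarith, by linarith⟩).eventually_const_lt hp,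
    (hlim (x₀ + -r) ⟨by linarith, by linarith⟩).eventually_lt_const hn,
    eventually_zero_near hU hF hgd.continuousOn hI hne hδ] with N hN hNp hNn hNε
  have hinj : ∀ s s' : ℝ, |s - x₀| < δ → |s' - x₀| < δ → F N s = 0 → F N s' = 0 → s' = s := by
    intro s s' hs hs' e1 e2
    have h := norm_sub_sub_mul_le_of_deriv ((hd N).mono hsub) (c := c) (fun z hz => ?_)
      (hmem s hs) (hmem s' hs')
    · rw [e1, e2, sub_self, zero_sub, norm_neg, norm_mul] at h
      have h5 : ‖(s' : ℂ) - s‖ ≤ 0 := by nlinarith [norm_nonneg ((s' : ℂ) - s)]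
      have h6 := sub_eq_zero.mp (norm_le_zero_iff.mp h5)
      exact_mod_cast h6
    · have h3 := hN z (hball z hz).2.2
      have h4 := (hball z hz).1
      rw [dist_eq_norm, ← norm_neg, neg_sub] at h3
      have h5 : deriv (F N) z - c = (deriv (F N) z - deriv g z) + (deriv g z - c) := by ring
      rw [h5]
      refine (norm_add_le _ _).trans ?_
      have h6 : ‖deriv (F N) z - deriv g z‖ < ‖c‖ / 4 := h3
      linarith
  have hcont : ContinuousOn (fun x : ℝ => (F N x).re * c.re) (Set.Icc (x₀ + -r) (x₀ + r)) := by
    refine ContinuousOn.mul (continuous_re.comp_continuousOn ?_) continuousOn_const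
    refine (hd N).continuousOn.comp continuous_ofReal.continuousOn fun x hx => ?_
    exact hI x ⟨by linarith [hx.1], by linarith [hx.2]⟩
  obtain ⟨s, hs, hs0⟩ := intermediate_value_Icc (by linarith) hcont ⟨hNn.le, hNp.le⟩
  have hc0 : c.re ≠ 0 := fun h => by rw [h, abs_zero] at hcre; linarith
  have hFs : F N s = 0 := Complex.ext ((mul_eq_zero.mp hs0).resolve_right hc0) (hre N s)
  have hsI : s ∈ Set.Ioo x₁ x₂ := ⟨by linarith [hs.1], by linarith [hs.2]⟩
  -- Local injectivity only covers the δ-ball, but by then every zero in the whole interval lies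
  -- inside that ball.
  exact ⟨s, hsI, hFs, fun s' hs' h' =>
    hinj s s' (hNε s ⟨hsI.1.le, hsI.2.le⟩ hFs) (hNε s' hs' h') hFs h'⟩

/-! ### Reality and the large zeros of the spectral function -/

/-- The parameters are all real, or two of them are conjugate and the third one is real. -/
def ConjInvariant (a b c : ℂ) : Prop :=
  (a.im = 0 ∧ b.im = 0 ∧ c.im = 0) ∨ (b = starRingEnd ℂ a ∧ c.im = 0) ∨
    (c = starRingEnd ℂ a ∧ b.im = 0) ∨ (c = starRingEnd ℂ b ∧ a.im = 0)

/-- Conjugation only permutes the three parameters, and the two transpositions in the hypotheses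
generate all permutations. -/
theorem ConjInvariant.map_conj {a b c : ℂ} (h : ConjInvariant a b c) {X : Type*}
    (f : ℂ → ℂ → ℂ → X) (h1 : ∀ a b c, f a b c = f b a c) (h2 : ∀ a b c, f a b c = f c b a) :
    f (starRingEnd ℂ a) (starRingEnd ℂ b) (starRingEnd ℂ c) = f a b c := by
  rcases h with ⟨ha, hb, hc⟩ | ⟨rfl, hc⟩ | ⟨rfl, hb⟩ | ⟨rfl, ha⟩
  · rw [conj_eq_iff_im.mpr ha, conj_eq_iff_im.mpr hb, conj_eq_iff_im.mpr hc]
  · rw [conj_eq_iff_im.mpr hc, conj_conj, h1]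
  · rw [conj_eq_iff_im.mpr hb, conj_conj, h2]
  · rw [conj_eq_iff_im.mpr ha, conj_conj, h1, h2, h1]

theorem ConjInvariant.conj_mul {a b c : ℂ} (h : ConjInvariant a b c) :
    starRingEnd ℂ (a * b * c) = a * b * c := by
  rw [map_mul, map_mul]
  exact h.map_conj (fun a b c => a * b * c) (fun a b c => by ring) (fun a b c => by ring)

theorem conj_vwpCoeff (q : ℝ) (a b c z : ℂ) (m : ℕ) :
    starRingEnd ℂ (vwpCoeff q a b c z m)
      = vwpCoeff q (starRingEnd ℂ a) (starRingEnd ℂ b) (starRingEnd ℂ c) (starRingEnd ℂ z) m := by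
  rcases m with _ | m
  · simp [vwpCoeff_zero]
  · simp [vwpCoeff, vwpFactor_succ, conj_qPoch]

theorem conj_spectralFun {q : ℝ} (hq0 : 0 < q) (hq1 : q < 1) {a b c e z Y : ℂ} (hz : z ≠ 0) :
    starRingEnd ℂ (spectralFun q a b c e z Y)
      = spectralFun q (starRingEnd ℂ a) (starRingEnd ℂ b) (starRingEnd ℂ c) (starRingEnd ℂ e)
          (starRingEnd ℂ z) (starRingEnd ℂ Y) := by
  unfold spectralFun
  rw [← conjCLE_apply, ContinuousLinearEquiv.map_tsum]
  refine tsum_congr fun m => ?_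
  have hm : Multipliable fun k => denFactor q e (a * b * c) z Y (m + k) := by
    have := multipliable_denFactor_div_scale (e := e) (κ := a * b * c) (s := Y) (N := 0)
      hq0 hq1 hz one_pos one_pos (by simp) le_rfl m
    simpa [scaleFactor] using this
  rw [conjCLE_apply, map_mul, map_mul, map_prod, conj_vwpCoeff,
    hm.map_tprod (starRingEnd ℂ) continuous_conj]
  simp [numFactor, denFactor]

theorem spectralFun_swap_left (q : ℝ) (a b c e z Y : ℂ) :
    spectralFun q a b c e z Y = spectralFun q b a c e z Y := by
  unfold spectralFun
  simp_rw [vwpCoeff_swap_left q a b c, mul_comm a b]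

theorem spectralFun_swap_outer (q : ℝ) (a b c e z Y : ℂ) :
    spectralFun q a b c e z Y = spectralFun q c b a e z Y := by
  unfold spectralFun
  simp_rw [vwpCoeff_swap_outer q a b c, show a * b * c = c * b * a by ring]

theorem ConjInvariant.conj_spectralFun {q : ℝ} (hq0 : 0 < q) (hq1 : q < 1) {a b c : ℂ}
    (h : ConjInvariant a b c) {e α : ℝ} (hα : α ≠ 0) (Y : ℂ) :
    starRingEnd ℂ (spectralFun q a b c e α Y) = spectralFun q a b c e α (starRingEnd ℂ Y) := by
  rw [_root_.conj_spectralFun hq0 hq1 (by exact_mod_cast hα), conj_ofReal, conj_ofReal]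
  exact h.map_conj (fun a b c => spectralFun q a b c e α (starRingEnd ℂ Y))
    (fun _ _ _ => spectralFun_swap_left ..) (fun _ _ _ => spectralFun_swap_outer ..)

/-- The spectral function at `s / q^N`, divided by its leading growth. -/
noncomputable def scaledSpectralFun (q : ℝ) (a b c e z : ℂ) (N : ℕ) (s : ℂ) : ℂ :=
  spectralFun q a b c e z (s / (q : ℂ) ^ N) / ∏ k ∈ Finset.range N, scaleFactor q z s N k

theorem differentiableOn_qTheta {q : ℝ} (hq0 : 0 < q) (hq1 : q < 1) (z : ℂ) :
    DifferentiableOn ℂ (qTheta q z) {0}ᶜ := by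
  intro s hs
  have hs' : s ≠ 0 := hs
  refine DifferentiableAt.differentiableWithinAt (DifferentiableAt.mul ?_ ?_)
  · exact ((differentiable_qPochInf hq0 hq1) _).comp s
      ((differentiableAt_const _).div differentiableAt_id hs')
  · exact ((differentiable_qPochInf hq0 hq1) _).comp s (differentiableAt_id.div_const _)

theorem tendstoLocallyUniformlyOn_scaledSpectralFun {q : ℝ} (hq0 : 0 < q) (hq1 : q < 1)
    {a b c e z : ℂ} (ha : ‖a‖ < 1) (hb : ‖b‖ < 1) (hc : ‖c‖ < 1) (he : ‖e‖ < 1) (hz : z ≠ 0)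
    (hz1 : ‖z‖ < 1) :
    TendstoLocallyUniformlyOn (scaledSpectralFun q a b c e z)
      (fun s => sixPhiFive q a b c z * qTheta q z s) atTop {0}ᶜ := by
  rw [isOpen_compl_singleton.tendstoLocallyUniformlyOn_iff_forall_tendsto]
  intro s hs
  have hs' : s ≠ 0 := hs
  have h1 := tendsto_spectralFun_div_scale hq0 hq1 ha hb hc he hz hz1 hs'
  have h2 : Tendsto (fun y : ℕ × ℂ => sixPhiFive q a b c z * qTheta q z y.2) (atTop ×ˢ 𝓝 s)
      (𝓝 (sixPhiFive q a b c z * qTheta q z s)) :=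
    ((((differentiableOn_qTheta hq0 hq1 z).differentiableAt
      (isOpen_compl_singleton.mem_nhds hs)).continuousAt.tendsto).const_mul _).comp tendsto_snd
  exact (h2.prodMk_nhds h1).mono_right (nhds_le_uniformity _)

theorem differentiableOn_scaledSpectralFun {q : ℝ} (hq0 : 0 < q) (hq1 : q < 1)
    {a b c e z : ℂ} (ha : ‖a‖ < 1) (hb : ‖b‖ < 1) (hc : ‖c‖ < 1) (he : ‖e‖ < 1) (hz : z ≠ 0)
    (hz1 : ‖z‖ < 1) (N : ℕ) : DifferentiableOn ℂ (scaledSpectralFun q a b c e z N) {0}ᶜ := by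
  intro s hs
  have hs' : s ≠ 0 := hs
  refine DifferentiableAt.differentiableWithinAt (DifferentiableAt.div ?_ ?_ ?_)
  · exact (differentiable_spectralFun hq0 hq1 ha hb hc he hz hz1 _).comp s
      (differentiableAt_id.div_const _)
  · refine DifferentiableAt.fun_finsetProd fun k _ => ?_
    unfold scaleFactor
    split_ifs <;> fun_prop
  · exact Finset.prod_ne_zero_iff.mpr fun k _ => scaleFactor_ne_zero hq0 hz (fun _ => hs') k

theorem scaledSpectralFun_eq_zero_iff {q : ℝ} (hq0 : 0 < q) {a b c e z s : ℂ} (hz : z ≠ 0)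
    (hs : s ≠ 0) (N : ℕ) :
    scaledSpectralFun q a b c e z N s = 0 ↔ spectralFun q a b c e z (s / (q : ℂ) ^ N) = 0 := by
  rw [scaledSpectralFun, div_eq_zero_iff, or_iff_left]
  exact Finset.prod_ne_zero_iff.mpr fun k _ => scaleFactor_ne_zero hq0 hz (fun _ => hs) k

theorem ConjInvariant.im_scaledSpectralFun {q : ℝ} (hq0 : 0 < q) (hq1 : q < 1) {a b c : ℂ}
    (h : ConjInvariant a b c) {e α : ℝ} (hα : α ≠ 0) (N : ℕ) (x : ℝ) :
    (scaledSpectralFun q a b c e α N x).im = 0 := by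
  rw [← conj_eq_iff_im, scaledSpectralFun, map_div₀, map_prod, h.conj_spectralFun hq0 hq1 hα]
  congr 1
  · simp
  · refine Finset.prod_congr rfl fun k _ => ?_
    unfold scaleFactor
    split_ifs <;> simp

section Theta

variable {q : ℝ} (hq0 : 0 < q) (hq1 : q < 1)
include hq0 hq1

theorem qTheta_self {z : ℂ} (hz : z ≠ 0) : qTheta q z z = 0 := by
  rw [qTheta, div_self hz, qPochInf_succ hq0 hq1 1]
  simp

theorem qTheta_self_eq {z : ℂ} (s : ℂ) :
    qTheta q z s = (1 - s / z) * (qPochInf q (z * q / s) * qPochInf q (s / z * q)) := by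
  rw [qTheta, qPochInf_succ hq0 hq1 (s / z)]
  ring

theorem deriv_qTheta_self {z : ℂ} (hz : z ≠ 0) : deriv (qTheta q z) z ≠ 0 := by
  have hq : ‖(q : ℂ)‖ < 1 := norm_ofReal_lt_one hq0 hq1
  have e : qTheta q z = fun s => (1 - s / z) * (qPochInf q (z * q / s) * qPochInf q (s / z * q)) :=
    funext fun s => qTheta_self_eq hq0 hq1 s
  have hd : DifferentiableAt ℂ (fun s => qPochInf q (z * q / s) * qPochInf q (s / z * q)) z := by
    refine DifferentiableAt.mul ?_ ?_
    · exact ((differentiable_qPochInf hq0 hq1) _).comp z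
        ((differentiableAt_const _).div differentiableAt_id hz)
    · exact ((differentiable_qPochInf hq0 hq1) _).comp z
        ((differentiableAt_id.div_const _).mul_const _)
  have h1 : HasDerivAt (fun s : ℂ => 1 - s / z) (-(1 / z)) z :=
    ((hasDerivAt_id z).div_const z).const_sub 1
  have h2 := h1.mul hd.hasDerivAt
  have h3 : deriv (qTheta q z) z = -(1 / z) * (qPochInf q (z * q / z) * qPochInf q (z / z * q)) := by
    rw [e]
    refine h2.deriv.trans ?_
    rw [div_self hz, sub_self, zero_mul, add_zero]
  rw [h3, div_self hz, one_mul, mul_comm z, mul_div_assoc, div_self hz, mul_one]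
  exact mul_ne_zero (neg_ne_zero.mpr (one_div_ne_zero hz)) (mul_ne_zero
    (qPochInf_ne_zero_of_norm_lt_one hq0 hq1 hq) (qPochInf_ne_zero_of_norm_lt_one hq0 hq1 hq))

/-- In the open annulus q|z| < |s| < |z|/q the only factor that can vanish is 1 - s/z. -/
theorem qTheta_ne_zero {z s : ℂ} (hz : z ≠ 0) (h1 : ‖z‖ * q < ‖s‖) (h2 : ‖s‖ * q < ‖z‖)
    (hsz : s ≠ z) : qTheta q z s ≠ 0 := by
  have hz0 : 0 < ‖z‖ := norm_pos_iff.mpr hz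
  have hs0 : 0 < ‖s‖ := lt_of_le_of_lt (by positivity) h1
  rw [qTheta_self_eq hq0 hq1]
  refine mul_ne_zero ?_ (mul_ne_zero ?_ ?_)
  · intro h
    exact hsz ((div_eq_one_iff_eq hz).mp (sub_eq_zero.mp h).symm)
  · refine qPochInf_ne_zero_of_norm_lt_one hq0 hq1 ?_
    rw [norm_div, norm_mul, norm_real, Real.norm_of_nonneg hq0.le, div_lt_one hs0]
    exact h1
  · refine qPochInf_ne_zero_of_norm_lt_one hq0 hq1 ?_
    rw [norm_mul, norm_div, norm_real, Real.norm_of_nonneg hq0.le, div_mul_eq_mul_div,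
      div_lt_one hz0]
    exact h2

end Theta

section LargeZeros

variable {q : ℝ} (hq0 : 0 < q) (hq1 : q < 1) {a b c : ℂ} (ha : ‖a‖ < 1) (hb : ‖b‖ < 1)
  (hc : ‖c‖ < 1) (hreal : ConjInvariant a b c) {e α : ℝ} (he : |e| < 1) (hα0 : 0 < α) (hα1 : α < 1)
  (hdef : ∀ k : ℕ, a * b * c / α * (q : ℂ) ^ k ≠ 1)
include hq0 hq1 ha hb hc he hα0 hα1 hdef

omit ha hb hc he hα1 hdef in
-- The windows q^{-N} [α√q, α/√q] tile the positive half-line, each containing the expected zero α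
-- q^{-N} as its geometric centre.
theorem sqrt_interval : 0 < α * √q ∧ α * q < α * √q ∧ α * √q < α ∧ α < α / √q ∧ α / √q * q < α := by
  have h1 : 0 < √q := Real.sqrt_pos.mpr hq0
  have h2 : √q < 1 := by rw [Real.sqrt_lt' one_pos]; simpa using hq1
  have h3 : √q * √q = q := Real.mul_self_sqrt hq0.le
  have h4 : α / √q * q = α * √q := by
    rw [div_mul_eq_mul_div, div_eq_iff h1.ne', mul_assoc, h3]
  refine ⟨by positivity, ?_, by nlinarith, ?_, by rw [h4]; nlinarith⟩
  · exact mul_lt_mul_of_pos_left (by nlinarith) hα0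
  · rw [lt_div_iff₀ h1]; nlinarith

omit he in
theorem limit_ne_zero (x : ℝ) (hx : x ∈ Set.Icc (α * √q) (α / √q))
    (h0 : sixPhiFive q a b c α * qTheta q α x = 0) : x = α := by
  obtain ⟨i1, i2, i3, i4, i5⟩ := sqrt_interval hq0 hq1 hα0
  have hαc : (α : ℂ) ≠ 0 := by exact_mod_cast hα0.ne'
  have hx0 : 0 < x := i1.trans_le hx.1
  have hC : sixPhiFive q a b c α ≠ 0 := sixPhiFive_ne_zero hq0 hq1 ha hb hc hαc
    (by rw [norm_real, Real.norm_of_nonneg hα0.le]; exact hα1) hdef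
  by_contra hne
  refine mul_ne_zero hC (qTheta_ne_zero hq0 hq1 hαc ?_ ?_ (by exact_mod_cast hne)) h0
  · rw [norm_real, norm_real, Real.norm_of_nonneg hα0.le, Real.norm_of_nonneg hx0.le]
    linarith [hx.1]
  · rw [norm_real, norm_real, Real.norm_of_nonneg hα0.le, Real.norm_of_nonneg hx0.le]
    nlinarith [hx.2]

theorem eventually_spectralFun_zero_near {ε : ℝ} (hε : 0 < ε) : ∀ᶠ N : ℕ in atTop,
    ∀ s ∈ Set.Icc (α * √q) (α / √q), spectralFun q a b c e α (s / (q : ℂ) ^ N) = 0 →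
      |s - α| < ε := by
  obtain ⟨i1, i2, i3, i4, i5⟩ := sqrt_interval hq0 hq1 hα0
  have hαc : (α : ℂ) ≠ 0 := by exact_mod_cast hα0.ne'
  have hI : ∀ x ∈ Set.Icc (α * √q) (α / √q), (x : ℂ) ∈ ({0}ᶜ : Set ℂ) := fun x hx => by
    have : x ≠ 0 := (i1.trans_le hx.1).ne'
    simpa using this
  have hα1' : ‖(α : ℂ)‖ < 1 := by rwa [norm_real, Real.norm_of_nonneg hα0.le]
  have h := eventually_zero_near isOpen_compl_singleton
    (tendstoLocallyUniformlyOn_scaledSpectralFun hq0 hq1 ha hb hc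
      (by simpa using he : ‖(e : ℂ)‖ < 1) hαc hα1')
    (continuousOn_const.mul (differentiableOn_qTheta hq0 hq1 α).continuousOn) hI
    (limit_ne_zero hq0 hq1 ha hb hc hα0 hα1 hdef) hε
  filter_upwards [h] with N hN s hs h0
  exact hN s hs ((scaledSpectralFun_eq_zero_iff hq0 hαc (hI s hs) N).mpr h0)

include hreal in
-- The limit is a nonzero constant times the theta function, whose zero at α is simple and alone in
-- the window. Uniqueness is claimed on the closed window so that no zero escapes at an end point
-- shared by two windows.
theorem eventually_existsUnique_spectralFun_zero : ∀ᶠ N : ℕ in atTop,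
    ∃ s ∈ Set.Ioo (α * √q) (α / √q), spectralFun q a b c e α (s / (q : ℂ) ^ N) = 0 ∧
      ∀ s' ∈ Set.Icc (α * √q) (α / √q), spectralFun q a b c e α (s' / (q : ℂ) ^ N) = 0 →
        s' = s := by
  obtain ⟨i1, i2, i3, i4, i5⟩ := sqrt_interval hq0 hq1 hα0
  have hαc : (α : ℂ) ≠ 0 := by exact_mod_cast hα0.ne'
  have hI : ∀ x ∈ Set.Icc (α * √q) (α / √q), (x : ℂ) ∈ ({0}ᶜ : Set ℂ) := fun x hx => by
    have : x ≠ 0 := (i1.trans_le hx.1).ne'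
    simpa using this
  have hα1' : ‖(α : ℂ)‖ < 1 := by rwa [norm_real, Real.norm_of_nonneg hα0.le]
  have he' : ‖(e : ℂ)‖ < 1 := by simpa using he
  have hC : sixPhiFive q a b c α ≠ 0 := sixPhiFive_ne_zero hq0 hq1 ha hb hc hαc hα1' hdef
  have h := eventually_existsUnique_real_zero isOpen_compl_singleton
    (tendstoLocallyUniformlyOn_scaledSpectralFun hq0 hq1 ha hb hc he' hαc hα1')
    (differentiableOn_scaledSpectralFun hq0 hq1 ha hb hc he' hαc hα1')
    (hreal.im_scaledSpectralFun hq0 hq1 hα0.ne') i3 i4 hI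
    (by rw [qTheta_self hq0 hq1 hαc, mul_zero])
    (by
      rw [deriv_const_mul _ ((differentiableOn_qTheta hq0 hq1 α).differentiableAt
        (isOpen_compl_singleton.mem_nhds hαc))]
      exact mul_ne_zero hC (deriv_qTheta_self hq0 hq1 hαc))
    (limit_ne_zero hq0 hq1 ha hb hc hα0 hα1 hdef)
  filter_upwards [h] with N hN
  obtain ⟨s, hs, h0, hu⟩ := hN
  have hz := fun s hs => scaledSpectralFun_eq_zero_iff (a := a) (b := b) (c := c) (e := e) (s := s)
    hq0 hαc hs N
  exact ⟨s, hs, (hz s (hI s ⟨hs.1.le, hs.2.le⟩)).mp h0, fun s' hs' h' =>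
    hu s' hs' ((hz s' (hI s' hs')).mpr h')⟩

end LargeZeros

/-! ### Enumeration of the zeros -/

theorem exists_strictMono_enumeration (S : Finset ℝ) :
    ∀ ζ : ℕ → ℝ, StrictMono ζ → (∀ x ∈ S, x < ζ 0) →
      ∃ z : ℕ → ℝ, StrictMono z ∧ Set.range z = ↑S ∪ Set.range ζ ∧ ∀ n, z (S.card + n) = ζ n := by
  induction S using Finset.induction_on_max with
  | empty => exact fun ζ hζ _ => ⟨ζ, hζ, by simp, by simp⟩
  | insert a s has ih =>
    intro ζ hζ h
    obtain ⟨z, hz, hr, hn⟩ := ih (fun n => Nat.casesOn n a ζ)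
      (strictMono_nat_of_lt_succ fun n => by
        rcases n with _ | n
        · exact h a (Finset.mem_insert_self a s)
        · exact hζ (Nat.lt_succ_self n)) has
    refine ⟨z, hz, ?_, fun n => ?_⟩
    · rw [hr]
      ext x
      simp only [Set.mem_union, Finset.mem_coe, Set.mem_range, Finset.mem_insert]
      constructor
      · rintro (h | ⟨_ | n, rfl⟩)
        · exact Or.inl (Or.inr h)
        · exact Or.inl (Or.inl rfl)
        · exact Or.inr ⟨n, rfl⟩
      · rintro ((rfl | h) | ⟨n, rfl⟩)
        · exact Or.inr ⟨0, rfl⟩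
        · exact Or.inl h
        · exact Or.inr ⟨n + 1, rfl⟩
    · rw [Finset.card_insert_of_notMem fun ha => lt_irrefl a (has a ha)]
      have := hn (n + 1)
      rwa [show s.card + 1 + n = s.card + (n + 1) by ring]

/-- Infinitely many zeros in a compact interval would accumulate, and the identity theorem would
make the entire function vanish. -/
theorem finite_real_zeros {G : ℂ → ℂ} (hG : Differentiable ℂ G) {x₁ : ℂ} (hne : G x₁ ≠ 0)
    (u v : ℝ) : {x : ℝ | x ∈ Set.Icc u v ∧ G x = 0}.Finite := by
  by_contra hinf
  have hinf' : {x : ℝ | x ∈ Set.Icc u v ∧ G x = 0}.Infinite := hinf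
  have h2 : ((↑) '' {x : ℝ | x ∈ Set.Icc u v ∧ G x = 0} : Set ℂ).Infinite :=
    hinf'.image ofReal_injective.injOn
  obtain ⟨x, -, hx⟩ := h2.exists_accPt_of_subset_isCompact
    (K := (↑) '' Set.Icc u v) (isCompact_Icc.image continuous_ofReal)
    (Set.image_mono fun x hx => hx.1)
  have h3 : ∃ᶠ y in 𝓝[≠] x, G y = 0 := by
    refine (accPt_iff_frequently_nhdsNE.mp hx).mono ?_
    rintro _ ⟨y, hy, rfl⟩
    exact hy.2
  have h4 : AnalyticOnNhd ℂ G Set.univ := fun y _ => hG.analyticAt y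
  exact hne (h4.eqOn_zero_of_preconnected_of_frequently_eq_zero isPreconnected_univ
    (Set.mem_univ x) h3 (Set.mem_univ x₁))

/-- The spectral parameter `(t - 1) (e - κ / t)` at `t = q^{-ν}`. -/
noncomputable def specParam (q e κ ν : ℝ) : ℝ := (q ^ (-ν) - 1) * (e - κ / q ^ (-ν))

section SpecParam

variable {q e κ : ℝ} (hq0 : 0 < q) (hq1 : q < 1) (he : 0 < e)
include hq0

theorem continuous_specParam : Continuous (specParam q e κ) := by
  have h : Continuous fun ν : ℝ => q ^ (-ν) := Real.continuous_const_rpow hq0.ne' |>.comp continuous_neg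
  refine (h.sub continuous_const).mul (continuous_const.sub (continuous_const.div h fun ν => ?_))
  exact (Real.rpow_pos_of_pos hq0 _).ne'

theorem specParam_sub (μ ν : ℝ) : specParam q e κ ν - specParam q e κ μ
    = (q ^ (-ν) - q ^ (-μ)) * (e - κ / (q ^ (-μ) * q ^ (-ν))) := by
  have h1 := (Real.rpow_pos_of_pos hq0 (-ν)).ne'
  have h2 := (Real.rpow_pos_of_pos hq0 (-μ)).ne'
  unfold specParam
  field_simp
  ring

include hq1

theorem strictMono_rpow_neg : StrictMono fun ν : ℝ => q ^ (-ν) := fun _ _ h =>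
  Real.rpow_lt_rpow_of_exponent_gt hq0 hq1 (neg_lt_neg h)

theorem tendsto_rpow_neg_self_atTop : Tendsto (fun ν : ℝ => q ^ (-ν)) atTop atTop := by
  have h := tendsto_rpow_atTop_of_base_gt_one (q⁻¹) ((one_lt_inv₀ hq0).mpr hq1)
  refine h.congr fun ν => ?_
  rw [Real.inv_rpow hq0.le, Real.rpow_neg hq0.le]

theorem tendsto_specParam_div : Tendsto (fun ν : ℝ => specParam q e κ ν / q ^ (-ν)) atTop (𝓝 e) := by
  have hi := tendsto_inv_atTop_zero.comp (tendsto_rpow_neg_self_atTop hq0 hq1)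
  have h : ∀ ν : ℝ, (1 - (q ^ (-ν))⁻¹) * (e - κ * (q ^ (-ν))⁻¹)
      = specParam q e κ ν / q ^ (-ν) := fun ν => by
    have h1 := (Real.rpow_pos_of_pos hq0 (-ν)).ne'
    unfold specParam
    field_simp
  refine Tendsto.congr h ?_
  have := (tendsto_const_nhds (x := (1 : ℝ)).sub hi).mul
    (tendsto_const_nhds (x := e).sub (hi.const_mul κ))
  simpa using this

include he

theorem tendsto_specParam_atTop : Tendsto (specParam q e κ) atTop atTop := by
  have h := (tendsto_specParam_div (e := e) (κ := κ) hq0 hq1).pos_mul_atTop he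
    (tendsto_rpow_neg_self_atTop hq0 hq1)
  refine h.congr fun ν => ?_
  rw [div_mul_cancel₀ _ (Real.rpow_pos_of_pos hq0 (-ν)).ne']

/-- The difference Y(ν) - Y(μ) is (t_ν - t_μ)(e - κ/(t_μ t_ν)), and the second factor is positive as
soon as t_μ t_ν > |κ|/e. -/
theorem exists_strictMonoOn_specParam :
    ∃ ν₀ : ℝ, 0 < ν₀ ∧ StrictMonoOn (specParam q e κ) (Set.Ici ν₀) := by
  obtain ⟨ν₀, h0, h1⟩ := ((eventually_gt_atTop (0 : ℝ)).and
    ((tendsto_rpow_neg_self_atTop hq0 hq1).eventually_gt_atTop (1 + |κ| / e))).exists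
  refine ⟨ν₀, h0, fun μ hμ ν hν hμν => ?_⟩
  have m := strictMono_rpow_neg hq0 hq1
  have hμ' : 1 + |κ| / e < q ^ (-μ) := h1.trans_le (m.monotone hμ)
  have hν' : q ^ (-μ) < q ^ (-ν) := m hμν
  have h2 : 0 ≤ |κ| / e := by positivity
  rw [← sub_pos, specParam_sub hq0]
  refine mul_pos (sub_pos.mpr hν') ?_
  rw [sub_pos, div_lt_iff₀ (mul_pos (Real.rpow_pos_of_pos hq0 _) (Real.rpow_pos_of_pos hq0 _))]
  have h3 : |κ| / e < q ^ (-μ) * q ^ (-ν) := by nlinarith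
  rw [div_lt_iff₀ he] at h3
  linarith [le_abs_self κ]

end SpecParam

/-- If p elements precede the zero belonging to window N, the n-th element belongs to window n + N -
p for large n; this is the origin of the integer shift. -/
theorem tendsto_enumeration_shift {x : ℕ → ℝ} {N p : ℕ} {l : ℝ}
    (h : Tendsto (fun n => x (p + n) - ((N + n : ℕ) : ℝ)) atTop (𝓝 l)) :
    Tendsto (fun n => x n - ((n : ℝ) + ((N - p : ℤ) : ℝ) + l)) atTop (𝓝 0) := by
  have h1 : Tendsto (fun n => x n - ((n : ℝ) + ((N - p : ℤ) : ℝ))) atTop (𝓝 l) := by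
    rw [← tendsto_add_atTop_iff_nat p]
    refine h.congr fun n => ?_
    rw [add_comm p n]
    push_cast
    ring
  have h2 := h1.sub_const l
  rw [sub_self] at h2
  exact h2.congr fun n => by ring

/-- Above a threshold each window holds one zero and ν ↦ Y is a bijection onto its image; below the
threshold the zeros are finitely many. The enumeration is a finite set followed by one zero per
window. -/
theorem exists_zero_enumeration {q : ℝ} (hq0 : 0 < q) (hq1 : q < 1) {a b c : ℂ} (ha : ‖a‖ < 1)
    (hb : ‖b‖ < 1) (hc : ‖c‖ < 1) (hreal : ConjInvariant a b c) {κ e α : ℝ}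
    (he0 : 0 < e) (he : e < 1) (hα0 : 0 < α) (hα1 : α < 1)
    (hdef : ∀ k : ℕ, a * b * c / α * (q : ℂ) ^ k ≠ 1) :
    ∃ z : ℕ → ℝ, ∃ k : ℤ, StrictMono z ∧
      Set.range z = {ν : ℝ | 0 < ν ∧ spectralFun q a b c e α (specParam q e κ ν) = 0} ∧
      Tendsto (fun n : ℕ => z n - ((n : ℝ) + k + -(Real.log (α / e) / Real.log q)))
        atTop (𝓝 0) := by
  have hlq : Real.log q < 0 := Real.log_neg hq0 hq1
  obtain ⟨i1, i2, i3, i4, i5⟩ := sqrt_interval hq0 hq1 hα0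
  have he' : |e| < 1 := by rwa [abs_of_pos he0]
  have hsq : 0 < √q := Real.sqrt_pos.mpr hq0
  set y := specParam q e κ with hy
  have hyc : Continuous y := continuous_specParam hq0
  have hyt : Tendsto y atTop atTop := tendsto_specParam_atTop hq0 hq1 he0
  obtain ⟨ν₀, hν₀, hmono⟩ := exists_strictMonoOn_specParam (κ := κ) hq0 hq1 he0
  obtain ⟨B, hB⟩ := (isCompact_Icc (a := (0 : ℝ)) (b := ν₀)).exists_bound_of_continuousOn
    hyc.continuousOn
  set L : ℕ → ℝ := fun N => α * √q / q ^ N with hL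
  have hLsucc : ∀ N, L (N + 1) = α / √q / q ^ N := fun N => by
    have : q = √q * √q := (Real.mul_self_sqrt hq0.le).symm
    rw [hL]
    simp only [pow_succ]
    rw [div_div, div_eq_div_iff (by positivity) (by positivity)]
    linear_combination (-α * q ^ N) * this
  have hLt : Tendsto L atTop atTop := by
    have h := tendsto_pow_atTop_atTop_of_one_lt ((one_lt_inv₀ hq0).mpr hq1)
    refine (h.const_mul_atTop i1).congr fun N => ?_
    simp only [hL, inv_pow, div_eq_mul_inv]
  have hqN : ∀ N : ℕ, 0 < q ^ N := fun N => pow_pos hq0 N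
  have hLlt : ∀ N, L N < L (N + 1) := fun N => by
    rw [hLsucc]
    exact div_lt_div_of_pos_right (i3.trans i4) (hqN N)
  have hLm : StrictMono L := strictMono_nat_of_lt_succ hLlt
  -- The window N₀ is beyond all values of |Y| on [0, ν₀], so every positive ν with Y(ν) at or above
  -- this level lies in the range of strict monotonicity.
  obtain ⟨N₀, hN₀⟩ := eventually_atTop.mp ((eventually_existsUnique_spectralFun_zero hq0 hq1 ha hb hc
    hreal he' hα0 hα1 hdef).and (hLt.eventually_gt_atTop B))
  choose! s hs hs0 hsu using fun N hN => (hN₀ N hN).1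
  have hbig : ∀ ν, 0 < ν → L N₀ ≤ y ν → ν₀ < ν := by
    intro ν hν h
    by_contra hcon
    have h1 := hB ν ⟨hν.le, not_lt.mp hcon⟩
    have h2 := (hN₀ N₀ le_rfl).2
    rw [Real.norm_eq_abs] at h1
    linarith [le_abs_self (y ν)]
  have hyν₀ : y ν₀ < L N₀ := by
    have h1 := hB ν₀ ⟨hν₀.le, le_rfl⟩
    have h2 := (hN₀ N₀ le_rfl).2
    rw [Real.norm_eq_abs] at h1
    linarith [le_abs_self (y ν₀)]
  have hsurj : ∀ Y, L N₀ ≤ Y → ∃ ν, ν₀ < ν ∧ y ν = Y := by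
    intro Y hY
    obtain ⟨ν₁, h1, h2⟩ := ((hyt.eventually_ge_atTop Y).and (eventually_ge_atTop ν₀)).exists
    obtain ⟨ν, hν, h3⟩ := intermediate_value_Icc h2 hyc.continuousOn
      ⟨(hyν₀.trans_le hY).le, h1⟩
    refine ⟨ν, lt_of_le_of_ne hν.1 ?_, h3⟩
    rintro rfl
    linarith
  have hsL : ∀ N, N₀ ≤ N → L N < s N / q ^ N ∧ s N / q ^ N < L (N + 1) := fun N hN => by
    rw [hLsucc]
    exact ⟨div_lt_div_of_pos_right (hs N hN).1 (hqN N), div_lt_div_of_pos_right (hs N hN).2 (hqN N)⟩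
  choose! ζ hζ hζy using fun n : ℕ => hsurj (s (N₀ + n) / q ^ (N₀ + n))
    ((hLm.monotone (Nat.le_add_right N₀ n)).trans (hsL _ (Nat.le_add_right N₀ n)).1.le)
  have hζm : StrictMono ζ := strictMono_nat_of_lt_succ fun n => by
    rw [← hmono.lt_iff_lt (hζ n).le (hζ (n + 1)).le]
    change y _ < y _
    rw [hζy, hζy]
    exact (hsL (N₀ + n) (by omega)).2.trans (hsL (N₀ + n + 1) (by omega)).1
  set H := spectralFun q a b c e α with hH
  have hαc : (α : ℂ) ≠ 0 := by exact_mod_cast hα0.ne'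
  have hHd : Differentiable ℂ H := differentiable_spectralFun hq0 hq1 ha hb hc
    (by simpa using he') hαc (by rw [norm_real, Real.norm_of_nonneg hα0.le]; exact hα1)
  -- The identity theorem needs an entire function of ν, so q^{-ν} is replaced by an exponential
  -- with complex argument.
  set G : ℂ → ℂ := fun w => H ((exp (-w * Real.log q) - 1) * (e - κ / exp (-w * Real.log q)))
    with hG
  have hGd : Differentiable ℂ G := by
    have h1 : Differentiable ℂ fun w : ℂ => exp (-w * Real.log q) := by fun_prop
    refine hHd.comp ((h1.sub_const 1).mul (Differentiable.sub (differentiable_const _) ?_))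
    exact (differentiable_const _).div h1 fun w => exp_ne_zero _
  have hGy : ∀ ν : ℝ, G ν = H (y ν) := fun ν => by
    have : exp (-(ν : ℂ) * Real.log q) = ((q ^ (-ν) : ℝ) : ℂ) := by
      rw [Real.rpow_def_of_pos hq0]
      push_cast
      rw [mul_comm]
    simp only [hG, this, hy, specParam]
    push_cast
    rfl
  have hcast : ∀ (x : ℝ) (N : ℕ), ((x / q ^ N : ℝ) : ℂ) = (x : ℂ) / (q : ℂ) ^ N := fun x N => by
    push_cast; rfl
  obtain ⟨ν₁, hν₁, hyν₁⟩ := hsurj (L N₀) le_rfl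
  -- At ν₁ the spectral parameter is the left end point of a window, whose only zero is interior;
  -- hence G is not identically zero.
  have hGne : G ν₁ ≠ 0 := by
    intro h
    rw [hGy, hyν₁, hL, hcast] at h
    have := hsu N₀ le_rfl _ ⟨le_rfl, (i3.trans i4).le⟩ h
    exact (hs N₀ le_rfl).1.ne this
  have hfin : {ν : ℝ | 0 < ν ∧ H (y ν) = 0 ∧ y ν < L N₀}.Finite := by
    refine (finite_real_zeros hGd hGne 0 (ζ 0)).subset ?_
    rintro ν ⟨h1, h2, h3⟩
    refine ⟨⟨h1.le, ?_⟩, by rwa [hGy]⟩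
    by_contra hcon
    have h4 := hmono (hζ 0).le ((hζ 0).trans (not_le.mp hcon)).le (not_le.mp hcon)
    change y _ < y _ at h4
    rw [hζy] at h4
    have := (hsL (N₀ + 0) (by omega)).1
    simp only [add_zero] at this h4
    linarith
  obtain ⟨z, hzm, hzr, hzn⟩ := exists_strictMono_enumeration hfin.toFinset ζ hζm (by
    intro ν hν
    rw [Set.Finite.mem_toFinset] at hν
    obtain ⟨h1, h2, h3⟩ := hν
    by_contra hcon
    have h4 := hmono.monotoneOn (hζ 0).le ((hζ 0).le.trans (not_lt.mp hcon)) (not_lt.mp hcon)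
    change y _ ≤ y _ at h4
    rw [hζy] at h4
    have := (hsL (N₀ + 0) (by omega)).1
    simp only [add_zero] at this h4
    linarith)
  refine ⟨z, (N₀ - hfin.toFinset.card : ℤ), hzm, ?_, ?_⟩
  · rw [hzr]
    ext ν
    simp only [Set.Finite.coe_toFinset, Set.mem_union, Set.mem_ofPred_eq, Set.mem_range]
    constructor
    · rintro (⟨h1, h2, -⟩ | ⟨n, rfl⟩)
      · exact ⟨h1, h2⟩
      · refine ⟨hν₀.trans (hζ n), ?_⟩
        rw [hζy, hcast]
        exact hs0 (N₀ + n) (by omega)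
    · rintro ⟨h1, h2⟩
      rcases lt_or_ge (y ν) (L N₀) with h3 | h3
      · exact Or.inl ⟨h1, h2, h3⟩
      · right
        have hν := hbig ν h1 h3
        obtain ⟨M, hM⟩ := (hLt.eventually_gt_atTop (y ν)).exists
        classical
        -- The first window boundary exceeding y(ν) identifies the window containing it.
        have hex : ∃ M, y ν < L M := ⟨M, hM⟩
        have hspec := Nat.find_spec hex
        have hmin := fun m hm => Nat.find_min hex (m := m) hm
        set K := Nat.find hex
        have hK : N₀ < K := by
          by_contra hcon
          linarith [hLm.monotone (not_lt.mp hcon)]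
        obtain ⟨n, hn⟩ := Nat.exists_eq_add_of_lt hK
        have hlow := not_lt.mp (hmin (N₀ + n) (by omega))
        rw [hn] at hspec
        refine ⟨n, hmono.injOn (hζ n).le hν.le ?_⟩
        change y _ = y _
        rw [hζy]
        have h5 : y ν * q ^ (N₀ + n) = s (N₀ + n) := by
          refine hsu (N₀ + n) (by omega) _ ⟨?_, ?_⟩ ?_
          · rw [hL, div_le_iff₀ (hqN _)] at hlow
            exact hlow
          · rw [hLsucc, lt_div_iff₀ (hqN _)] at hspec
            exact hspec.le
          · rw [← hcast, mul_div_cancel_right₀ _ (hqN _).ne']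
            exact h2
        rw [← h5, mul_div_cancel_right₀ _ (hqN _).ne']
  · refine tendsto_enumeration_shift ?_
    have hst : Tendsto (fun n => s (N₀ + n)) atTop (𝓝 α) := by
      rw [Metric.tendsto_nhds]
      intro ε hε
      have h := eventually_spectralFun_zero_near hq0 hq1 ha hb hc he' hα0 hα1 hdef hε
      filter_upwards [(tendsto_add_atTop_nat N₀).eventually h] with n hn
      rw [add_comm n N₀] at hn
      have hsn := hs (N₀ + n) (by omega)
      exact hn _ ⟨hsn.1.le, hsn.2.le⟩ (hs0 (N₀ + n) (by omega))
    have hζt : Tendsto ζ atTop atTop := by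
      refine tendsto_atTop_atTop.mpr fun b => ?_
      obtain ⟨n, hn⟩ := (hLt.eventually_gt_atTop (max (y b) (y ν₀))).exists
      refine ⟨n, fun m hm => ?_⟩
      by_contra hcon
      have hcon := not_le.mp hcon
      have h1 := hmono (hζ m).le ((hζ m).trans hcon).le hcon
      change y _ < y _ at h1
      rw [hζy] at h1
      have h2 := (hsL (N₀ + m) (by omega)).1
      have h3 := hLm.monotone (show n ≤ N₀ + m by omega)
      linarith [le_max_left (y b) (y ν₀)]
    -- Here s = Y q^N → α while Y/q^{-ν} → e; the quotient is q^{-ν} q^N, and its logarithm gives ν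
    -- - N.
    have h1 : Tendsto (fun n => q ^ (-ζ n) * q ^ (N₀ + n)) atTop (𝓝 (α / e)) := by
      refine (hst.div ((tendsto_specParam_div (κ := κ) hq0 hq1).comp hζt) he0.ne').congr fun n => ?_
      have h2 := (Real.rpow_pos_of_pos hq0 (-ζ n)).ne'
      have h3 := (hqN (N₀ + n)).ne'
      have h4 : s (N₀ + n) ≠ 0 := (i1.trans (hs (N₀ + n) (by omega)).1).ne'
      simp only [Pi.div_apply, Function.comp_apply]
      change s (N₀ + n) / (y (ζ n) / _) = _
      rw [hζy]
      field_simp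
    have h2 := (h1.log (div_pos hα0 he0).ne').div_const (-Real.log q)
    rw [div_neg] at h2
    refine h2.congr fun n => ?_
    rw [hzn, Real.log_mul (Real.rpow_pos_of_pos hq0 _).ne' (hqN _).ne', Real.log_rpow hq0,
      Real.log_pow]
    have := hlq.ne
    field_simp
    ring

/-! ### Continuous dual `q`-Hahn polynomials -/

/-- The leading recurrence coefficient `(1 - q^{n+1}) (1 - ab q^n) (1 - ac q^n) (1 - bc q^n)`. -/
noncomputable def dualHahnG (q : ℝ) (a b c : ℂ) (n : ℕ) : ℂ :=
  (1 - (q : ℂ) ^ (n + 1)) * (1 - a * b * (q : ℂ) ^ n) * (1 - a * c * (q : ℂ) ^ n)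
    * (1 - b * c * (q : ℂ) ^ n)

/-- The diagonal recurrence coefficient. -/
noncomputable def dualHahnB (q : ℝ) (a b c : ℂ) (n : ℕ) : ℂ :=
  (q : ℂ) ^ n * (a + b + c + a * b * c * ((1 - (q : ℂ) ^ n) / q - (q : ℂ) ^ n))

/-- The continuous dual `q`-Hahn polynomials in `y = z + 1 / z`, in a normalization in which the
recurrence reads `G n * Q (n + 1) = (y - B n) * Q n - Q (n - 1)`. -/
noncomputable def dualHahn (q : ℝ) (a b c y : ℂ) : ℕ → ℂ
  | 0 => 1
  | 1 => (y - dualHahnB q a b c 0) / dualHahnG q a b c 0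
  | n + 2 => ((y - dualHahnB q a b c (n + 1)) * dualHahn q a b c y (n + 1)
      - dualHahn q a b c y n) / dualHahnG q a b c (n + 1)

section DualHahn

variable {q : ℝ} {a b c z : ℂ}

theorem dualHahnG_ne_zero (hq0 : 0 < q) (hq1 : q < 1) (ha : ‖a‖ < 1) (hb : ‖b‖ < 1) (hc : ‖c‖ < 1)
    (n : ℕ) : dualHahnG q a b c n ≠ 0 := by
  have h : ∀ x : ℂ, ‖x‖ < 1 → 1 - x * (q : ℂ) ^ n ≠ 0 := fun x hx =>
    sub_ne_zero.mpr (mul_pow_ne_one_of_norm_lt_one hq0 hq1 hx n).symm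
  have h1 := h q (norm_ofReal_lt_one hq0 hq1)
  rw [mul_comm, ← pow_succ] at h1
  exact mul_ne_zero (mul_ne_zero (mul_ne_zero h1 (h _ (norm_mul_lt_one ha hb)))
    (h _ (norm_mul_lt_one ha hc))) (h _ (norm_mul_lt_one hb hc))

theorem dualHahn_one (hG : dualHahnG q a b c 0 ≠ 0) (y : ℂ) :
    dualHahnG q a b c 0 * dualHahn q a b c y 1 = y - dualHahnB q a b c 0 := by
  simp only [dualHahn]
  rw [mul_div_cancel₀ _ hG]

theorem dualHahn_succ_succ {n : ℕ} (hG : dualHahnG q a b c (n + 1) ≠ 0) (y : ℂ) :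
    dualHahnG q a b c (n + 1) * dualHahn q a b c y (n + 2)
      = (y - dualHahnB q a b c (n + 1)) * dualHahn q a b c y (n + 1) - dualHahn q a b c y n := by
  rw [dualHahn, mul_div_cancel₀ _ hG]

/-- The summand in the very-well-poised expansion of the continuous dual `q`-Hahn polynomials. -/
noncomputable def vwpTerm (q : ℝ) (a b c z : ℂ) (m i : ℕ) : ℂ :=
  vwpCoeff q a b c z m * z ^ (2 * m)
    / (qPoch q q i * qPoch q (a * b * c / z) (2 * m + i))

/-- The certificate term of the recurrence for `vwpTerm`. -/
noncomputable def vwpCert (q : ℝ) (a b c z : ℂ) (m i : ℕ) : ℂ :=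
  qPoch q (a * b * c / z) m * (qPoch q (a / z) m * qPoch q (b / z) m * qPoch q (c / z) m)
    * z ^ (2 * m) / (qPoch q q m * qPoch q (a * b) m * qPoch q (a * c) m * qPoch q (b * c) m
    * qPoch q q i * qPoch q (a * b * c / z) (2 * m + i))

/-- Lowering i multiplies by an explicit polynomial factor. Its part 1 - q^i vanishes at i = 0, in
agreement with the convention that terms with negative index are 0. -/
theorem vwpTerm_pred (hq0 : 0 < q) (hq1 : q < 1)
    (hdef : ∀ k : ℕ, a * b * c / z * (q : ℂ) ^ k ≠ 1) (m i : ℕ) :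
    (if 1 ≤ i then vwpTerm q a b c z m (i - 1) else 0)
      = vwpTerm q a b c z m i * ((1 - (q : ℂ) ^ i)
        * (1 - a * b * c / z * ((q : ℂ) ^ m) ^ 2 * (q : ℂ) ^ i / q)) := by
  have hq : (q : ℂ) ≠ 0 := by exact_mod_cast hq0.ne'
  rcases i with _ | i
  · simp
  have h1 : qPoch q q (i + 1) = qPoch q q i * (1 - (q : ℂ) ^ (i + 1)) := by
    rw [qPoch_succ, pow_succ']
  have h2 : qPoch q (a * b * c / z) (2 * m + (i + 1)) = qPoch q (a * b * c / z) (2 * m + i)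
      * (1 - a * b * c / z * ((q : ℂ) ^ m) ^ 2 * (q : ℂ) ^ (i + 1) / q) := by
    rw [← add_assoc, qPoch_succ]
    congr 2
    field_simp
    ring
  have n1 : qPoch q q (i + 1) ≠ 0 :=
    qPoch_ne_zero_of_norm_lt_one hq0 hq1 (norm_ofReal_lt_one hq0 hq1) _
  have n2 := qPoch_ne_zero hdef (2 * m + (i + 1))
  rw [if_pos (by omega), Nat.add_sub_cancel, vwpTerm, vwpTerm]
  rw [h1] at n1 ⊢
  rw [h2] at n2 ⊢
  rw [div_mul_eq_mul_div, div_eq_div_iff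
    (mul_ne_zero (left_ne_zero_of_mul n1) (left_ne_zero_of_mul n2)) (mul_ne_zero n1 n2)]
  ring

theorem vwpTerm_pred_pred (hq0 : 0 < q) (hq1 : q < 1)
    (hdef : ∀ k : ℕ, a * b * c / z * (q : ℂ) ^ k ≠ 1) (m i : ℕ) :
    (if 2 ≤ i then vwpTerm q a b c z m (i - 2) else 0)
      = vwpTerm q a b c z m i * ((1 - (q : ℂ) ^ i) * (1 - (q : ℂ) ^ i / q)
        * (1 - a * b * c / z * ((q : ℂ) ^ m) ^ 2 * (q : ℂ) ^ i / q)
        * (1 - a * b * c / z * ((q : ℂ) ^ m) ^ 2 * (q : ℂ) ^ i / q / q)) := by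
  have hq : (q : ℂ) ≠ 0 := by exact_mod_cast hq0.ne'
  rcases i with _ | i
  · simp
  have h1 := vwpTerm_pred hq0 hq1 hdef m (i + 1)
  have h2 := vwpTerm_pred hq0 hq1 hdef m i
  rw [if_pos (by omega), Nat.add_sub_cancel] at h1
  have e : (q : ℂ) ^ (i + 1) / q = (q : ℂ) ^ i := by rw [pow_succ, mul_div_cancel_right₀ _ hq]
  have e2 : a * b * c / z * ((q : ℂ) ^ m) ^ 2 * (q : ℂ) ^ (i + 1) / q / q
      = a * b * c / z * ((q : ℂ) ^ m) ^ 2 * (q : ℂ) ^ i / q := by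
    rw [← e]; ring
  rw [e, e2]
  rw [h1] at h2
  simp only [show (2 ≤ i + 1) = (1 ≤ i) by simp, show i + 1 - 2 = i - 1 by omega]
  rw [h2]
  ring

/-- Passing from m to m + 1 is expressed through a common multiple E instead of a quotient, because
factors such as 1 - a q^m/z may vanish. -/
theorem exists_vwpTerm_succ_eq (hq0 : 0 < q) (hq1 : q < 1) (ha : ‖a‖ < 1) (hb : ‖b‖ < 1)
    (hc : ‖c‖ < 1) (hdef : ∀ k : ℕ, a * b * c / z * (q : ℂ) ^ k ≠ 1) (m i : ℕ) :
    ∃ E : ℂ, (vwpCert q a b c z m (i + 1) * ((1 - a / z * (q : ℂ) ^ m) * (1 - b / z * (q : ℂ) ^ m)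
        * (1 - c / z * (q : ℂ) ^ m) * z ^ 2 * (1 - (q : ℂ) * (q : ℂ) ^ i))
      = E * ((1 - (q : ℂ) * (q : ℂ) ^ m) * (1 - a * b * (q : ℂ) ^ m) * (1 - a * c * (q : ℂ) ^ m)
        * (1 - b * c * (q : ℂ) ^ m)
        * (1 - a * b * c / z * (q * ((q : ℂ) ^ m) ^ 2 * (q : ℂ) ^ i)))) ∧
      vwpTerm q a b c z (m + 1) i = E * (1 - a * b * c / z * (q * ((q : ℂ) ^ m) ^ 2)) ∧
      vwpCert q a b c z (m + 1) i = E * (1 - a * b * c / z * (q : ℂ) ^ m) := by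
  have hq : (q : ℂ) ≠ 0 := by exact_mod_cast hq0.ne'
  refine ⟨qPoch q (a * b * c / z) m * (qPoch q (a / z) (m + 1) * qPoch q (b / z) (m + 1)
    * qPoch q (c / z) (m + 1)) * z ^ (2 * (m + 1)) / (qPoch q q (m + 1) * qPoch q (a * b) (m + 1)
    * qPoch q (a * c) (m + 1) * qPoch q (b * c) (m + 1)
    * qPoch q q i * qPoch q (a * b * c / z) (2 * (m + 1) + i)), ?_, ?_, ?_⟩
  · have hn := fun x (hx : ‖x‖ < 1) k => qPoch_ne_zero_of_norm_lt_one hq0 hq1 (x := x) hx k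
    have n1 := hn q (norm_ofReal_lt_one hq0 hq1) (m + 1)
    have n2 := hn _ (norm_mul_lt_one ha hb) (m + 1)
    have n3 := hn _ (norm_mul_lt_one ha hc) (m + 1)
    have n4 := hn _ (norm_mul_lt_one hb hc) (m + 1)
    have n5 := hn q (norm_ofReal_lt_one hq0 hq1) (i + 1)
    have n6 := qPoch_ne_zero hdef (2 * (m + 1) + i)
    have e6 : qPoch q (a * b * c / z) (2 * (m + 1) + i)
        = qPoch q (a * b * c / z) (2 * m + (i + 1))
          * (1 - a * b * c / z * (q * ((q : ℂ) ^ m) ^ 2 * (q : ℂ) ^ i)) := by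
      rw [show 2 * (m + 1) + i = 2 * m + (i + 1) + 1 by ring, qPoch_succ]
      congr 3
      ring
    unfold vwpCert
    rw [e6] at n6 ⊢
    rw [qPoch_succ] at n1 n2 n3 n4 n5
    simp only [qPoch_succ q _ m, qPoch_succ q _ i]
    generalize qPoch q (a * b * c / z) m = B1 at *
    generalize qPoch q (a * b * c / z) (2 * m + (i + 1)) = B2 at *
    generalize qPoch q q m = P1 at *
    generalize qPoch q (a * b) m = P2 at *
    generalize qPoch q (a * c) m = P3 at *
    generalize qPoch q (b * c) m = P4 at *
    generalize qPoch q q i = P5 at *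
    generalize qPoch q (a / z) m = A1
    generalize qPoch q (b / z) m = A2
    generalize qPoch q (c / z) m = A3
    generalize a / z * (q : ℂ) ^ m = u1
    generalize b / z * (q : ℂ) ^ m = u2
    generalize c / z * (q : ℂ) ^ m = u3
    generalize a * b * c / z * (q * ((q : ℂ) ^ m) ^ 2 * (q : ℂ) ^ i) = u4 at *
    rw [div_mul_eq_mul_div, div_mul_eq_mul_div, div_eq_div_iff
      (by
        have := left_ne_zero_of_mul n1
        have := left_ne_zero_of_mul n2
        have := left_ne_zero_of_mul n3
        have := left_ne_zero_of_mul n4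
        have := left_ne_zero_of_mul n6
        simp only [ne_eq, mul_eq_zero, not_or] at *
        tauto)
      (by
        have := left_ne_zero_of_mul n5
        simp only [ne_eq, mul_eq_zero, not_or] at *
        tauto)]
    ring
  · have e1 : a * b * c / z * (q : ℂ) ^ (2 * m + 1) = a * b * c / z * (q * ((q : ℂ) ^ m) ^ 2) := by
      ring
    rw [vwpTerm, vwpCoeff, vwpFactor_succ, e1]
    simp only [div_eq_mul_inv, mul_inv]
    ring
  · rw [vwpCert, qPoch_succ q (a * b * c / z) m]
    ring

theorem vwpTerm_zero (i : ℕ) : vwpTerm q a b c z 0 i = vwpCert q a b c z 0 i := by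
  simp [vwpTerm, vwpCert, vwpCoeff_zero, qPoch_zero]

/-- Creative telescoping: the recurrence operator applied to the j-th summand is a difference of
certificates. For m = p + 1, i = 0 the right side contains 1 - q^0 = 0, so the full sum satisfies
the recurrence. -/
theorem sum_vwpTerm_recurrence (hq0 : 0 < q) (hq1 : q < 1) (ha : ‖a‖ < 1) (hb : ‖b‖ < 1)
    (hc : ‖c‖ < 1) (hz : z ≠ 0) (hdef : ∀ k : ℕ, a * b * c / z * (q : ℂ) ^ k ≠ 1) (p m i : ℕ)
    (h : m + i = p + 1) :
    ∑ j ∈ Finset.range (m + 1), (dualHahnG q a b c p * vwpTerm q a b c z j (p + 1 - j)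
      - (z ^ 2 + 1 - dualHahnB q a b c p * z)
        * (if 1 ≤ p + 1 - j then vwpTerm q a b c z j (p + 1 - j - 1) else 0)
      + z ^ 2 * (if 2 ≤ p + 1 - j then vwpTerm q a b c z j (p + 1 - j - 2) else 0))
    = vwpCert q a b c z m i * (-((q : ℂ) ^ i / q) * (1 - (q : ℂ) ^ i) * (1 - a / z * (q : ℂ) ^ m)
      * (1 - b / z * (q : ℂ) ^ m) * (1 - c / z * (q : ℂ) ^ m) * z ^ 2) := by
  have hq : (q : ℂ) ≠ 0 := by exact_mod_cast hq0.ne'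
  induction m generalizing i with
  | zero =>
    rw [Finset.sum_range_one, Nat.sub_zero, vwpTerm_pred hq0 hq1 hdef,
      vwpTerm_pred_pred hq0 hq1 hdef, vwpTerm_zero]
    have hi : i = p + 1 := by omega
    subst hi
    rw [dualHahnG, dualHahnB, pow_zero, pow_succ]
    generalize (q : ℂ) ^ p = x
    field_simp
    ring
  | succ m ih =>
    rw [Finset.sum_range_succ, ih (i + 1) (by omega), show p + 1 - (m + 1) = i by omega,
      vwpTerm_pred hq0 hq1 hdef, vwpTerm_pred_pred hq0 hq1 hdef]
    obtain ⟨E, h1, h2, h3⟩ := exists_vwpTerm_succ_eq hq0 hq1 ha hb hc hdef m i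
    have hp : p = m + i := by omega
    rw [h2, h3, dualHahnG, dualHahnB, hp, pow_succ _ (m + i), pow_add (q : ℂ) m i, pow_succ _ m, pow_succ _ i]
    have e : vwpCert q a b c z m (i + 1) * (-((q : ℂ) ^ i * q / q) * (1 - (q : ℂ) ^ i * q)
        * (1 - a / z * (q : ℂ) ^ m) * (1 - b / z * (q : ℂ) ^ m) * (1 - c / z * (q : ℂ) ^ m) * z ^ 2)
        = -(q : ℂ) ^ i * (E * ((1 - (q : ℂ) * (q : ℂ) ^ m) * (1 - a * b * (q : ℂ) ^ m)
        * (1 - a * c * (q : ℂ) ^ m) * (1 - b * c * (q : ℂ) ^ m)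
        * (1 - a * b * c / z * (q * ((q : ℂ) ^ m) ^ 2 * (q : ℂ) ^ i)))) := by
      rw [← h1, mul_div_cancel_right₀ _ hq]
      ring
    rw [e]
    generalize (q : ℂ) ^ m = x
    generalize (q : ℂ) ^ i = w
    field_simp
    ring

/-- The very-well-poised sum that represents the continuous dual `q`-Hahn polynomials. -/
noncomputable def vwpSum (q : ℝ) (a b c z : ℂ) (n : ℕ) : ℂ :=
  ∑ m ∈ Finset.range (n + 1), vwpTerm q a b c z m (n - m)

/-- Both sides obey the three-term recurrence of z^n Q_n with the same initial values. The sum is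
not visibly invariant under z ↔ 1/z, but the polynomial is, which later permits the use of either
point. -/
theorem vwpSum_eq (hq0 : 0 < q) (hq1 : q < 1) (ha : ‖a‖ < 1) (hb : ‖b‖ < 1)
    (hc : ‖c‖ < 1) (hz : z ≠ 0) (hdef : ∀ k : ℕ, a * b * c / z * (q : ℂ) ^ k ≠ 1) (n : ℕ) :
    vwpSum q a b c z n = z ^ n * dualHahn q a b c (z + 1 / z) n := by
  have hG := dualHahnG_ne_zero (a := a) (b := b) (c := c) hq0 hq1 ha hb hc
  have h0 : vwpSum q a b c z 0 = 1 := by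
    simp [vwpSum, vwpTerm, vwpCoeff_zero, qPoch_zero]
  have hrec : ∀ p, dualHahnG q a b c p * vwpSum q a b c z (p + 1)
      - (z ^ 2 + 1 - dualHahnB q a b c p * z) * vwpSum q a b c z p
      + z ^ 2 * (∑ j ∈ Finset.range (p + 1 + 1),
        (if 2 ≤ p + 1 - j then vwpTerm q a b c z j (p + 1 - j - 2) else 0)) = 0 := by
    intro p
    have h := sum_vwpTerm_recurrence hq0 hq1 ha hb hc hz hdef p (p + 1) 0 rfl
    rw [Finset.sum_add_distrib, Finset.sum_sub_distrib, ← Finset.mul_sum, ← Finset.mul_sum,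
      ← Finset.mul_sum] at h
    have e : ∑ j ∈ Finset.range (p + 1 + 1),
        (if 1 ≤ p + 1 - j then vwpTerm q a b c z j (p + 1 - j - 1) else 0) = vwpSum q a b c z p := by
      rw [Finset.sum_range_succ, if_neg (by omega), add_zero, vwpSum]
      refine Finset.sum_congr rfl fun j hj => ?_
      have := Finset.mem_range.mp hj
      rw [if_pos (by omega)]
      congr 1
      omega
    rw [e] at h
    simpa [vwpSum] using h
  have hone : vwpSum q a b c z 1 = z * dualHahn q a b c (z + 1 / z) 1 := by
    have h := hrec 0
    rw [Finset.sum_eq_zero (fun j _ => if_neg (by omega)), h0] at h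
    have h2 := dualHahn_one (hG 0) (z + 1 / z)
    refine mul_left_cancel₀ (hG 0) ?_
    rw [mul_left_comm, h2]
    field_simp
    linear_combination h
  have hstep : ∀ p, dualHahnG q a b c (p + 1) * vwpSum q a b c z (p + 2)
      = (z ^ 2 + 1 - dualHahnB q a b c (p + 1) * z) * vwpSum q a b c z (p + 1)
        - z ^ 2 * vwpSum q a b c z p := by
    intro p
    have h := hrec (p + 1)
    have e : ∑ j ∈ Finset.range (p + 1 + 1 + 1),
        (if 2 ≤ p + 1 + 1 - j then vwpTerm q a b c z j (p + 1 + 1 - j - 2) else 0)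
        = vwpSum q a b c z p := by
      rw [Finset.sum_range_succ, Finset.sum_range_succ, if_neg (by omega), if_neg (by omega),
        add_zero, add_zero, vwpSum]
      refine Finset.sum_congr rfl fun j hj => ?_
      have := Finset.mem_range.mp hj
      rw [if_pos (by omega)]
      congr 1
      omega
    rw [e] at h
    linear_combination h
  have key : ∀ n, vwpSum q a b c z n = z ^ n * dualHahn q a b c (z + 1 / z) n ∧
      vwpSum q a b c z (n + 1) = z ^ (n + 1) * dualHahn q a b c (z + 1 / z) (n + 1) := by
    intro n
    induction n with
    | zero => exact ⟨by simp [h0, dualHahn], by simpa using hone⟩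
    | succ n ih =>
      refine ⟨ih.2, mul_left_cancel₀ (hG (n + 1)) ?_⟩
      have h := dualHahn_succ_succ (hG (n + 1)) (z + 1 / z)
      have hy : z * (z + 1 / z) = z ^ 2 + 1 := by field_simp
      rw [hstep, ih.1, ih.2]
      linear_combination (-z ^ (n + 2)) * h
        - z ^ (n + 1) * dualHahn q a b c (z + 1 / z) (n + 1) * hy
  exact (key n).1

end DualHahn

/-! ### Growth of the polynomials and a `q`-Gauss type product expansion -/

section Growth

variable {q : ℝ}

theorem norm_prod_numFactor_le (hq0 : 0 < q) (hq1 : q < 1) {e κ Y : ℂ} {ρ R : ℝ} (hρ : 0 < ρ)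
    (he : ‖e‖ ≤ ρ) (hY : ‖Y‖ ≤ R) (n : ℕ) :
    ‖∏ k ∈ Finset.range n, numFactor q e κ Y k‖ ≤ ρ ^ n * Real.exp ((‖κ‖ + R) / ρ / (1 - q)) := by
  have hR : 0 ≤ R := (norm_nonneg _).trans hY
  have h1 : ∏ k ∈ Finset.range n, numFactor q e κ Y k
      = (ρ : ℂ) ^ n * ∏ k ∈ Finset.range n, (numFactor q e κ Y k / ρ) := by
    have : (ρ : ℂ) ≠ 0 := by exact_mod_cast hρ.ne'
    rw [Finset.prod_div_distrib, Finset.prod_const, Finset.card_range, mul_div_cancel₀]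
    exact pow_ne_zero _ this
  rw [h1, norm_mul, norm_pow, norm_real, Real.norm_of_nonneg hρ.le]
  refine mul_le_mul_of_nonneg_left ?_ (by positivity)
  refine (norm_prod_le_exp_sum _ _ (fun k => (‖κ‖ + R) / ρ * q ^ k) fun k _ => ?_).trans
    (Real.exp_le_exp.mpr (sum_geometric_le hq0 hq1 (by positivity) n))
  have hqk : q ^ k ≤ 1 := pow_le_one₀ hq0.le hq1.le
  have hqk0 : 0 < q ^ k := pow_pos hq0 k
  rw [norm_div, norm_real, Real.norm_of_nonneg hρ.le, div_le_iff₀ hρ]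
  have h2 : (1 + (‖κ‖ + R) / ρ * q ^ k) * ρ = ρ + (‖κ‖ + R) * q ^ k := by field_simp
  rw [h2]
  have h3 : ‖1 - (q : ℂ) ^ k‖ ≤ 1 := by
    rw [← ofReal_pow, ← ofReal_one, ← ofReal_sub, norm_real, Real.norm_of_nonneg (by linarith)]
    linarith
  have h4 : numFactor q e κ Y k = (1 - (q : ℂ) ^ k) * e - (q : ℂ) ^ k * ((1 - (q : ℂ) ^ k) * κ + Y) := by
    rw [numFactor]; ring
  rw [h4]
  refine (norm_sub_le _ _).trans (add_le_add ?_ ?_)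
  · rw [norm_mul]; nlinarith [norm_nonneg e]
  · rw [norm_mul, norm_ofReal_pow hq0, mul_comm]
    refine mul_le_mul_of_nonneg_right ((norm_add_le _ _).trans (add_le_add ?_ hY)) hqk0.le
    rw [norm_mul]; nlinarith [norm_nonneg κ]

/-- The sum is taken at 1/w, where abc/z = abc w has modulus less than 1, so no denominator
degenerates. Each of the n + 1 terms is then O(1) after multiplication by w^{2n}. -/
theorem exists_dualHahn_bound (hq0 : 0 < q) (hq1 : q < 1) {a b c : ℂ} (ha : ‖a‖ < 1)
    (hb : ‖b‖ < 1) (hc : ‖c‖ < 1) : ∃ C, 0 < C ∧ ∀ w : ℂ, w ≠ 0 → ‖w‖ ≤ 1 → ∀ n : ℕ,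
      ‖dualHahn q a b c (w + 1 / w) n‖ * ‖w‖ ^ n ≤ C * (n + 1) := by
  obtain ⟨C, hC, hV⟩ := exists_vwpCoeff_bound hq0 hq1 ha hb hc 1 one_pos
  have hκ : ‖a * b * c‖ < 1 := norm_mul_lt_one (norm_mul_lt_one ha hb) hc
  obtain ⟨c₁, hc₁, h₁⟩ := exists_pos_le_norm_qPoch_of_norm_le hq0 hq1 (norm_nonneg _) hκ
  obtain ⟨c₂, hc₂, h₂⟩ := exists_pos_le_norm_qPoch_of_norm_le hq0 hq1 hq0.le hq1
  refine ⟨C / (c₂ * c₁), by positivity, fun w hw hw1 n => ?_⟩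
  have hw0 : 0 < ‖w‖ := norm_pos_iff.mpr hw
  have hz : w⁻¹ ≠ 0 := inv_ne_zero hw
  have hz1 : 1 ≤ ‖w⁻¹‖ := by rw [norm_inv]; exact (one_le_inv₀ hw0).mpr hw1
  have hκw : ‖a * b * c / w⁻¹‖ ≤ ‖a * b * c‖ := by
    rw [norm_div]
    exact div_le_self (norm_nonneg _) hz1
  have hdef := mul_pow_ne_one_of_norm_lt_one hq0 hq1 (hκw.trans_lt hκ)
  have h := vwpSum_eq hq0 hq1 ha hb hc hz hdef n
  rw [show w⁻¹ + 1 / w⁻¹ = w + 1 / w by rw [one_div, inv_inv, one_div, add_comm]] at h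
  have h3 : dualHahn q a b c (w + 1 / w) n * w ^ n = vwpSum q a b c w⁻¹ n * w ^ n * w ^ n := by
    rw [h, inv_pow]
    have := pow_ne_zero n hw
    field_simp
  rw [← norm_pow, ← norm_mul, h3, vwpSum, Finset.sum_mul, Finset.sum_mul]
  refine (norm_sum_le_of_le (f := _) (n := fun _ => C / (c₂ * c₁)) _ fun m hm => ?_).trans
    (le_of_eq ?_)
  · have hmn : m ≤ n := Nat.lt_succ_iff.mp (Finset.mem_range.mp hm)
    rw [vwpTerm, norm_mul, norm_mul, norm_div, norm_mul, norm_mul]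
    have e1 : ‖w⁻¹ ^ (2 * m)‖ * (‖w ^ n‖ * ‖w ^ n‖) ≤ 1 := by
      obtain ⟨j, rfl⟩ := Nat.exists_eq_add_of_le hmn
      have : w⁻¹ ^ (2 * m) * (w ^ (m + j) * w ^ (m + j)) = w ^ (2 * j) := by
        rw [← pow_add, show m + j + (m + j) = 2 * m + 2 * j by ring, pow_add, inv_pow,
          inv_mul_cancel_left₀ (pow_ne_zero _ hw)]
      rw [← norm_mul, ← norm_mul, this, norm_pow]
      exact pow_le_one₀ (norm_nonneg _) hw1
    have hV' := hV 1 (by simp) w⁻¹ hz1 m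
    rw [mul_one] at hV'
    have d1 := h₂ q (by rw [norm_real, Real.norm_of_nonneg hq0.le]) (n - m)
    have d2 := h₁ _ hκw (2 * m + (n - m))
    have e2 : ‖vwpCoeff q a b c w⁻¹ m‖ * ‖w⁻¹ ^ (2 * m)‖
        / (‖qPoch q q (n - m)‖ * ‖qPoch q (a * b * c / w⁻¹) (2 * m + (n - m))‖) * ‖w ^ n‖ * ‖w ^ n‖
        = ‖vwpCoeff q a b c w⁻¹ m‖ * (‖w⁻¹ ^ (2 * m)‖ * (‖w ^ n‖ * ‖w ^ n‖))
        / (‖qPoch q q (n - m)‖ * ‖qPoch q (a * b * c / w⁻¹) (2 * m + (n - m))‖) := by ring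
    rw [e2]
    refine div_le_div₀ hC.le ?_ (by positivity) (mul_le_mul d1 d2 hc₁.le (norm_nonneg _))
    calc _ ≤ C * 1 := mul_le_mul hV' e1 (by positivity) hC.le
      _ = C := mul_one C
  · rw [Finset.sum_const, Finset.card_range, nsmul_eq_mul]
    push_cast
    ring

end Growth

section ProductExpansion

variable {q : ℝ}

/-- The summand of the expansion of `∏ (1 - q^k ε x + q^{2k} ε² p)`. -/
noncomputable def quadTerm (q : ℝ) (x p ε : ℂ) (j : ℕ) : ℂ :=
  (∏ k ∈ Finset.range j, (1 - (q : ℂ) ^ k * x + p * (q : ℂ) ^ (2 * k))) * ε ^ j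
    * qPochInf q (ε * p * (q : ℂ) ^ j) / qPoch q q j

theorem norm_quad_sub_one_le (hq0 : 0 < q) (hq1 : q < 1) (x p : ℂ) (k : ℕ) :
    ‖(1 - (q : ℂ) ^ k * x + p * (q : ℂ) ^ (2 * k)) - 1‖ ≤ (‖x‖ + ‖p‖) * q ^ k := by
  have e : (1 - (q : ℂ) ^ k * x + p * (q : ℂ) ^ (2 * k)) - 1
      = p * (q : ℂ) ^ (2 * k) - (q : ℂ) ^ k * x := by ring
  rw [e]
  refine (norm_sub_le _ _).trans ?_
  rw [norm_mul, norm_mul, norm_ofReal_pow hq0, norm_ofReal_pow hq0]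
  have : q ^ (2 * k) ≤ q ^ k := pow_le_pow_of_le_one hq0.le hq1.le (by omega)
  nlinarith [norm_nonneg p]

theorem exists_quadTerm_bound (hq0 : 0 < q) (hq1 : q < 1) (x p : ℂ) :
    ∃ C, 0 < C ∧ ∀ ε : ℂ, ‖ε‖ ≤ 1 → ∀ j, ‖quadTerm q x p ε j‖ ≤ C * ‖ε‖ ^ j := by
  obtain ⟨c₂, hc₂, h₂⟩ := exists_pos_le_norm_qPoch_of_norm_le hq0 hq1 hq0.le hq1
  refine ⟨Real.exp ((‖x‖ + ‖p‖) / (1 - q)) * Real.exp (‖p‖ / (1 - q)) / c₂, by positivity,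
    fun ε hε j => ?_⟩
  have h1 := norm_prod_range_le_of_geometric hq0 hq1 (norm_quad_sub_one_le hq0 hq1 x p) j
  have h2 : ‖qPochInf q (ε * p * (q : ℂ) ^ j)‖ ≤ Real.exp (‖p‖ / (1 - q)) := by
    refine norm_qPochInf_le_of_norm_le hq0 hq1 ?_
    rw [norm_mul, norm_mul, norm_ofReal_pow hq0]
    have h3 : q ^ j ≤ 1 := pow_le_one₀ hq0.le hq1.le
    have h4 : ‖ε‖ * ‖p‖ ≤ ‖p‖ := by nlinarith [norm_nonneg p]
    have h5 : 0 ≤ ‖ε‖ * ‖p‖ := by positivity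
    nlinarith [pow_pos hq0 j]
  have h3 := h₂ q (by rw [norm_real, Real.norm_of_nonneg hq0.le]) j
  rw [quadTerm, norm_div, norm_mul, norm_mul, norm_pow]
  calc _ = ‖∏ k ∈ Finset.range j, (1 - (q : ℂ) ^ k * x + p * (q : ℂ) ^ (2 * k))‖
        * ‖qPochInf q (ε * p * (q : ℂ) ^ j)‖ / ‖qPoch q q j‖ * ‖ε‖ ^ j := by ring
    _ ≤ _ := by
      refine mul_le_mul_of_nonneg_right (div_le_div₀ (by positivity) ?_ hc₂ h3) (by positivity)
      exact mul_le_mul h1 h2 (norm_nonneg _) (Real.exp_pos _).le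

theorem summable_quadTerm (hq0 : 0 < q) (hq1 : q < 1) (x p : ℂ) {ε : ℂ} (hε : ‖ε‖ < 1) :
    Summable (quadTerm q x p ε) := by
  obtain ⟨C, -, hC⟩ := exists_quadTerm_bound hq0 hq1 x p
  exact .of_norm_bounded ((summable_geometric_of_lt_one (norm_nonneg ε) hε).mul_left C)
    fun j => hC ε hε.le j

/-- Again a telescoping pair; the closed form of the partial sums is a multiple of the J-th term and
tends to 0. -/
theorem tsum_quadTerm_step (hq0 : 0 < q) (hq1 : q < 1) (x p : ℂ) {ε : ℂ} (hε : ‖ε‖ < 1) :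
    (1 - ε) * ∑' j, quadTerm q x p ε j
      = (1 - ε * x + ε ^ 2 * p) * ∑' j, quadTerm q x p (ε * q) j := by
  have hqn : ‖(q : ℂ)‖ < 1 := norm_ofReal_lt_one hq0 hq1
  have hs1 := summable_quadTerm hq0 hq1 x p hε
  have hs2 := summable_quadTerm hq0 hq1 x p (norm_mul_lt_one hε hqn)
  have hs := ((hs1.mul_left (1 - ε)).sub (hs2.mul_left (1 - ε * x + ε ^ 2 * p)))
  have htel : ∀ J, ∑ j ∈ Finset.range J, ((1 - ε) * quadTerm q x p ε j
      - (1 - ε * x + ε ^ 2 * p) * quadTerm q x p (ε * q) j)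
      = -(1 - (q : ℂ) ^ J) * quadTerm q x p ε J := by
    intro J
    induction J with
    | zero => simp
    | succ J ih =>
      rw [Finset.sum_range_succ, ih]
      have e1 := qPochInf_succ hq0 hq1 (ε * p * (q : ℂ) ^ J)
      have e2 : ε * p * (q : ℂ) ^ J * q = ε * p * (q : ℂ) ^ (J + 1) := by ring
      have e3 : ε * q * p * (q : ℂ) ^ J = ε * p * (q : ℂ) ^ (J + 1) := by ring
      rw [e2] at e1
      have n1 := qPoch_ne_zero_of_norm_lt_one hq0 hq1 hqn (J + 1)
      simp only [quadTerm, e3, e1, mul_pow, Finset.prod_range_succ]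
      rw [qPoch_succ] at n1 ⊢
      generalize qPochInf q (ε * p * (q : ℂ) ^ (J + 1)) = W
      generalize (∏ k ∈ Finset.range J, (1 - (q : ℂ) ^ k * x + p * (q : ℂ) ^ (2 * k))) = Φ
      have n2 := left_ne_zero_of_mul n1
      have n3 := right_ne_zero_of_mul n1
      generalize qPoch q q J = D at *
      rw [pow_succ _ J, pow_mul' _ 2 J, pow_succ _ J]
      generalize hX : (q : ℂ) ^ J = X at *
      have n3' : 1 - X * q ≠ 0 := by rwa [mul_comm]
      rw [mul_comm (q : ℂ) X]
      field_simp
      ring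
  have hlim : Tendsto (fun J => -(1 - (q : ℂ) ^ J) * quadTerm q x p ε J) atTop (𝓝 0) := by
    have := (((tendsto_pow_coe hq0 hq1).const_sub 1).neg).mul hs1.tendsto_atTop_zero
    simpa using this
  have h0 := tendsto_nhds_unique (hs.hasSum.tendsto_sum_nat) (hlim.congr fun J => (htel J).symm)
  rw [(hs1.mul_left _).tsum_sub (hs2.mul_left _), tsum_mul_left, tsum_mul_left] at h0
  exact sub_eq_zero.mp h0

/-- This is the q-Gauss sum with upper parameters u, v such that u + v = x and uv = p. Written
through x and p it needs no square roots. The proof iterates ε → qε, down to ε = 0. -/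
theorem tprod_quad_eq (hq0 : 0 < q) (hq1 : q < 1) (x p : ℂ) {ε : ℂ} (hε : ‖ε‖ < 1) :
    ∏' k : ℕ, (1 - (q : ℂ) ^ k * (ε * x) + (q : ℂ) ^ (2 * k) * (ε ^ 2 * p))
      = qPochInf q ε * ∑' j, quadTerm q x p ε j := by
  have hstep : ∀ N, qPoch q ε N * ∑' j, quadTerm q x p ε j
      = (∏ k ∈ Finset.range N, (1 - (q : ℂ) ^ k * (ε * x) + (q : ℂ) ^ (2 * k) * (ε ^ 2 * p)))
        * ∑' j, quadTerm q x p (ε * (q : ℂ) ^ N) j := by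
    intro N
    induction N with
    | zero => simp [qPoch_zero]
    | succ N ih =>
      have h := tsum_quadTerm_step hq0 hq1 x p (norm_mul_ofReal_pow_lt_one hq0 hq1 hε N)
      rw [qPoch_succ, Finset.prod_range_succ, mul_right_comm, ih, pow_succ (q : ℂ) N, ← mul_assoc ε]
      linear_combination (∏ k ∈ Finset.range N,
        (1 - (q : ℂ) ^ k * (ε * x) + (q : ℂ) ^ (2 * k) * (ε ^ 2 * p))) * h
  have hone : ∑' j, quadTerm q x p 0 j = 1 := by
    rw [tsum_eq_single 0 fun j hj => by simp [quadTerm, hj]]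
    simp [quadTerm, qPoch_zero, qPochInf_zero]
  have hlim : Tendsto (fun N : ℕ => ∑' j, quadTerm q x p (ε * (q : ℂ) ^ N) j) atTop (𝓝 1) := by
    rw [← hone]
    obtain ⟨C, hC0, hC⟩ := exists_quadTerm_bound hq0 hq1 x p
    have ht : Tendsto (fun N : ℕ => ε * (q : ℂ) ^ N) atTop (𝓝 0) := by
      simpa using (tendsto_pow_coe hq0 hq1).const_mul ε
    refine tendsto_tsum_of_dominated_convergence (bound := fun j => C * ‖ε‖ ^ j)
      ((summable_geometric_of_lt_one (norm_nonneg ε) hε).mul_left C) (fun j => ?_)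
      (Eventually.of_forall fun N j => ?_)
    · have hc : Continuous fun ε : ℂ => quadTerm q x p ε j := by
        unfold quadTerm
        have := continuous_qPochInf hq0 hq1
        fun_prop
      exact (hc.tendsto 0).comp ht
    · have h1 : ‖ε * (q : ℂ) ^ N‖ ≤ ‖ε‖ := by
        rw [norm_mul, norm_ofReal_pow hq0]
        have h3 : q ^ N ≤ 1 := pow_le_one₀ hq0.le hq1.le
        nlinarith [norm_nonneg ε]
      refine (hC _ (h1.trans hε.le) j).trans ?_
      exact mul_le_mul_of_nonneg_left (pow_le_pow_left₀ (norm_nonneg _) h1 j) hC0.le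
  have hm : Multipliable fun k : ℕ =>
      (1 - (q : ℂ) ^ k * (ε * x) + (q : ℂ) ^ (2 * k) * (ε ^ 2 * p)) := by
    refine multipliable_of_geometric hq0 hq1 (M := ‖ε * x‖ + ‖ε ^ 2 * p‖) fun k => ?_
    have := norm_quad_sub_one_le hq0 hq1 (ε * x) (ε ^ 2 * p) k
    rwa [mul_comm (ε ^ 2 * p)] at this
  have h1 := ((tendsto_qPoch hq0 hq1 ε).mul_const (∑' j, quadTerm q x p ε j))
  have h2 := (hm.hasProd.tendsto_prod_nat).mul hlim
  rw [mul_one] at h2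
  exact (tendsto_nhds_unique h1 (h2.congr fun N => (hstep N).symm)).symm

end ProductExpansion

/-! ### Expansion of the spectral function in continuous dual `q`-Hahn polynomials -/

/-- The series `∑ F_n(Y) Q_n(z + 1/z)` with `F_n(Y) = ∏_{k<n} numFactor k`. -/
noncomputable def dualSeries (q : ℝ) (a b c e Y z : ℂ) : ℂ :=
  ∑' n : ℕ, (∏ k ∈ Finset.range n, numFactor q e (a * b * c) Y k)
    * dualHahn q a b c (z + 1 / z) n

/-- The tail product from m is a product of quadratics in q^k, to which the q-Gauss expansion
applies with ε = e/z. The factors it produces are those missing from F_m to complete F_{m+j}. -/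
theorem tprod_denFactor_eq {q : ℝ} (hq0 : 0 < q) (hq1 : q < 1) {e κ z Y : ℂ} (he : e ≠ 0)
    (hz : z ≠ 0) (hez : ‖e‖ < ‖z‖) (m : ℕ) :
    (∏ k ∈ Finset.range m, numFactor q e κ Y k) * ∏' k : ℕ, denFactor q e κ z Y (m + k)
      = qPochInf q (e / z) * ∑' j, (∏ k ∈ Finset.range (m + j), numFactor q e κ Y k) / z ^ j
        * qPochInf q (κ / z * (q : ℂ) ^ (2 * m + j)) / qPoch q q j := by
  have hε : ‖e / z‖ < 1 := by rw [norm_div]; exact (div_lt_one (norm_pos_iff.mpr hz)).mpr hez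
  have h := tprod_quad_eq hq0 hq1 ((q : ℂ) ^ m * (1 + κ / e + Y / e)) ((q : ℂ) ^ (2 * m) * (κ / e)) hε
  have e1 : ∏' k : ℕ, denFactor q e κ z Y (m + k) = ∏' k : ℕ, (1 - (q : ℂ) ^ k
      * (e / z * ((q : ℂ) ^ m * (1 + κ / e + Y / e)))
      + (q : ℂ) ^ (2 * k) * ((e / z) ^ 2 * ((q : ℂ) ^ (2 * m) * (κ / e)))) := by
    refine tprod_congr fun k => ?_
    rw [denFactor, pow_add, pow_mul' _ 2 k, pow_mul' _ 2 m]
    field_simp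
    ring
  rw [e1, h, mul_left_comm, ← tsum_mul_left]
  congr 1
  refine tsum_congr fun j => ?_
  have e2 : ∏ k ∈ Finset.range (m + j), numFactor q e κ Y k
      = (∏ k ∈ Finset.range m, numFactor q e κ Y k) * (e ^ j * ∏ k ∈ Finset.range j,
        (1 - (q : ℂ) ^ k * ((q : ℂ) ^ m * (1 + κ / e + Y / e))
          + (q : ℂ) ^ (2 * m) * (κ / e) * (q : ℂ) ^ (2 * k))) := by
    rw [Finset.prod_range_add]
    congr 1
    have : e ^ j = ∏ _k ∈ Finset.range j, e := by simp
    rw [this, ← Finset.prod_mul_distrib]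
    refine Finset.prod_congr rfl fun k _ => ?_
    rw [numFactor, pow_add, pow_mul' _ 2 k, pow_mul' _ 2 m]
    field_simp
    ring
  have e3 : e / z * ((q : ℂ) ^ (2 * m) * (κ / e)) * (q : ℂ) ^ j = κ / z * (q : ℂ) ^ (2 * m + j) := by
    rw [pow_add]
    field_simp
  rw [e2, quadTerm, e3, div_pow]
  ring

theorem tsum_antidiagonal_swap {g : ℕ × ℕ → ℂ} (hg : Summable g) :
    ∑' m, ∑' j, g (m, j) = ∑' n, ∑ m ∈ Finset.range (n + 1), g (m, n - m) := by
  rw [← hg.tsum_prod, ← (Finset.HasAntidiagonal.sigmaAntidiagonalEquivProd (A := ℕ)).tsum_eq g]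
  have hs : Summable fun x : (n : ℕ) × Finset.HasAntidiagonal.antidiagonal n =>
      g (Finset.HasAntidiagonal.sigmaAntidiagonalEquivProd x) :=
    (Finset.HasAntidiagonal.sigmaAntidiagonalEquivProd.summable_iff).mpr hg
  rw [hs.tsum_sigma' fun n => (hasSum_fintype _).summable]
  refine tsum_congr fun n => ?_
  rw [tsum_fintype, ← Finset.Nat.sum_antidiagonal_eq_sum_range_succ_mk]
  exact Finset.sum_coe_sort (Finset.HasAntidiagonal.antidiagonal n) g

/-- Expanding every tail product gives a double series in (m, j) that depends on Y only through
F_{m+j}(Y). Summed along m + j = n, the coefficients form the finite very-well-poised sum of Q_n. -/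
theorem spectralFun_eq_dualSeries {q : ℝ} (hq0 : 0 < q) (hq1 : q < 1) {a b c e z : ℂ}
    (ha : ‖a‖ < 1) (hb : ‖b‖ < 1) (hc : ‖c‖ < 1) (he : e ≠ 0) (hz : z ≠ 0) (hz1 : ‖z‖ < 1)
    (hez : ‖e‖ < ‖z‖) (hdef : ∀ k : ℕ, a * b * c / z * (q : ℂ) ^ k ≠ 1) (Y : ℂ) :
    spectralFun q a b c e z Y
      = qPochInf q (e / z) * qPochInf q (a * b * c / z) * dualSeries q a b c e Y z := by
  have hz0 : 0 < ‖z‖ := norm_pos_iff.mpr hz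
  have he0 : 0 < ‖e‖ := norm_pos_iff.mpr he
  set κ := a * b * c with hκ
  set F : ℕ → ℂ := fun n => ∏ k ∈ Finset.range n, numFactor q e κ Y k with hF
  set g : ℕ × ℕ → ℂ := fun x => vwpCoeff q a b c z x.1 * z ^ x.1 * (F (x.1 + x.2) / z ^ x.2
    * qPochInf q (κ / z * (q : ℂ) ^ (2 * x.1 + x.2)) / qPoch q q x.2) with hg
  have hgs : Summable g := by
    obtain ⟨C, hC, hV⟩ := exists_vwpCoeff_bound_at hq0 hq1 ha hb hc hz
    obtain ⟨c₂, hc₂, h₂⟩ := exists_pos_le_norm_qPoch_of_norm_le hq0 hq1 hq0.le hq1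
    set K := Real.exp ((‖κ‖ + ‖Y‖) / ‖e‖ / (1 - q))
    set L := Real.exp (‖κ / z‖ / (1 - q))
    -- The majorant is (|e||z|)^m (|e|/|z|)^j; the second ratio is where |e| < |z| enters.
    have s1 := summable_geometric_of_lt_one (r := ‖e‖ * ‖z‖) (by positivity) (by nlinarith)
    have s2 := summable_geometric_of_lt_one (r := ‖e‖ / ‖z‖) (by positivity)
      ((div_lt_one hz0).mpr hez)
    refine .of_norm_bounded ((s1.mul_of_nonneg s2 (fun _ => by positivity)
      fun _ => by positivity).mul_left (C * K * L / c₂)) fun x => ?_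
    have b1 := hV x.1
    have b2 := norm_prod_numFactor_le (e := e) (κ := κ) (Y := Y) hq0 hq1 he0 le_rfl le_rfl
      (x.1 + x.2)
    have b3 : ‖qPochInf q (κ / z * (q : ℂ) ^ (2 * x.1 + x.2))‖ ≤ L := by
      refine norm_qPochInf_le_of_norm_le hq0 hq1 ?_
      rw [norm_mul, norm_ofReal_pow hq0]
      exact mul_le_of_le_one_right (norm_nonneg _) (pow_le_one₀ hq0.le hq1.le)
    have b4 := h₂ q (by rw [norm_real, Real.norm_of_nonneg hq0.le]) x.2
    simp only [hg, norm_mul, norm_div, norm_pow]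
    calc _ = ‖vwpCoeff q a b c z x.1‖ * ‖F (x.1 + x.2)‖
          * ‖qPochInf q (κ / z * (q : ℂ) ^ (2 * x.1 + x.2))‖ / ‖qPoch q q x.2‖
          * (‖z‖ ^ x.1 / ‖z‖ ^ x.2) := by ring
      _ ≤ C * (‖e‖ ^ (x.1 + x.2) * K) * L / c₂ * (‖z‖ ^ x.1 / ‖z‖ ^ x.2) := by
        gcongr
      _ = _ := by
        rw [mul_pow, div_pow, pow_add]
        ring
  have h1 : spectralFun q a b c e z Y = qPochInf q (e / z) * ∑' m, ∑' j, g (m, j) := by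
    rw [← tsum_mul_left, spectralFun]
    refine tsum_congr fun m => ?_
    have h2 := tprod_denFactor_eq (κ := κ) (Y := Y) hq0 hq1 he hz hez m
    rw [Finset.prod_mul_distrib, Finset.prod_const, Finset.card_range, mul_assoc, h2]
    simp only [hg]
    rw [tsum_mul_left]
    ring
  rw [h1, tsum_antidiagonal_swap hgs, mul_assoc, dualSeries, ← tsum_mul_left (a := qPochInf q (κ / z))]
  refine congrArg _ (tsum_congr fun n => ?_)
  have h3 := vwpSum_eq hq0 hq1 ha hb hc hz hdef n
  have h4 : dualHahn q a b c (z + 1 / z) n = vwpSum q a b c z n / z ^ n := by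
    rw [h3, mul_div_cancel_left₀ _ (pow_ne_zero n hz)]
  rw [h4, vwpSum, Finset.sum_div, ← mul_assoc, Finset.mul_sum]
  refine Finset.sum_congr rfl fun m hm => ?_
  obtain ⟨j, rfl⟩ := Nat.exists_eq_add_of_le (Nat.lt_succ_iff.mp (Finset.mem_range.mp hm))
  have n1 : qPoch q (κ / z) (2 * m + j) ≠ 0 := qPoch_ne_zero hdef _
  have h5 := qPochInf_eq_mul hq0 hq1 (κ / z) (2 * m + j)
  simp only [hg, vwpTerm, show m + j - m = j by omega]
  rw [h5, ← hκ]
  have n2 : qPoch q q j ≠ 0 :=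
    qPoch_ne_zero_of_norm_lt_one hq0 hq1 (norm_ofReal_lt_one hq0 hq1) _
  have hF' : F (m + j) = ∏ k ∈ Finset.range (m + j), numFactor q e κ Y k := rfl
  rw [← hF', show z ^ (2 * m) = z ^ m * z ^ m by ring, pow_add z]
  generalize qPoch q (κ / z) (2 * m + j) = D1 at *
  generalize qPochInf q (κ / z * (q : ℂ) ^ (2 * m + j)) = D2
  field_simp

/-! ### The second order `q`-difference equation -/

section QDifference

variable {q : ℝ} {a b c : ℂ}

/-- `dualHahn` shifted by one, with value `0` at `0`. -/
noncomputable def dualHahnPred (q : ℝ) (a b c y : ℂ) : ℕ → ℂ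
  | 0 => 0
  | n + 1 => dualHahn q a b c y n

theorem dualHahn_rec (hq0 : 0 < q) (hq1 : q < 1) (ha : ‖a‖ < 1) (hb : ‖b‖ < 1) (hc : ‖c‖ < 1)
    (y : ℂ) (n : ℕ) : dualHahnG q a b c n * dualHahn q a b c y (n + 1)
      = (y - dualHahnB q a b c n) * dualHahn q a b c y n - dualHahnPred q a b c y n := by
  have hG := dualHahnG_ne_zero (a := a) (b := b) (c := c) hq0 hq1 ha hb hc
  rcases n with _ | n
  · rw [dualHahn_one (hG 0), dualHahnPred, dualHahn]
    ring
  · exact dualHahn_succ_succ (hG (n + 1)) y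

/-- A first order structure relation: the q-shift in z is expressed by Q_n and Q_{n-1} at the
unshifted point. It follows by induction from the three-term recurrences at z and at qz. -/
theorem dualHahn_shift (hq0 : 0 < q) (hq1 : q < 1) (ha : ‖a‖ < 1) (hb : ‖b‖ < 1) (hc : ‖c‖ < 1)
    {z : ℂ} (hz : z ≠ 0) (n : ℕ) :
    (q : ℂ) ^ n * ((1 - a * z) * (1 - b * z) * (1 - c * z))
      * (dualHahn q a b c (q * z + 1 / (q * z)) n - dualHahn q a b c (z + 1 / z) n)
    = (1 - q * z ^ 2) * ((1 - (q : ℂ) ^ n) * (1 - a * b * c * z * (q : ℂ) ^ n / q)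
      * dualHahn q a b c (z + 1 / z) n - z * dualHahnPred q a b c (z + 1 / z) n) := by
  have hq : (q : ℂ) ≠ 0 := by exact_mod_cast hq0.ne'
  have hG := dualHahnG_ne_zero (a := a) (b := b) (c := c) hq0 hq1 ha hb hc
  have hr := dualHahn_rec hq0 hq1 ha hb hc
  induction n using Nat.twoStepInduction with
  | zero => simp [dualHahn, dualHahnPred]
  | one =>
    have r1 := hr (z + 1 / z) 0
    have r2 := hr (q * z + 1 / (q * z)) 0
    refine mul_left_cancel₀ (hG 0) ?_
    simp only [dualHahnPred, dualHahn.eq_1] at r1 r2 ⊢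
    simp only [zero_add] at r1 r2
    linear_combination (norm := skip) (q : ℂ) ^ 1 * ((1 - a * z) * (1 - b * z) * (1 - c * z))
      * (r2 - r1) - (1 - q * z ^ 2) * ((1 - (q : ℂ) ^ 1) * (1 - a * b * c * z * (q : ℂ) ^ 1 / q)) * r1
    simp only [dualHahnB, dualHahnG]
    field_simp
    ring
  | more n h0 h1 =>
    have r0 := hr (z + 1 / z) n
    have r1 := hr (z + 1 / z) (n + 1)
    have r2 := hr (q * z + 1 / (q * z)) (n + 1)
    simp only [dualHahnPred] at r1 r2 h1 ⊢
    refine mul_left_cancel₀ (hG (n + 1)) ?_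
    -- The recurrences eliminate index n + 2 at both points, the induction hypotheses remove the
    -- shifted values, and one more recurrence removes Q_{n-1}. Normalization is postponed because
    -- the denominators have to be cleared first.
    linear_combination (norm := skip) (q : ℂ) ^ (n + 2)
      * ((1 - a * z) * (1 - b * z) * (1 - c * z)) * (r2 - r1)
      - (1 - q * z ^ 2) * ((1 - (q : ℂ) ^ (n + 2)) * (1 - a * b * c * z * (q : ℂ) ^ (n + 2) / q)) * r1
      + q * (q * z + 1 / (q * z) - dualHahnB q a b c (n + 1)) * h1 - (q : ℂ) ^ 2 * h0
      + (1 - q * z ^ 2) * (q : ℂ) ^ 2 * z * r0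
    simp only [dualHahnB, dualHahnG, pow_succ]
    generalize dualHahn q a b c (z + 1 / z) n = B0
    generalize dualHahn q a b c (z + 1 / z) (n + 1) = B1
    generalize dualHahn q a b c (z + 1 / z) (n + 1 + 1) = B2
    generalize dualHahn q a b c (q * z + 1 / (q * z)) n = C0
    generalize dualHahn q a b c (q * z + 1 / (q * z)) (n + 1) = C1
    generalize dualHahn q a b c (q * z + 1 / (q * z)) (n + 1 + 1) = C2
    generalize dualHahnPred q a b c (z + 1 / z) n = Bp
    generalize (q : ℂ) ^ n = x
    field_simp
    ring

theorem add_one_div_inv (z : ℂ) : z⁻¹ + 1 / z⁻¹ = z + 1 / z := by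
  rw [one_div, inv_inv, one_div, add_comm]

theorem dualSeries_inv (q : ℝ) (a b c e Y z : ℂ) :
    dualSeries q a b c e Y z⁻¹ = dualSeries q a b c e Y z := by
  rw [dualSeries, dualSeries, add_one_div_inv]

/-- The coefficient of the Askey-Wilson type `q`-difference operator. -/
noncomputable def awCoeff (q : ℝ) (a b c z : ℂ) : ℂ :=
  (1 - a * z) * (1 - b * z) * (1 - c * z) / ((1 - z ^ 2) * (1 - q * z ^ 2))

/-- The structure relations at z and 1/z are combined. The factors e - qz and e - q/z make the
operator act on Q_n with only Q_n and Q_{n-1} in the result. -/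
theorem dualHahn_qDifference (hq0 : 0 < q) (hq1 : q < 1) (ha : ‖a‖ < 1) (hb : ‖b‖ < 1)
    (hc : ‖c‖ < 1) {e z : ℂ} (hz : z ≠ 0) (hz2 : z ^ 2 ≠ 1) (hz3 : q * z ^ 2 ≠ 1)
    (hz4 : z ^ 2 ≠ q) (n : ℕ) :
    (e - q * z) * awCoeff q a b c z
      * (dualHahn q a b c (q * z + 1 / (q * z)) n - dualHahn q a b c (z + 1 / z) n)
    + (e - q * z⁻¹) * awCoeff q a b c z⁻¹
      * (dualHahn q a b c (q * z⁻¹ + 1 / (q * z⁻¹)) n - dualHahn q a b c (z + 1 / z) n)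
    = ((1 - (q : ℂ) ^ n) * (e - a * b * c * (q : ℂ) ^ n) * dualHahn q a b c (z + 1 / z) n
      - q * dualHahnPred q a b c (z + 1 / z) n) / (q : ℂ) ^ n := by
  have hq : (q : ℂ) ≠ 0 := by exact_mod_cast hq0.ne'
  have h1 := dualHahn_shift hq0 hq1 ha hb hc hz n
  have h2 := dualHahn_shift hq0 hq1 ha hb hc (inv_ne_zero hz) n
  rw [add_one_div_inv] at h2
  have n1 : 1 - z ^ 2 ≠ 0 := sub_ne_zero.mpr hz2.symm
  have n2 : 1 - q * z ^ 2 ≠ 0 := sub_ne_zero.mpr hz3.symm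
  have n3 : z ^ 2 - q ≠ 0 := sub_ne_zero.mpr hz4
  have n4 : z ^ 2 - 1 ≠ 0 := sub_ne_zero.mpr hz2
  have hx : (q : ℂ) ^ n ≠ 0 := pow_ne_zero n hq
  rw [awCoeff, awCoeff]
  generalize dualHahn q a b c (q * z + 1 / (q * z)) n = Q1 at *
  generalize dualHahn q a b c (q * z⁻¹ + 1 / (q * z⁻¹)) n = Q2 at *
  generalize dualHahn q a b c (z + 1 / z) n = Q0 at *
  generalize dualHahnPred q a b c (z + 1 / z) n = Qp at *
  generalize (q : ℂ) ^ n = x at *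
  have e1 : (1 - a * z) * (1 - b * z) * (1 - c * z) / ((1 - z ^ 2) * (1 - q * z ^ 2)) * (Q1 - Q0)
      = ((1 - x) * (1 - a * b * c * z * x / q) * Q0 - z * Qp) / (x * (1 - z ^ 2)) := by
    rw [div_mul_eq_mul_div, div_eq_div_iff (mul_ne_zero n1 n2) (mul_ne_zero hx n1)]
    linear_combination (1 - z ^ 2) * h1
  have n5 : 1 - z⁻¹ ^ 2 ≠ 0 := by
    rw [show 1 - z⁻¹ ^ 2 = (z ^ 2 - 1) / z ^ 2 by field_simp]
    exact div_ne_zero n4 (pow_ne_zero 2 hz)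
  have n6 : 1 - q * z⁻¹ ^ 2 ≠ 0 := by
    rw [show 1 - q * z⁻¹ ^ 2 = (z ^ 2 - q) / z ^ 2 by field_simp]
    exact div_ne_zero n3 (pow_ne_zero 2 hz)
  have e2 : (1 - a * z⁻¹) * (1 - b * z⁻¹) * (1 - c * z⁻¹) / ((1 - z⁻¹ ^ 2) * (1 - q * z⁻¹ ^ 2))
      * (Q2 - Q0)
      = ((1 - x) * (1 - a * b * c * z⁻¹ * x / q) * Q0 - z⁻¹ * Qp) / (x * (1 - z⁻¹ ^ 2)) := by
    rw [div_mul_eq_mul_div, div_eq_div_iff (mul_ne_zero n5 n6) (mul_ne_zero hx n5)]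
    linear_combination (1 - z⁻¹ ^ 2) * h2
  rw [mul_assoc (e - q * z), e1, mul_assoc (e - q * z⁻¹), e2,
    show 1 - z⁻¹ ^ 2 = -(1 - z ^ 2) / z ^ 2 by field_simp; ring]
  field_simp
  ring

/-- F_n is O(ρ^n) and Q_n is O(n r^{-n}) on the annulus r ≤ |z| ≤ 1/r, by invariance under z ↔ 1/z.
-/
theorem exists_dualSeries_bound (hq0 : 0 < q) (hq1 : q < 1) (ha : ‖a‖ < 1) (hb : ‖b‖ < 1)
    (hc : ‖c‖ < 1) {ρ r : ℝ} (hρ : 0 < ρ) (hρr : ρ < r) (R : ℝ) :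
    ∃ v : ℕ → ℝ, Summable v ∧ ∀ e Y z : ℂ, ‖e‖ ≤ ρ → ‖Y‖ ≤ R → r ≤ ‖z‖ → r * ‖z‖ ≤ 1 → ∀ n,
      ‖(∏ k ∈ Finset.range n, numFactor q e (a * b * c) Y k)
        * dualHahn q a b c (z + 1 / z) n‖ ≤ v n := by
  have hr : 0 < r := hρ.trans hρr
  obtain ⟨C, hC, hQ⟩ := exists_dualHahn_bound hq0 hq1 ha hb hc
  set K := Real.exp ((‖a * b * c‖ + R) / ρ / (1 - q))
  refine ⟨fun n => K * C * ((n + 1) * (ρ / r) ^ n), ?_, fun e Y z he hY hz1 hz2 n => ?_⟩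
  · have h1 : ρ / r < 1 := (div_lt_one hr).mpr hρr
    have h0 : 0 ≤ ρ / r := by positivity
    have s1 := summable_pow_mul_geometric_of_norm_lt_one 1
      (show ‖ρ / r‖ < 1 by rwa [Real.norm_of_nonneg h0])
    have s2 := summable_geometric_of_lt_one h0 h1
    refine Summable.mul_left _ ((s1.add s2).congr fun n => ?_)
    ring
  · have hz0 : 0 < ‖z‖ := hr.trans_le hz1
    have hz : z ≠ 0 := norm_pos_iff.mp hz0
    have key : ‖dualHahn q a b c (z + 1 / z) n‖ * r ^ n ≤ C * (n + 1) := by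
      rcases le_total ‖z‖ 1 with h | h
      · refine le_trans ?_ (hQ z hz h n)
        gcongr
      · have h2 := hQ z⁻¹ (inv_ne_zero hz) (by rw [norm_inv]; exact inv_le_one_of_one_le₀ h) n
        rw [add_one_div_inv] at h2
        refine le_trans ?_ h2
        rw [norm_inv]
        gcongr
        rw [← one_div, le_div_iff₀ hz0]
        exact hz2
    have hF := norm_prod_numFactor_le (κ := a * b * c) hq0 hq1 hρ he hY n
    rw [norm_mul]
    have h3 : ‖dualHahn q a b c (z + 1 / z) n‖ ≤ C * (n + 1) / r ^ n :=
      (le_div_iff₀ (pow_pos hr n)).mpr key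
    calc _ ≤ ρ ^ n * K * (C * (n + 1) / r ^ n) := mul_le_mul hF h3 (norm_nonneg _) (by positivity)
      _ = K * C * ((n + 1) * (ρ / r) ^ n) := by rw [div_pow]; ring

theorem summable_dualSeries (hq0 : 0 < q) (hq1 : q < 1) (ha : ‖a‖ < 1) (hb : ‖b‖ < 1)
    (hc : ‖c‖ < 1) {e Y z : ℂ} (h1 : ‖e‖ < ‖z‖) (h2 : ‖e‖ * ‖z‖ < 1) :
    Summable fun n => (∏ k ∈ Finset.range n, numFactor q e (a * b * c) Y k)
      * dualHahn q a b c (z + 1 / z) n := by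
  have hz0 : 0 < ‖z‖ := (norm_nonneg e).trans_lt h1
  set m := min ‖z‖ (1 / ‖z‖) with hm
  have hem : ‖e‖ < m := lt_min h1 ((lt_div_iff₀ hz0).mpr h2)
  obtain ⟨ρ, hρ1, hρ2⟩ := exists_between hem
  obtain ⟨v, hv, h⟩ := exists_dualSeries_bound hq0 hq1 ha hb hc
    ((norm_nonneg e).trans_lt hρ1) hρ2 ‖Y‖
  refine .of_norm_bounded hv (h e Y z hρ1.le le_rfl (min_le_left _ _) ?_)
  calc m * ‖z‖ ≤ 1 / ‖z‖ * ‖z‖ := mul_le_mul_of_nonneg_right (min_le_right _ _) hz0.le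
    _ = 1 := by field_simp

/-- F_{n+1}/F_n is exactly the factor for which the Q_n and Q_{n-1} contributions telescope against
Y F_n Q_n. The remainder F_N Q_{N-1}/q^{N-1} tends to 0 only because |e| < q, and the same bound
makes the series converge at qz. -/
theorem dualSeries_qDifference (hq0 : 0 < q) (hq1 : q < 1) (ha : ‖a‖ < 1) (hb : ‖b‖ < 1)
    (hc : ‖c‖ < 1) {e z : ℂ} (he : ‖e‖ < q) (hz1 : ‖z‖ = 1) (hz2 : z ^ 2 ≠ 1) (Y : ℂ) :
    (e - q * z) * awCoeff q a b c z * (dualSeries q a b c e Y (q * z) - dualSeries q a b c e Y z)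
    + (e - q * z⁻¹) * awCoeff q a b c z⁻¹
      * (dualSeries q a b c e Y (q * z⁻¹) - dualSeries q a b c e Y z)
    = Y * dualSeries q a b c e Y z := by
  have hq : (q : ℂ) ≠ 0 := by exact_mod_cast hq0.ne'
  have hqn : ‖(q : ℂ)‖ = q := by rw [norm_real, Real.norm_of_nonneg hq0.le]
  have hz : z ≠ 0 := norm_pos_iff.mp (by rw [hz1]; exact one_pos)
  have hz3 : q * z ^ 2 ≠ 1 := fun h => by
    have := congrArg norm h
    rw [norm_mul, norm_pow, hz1, hqn, norm_one] at this
    linarith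
  have hz4 : z ^ 2 ≠ q := fun h => by
    have := congrArg norm h
    rw [norm_pow, hz1, hqn] at this
    linarith
  have s0 := summable_dualSeries hq0 hq1 ha hb hc (Y := Y) (e := e) (z := z)
    (by rw [hz1]; linarith) (by rw [hz1]; linarith)
  have s1 := summable_dualSeries hq0 hq1 ha hb hc (Y := Y) (e := e) (z := q * z)
    (by rw [norm_mul, hz1, hqn]; linarith) (by rw [norm_mul, hz1, hqn]; nlinarith)
  have s2 := summable_dualSeries hq0 hq1 ha hb hc (Y := Y) (e := e) (z := q * z⁻¹)
    (by rw [norm_mul, norm_inv, hz1, hqn]; linarith)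
    (by rw [norm_mul, norm_inv, hz1, hqn]; nlinarith)
  have hs := (((s1.hasSum.sub s0.hasSum).mul_left ((e - q * z) * awCoeff q a b c z)).add
    ((s2.hasSum.sub s0.hasSum).mul_left ((e - q * z⁻¹) * awCoeff q a b c z⁻¹))).sub
      (s0.hasSum.mul_left Y)
  have ht := hs.tendsto_sum_nat
  have htel : ∀ N, ∑ n ∈ Finset.range N,
      ((e - q * z) * awCoeff q a b c z * ((∏ k ∈ Finset.range n, numFactor q e (a * b * c) Y k)
          * dualHahn q a b c (q * z + 1 / (q * z)) n
        - (∏ k ∈ Finset.range n, numFactor q e (a * b * c) Y k) * dualHahn q a b c (z + 1 / z) n)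
      + (e - q * z⁻¹) * awCoeff q a b c z⁻¹
        * ((∏ k ∈ Finset.range n, numFactor q e (a * b * c) Y k)
          * dualHahn q a b c (q * z⁻¹ + 1 / (q * z⁻¹)) n
        - (∏ k ∈ Finset.range n, numFactor q e (a * b * c) Y k) * dualHahn q a b c (z + 1 / z) n)
      - Y * ((∏ k ∈ Finset.range n, numFactor q e (a * b * c) Y k)
        * dualHahn q a b c (z + 1 / z) n))
      = q * (∏ k ∈ Finset.range N, numFactor q e (a * b * c) Y k)
        * dualHahnPred q a b c (z + 1 / z) N / (q : ℂ) ^ N := by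
    intro N
    induction N with
    | zero => simp [dualHahnPred]
    | succ N ih =>
      have h := dualHahn_qDifference hq0 hq1 ha hb hc (e := e) hz hz2 hz3 hz4 N
      rw [Finset.sum_range_succ, ih, Finset.prod_range_succ, dualHahnPred]
      generalize (∏ k ∈ Finset.range N, numFactor q e (a * b * c) Y k) = F
      have hx : (q : ℂ) ^ N ≠ 0 := pow_ne_zero N hq
      linear_combination (norm := skip) F * h
      rw [numFactor, pow_succ]
      field_simp
      ring
  have hlim : Tendsto (fun N => q * (∏ k ∈ Finset.range N, numFactor q e (a * b * c) Y k)
        * dualHahnPred q a b c (z + 1 / z) N / (q : ℂ) ^ N) atTop (𝓝 0) := by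
    rw [← tendsto_add_atTop_iff_nat 1]
    obtain ⟨C, hC, hQ⟩ := exists_dualHahn_bound hq0 hq1 ha hb hc
    obtain ⟨ρ, hρ1, hρ2⟩ := exists_between he
    have hρ0 : 0 < ρ := (norm_nonneg e).trans_lt hρ1
    set K := Real.exp ((‖a * b * c‖ + ‖Y‖) / ρ / (1 - q))
    have hr0 : 0 ≤ ρ / q := by positivity
    have hr1 : ρ / q < 1 := (div_lt_one hq0).mpr hρ2
    have s1 := (tendsto_self_mul_const_pow_of_lt_one hr0 hr1).add
      (tendsto_pow_atTop_nhds_zero_of_lt_one hr0 hr1)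
    have s2 := s1.const_mul (ρ * K * C)
    rw [add_zero, mul_zero] at s2
    refine squeeze_zero_norm (fun N => ?_) s2
    have b1 := norm_prod_numFactor_le (κ := a * b * c) (Y := Y) hq0 hq1 hρ0 hρ1.le le_rfl (N + 1)
    have b2 := hQ z hz hz1.le N
    rw [hz1, one_pow, mul_one] at b2
    rw [dualHahnPred, norm_div, norm_mul, norm_mul, norm_ofReal_pow hq0, hqn]
    have hqN := pow_pos hq0 N
    calc _ = ‖∏ k ∈ Finset.range (N + 1), numFactor q e (a * b * c) Y k‖
          * ‖dualHahn q a b c (z + 1 / z) N‖ / q ^ N := by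
            rw [pow_succ]; field_simp
      _ ≤ ρ ^ (N + 1) * K * (C * (N + 1)) / q ^ N := by gcongr
      _ = _ := by rw [div_pow, pow_succ]; field_simp
  have h0 := tendsto_nhds_unique ht (hlim.congr fun N => (htel N).symm)
  exact sub_eq_zero.mp h0

end QDifference

/-! ### Circle averages -/

section CircleAverage
open Real (circleAverage circleAverage_def circleAverage_eq_circleAverage_zero_one
  circleAverage_zero_one_congr_inv circleAverage_eq_circleIntegral)

theorem circleAverage_reflect (f : ℂ → ℂ) {R : ℝ} (hR : R ≠ 0) :
    circleAverage (fun z => f ((R : ℂ) ^ 2 / z)) 0 R = circleAverage f 0 R := by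
  have hRc : (R : ℂ) ≠ 0 := by exact_mod_cast hR
  rw [circleAverage_eq_circleAverage_zero_one, circleAverage_eq_circleAverage_zero_one (f := f),
    ← circleAverage_zero_one_congr_inv (f := fun z => f (R * z + 0))]
  congr 1
  funext z
  rw [add_zero, add_zero, sq, mul_div_mul_left _ _ hRc, div_eq_mul_inv]

/-- The average is the contour integral of f(z)/z up to a constant, so Cauchy's theorem on the
annulus applies. -/
theorem circleAverage_eq_of_annulus {f : ℂ → ℂ} {r R : ℝ} (hr : 0 < r) (hrR : r ≤ R)
    (hf : ∀ z : ℂ, r ≤ ‖z‖ → ‖z‖ ≤ R → DifferentiableAt ℂ f z) :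
    circleAverage f 0 R = circleAverage f 0 r := by
  rw [circleAverage_eq_circleIntegral hr.ne', circleAverage_eq_circleIntegral (hr.trans_le hrR).ne']
  congr 1
  refine circleIntegral_sub_center_inv_smul_eq_of_differentiable_on_annulus_off_countable hr hrR
    Set.countable_empty (fun z hz => ?_) fun z hz => ?_
  · simp only [Set.mem_sdiff, Metric.mem_closedBall, Metric.mem_ball, dist_zero_right, not_lt] at hz
    exact (hf z hz.2 hz.1).continuousAt.continuousWithinAt
  · simp only [Set.mem_sdiff, Metric.mem_closedBall, Metric.mem_ball, dist_zero_right, not_le,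
      Set.mem_empty_iff_false, not_false_eq_true, and_true] at hz
    exact hf z hz.2.le hz.1.le

theorem circleAverage_pos {f : ℂ → ℝ} {R : ℝ} (hf : ContinuousOn f (Metric.sphere 0 |R|))
    (h0 : ∀ z ∈ Metric.sphere (0 : ℂ) |R|, 0 ≤ f z) {z : ℂ} (hz : z ∈ Metric.sphere (0 : ℂ) |R|)
    (hfz : 0 < f z) : 0 < circleAverage f 0 R := by
  rw [circleAverage_def]
  refine smul_pos (by positivity) ?_
  rw [← image_circleMap_Ioc] at hz
  obtain ⟨θ, hθ, rfl⟩ := hz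
  refine intervalIntegral.integral_pos Real.two_pi_pos
    (hf.comp (continuous_circleMap 0 R).continuousOn fun θ _ => circleMap_mem_sphere' 0 R θ)
    (fun θ _ => h0 _ (circleMap_mem_sphere' 0 R θ)) ⟨θ, Set.Ioc_subset_Icc_self hθ, hfz⟩

theorem circleAverage_ofReal {f : ℂ → ℝ} {R : ℝ} (hf : ContinuousOn f (Metric.sphere 0 |R|)) :
    circleAverage (fun z => (f z : ℂ)) 0 R = (circleAverage f 0 R : ℝ) :=
  Complex.ofRealCLM.circleAverage_comp_comm (f := f) hf.circleIntegrable'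

/-- Differentiation under the integral sign, with a derivative bound obtained from Cauchy's estimate
on a compact neighbourhood. -/
theorem differentiableOn_circleAverage {F : ℂ → ℂ → ℂ} {U : Set ℂ} (hU : IsOpen U) {R : ℝ}
    (hF : ContinuousOn (Function.uncurry F) (U ×ˢ Metric.sphere 0 |R|))
    (hd : ∀ z ∈ Metric.sphere (0 : ℂ) |R|, DifferentiableOn ℂ (fun e => F e z) U) :
    DifferentiableOn ℂ (fun e => circleAverage (F e) 0 R) U := by
  intro e₀ he₀
  obtain ⟨ε, hε, hball⟩ := Metric.isOpen_iff.mp hU e₀ he₀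
  -- Discs of radius r around points of the r-ball stay in the closed 2r-ball, which lies in U.
  set r := ε / 3 with hr
  have hr0 : 0 < r := by positivity
  have hsub : Metric.closedBall e₀ (2 * r) ⊆ U := fun x hx => hball <| by
    rw [Metric.mem_closedBall] at hx; rw [Metric.mem_ball]; linarith
  obtain ⟨C, hC⟩ := ((isCompact_closedBall e₀ (2 * r)).prod
    (isCompact_sphere (0 : ℂ) |R|)).exists_bound_of_continuousOn
      (hF.mono (Set.prod_mono hsub subset_rfl))
  have hcont : ∀ e ∈ U, Continuous fun θ : ℝ => F e (circleMap 0 R θ) := fun e he =>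
    hF.comp_continuous (f := fun θ : ℝ => (e, circleMap 0 R θ)) (by fun_prop)
      fun θ => ⟨he, circleMap_mem_sphere' 0 R θ⟩
  have hmem : ∀ᶠ e in 𝓝 e₀, e ∈ U := hU.mem_nhds he₀
  have hderiv : ∀ θ : ℝ, ∀ e ∈ Metric.ball e₀ r, HasDerivAt (fun e => F e (circleMap 0 R θ))
      (deriv (fun e => F e (circleMap 0 R θ)) e) e := fun θ e he =>
    ((hd _ (circleMap_mem_sphere' 0 R θ)).differentiableAt (hU.mem_nhds (hsub
      (Metric.ball_subset_closedBall (Metric.ball_subset_ball (by linarith) he))))).hasDerivAt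
  have h := (intervalIntegral.hasDerivAt_integral_of_dominated_loc_of_deriv_le
    (μ := MeasureTheory.volume) (a := 0) (b := 2 * Real.pi)
    (F := fun e θ => F e (circleMap 0 R θ))
    (F' := fun e θ => deriv (fun e => F e (circleMap 0 R θ)) e) (x₀ := e₀)
    (bound := fun _ => C / r) (Metric.ball_mem_nhds e₀ hr0)
    (hmem.mono fun e he => (hcont e he).aestronglyMeasurable)
    ((hcont e₀ he₀).intervalIntegrable _ _) ?_ ?_ intervalIntegrable_const
    (.of_forall fun θ _ e he => hderiv θ e he)).2
  · simp only [circleAverage_def]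
    exact (h.differentiableAt.const_smul _).differentiableWithinAt
  -- Measurability of the derivative in θ: it is a pointwise limit of continuous difference
  -- quotients.
  · have ht : Tendsto (fun n : ℕ => ((1 / ((n : ℝ) + 1) : ℝ) : ℂ)) atTop (𝓝[≠] 0) := by
      refine tendsto_nhdsWithin_iff.mpr ⟨?_, .of_forall fun n => ?_⟩
      · exact_mod_cast (Complex.continuous_ofReal.tendsto 0).comp
          (tendsto_one_div_add_atTop_nhds_zero_nat (𝕜 := ℝ))
      · have : (0 : ℝ) < 1 / ((n : ℝ) + 1) := by positivity
        exact ofReal_ne_zero.mpr this.ne'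
    have ht0 := ht.mono_right nhdsWithin_le_nhds
    obtain ⟨N, hN⟩ := eventually_atTop.mp ((ht0.const_add e₀).eventually
      (by rw [add_zero]; exact hmem))
    refine aestronglyMeasurable_of_tendsto_ae atTop (f := fun n : ℕ => fun θ =>
      ((1 / (((n + N : ℕ) : ℝ) + 1) : ℝ) : ℂ)⁻¹ • (F (e₀ + ((1 / (((n + N : ℕ) : ℝ) + 1) : ℝ) : ℂ))
        (circleMap 0 R θ) - F e₀ (circleMap 0 R θ))) (fun n => ?_) (.of_forall fun θ => ?_)
    · exact Continuous.aestronglyMeasurable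
        (((hcont _ (hN _ (Nat.le_add_left N n))).fun_sub (hcont _ he₀)).fun_const_smul _)
    · exact (hasDerivAt_iff_tendsto_slope_zero.mp (hderiv θ e₀ (Metric.mem_ball_self hr0))).comp
        (ht.comp (tendsto_add_atTop_nat N))
  · refine .of_forall fun θ _ e he => ?_
    refine norm_deriv_le_of_forall_mem_sphere_norm_le hr0 (DifferentiableOn.diffContOnCl ?_) ?_
    · rw [closure_ball e hr0.ne']
      refine (hd _ (circleMap_mem_sphere' 0 R θ)).mono fun x hx => hsub ?_
      rw [Metric.mem_ball] at he
      rw [Metric.mem_closedBall] at hx ⊢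
      linarith [dist_triangle x e e₀]
    · intro x hx
      refine hC (x, circleMap 0 R θ) ⟨?_, circleMap_mem_sphere' 0 R θ⟩
      rw [Metric.mem_ball] at he
      rw [Metric.mem_sphere] at hx
      rw [Metric.mem_closedBall]
      linarith [dist_triangle x e e₀]

end CircleAverage

/-! ### Regularity and reality of the dual series -/

section DualSeriesRegularity

variable {q : ℝ} {a b c : ℂ}

theorem differentiable_dualHahn (n : ℕ) : Differentiable ℂ fun y => dualHahn q a b c y n := by
  induction n using Nat.twoStepInduction with
  | zero => simp only [dualHahn]; fun_prop
  | one => simp only [dualHahn]; fun_prop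
  | more n h1 h2 => simp only [dualHahn]; fun_prop

theorem exists_dualSeries_local_bound (hq0 : 0 < q) (hq1 : q < 1) (ha : ‖a‖ < 1) (hb : ‖b‖ < 1)
    (hc : ‖c‖ < 1) {X : Type*} [TopologicalSpace X] {x₀ : X} {E Y Z : X → ℂ}
    (hE : ContinuousAt E x₀) (hY : ContinuousAt Y x₀) (hZ : ContinuousAt Z x₀)
    (h1 : ‖E x₀‖ < ‖Z x₀‖) (h2 : ‖E x₀‖ * ‖Z x₀‖ < 1) :
    ∃ v : ℕ → ℝ, Summable v ∧ ∀ᶠ x in 𝓝 x₀, ∀ n,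
      ‖(∏ k ∈ Finset.range n, numFactor q (E x) (a * b * c) (Y x) k)
        * dualHahn q a b c (Z x + 1 / Z x) n‖ ≤ v n := by
  have hz0 : 0 < ‖Z x₀‖ := (norm_nonneg _).trans_lt h1
  have hem : ‖E x₀‖ < min ‖Z x₀‖ (1 / ‖Z x₀‖) := lt_min h1 ((lt_div_iff₀ hz0).mpr h2)
  obtain ⟨ρ, hρ1, hρ2⟩ := exists_between hem
  obtain ⟨r, hr1, hr2⟩ := exists_between hρ2
  have hρ0 : 0 < ρ := (norm_nonneg _).trans_lt hρ1
  have hr0 : 0 < r := hρ0.trans hr1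
  obtain ⟨v, hv, h⟩ := exists_dualSeries_bound hq0 hq1 ha hb hc hρ0 hr1 (‖Y x₀‖ + 1)
  refine ⟨v, hv, ?_⟩
  have hz' : ‖Z x₀‖ < 1 / r := by
    rw [lt_div_iff₀ hr0, mul_comm, ← lt_div_iff₀ hz0]
    exact hr2.trans_le (min_le_right _ _)
  filter_upwards [hE.norm.eventually_le_const hρ1,
    hY.norm.eventually_le_const (lt_add_one _),
    hZ.norm.eventually_const_le (hr2.trans_le (min_le_left _ _)), hZ.norm.eventually_le_const hz']
    with x e1 e2 e3 e4 n
  refine h _ _ _ e1 e2 e3 ?_ n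
  rwa [le_div_iff₀ hr0, mul_comm] at e4

theorem differentiableOn_dualSeries_comp (hq0 : 0 < q) (hq1 : q < 1) (ha : ‖a‖ < 1)
    (hb : ‖b‖ < 1) (hc : ‖c‖ < 1) {U : Set ℂ} (hU : IsOpen U) {E Y Z : ℂ → ℂ}
    (hE : DifferentiableOn ℂ E U) (hY : DifferentiableOn ℂ Y U) (hZ : DifferentiableOn ℂ Z U)
    (h1 : ∀ x ∈ U, ‖E x‖ < ‖Z x‖) (h2 : ∀ x ∈ U, ‖E x‖ * ‖Z x‖ < 1) :
    DifferentiableOn ℂ (fun x => dualSeries q a b c (E x) (Y x) (Z x)) U := by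
  have hz : ∀ x ∈ U, Z x ≠ 0 := fun x hx => norm_pos_iff.mp ((norm_nonneg _).trans_lt (h1 x hx))
  refine differentiableOn_tsum_of_locally_summable hU (fun n => ?_) fun x hx =>
    exists_dualSeries_local_bound hq0 hq1 ha hb hc (hE.continuousOn.continuousAt (hU.mem_nhds hx))
      (hY.continuousOn.continuousAt (hU.mem_nhds hx))
      (hZ.continuousOn.continuousAt (hU.mem_nhds hx)) (h1 x hx) (h2 x hx)
  refine DifferentiableOn.fun_mul (DifferentiableOn.fun_finsetProd fun k _ => ?_)
    ((differentiable_dualHahn n).comp_differentiableOn (hZ.add ((differentiableOn_const _).div hZ hz)))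
  unfold numFactor
  exact ((differentiableOn_const _).mul (hE.sub (differentiableOn_const _))).sub
    ((differentiableOn_const _).mul hY)

theorem continuousAt_dualSeries_comp (hq0 : 0 < q) (hq1 : q < 1) (ha : ‖a‖ < 1)
    (hb : ‖b‖ < 1) (hc : ‖c‖ < 1) {X : Type*} [TopologicalSpace X] {x₀ : X} {E Y Z : X → ℂ}
    (hE : ContinuousAt E x₀) (hY : ContinuousAt Y x₀) (hZ : ContinuousAt Z x₀)
    (h1 : ‖E x₀‖ < ‖Z x₀‖) (h2 : ‖E x₀‖ * ‖Z x₀‖ < 1) :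
    ContinuousAt (fun x => dualSeries q a b c (E x) (Y x) (Z x)) x₀ := by
  obtain ⟨v, hv, h⟩ := exists_dualSeries_local_bound hq0 hq1 ha hb hc hE hY hZ h1 h2
  have hz : Z x₀ ≠ 0 := norm_pos_iff.mp ((norm_nonneg _).trans_lt h1)
  refine tendsto_tsum_of_dominated_convergence hv (fun n => ?_) h
  refine Tendsto.mul (tendsto_finsetProd _ fun k _ => ?_)
    (((differentiable_dualHahn n).continuous.tendsto _).comp
      (hZ.add (continuousAt_const.div hZ hz)))
  unfold numFactor
  exact (continuousAt_const.mul (hE.sub continuousAt_const)).sub (continuousAt_const.mul hY)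

theorem continuousOn_dualSeries_comp (hq0 : 0 < q) (hq1 : q < 1) (ha : ‖a‖ < 1)
    (hb : ‖b‖ < 1) (hc : ‖c‖ < 1) {X : Type*} [TopologicalSpace X] {S : Set X} {E Y Z : X → ℂ}
    (hE : ContinuousOn E S) (hY : ContinuousOn Y S) (hZ : ContinuousOn Z S)
    (h1 : ∀ x ∈ S, ‖E x‖ < ‖Z x‖) (h2 : ∀ x ∈ S, ‖E x‖ * ‖Z x‖ < 1) :
    ContinuousOn (fun x => dualSeries q a b c (E x) (Y x) (Z x)) S := by
  rw [continuousOn_iff_continuous_domRestrict] at *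
  exact continuous_iff_continuousAt.mpr fun x => continuousAt_dualSeries_comp hq0 hq1 ha hb hc
    hE.continuousAt hY.continuousAt hZ.continuousAt (h1 x x.2) (h2 x x.2)

theorem dualHahn_congr {a' b' c' : ℂ} (hG : dualHahnG q a b c = dualHahnG q a' b' c')
    (hB : dualHahnB q a b c = dualHahnB q a' b' c') (y : ℂ) (n : ℕ) :
    dualHahn q a b c y n = dualHahn q a' b' c' y n := by
  induction n using Nat.twoStepInduction with
  | zero => rfl
  | one => rw [dualHahn, dualHahn, hG, hB]
  | more n h1 h2 => rw [dualHahn, dualHahn, hG, hB, h1, h2]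

theorem dualHahn_swap_left (a b c y : ℂ) (n : ℕ) : dualHahn q a b c y n = dualHahn q b a c y n := by
  refine dualHahn_congr (funext fun n => ?_) (funext fun n => ?_) y n
  · simp only [dualHahnG]; ring
  · simp only [dualHahnB]; ring

theorem dualHahn_swap_outer (a b c y : ℂ) (n : ℕ) :
    dualHahn q a b c y n = dualHahn q c b a y n := by
  refine dualHahn_congr (funext fun n => ?_) (funext fun n => ?_) y n
  · simp only [dualHahnG]; ring
  · simp only [dualHahnB]; ring

theorem conj_dualHahn (y : ℂ) (n : ℕ) : starRingEnd ℂ (dualHahn q a b c y n)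
    = dualHahn q (starRingEnd ℂ a) (starRingEnd ℂ b) (starRingEnd ℂ c) (starRingEnd ℂ y) n := by
  induction n using Nat.twoStepInduction with
  | zero => simp [dualHahn]
  | one => simp [dualHahn, dualHahnG, dualHahnB]
  | more n h1 h2 => rw [dualHahn, dualHahn, ← h1, ← h2]; simp [dualHahnG, dualHahnB]

theorem ConjInvariant.conj_dualHahn (h : ConjInvariant a b c) (y : ℂ) (n : ℕ) :
    starRingEnd ℂ (dualHahn q a b c y n) = dualHahn q a b c (starRingEnd ℂ y) n := by
  rw [_root_.conj_dualHahn]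
  exact h.map_conj (fun a b c => dualHahn q a b c (starRingEnd ℂ y) n)
    (fun _ _ _ => dualHahn_swap_left ..) (fun _ _ _ => dualHahn_swap_outer ..)

theorem ConjInvariant.conj_dualSeries (h : ConjInvariant a b c) (e : ℝ) (Y z : ℂ) :
    starRingEnd ℂ (dualSeries q a b c e Y z)
      = dualSeries q a b c e (starRingEnd ℂ Y) (starRingEnd ℂ z) := by
  rw [dualSeries, Complex.conj_tsum]
  refine tsum_congr fun n => ?_
  rw [map_mul, h.conj_dualHahn, map_prod]
  congr 1
  · refine Finset.prod_congr rfl fun k _ => ?_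
    simp only [numFactor, map_sub, map_mul, map_pow, map_one, conj_ofReal]
    rw [← map_mul, ← map_mul, h.conj_mul]
  · simp

/-- At Y = 0 the factor with k = 0 vanishes, so only n = 0 survives. -/
theorem dualSeries_zero (q : ℝ) (a b c e z : ℂ) : dualSeries q a b c e 0 z = 1 := by
  rw [dualSeries, tsum_eq_single 0 fun n hn => ?_]
  · simp [dualHahn]
  · obtain ⟨n, rfl⟩ := Nat.exists_eq_succ_of_ne_zero hn
    rw [Finset.prod_range_succ', numFactor]
    simp

end DualSeriesRegularity

/-! ### The weight function and the kernel of the bilinear form -/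

/-- Half of the orthogonality weight. -/
noncomputable def weightHalf (q : ℝ) (a b c e α z : ℂ) : ℂ :=
  qPochInf q (z ^ 2) * qPochInf q (e * z) / (qPochInf q (a * z) * qPochInf q (b * z)
    * qPochInf q (c * z) * (qPochInf q (α * z) * qPochInf q (q * z / α)))

/-- The orthogonality weight on the unit circle. -/
noncomputable def weight (q : ℝ) (a b c e α z : ℂ) : ℂ :=
  weightHalf q a b c e α z * weightHalf q a b c e α z⁻¹

/-- Half of the kernel of the bilinear form. -/
noncomputable def kernelHalf (q : ℝ) (a b c e α z : ℂ) : ℂ :=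
  qPochInf q ((q * z) ^ 2) * qPochInf q (e * z) / (qPochInf q (a * (q * z))
    * qPochInf q (b * (q * z)) * qPochInf q (c * (q * z))
    * (qPochInf q (α * (q * z)) * qPochInf q (q * z / α)))

/-- The kernel of the bilinear form of the `q`-difference operator. -/
noncomputable def kernel (q : ℝ) (a b c e α z : ℂ) : ℂ :=
  q / α * (kernelHalf q a b c e α z * kernelHalf q a b c e α (q * z)⁻¹)

/-- The kernel multiplied by `1 - 1 / (α z)`. -/
noncomputable def kernelReg (q : ℝ) (a b c e α z : ℂ) : ℂ :=
  q / α * (kernelHalf q a b c e α z * (qPochInf q (z⁻¹ ^ 2) * qPochInf q (e * (q * z)⁻¹)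
    / (qPochInf q (a * z⁻¹) * qPochInf q (b * z⁻¹) * qPochInf q (c * z⁻¹)
      * (qPochInf q (α * z⁻¹) * qPochInf q (q * z⁻¹ / α)))))

section Weight

variable {q : ℝ} {a b c e α z : ℂ}

theorem weight_inv (q : ℝ) (a b c e α z : ℂ) : weight q a b c e α z⁻¹ = weight q a b c e α z := by
  rw [weight, weight, inv_inv, mul_comm]

theorem kernel_reflect (hq0 : 0 < q) (a b c e α : ℂ) (hz : z ≠ 0) :
    kernel q a b c e α (q * z)⁻¹ = kernel q a b c e α z := by
  have hq : (q : ℂ) ≠ 0 := by exact_mod_cast hq0.ne'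
  rw [kernel, kernel, show ((q : ℂ) * (q * z)⁻¹)⁻¹ = z by field_simp,
    mul_comm (kernelHalf q a b c e α z)]

theorem qPochInf_one (hq0 : 0 < q) (hq1 : q < 1) : qPochInf q 1 = 0 := by
  rw [qPochInf_succ hq0 hq1, sub_self, zero_mul]

theorem weight_eq_zero (hq0 : 0 < q) (hq1 : q < 1) (a b c e α : ℂ) (hz : z ^ 2 = 1) :
    weight q a b c e α z = 0 := by
  rw [weight, weightHalf, hz, qPochInf_one hq0 hq1]
  simp

theorem kernel_eq_zero (hq0 : 0 < q) (hq1 : q < 1) (a b c e α : ℂ) (hz : z ^ 2 = 1) :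
    kernel q a b c e α z = 0 := by
  have hq : (q : ℂ) ≠ 0 := by exact_mod_cast hq0.ne'
  rw [kernel, kernelHalf, kernelHalf, show ((q : ℂ) * (q * z)⁻¹) ^ 2 = (z ^ 2)⁻¹ by field_simp, hz,
    inv_one, qPochInf_one hq0 hq1]
  simp

theorem kernelReg_eq (hq0 : 0 < q) (hq1 : q < 1) (a b c e : ℂ) (hα : α ≠ 0) (hz : z ≠ 0)
    (hαz : α * z ≠ 1) :
    kernelReg q a b c e α z = kernel q a b c e α z * (1 - 1 / (α * z)) := by
  have hq : (q : ℂ) ≠ 0 := by exact_mod_cast hq0.ne'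
  have h1 : (1 : ℂ) - z⁻¹ / α ≠ 0 := by
    rw [sub_ne_zero, ne_comm, Ne, div_eq_iff hα, inv_eq_iff_eq_inv]
    intro h
    rw [h, one_mul, mul_inv_cancel₀ hα] at hαz
    exact hαz rfl
  have e1 : (q : ℂ) * (q * z)⁻¹ = z⁻¹ := by field_simp
  rw [kernelReg, kernel, kernelHalf.eq_def q a b c e α (q * z)⁻¹, e1,
    qPochInf_succ hq0 hq1 (z⁻¹ / α), show z⁻¹ / α * (q : ℂ) = q * z⁻¹ / α by ring,
    show 1 / (α * z) = z⁻¹ / α by field_simp]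
  generalize z⁻¹ / α = w at *
  generalize qPochInf q (q * z⁻¹ / α) = p
  rw [show ∀ A B p : ℂ, A * (B * ((1 - w) * p)) = (1 - w) * (A * (B * p)) by intros; ring]
  field_simp

/-- Detailed balance. In e - qz = -qz (1 - e/(qz)) the second factor is absorbed by the shift of
(e/z; q)_∞, and the factor -qz by the quasi-periodicity of the theta products in α. The resulting
kernel is invariant under z ↦ 1/(qz), as symmetry of the operator requires. -/
theorem weight_mul_awCoeff (hq0 : 0 < q) (hq1 : q < 1) (ha : ‖a‖ < 1) (hb : ‖b‖ < 1)
    (hc : ‖c‖ < 1) (e : ℂ) (hα : α ≠ 0) (hα1 : ‖α‖ < 1) (hz1 : ‖z‖ = 1) (hz2 : z ^ 2 ≠ 1) :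
    weight q a b c e α z * ((e - q * z) * awCoeff q a b c z) = kernel q a b c e α z := by
  have hq : (q : ℂ) ≠ 0 := by exact_mod_cast hq0.ne'
  have hz : z ≠ 0 := norm_pos_iff.mp (by rw [hz1]; exact one_pos)
  have hne : ∀ x : ℂ, ‖x‖ < 1 → 1 - x * z ≠ 0 := fun x hx h => by
    have := congrArg norm (sub_eq_zero.mp h)
    rw [norm_mul, hz1, mul_one, norm_one] at this
    exact hx.ne this.symm
  have n1 := hne a ha
  have n2 := hne b hb
  have n3 := hne c hc
  have n4 := hne α hα1
  have n5 : 1 - z ^ 2 ≠ 0 := sub_ne_zero.mpr hz2.symm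
  have n6 : 1 - z ^ 2 * q ≠ 0 := by
    have := hne (z * q) (by rw [norm_mul, hz1, norm_real, Real.norm_of_nonneg hq0.le]; linarith)
    rwa [show z * q * z = z ^ 2 * q by ring] at this
  have n7 : (1 : ℂ) - z⁻¹ / α ≠ 0 := by
    rw [sub_ne_zero, ne_comm, Ne, div_eq_iff hα, one_mul]
    intro h
    have := congrArg norm h
    rw [norm_inv, hz1, inv_one] at this
    exact hα1.ne this.symm
  rw [weight, kernel, weightHalf, weightHalf, kernelHalf, kernelHalf, awCoeff,
    show (q : ℂ) * (q * z)⁻¹ = z⁻¹ by field_simp,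
    qPochInf_succ hq0 hq1 (z ^ 2), qPochInf_succ hq0 hq1 (z ^ 2 * q), qPochInf_succ hq0 hq1 (a * z),
    qPochInf_succ hq0 hq1 (b * z), qPochInf_succ hq0 hq1 (c * z), qPochInf_succ hq0 hq1 (α * z),
    qPochInf_succ hq0 hq1 (e * (q * z)⁻¹), qPochInf_succ hq0 hq1 (z⁻¹ / α),
    show z⁻¹ / α * (q : ℂ) = q * z⁻¹ / α by ring,
    show e * (q * z)⁻¹ * (q : ℂ) = e * z⁻¹ by field_simp,
    show a * z * (q : ℂ) = a * (q * z) by ring, show b * z * (q : ℂ) = b * (q * z) by ring,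
    show c * z * (q : ℂ) = c * (q * z) by ring, show α * z * (q : ℂ) = α * (q * z) by ring,
    show z ^ 2 * (q : ℂ) * q = (q * z) ^ 2 by ring,
    show e - (q : ℂ) * z = -(q * z) * (1 - e * (q * z)⁻¹) by field_simp; ring,
    show (1 : ℂ) - q * z ^ 2 = 1 - z ^ 2 * q by ring]
  have hw : -(z : ℂ) * (1 - z⁻¹ / α) = 1 / α * (1 - α * z) := by field_simp; ring
  generalize 1 - z⁻¹ / α = w at *
  generalize 1 - e * (q * z)⁻¹ = w2 at *
  generalize 1 - a * z = w3 at *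
  generalize 1 - b * z = w4 at *
  generalize 1 - c * z = w5 at *
  generalize 1 - α * z = w6 at *
  generalize 1 - z ^ 2 = w7 at *
  generalize 1 - z ^ 2 * q = w8 at *
  have hw' : w6 = -α * z * w := by field_simp at hw; linear_combination -hw
  subst hw'
  generalize qPochInf q (a * (q * z)) = p1
  generalize qPochInf q (b * (q * z)) = p2
  generalize qPochInf q (c * (q * z)) = p3
  generalize qPochInf q (α * (q * z)) = p4
  generalize qPochInf q ((q * z) ^ 2) = p5
  generalize qPochInf q (e * z) = p6
  generalize qPochInf q (q * z / α) = p7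
  generalize qPochInf q (q * z⁻¹ / α) = p8
  generalize qPochInf q (α * z⁻¹) = p9
  generalize qPochInf q (a * z⁻¹) * qPochInf q (b * z⁻¹) * qPochInf q (c * z⁻¹) = p10
  generalize qPochInf q (e * z⁻¹) = p11
  generalize qPochInf q (z⁻¹ ^ 2) = p12
  have e1 : w7 * (w8 * p5) * p6 / (w3 * p1 * (w4 * p2) * (w5 * p3) * (-α * z * w * p4 * p7))
      * (-(q * z * w2) * (w3 * w4 * w5 / (w7 * w8)))
      = q / (α * w) * w2 * (p5 * p6 / (p1 * p2 * p3 * (p4 * p7))) := by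
    field_simp
  have e2 : p12 * (w2 * p11) / (p10 * (p9 * (w * p8)))
      = w2 / w * (p12 * p11 / (p10 * (p9 * p8))) := by
    field_simp
  rw [e2, mul_right_comm]
  linear_combination (p12 * p11 / (p10 * (p9 * p8))) * e1

end Weight

/-! ### The bilinear form of the `q`-difference operator -/

section BilinearForm
open Real (circleAverage)

theorem circleAverage_add_reflect {f : ℂ → ℂ} {R : ℝ} (hR : 0 < R)
    (hf : ContinuousOn f (Metric.sphere 0 |R|)) :
    circleAverage (fun z => f z + f ((R : ℂ) ^ 2 / z)) 0 R = 2 * circleAverage f 0 R := by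
  have hm : Set.MapsTo (fun z : ℂ => (R : ℂ) ^ 2 / z) (Metric.sphere 0 |R|) (Metric.sphere 0 |R|) := by
    intro z hz
    rw [mem_sphere_zero_iff_norm, abs_of_pos hR] at hz ⊢
    rw [norm_div, norm_pow, hz, norm_real, Real.norm_of_nonneg hR.le, sq, mul_div_cancel_right₀ _ hR.ne']
  have hc : ContinuousOn (fun z : ℂ => (R : ℂ) ^ 2 / z) (Metric.sphere 0 |R|) := by
    refine continuousOn_const.div continuousOn_id fun z hz => ?_
    rw [mem_sphere_zero_iff_norm, abs_of_pos hR] at hz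
    exact norm_pos_iff.mp (by rw [hz]; exact hR)
  have hf' : ContinuousOn (fun z => f ((R : ℂ) ^ 2 / z)) (Metric.sphere 0 |R|) := hf.comp hc hm
  rw [Real.circleAverage_fun_add hf.circleIntegrable' hf'.circleIntegrable',
    circleAverage_reflect f hR.ne', two_mul]

variable {q : ℝ} {a b c e α : ℂ}

theorem differentiableAt_qPochInf_comp (hq0 : 0 < q) (hq1 : q < 1) {f : ℂ → ℂ} {z : ℂ}
    (hf : DifferentiableAt ℂ f z) : DifferentiableAt ℂ (fun z => qPochInf q (f z)) z :=
  ((differentiable_qPochInf hq0 hq1) (f z)).comp z hf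

theorem qPochInf_mul_ne_zero (hq0 : 0 < q) (hq1 : q < 1) {x z : ℂ} (hx : ‖x‖ < 1)
    (hz : ‖z‖ ≤ 1) : qPochInf q (x * z) ≠ 0 := by
  refine qPochInf_ne_zero_of_norm_lt_one hq0 hq1 ?_
  rw [norm_mul]
  nlinarith [norm_nonneg x, norm_nonneg z]

theorem qPochInf_mul_div_ne_zero (hq0 : 0 < q) (hq1 : q < 1) {z : ℂ} (hα : q * ‖z‖ < ‖α‖) :
    qPochInf q (q * z / α) ≠ 0 := by
  refine qPochInf_ne_zero_of_norm_lt_one hq0 hq1 ?_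
  have : 0 < ‖α‖ := (mul_nonneg hq0.le (norm_nonneg z)).trans_lt hα
  rw [norm_div, norm_mul, norm_real, Real.norm_of_nonneg hq0.le]
  exact (div_lt_one this).mpr hα

theorem differentiableAt_kernelHalf (hq0 : 0 < q) (hq1 : q < 1) (ha : ‖a‖ < 1) (hb : ‖b‖ < 1)
    (hc : ‖c‖ < 1) (hα1 : ‖α‖ < 1) {z : ℂ} (hz : q * ‖z‖ < ‖α‖) :
    DifferentiableAt ℂ (kernelHalf q a b c e α) z := by
  have hqz : ‖(q : ℂ) * z‖ ≤ 1 := by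
    rw [norm_mul, norm_real, Real.norm_of_nonneg hq0.le]; linarith
  have hd : ∀ {f : ℂ → ℂ}, DifferentiableAt ℂ f z → DifferentiableAt ℂ (fun z => qPochInf q (f z)) z :=
    fun hf => differentiableAt_qPochInf_comp hq0 hq1 hf
  simp only [funext (kernelHalf.eq_def q a b c e α)]
  refine DifferentiableAt.fun_div (.fun_mul (hd (by fun_prop)) (hd (by fun_prop)))
    (.fun_mul (.fun_mul (.fun_mul (hd (by fun_prop)) (hd (by fun_prop))) (hd (by fun_prop)))
      (.fun_mul (hd (by fun_prop)) (hd (by fun_prop)))) ?_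
  have := qPochInf_mul_div_ne_zero hq0 hq1 hz
  have hn := fun x (hx : ‖x‖ < 1) => qPochInf_mul_ne_zero hq0 hq1 hx hqz
  simp [hn a ha, hn b hb, hn c hc, hn α hα1, this]

theorem differentiableAt_kernelReg (hq0 : 0 < q) (hq1 : q < 1) (ha : ‖a‖ < 1) (hb : ‖b‖ < 1)
    (hc : ‖c‖ < 1) (hα1 : ‖α‖ < 1) {z : ℂ} (hz1 : 1 ≤ ‖z‖) (hz : q * ‖z‖ < ‖α‖) :
    DifferentiableAt ℂ (kernelReg q a b c e α) z := by
  have hq : (q : ℂ) ≠ 0 := by exact_mod_cast hq0.ne'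
  have hz0 : z ≠ 0 := norm_pos_iff.mp (one_pos.trans_le hz1)
  have hzi : ‖z⁻¹‖ ≤ 1 := by rw [norm_inv]; exact inv_le_one_of_one_le₀ hz1
  have hd : ∀ {f : ℂ → ℂ}, DifferentiableAt ℂ f z → DifferentiableAt ℂ (fun z => qPochInf q (f z)) z :=
    fun hf => differentiableAt_qPochInf_comp hq0 hq1 hf
  have hi : DifferentiableAt ℂ (fun z : ℂ => z⁻¹) z := differentiableAt_inv hz0
  have hi2 : DifferentiableAt ℂ (fun z : ℂ => ((q : ℂ) * z)⁻¹) z :=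
    (differentiableAt_id.const_mul (q : ℂ)).inv (mul_ne_zero hq hz0)
  unfold kernelReg
  refine ((differentiableAt_kernelHalf hq0 hq1 ha hb hc hα1 hz).fun_mul (DifferentiableAt.fun_div
    (.fun_mul (hd (by fun_prop)) (hd (by fun_prop)))
    (.fun_mul (.fun_mul (.fun_mul (hd (by fun_prop)) (hd (by fun_prop))) (hd (by fun_prop)))
      (.fun_mul (hd (by fun_prop)) (hd (by fun_prop)))) ?_)).const_mul _
  have := qPochInf_mul_div_ne_zero (α := α) (z := z⁻¹) hq0 hq1 (by nlinarith)
  have hn := fun x (hx : ‖x‖ < 1) => qPochInf_mul_ne_zero hq0 hq1 hx hzi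
  simp [hn a ha, hn b hb, hn c hc, hn α hα1, this]

theorem continuousOn_weight (hq0 : 0 < q) (hq1 : q < 1) (ha : ‖a‖ < 1) (hb : ‖b‖ < 1)
    (hc : ‖c‖ < 1) (hα1 : ‖α‖ < 1) (hqα : q < ‖α‖) :
    ContinuousOn (weight q a b c e α) (Metric.sphere 0 1) := by
  have hP := continuous_qPochInf hq0 hq1
  have h1 : ContinuousOn (weightHalf q a b c e α) (Metric.sphere 0 1) := by
    unfold weightHalf
    refine ContinuousOn.div (by fun_prop) (by fun_prop) fun z hz => ?_
    rw [mem_sphere_zero_iff_norm] at hz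
    have := qPochInf_mul_div_ne_zero (α := α) (z := z) hq0 hq1 (by rwa [hz, mul_one])
    have hn := fun x (hx : ‖x‖ < 1) => qPochInf_mul_ne_zero hq0 hq1 hx hz.le
    simp [hn a ha, hn b hb, hn c hc, hn α hα1, this]
  refine h1.mul (h1.comp (continuousOn_inv₀.mono fun z hz => ?_) fun z hz => ?_)
  · rw [mem_sphere_zero_iff_norm] at hz
    exact norm_pos_iff.mp (by rw [hz]; exact one_pos)
  · rw [mem_sphere_zero_iff_norm] at hz ⊢
    rw [norm_inv, hz, inv_one]

/-- Summation by parts. On |z| = 1 the equation turns the left side into twice the mean of K(z) h(z)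
(u(qz) - u(z)), h = w - w(α). The circle is moved to |z| = q^{-1/2}, the fixed circle of z ↦ 1/(qz),
and symmetrization there gives a form symmetric in u and w. -/
theorem weighted_bilinear_form (hq0 : 0 < q) (hq1 : q < 1) (ha : ‖a‖ < 1) (hb : ‖b‖ < 1)
    (hc : ‖c‖ < 1) (hα1 : ‖α‖ < 1) (hqα : √q < ‖α‖) {u w : ℂ → ℂ}
    (hu : ∀ z : ℂ, q ≤ ‖z‖ → q * ‖z‖ ≤ 1 → DifferentiableAt ℂ u z)
    (hw : ∀ z : ℂ, q ≤ ‖z‖ → q * ‖z‖ ≤ 1 → DifferentiableAt ℂ w z)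
    (hui : ∀ z, u z⁻¹ = u z) (hwi : ∀ z, w z⁻¹ = w z) {Y : ℂ}
    (hY : ∀ z : ℂ, ‖z‖ = 1 → z ^ 2 ≠ 1 → (e - q * z) * awCoeff q a b c z * (u (q * z) - u z)
      + (e - q * z⁻¹) * awCoeff q a b c z⁻¹ * (u (q * z⁻¹) - u z) = Y * u z) :
    Y * circleAverage (fun z => weight q a b c e α z * u z * (w z - w α)) 0 1
      = -circleAverage (fun z => kernel q a b c e α z * (w z - w (q * z)) * (u z - u (q * z)))
        0 (√q)⁻¹ := by
  have hs0 : 0 < √q := Real.sqrt_pos.mpr hq0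
  have hss : √q * √q = q := Real.mul_self_sqrt hq0.le
  have hs1 : √q < 1 := hqα.trans hα1
  have hq : (q : ℂ) ≠ 0 := by exact_mod_cast hq0.ne'
  have hα0 : 0 < ‖α‖ := hs0.trans hqα
  have hα : α ≠ 0 := norm_pos_iff.mp hα0
  set R : ℝ := (√q)⁻¹ with hR
  have hR1 : 1 ≤ R := (one_le_inv₀ hs0).mpr hs1.le
  have hR0 : 0 < R := one_pos.trans_le hR1
  have hqR : q * R = √q := by rw [hR, ← div_eq_mul_inv, div_eq_iff hs0.ne', hss]
  set h : ℂ → ℂ := fun z => w z - w α with hh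
  set g : ℂ → ℂ := fun z => kernel q a b c e α z * h z * (u (q * z) - u z) with hg
  -- On the way outwards the kernel has just the simple pole 1/α, and h vanishes there since w(1/α)
  -- = w(α). The divided slope of h cancels it, giving a function regular on the closed annulus.
  set g' : ℂ → ℂ := fun z => kernelReg q a b c e α z * z * dslope h α⁻¹ z * (u (q * z) - u z) with hg'
  have hhα : h α⁻¹ = 0 := by simp only [hh]; rw [hwi, sub_self]
  have hhd : ∀ z : ℂ, q ≤ ‖z‖ → q * ‖z‖ ≤ 1 → DifferentiableAt ℂ h z := fun z h1 h2 =>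
    (hw z h1 h2).sub_const _
  have hαi : ‖α⁻¹‖ < R := by
    rw [norm_inv, hR]; exact inv_strictAnti₀ hs0 hqα
  have hαi1 : 1 < ‖α⁻¹‖ := by rw [norm_inv]; exact (one_lt_inv₀ hα0).mpr hα1
  have heq : ∀ z : ℂ, z ≠ 0 → α * z ≠ 1 → g z = g' z := by
    intro z hz hαz
    simp only [hg, hg']
    have hne : z - α⁻¹ ≠ 0 := by
      rw [sub_ne_zero]
      rintro rfl
      exact hαz (mul_inv_cancel₀ hα)
    have h1 : (1 : ℂ) - 1 / (α * z) = (z - α⁻¹) / z := by field_simp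
    rw [kernelReg_eq hq0 hq1 a b c e hα hz hαz, dslope_of_ne _ (sub_ne_zero.mp hne), slope_def_field,
      hhα, sub_zero, h1]
    generalize z - α⁻¹ = w at *
    field_simp
  have hg'd : ∀ z : ℂ, 1 ≤ ‖z‖ → ‖z‖ ≤ R → DifferentiableAt ℂ g' z := by
    intro z h1 h2
    have hV : IsOpen {z : ℂ | q < ‖z‖ ∧ q * ‖z‖ < 1} :=
      (isOpen_lt continuous_const continuous_norm).inter
        (isOpen_lt (continuous_const.mul continuous_norm) continuous_const)
    have hmem : ∀ z : ℂ, 1 ≤ ‖z‖ → ‖z‖ ≤ R → z ∈ {z : ℂ | q < ‖z‖ ∧ q * ‖z‖ < 1} := fun z h1 h2 =>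
      ⟨hq1.trans_le h1, by nlinarith⟩
    have hds : DifferentiableOn ℂ (dslope h α⁻¹) {z : ℂ | q < ‖z‖ ∧ q * ‖z‖ < 1} :=
      (Complex.differentiableOn_dslope (hV.mem_nhds (hmem _ hαi1.le hαi.le))).mpr fun z hz =>
        (hhd z hz.1.le hz.2.le).differentiableWithinAt
    have hn : ‖(q : ℂ) * z‖ = q * ‖z‖ := by rw [norm_mul, norm_real, Real.norm_of_nonneg hq0.le]
    have hz' := hmem z h1 h2
    refine DifferentiableAt.fun_mul (.fun_mul (.fun_mul (differentiableAt_kernelReg hq0 hq1 ha hb hc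
      hα1 h1 ?_) differentiableAt_id) (hds.differentiableAt (hV.mem_nhds hz')))
      (.fun_sub ?_ (hu z hz'.1.le hz'.2.le))
    · nlinarith
    · refine DifferentiableAt.comp (g := u) (f := fun z : ℂ => (q : ℂ) * z) z (hu _ ?_ ?_)
        (differentiableAt_id.const_mul _)
      · rw [hn]; nlinarith
      · rw [hn]; nlinarith [hz'.2]
  -- g and g' may differ at 1/α, which lies strictly between the two circles, so their averages
  -- agree.
  have hsph : ∀ r : ℝ, 1 ≤ r → r ≤ R → r ≠ ‖α⁻¹‖ → Set.EqOn g g' (Metric.sphere 0 |r|) := by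
    intro r h1 _ h3 z hz
    rw [mem_sphere_zero_iff_norm, abs_of_nonneg (zero_le_one.trans h1)] at hz
    refine heq z (norm_pos_iff.mp (by rw [hz]; linarith)) fun h => ?_
    rw [← eq_inv_of_mul_eq_one_right h, hz] at h3
    exact h3 rfl
  have hcont : ∀ r : ℝ, 1 ≤ r → r ≤ R → r ≠ ‖α⁻¹‖ → ContinuousOn g (Metric.sphere 0 |r|) := by
    intro r h1 h2 h3
    refine ContinuousOn.congr (fun z hz => ?_) (hsph r h1 h2 h3)
    rw [mem_sphere_zero_iff_norm, abs_of_nonneg (zero_le_one.trans h1)] at hz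
    exact (hg'd z (by rw [hz]; exact h1) (by rw [hz]; exact h2)).continuousAt.continuousWithinAt
  have hshift : circleAverage g 0 R = circleAverage g 0 1 := by
    rw [Real.circleAverage_congr_sphere (hsph R hR1 le_rfl hαi.ne'),
      Real.circleAverage_congr_sphere (hsph 1 le_rfl hR1 hαi1.ne),
      circleAverage_eq_of_annulus one_pos hR1 hg'd]
  have hleft : Y * circleAverage (fun z => weight q a b c e α z * u z * (w z - w α)) 0 1
      = 2 * circleAverage g 0 1 := by
    rw [← circleAverage_add_reflect one_pos (hcont 1 le_rfl hR1 hαi1.ne), ← smul_eq_mul,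
      ← Real.circleAverage_fun_smul]
    refine Real.circleAverage_congr_sphere fun z hz => ?_
    rw [mem_sphere_zero_iff_norm, abs_one] at hz
    have hzi : ‖z⁻¹‖ = 1 := by rw [norm_inv, hz, inv_one]
    have e1 : ((1 : ℝ) : ℂ) ^ 2 / z = z⁻¹ := by simp
    simp only [smul_eq_mul, hg, hh, e1, hwi, hui]
    by_cases hz2 : z ^ 2 = 1
    · rw [weight_eq_zero hq0 hq1 a b c e α hz2, kernel_eq_zero hq0 hq1 a b c e α hz2,
        kernel_eq_zero hq0 hq1 a b c e α (by rw [inv_pow, hz2, inv_one])]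
      ring
    · rw [← weight_mul_awCoeff hq0 hq1 ha hb hc e hα hα1 hz hz2,
        ← weight_mul_awCoeff hq0 hq1 ha hb hc e hα hα1 hzi (by rwa [inv_pow, Ne, inv_eq_one]),
        weight_inv]
      linear_combination -(weight q a b c e α z * (w z - w α)) * hY z hz hz2
  rw [hleft, ← hshift, ← circleAverage_add_reflect hR0 (hcont R hR1 le_rfl hαi.ne'), ← neg_one_mul,
    ← smul_eq_mul, ← Real.circleAverage_fun_smul]
  refine Real.circleAverage_congr_sphere fun z hz => ?_
  rw [mem_sphere_zero_iff_norm, abs_of_pos hR0] at hz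
  have hz0 : z ≠ 0 := norm_pos_iff.mp (by rw [hz]; exact hR0)
  have e1 : (R : ℂ) ^ 2 / z = (q * z)⁻¹ := by
    have : (R : ℂ) ^ 2 = (q : ℂ)⁻¹ := by
      rw [← ofReal_pow, ← ofReal_inv, hR, inv_pow, Real.sq_sqrt hq0.le]
    rw [this, div_eq_mul_inv, ← mul_inv]
  simp only [smul_eq_mul, hg, hh, e1, hwi, hui, kernel_reflect hq0 a b c e α hz0,
    show (q : ℂ) * (q * z)⁻¹ = z⁻¹ by field_simp]
  ring

end BilinearForm

/-! ### The symmetry relation for the dual series -/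

section Symmetry
open Real (circleAverage)

variable {q : ℝ} {a b c e α : ℂ}

theorem weight_eq_mul (q : ℝ) (a b c e α z : ℂ) : weight q a b c e α z
    = weight q a b c 0 α z * (qPochInf q (e * z) * qPochInf q (e * z⁻¹)) := by
  simp only [weight, weightHalf, zero_mul, qPochInf_zero]
  ring

theorem differentiableAt_dualSeries (hq0 : 0 < q) (hq1 : q < 1) (ha : ‖a‖ < 1) (hb : ‖b‖ < 1)
    (hc : ‖c‖ < 1) (Y : ℂ) {z : ℂ} (h1 : ‖e‖ < ‖z‖) (h2 : ‖e‖ * ‖z‖ < 1) :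
    DifferentiableAt ℂ (dualSeries q a b c e Y) z := by
  have hV : IsOpen {z : ℂ | ‖e‖ < ‖z‖ ∧ ‖e‖ * ‖z‖ < 1} :=
    (isOpen_lt continuous_const continuous_norm).inter
      (isOpen_lt (continuous_const.mul continuous_norm) continuous_const)
  exact (differentiableOn_dualSeries_comp hq0 hq1 ha hb hc hV (E := fun _ => e) (Y := fun _ => Y)
    (Z := fun z => z) (by fun_prop) (by fun_prop) (by fun_prop) (fun z hz => hz.1)
    fun z hz => hz.2).differentiableAt (hV.mem_nhds ⟨h1, h2⟩)

theorem dualSeries_bilinear_form (hq0 : 0 < q) (hq1 : q < 1) (ha : ‖a‖ < 1) (hb : ‖b‖ < 1)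
    (hc : ‖c‖ < 1) (hα1 : ‖α‖ < 1) (hqα : √q < ‖α‖) (he : ‖e‖ < q) (Y Y' : ℂ) :
    Y * circleAverage (fun z => weight q a b c e α z * dualSeries q a b c e Y z
        * (dualSeries q a b c e Y' z - dualSeries q a b c e Y' α)) 0 1
      = -circleAverage (fun z => kernel q a b c e α z
        * (dualSeries q a b c e Y' z - dualSeries q a b c e Y' (q * z))
        * (dualSeries q a b c e Y z - dualSeries q a b c e Y (q * z))) 0 (√q)⁻¹ := by
  have hd : ∀ Y z : ℂ, q ≤ ‖z‖ → q * ‖z‖ ≤ 1 → DifferentiableAt ℂ (dualSeries q a b c e Y) z :=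
    fun Y z h1 h2 => differentiableAt_dualSeries hq0 hq1 ha hb hc Y (he.trans_le h1)
      (by nlinarith [norm_nonneg z])
  exact weighted_bilinear_form hq0 hq1 ha hb hc hα1 hqα (hd Y) (hd Y') (dualSeries_inv q a b c e Y)
    (dualSeries_inv q a b c e Y') fun z hz hz2 =>
      dualSeries_qDifference hq0 hq1 ha hb hc he hz hz2 Y

theorem differentiableOn_weighted_average (hq0 : 0 < q) (hq1 : q < 1) (ha : ‖a‖ < 1)
    (hb : ‖b‖ < 1) (hc : ‖c‖ < 1) (hα1 : ‖α‖ < 1) (hqα : q < ‖α‖) (Y Y' : ℂ) :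
    DifferentiableOn ℂ (fun e => circleAverage (fun z => weight q a b c e α z
      * dualSeries q a b c e Y z * (dualSeries q a b c e Y' z - dualSeries q a b c e Y' α)) 0 1)
      (Metric.ball 0 ‖α‖) := by
  have hα0 : 0 < ‖α‖ := hq0.trans hqα
  have hP := continuous_qPochInf hq0 hq1
  have hV : IsOpen (Metric.ball (0 : ℂ) ‖α‖) := Metric.isOpen_ball
  have hzp : ∀ p ∈ Metric.ball (0 : ℂ) ‖α‖ ×ˢ Metric.sphere (0 : ℂ) 1, p.2 ≠ 0 := fun p hp => by
    have := mem_sphere_zero_iff_norm.mp hp.2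
    exact norm_pos_iff.mp (by rw [this]; exact one_pos)
  have hpb : ∀ p ∈ Metric.ball (0 : ℂ) ‖α‖ ×ˢ Metric.sphere (0 : ℂ) 1, ‖p.1‖ < 1 ∧ ‖p.2‖ = 1 :=
    fun p hp => ⟨(mem_ball_zero_iff.mp hp.1).trans hα1, mem_sphere_zero_iff_norm.mp hp.2⟩
  refine differentiableOn_circleAverage hV ?_ fun z hz => ?_
  · rw [abs_one]
    have hu : ∀ Y, ContinuousOn (fun p : ℂ × ℂ => dualSeries q a b c p.1 Y p.2)
        (Metric.ball 0 ‖α‖ ×ˢ Metric.sphere 0 1) := fun Y =>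
      continuousOn_dualSeries_comp hq0 hq1 ha hb hc continuousOn_fst continuousOn_const
        continuousOn_snd (fun p hp => by have := hpb p hp; linarith)
        fun p hp => by have := hpb p hp; nlinarith
    have hu' : ContinuousOn (fun p : ℂ × ℂ => dualSeries q a b c p.1 Y' α)
        (Metric.ball 0 ‖α‖ ×ˢ Metric.sphere 0 1) :=
      continuousOn_dualSeries_comp hq0 hq1 ha hb hc continuousOn_fst continuousOn_const
        continuousOn_const (fun p hp => mem_ball_zero_iff.mp hp.1)
        fun p hp => by have := hpb p hp; nlinarith [norm_nonneg p.1]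
    have hw : ContinuousOn (fun p : ℂ × ℂ => weight q a b c p.1 α p.2)
        (Metric.ball 0 ‖α‖ ×ˢ Metric.sphere 0 1) := by
      refine ContinuousOn.congr (ContinuousOn.mul ((continuousOn_weight (e := 0) hq0 hq1 ha hb hc hα1
        hqα).comp continuousOn_snd fun p hp => hp.2) (ContinuousOn.mul (hP.comp_continuousOn
          (continuousOn_fst.mul continuousOn_snd)) (hP.comp_continuousOn
          (continuousOn_fst.mul (continuousOn_snd.inv₀ hzp))))) fun p _ =>
            weight_eq_mul q a b c p.1 α p.2
    exact (hw.mul (hu Y)).mul ((hu Y').sub hu')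
  · rw [abs_one, mem_sphere_zero_iff_norm] at hz
    have hd : ∀ Y, ∀ z : ℂ, ‖α‖ ≤ ‖z‖ → ‖z‖ ≤ 1 →
        DifferentiableOn ℂ (fun e => dualSeries q a b c e Y z) (Metric.ball 0 ‖α‖) :=
      fun Y z h1 h2 => differentiableOn_dualSeries_comp hq0 hq1 ha hb hc hV (E := fun e => e) differentiableOn_id
        (differentiableOn_const _) (differentiableOn_const _)
        (fun e he => (mem_ball_zero_iff.mp he).trans_le h1)
        fun e he => by
          have : ‖e‖ < ‖α‖ := mem_ball_zero_iff.mp he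
          nlinarith [norm_nonneg e]
    have hdP : ∀ x : ℂ, DifferentiableOn ℂ (fun e => qPochInf q (e * x)) (Metric.ball 0 ‖α‖) :=
      fun x => ((differentiable_qPochInf hq0 hq1).comp (differentiable_id.mul_const x)).differentiableOn
    refine DifferentiableOn.fun_mul (.fun_mul ?_ (hd Y z (by rw [hz]; exact hα1.le) hz.le))
      ((hd Y' z (by rw [hz]; exact hα1.le) hz.le).fun_sub (hd Y' α le_rfl hα1.le))
    exact (((hdP z).fun_mul (hdP z⁻¹)).const_mul _).congr fun e _ => weight_eq_mul q a b c e α z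

/-- For |e| < q both sides equal the same form, symmetric in Y and Y'. Both are holomorphic for |e|
< |α|, where the series at α still converges, so the identity theorem covers the whole disc. -/
theorem dualSeries_symmetry (hq0 : 0 < q) (hq1 : q < 1) (ha : ‖a‖ < 1) (hb : ‖b‖ < 1)
    (hc : ‖c‖ < 1) (hα1 : ‖α‖ < 1) (hqα : √q < ‖α‖) (he : ‖e‖ < ‖α‖) (Y Y' : ℂ) :
    Y * circleAverage (fun z => weight q a b c e α z * dualSeries q a b c e Y z
        * (dualSeries q a b c e Y' z - dualSeries q a b c e Y' α)) 0 1
      = Y' * circleAverage (fun z => weight q a b c e α z * dualSeries q a b c e Y' z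
        * (dualSeries q a b c e Y z - dualSeries q a b c e Y α)) 0 1 := by
  have hq : q < ‖α‖ := by
    have := Real.sqrt_nonneg q
    have := Real.mul_self_sqrt hq0.le
    nlinarith
  have hd := differentiableOn_weighted_average hq0 hq1 ha hb hc hα1 hq
  have h1 := ((hd Y Y').const_mul Y).analyticOnNhd Metric.isOpen_ball
  have h2 := ((hd Y' Y).const_mul Y').analyticOnNhd Metric.isOpen_ball
  refine h1.eqOn_of_preconnected_of_eventuallyEq h2 (convex_ball 0 ‖α‖).isPreconnected
    (Metric.mem_ball_self (hq0.trans hq)) ?_ (mem_ball_zero_iff.mpr he)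
  filter_upwards [Metric.ball_mem_nhds (0 : ℂ) hq0] with e he
  rw [mem_ball_zero_iff] at he
  rw [dualSeries_bilinear_form hq0 hq1 ha hb hc hα1 hqα he Y Y',
    dualSeries_bilinear_form hq0 hq1 ha hb hc hα1 hqα he Y' Y]
  congr 2
  funext z
  ring

end Symmetry

/-! ### Orthogonality of the continuous dual `q`-Hahn polynomials to the constants -/

/-- Half of the weight of the continuous dual `q`-Hahn polynomials. -/
noncomputable def orthoHalf (q : ℝ) (a b c z : ℂ) : ℂ :=
  qPochInf q (z ^ 2) / (qPochInf q (a * z) * qPochInf q (b * z) * qPochInf q (c * z))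

section Orthogonality
open Real (circleAverage)

variable {q : ℝ} {a b c : ℂ}

theorem differentiableAt_orthoHalf (hq0 : 0 < q) (hq1 : q < 1) (ha : ‖a‖ < 1) (hb : ‖b‖ < 1)
    (hc : ‖c‖ < 1) {z : ℂ} (hz : ‖z‖ ≤ 1) : DifferentiableAt ℂ (orthoHalf q a b c) z := by
  have hd : ∀ {f : ℂ → ℂ}, DifferentiableAt ℂ f z → DifferentiableAt ℂ (fun z => qPochInf q (f z)) z :=
    fun hf => differentiableAt_qPochInf_comp hq0 hq1 hf
  simp only [funext (orthoHalf.eq_def q a b c)]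
  refine DifferentiableAt.fun_div (hd (by fun_prop))
    (.fun_mul (.fun_mul (hd (by fun_prop)) (hd (by fun_prop))) (hd (by fun_prop))) ?_
  have hn := fun x (hx : ‖x‖ < 1) => qPochInf_mul_ne_zero hq0 hq1 hx hz
  simp [hn a ha, hn b hb, hn c hc]

theorem orthoHalf_mul_awCoeff (hq0 : 0 < q) (hq1 : q < 1) (ha : ‖a‖ < 1) (hb : ‖b‖ < 1)
    (hc : ‖c‖ < 1) {z : ℂ} (hz1 : ‖z‖ = 1) (hz2 : z ^ 2 ≠ 1) :
    orthoHalf q a b c z * awCoeff q a b c z = orthoHalf q a b c (q * z) := by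
  have hne : ∀ x : ℂ, ‖x‖ < 1 → 1 - x * z ≠ 0 := fun x hx h => by
    have := congrArg norm (sub_eq_zero.mp h)
    rw [norm_mul, hz1, mul_one, norm_one] at this
    exact hx.ne this.symm
  have n1 := hne a ha
  have n2 := hne b hb
  have n3 := hne c hc
  have n5 : 1 - z ^ 2 ≠ 0 := sub_ne_zero.mpr hz2.symm
  have n6 : 1 - z ^ 2 * q ≠ 0 := by
    have := hne (z * q) (by rw [norm_mul, hz1, norm_real, Real.norm_of_nonneg hq0.le]; linarith)
    rwa [show z * q * z = z ^ 2 * q by ring] at this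
  rw [orthoHalf, orthoHalf, awCoeff,
    qPochInf_succ hq0 hq1 (z ^ 2), qPochInf_succ hq0 hq1 (z ^ 2 * q), qPochInf_succ hq0 hq1 (a * z),
    qPochInf_succ hq0 hq1 (b * z), qPochInf_succ hq0 hq1 (c * z),
    show a * z * (q : ℂ) = a * (q * z) by ring, show b * z * (q : ℂ) = b * (q * z) by ring,
    show c * z * (q : ℂ) = c * (q * z) by ring,
    show z ^ 2 * (q : ℂ) * q = (q * z) ^ 2 by ring,
    show (1 : ℂ) - q * z ^ 2 = 1 - z ^ 2 * q by ring]
  generalize 1 - a * z = w3 at *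
  generalize 1 - b * z = w4 at *
  generalize 1 - c * z = w5 at *
  generalize 1 - z ^ 2 = w7 at *
  generalize 1 - z ^ 2 * q = w8 at *
  generalize qPochInf q (a * (q * z)) = p1
  generalize qPochInf q (b * (q * z)) = p2
  generalize qPochInf q (c * (q * z)) = p3
  generalize qPochInf q ((q * z) ^ 2) = p5
  field_simp

theorem orthoHalf_eq_zero (hq0 : 0 < q) (hq1 : q < 1) (a b c : ℂ) {z : ℂ} (hz : z ^ 2 = 1) :
    orthoHalf q a b c z = 0 := by
  rw [orthoHalf, hz, qPochInf_one hq0 hq1, zero_div]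

theorem continuousOn_sphere_of_differentiableAt {f : ℂ → ℂ} {r : ℝ} (hr : 0 ≤ r)
    (hf : ∀ z : ℂ, ‖z‖ = r → DifferentiableAt ℂ f z) : ContinuousOn f (Metric.sphere 0 |r|) :=
  fun z hz => (hf z (by rwa [mem_sphere_zero_iff_norm, abs_of_nonneg hr] at hz)).continuousAt
    |>.continuousWithinAt

theorem circleAverage_eq_zero_of_sphere {f : ℂ → ℂ} {R : ℝ} (hR : 0 ≤ R)
    (hf : ∀ z : ℂ, ‖z‖ = R → f z = 0) : circleAverage f 0 R = 0 :=
  Real.circleAverage_const_on_circle fun z hz =>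
    hf z (by rwa [mem_sphere_zero_iff_norm, abs_of_nonneg hR] at hz)

/-- The e-free part of the operator has Q_n as eigenfunction with eigenvalue (1 - q^n)/q^n ≠ 0. Its
range has mean zero: on |z| = q^{-1/2} the integrand is odd under z ↦ 1/(qz). -/
theorem circleAverage_ortho_mul_dualHahn (hq0 : 0 < q) (hq1 : q < 1) (ha : ‖a‖ < 1) (hb : ‖b‖ < 1)
    (hc : ‖c‖ < 1) {n : ℕ} (hn : n ≠ 0) :
    circleAverage (fun z => orthoHalf q a b c z * orthoHalf q a b c z⁻¹
      * dualHahn q a b c (z + 1 / z) n) 0 1 = 0 := by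
  have hs0 : 0 < √q := Real.sqrt_pos.mpr hq0
  have hss : √q * √q = q := Real.mul_self_sqrt hq0.le
  have hs1 : √q < 1 := by nlinarith
  have hq : (q : ℂ) ≠ 0 := by exact_mod_cast hq0.ne'
  set R : ℝ := (√q)⁻¹ with hR
  have hR1 : 1 ≤ R := (one_le_inv₀ hs0).mpr hs1.le
  have hR0 : 0 < R := one_pos.trans_le hR1
  have hqR : q * R = √q := by rw [hR, ← div_eq_mul_inv, div_eq_iff hs0.ne', hss]
  set Q : ℂ → ℂ := fun z => dualHahn q a b c (z + 1 / z) n with hQ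
  have hQi : ∀ z, Q z⁻¹ = Q z := fun z => by simp only [hQ, add_one_div_inv]
  have hQd : ∀ z : ℂ, z ≠ 0 → DifferentiableAt ℂ Q z := fun z hz =>
    ((differentiable_dualHahn n) _).comp z
      (differentiableAt_id.add ((differentiableAt_const _).div differentiableAt_id hz))
  set g : ℂ → ℂ := fun z => orthoHalf q a b c (q * z) * orthoHalf q a b c z⁻¹
    * (Q (q * z) - Q z) with hg
  have hgd : ∀ z : ℂ, 1 ≤ ‖z‖ → ‖z‖ ≤ R → DifferentiableAt ℂ g z := by
    intro z h1 h2
    have hz0 : z ≠ 0 := norm_pos_iff.mp (one_pos.trans_le h1)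
    have hm : DifferentiableAt ℂ (fun z : ℂ => (q : ℂ) * z) z := by fun_prop
    refine .fun_mul (.fun_mul
      ((differentiableAt_orthoHalf hq0 hq1 ha hb hc ?_).comp z hm)
      ((differentiableAt_orthoHalf hq0 hq1 ha hb hc ?_).comp z (differentiableAt_inv hz0)))
      (.fun_sub ((hQd _ (mul_ne_zero hq hz0)).comp z hm) (hQd z hz0))
    · rw [norm_mul, norm_real, Real.norm_of_nonneg hq0.le]; nlinarith
    · rw [norm_inv]; exact inv_le_one_of_one_le₀ h1
  have hc1 : ContinuousOn g (Metric.sphere 0 |1|) :=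
    continuousOn_sphere_of_differentiableAt one_pos.le fun z hz => hgd z hz.ge (by rw [hz]; exact hR1)
  have hcR : ContinuousOn g (Metric.sphere 0 |R|) :=
    continuousOn_sphere_of_differentiableAt hR0.le fun z hz => hgd z (by rw [hz]; exact hR1) hz.le
  have hzero : 2 * circleAverage g 0 1 = 0 := by
    rw [← circleAverage_eq_of_annulus one_pos hR1 hgd, ← circleAverage_add_reflect hR0 hcR]
    refine circleAverage_eq_zero_of_sphere hR0.le fun z hz => ?_
    have hz0 : z ≠ 0 := norm_pos_iff.mp (by rw [hz]; exact hR0)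
    have e1 : (R : ℂ) ^ 2 / z = (q * z)⁻¹ := by
      have : (R : ℂ) ^ 2 = (q : ℂ)⁻¹ := by
        rw [← ofReal_pow, ← ofReal_inv, hR, inv_pow, Real.sq_sqrt hq0.le]
      rw [this, div_eq_mul_inv, ← mul_inv]
    simp only [hg, e1, show (q : ℂ) * (q * z)⁻¹ = z⁻¹ by field_simp, inv_inv, hQi]
    ring
  have hmul : ((1 - (q : ℂ) ^ n) / (q : ℂ) ^ n) * circleAverage (fun z => orthoHalf q a b c z
      * orthoHalf q a b c z⁻¹ * Q z) 0 1 = 0 := by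
    rw [← smul_eq_mul, ← Real.circleAverage_fun_smul]
    refine Eq.trans ?_ ((circleAverage_add_reflect one_pos hc1).trans hzero)
    refine Real.circleAverage_congr_sphere fun z hz => ?_
    rw [mem_sphere_zero_iff_norm, abs_one] at hz
    have hz0 : z ≠ 0 := norm_pos_iff.mp (by rw [hz]; exact one_pos)
    have hzi : ‖z⁻¹‖ = 1 := by rw [norm_inv, hz, inv_one]
    have e1 : ((1 : ℝ) : ℂ) ^ 2 / z = z⁻¹ := by simp
    simp only [smul_eq_mul, hg, e1, hQi, inv_inv]
    by_cases hz2 : z ^ 2 = 1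
    · have hz2' : z⁻¹ ^ 2 = 1 := by rw [inv_pow, hz2, inv_one]
      rw [orthoHalf_eq_zero hq0 hq1 a b c hz2, orthoHalf_eq_zero hq0 hq1 a b c hz2']
      ring
    · have hz2' : z⁻¹ ^ 2 ≠ 1 := by rwa [inv_pow, Ne, inv_eq_one]
      have hz3 : (q : ℂ) * z ^ 2 ≠ 1 := fun h => by
        have := congrArg norm h
        rw [norm_mul, norm_pow, hz, norm_real, Real.norm_of_nonneg hq0.le, norm_one] at this
        linarith
      have hz4 : z ^ 2 ≠ q := fun h => by
        have := congrArg norm h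
        rw [norm_pow, hz, norm_real, Real.norm_of_nonneg hq0.le] at this
        linarith
      -- The equation is affine in e; subtracting the case e = 0 from e = 1 isolates the e-free
      -- operator and removes Q_{n-1}.
      have d1 := dualHahn_qDifference hq0 hq1 ha hb hc (e := 1) hz0 hz2 hz3 hz4 n
      have d0 := dualHahn_qDifference hq0 hq1 ha hb hc (e := 0) hz0 hz2 hz3 hz4 n
      rw [← orthoHalf_mul_awCoeff hq0 hq1 ha hb hc hz hz2,
        ← orthoHalf_mul_awCoeff hq0 hq1 ha hb hc hzi hz2']
      simp only [hQ]
      linear_combination -(orthoHalf q a b c z * orthoHalf q a b c z⁻¹) * (d1 - d0)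
  refine (mul_eq_zero.mp hmul).resolve_left (div_ne_zero ?_ (pow_ne_zero n hq))
  rw [sub_ne_zero, ne_comm]
  exact_mod_cast (pow_lt_one₀ hq0.le hq1 hn).ne

theorem circleAverage_ortho_mul_dualSeries (hq0 : 0 < q) (hq1 : q < 1) (ha : ‖a‖ < 1)
    (hb : ‖b‖ < 1) (hc : ‖c‖ < 1) {e : ℂ} (he : ‖e‖ < 1) (Y : ℂ) :
    circleAverage (fun z => orthoHalf q a b c z * orthoHalf q a b c z⁻¹
      * dualSeries q a b c e Y z) 0 1
      = circleAverage (fun z => orthoHalf q a b c z * orthoHalf q a b c z⁻¹) 0 1 := by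
  obtain ⟨ρ, hρ1, hρ2⟩ := exists_between he
  obtain ⟨v, hv, hb'⟩ := exists_dualSeries_bound hq0 hq1 ha hb hc ((norm_nonneg _).trans_lt hρ1) hρ2 ‖Y‖
  have hd : ∀ z : ℂ, ‖z‖ = 1 → DifferentiableAt ℂ (fun z => orthoHalf q a b c z
      * orthoHalf q a b c z⁻¹) z := fun z hz => by
    have hz0 : z ≠ 0 := norm_pos_iff.mp (by rw [hz]; exact one_pos)
    exact (differentiableAt_orthoHalf hq0 hq1 ha hb hc hz.le).mul
      ((differentiableAt_orthoHalf hq0 hq1 ha hb hc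
        (by rw [norm_inv, hz, inv_one])).comp z (differentiableAt_inv hz0))
  have hW := continuousOn_sphere_of_differentiableAt one_pos.le hd
  obtain ⟨C, hC⟩ := (isCompact_sphere (0 : ℂ) |(1 : ℝ)|).exists_bound_of_continuousOn hW
  set F : ℕ → ℂ := fun n => ∏ k ∈ Finset.range n, numFactor q e (a * b * c) Y k
  have hcm : ∀ θ : ℝ, ‖circleMap 0 1 θ‖ = 1 := fun θ => by simp
  have hcont : ∀ n, Continuous fun θ : ℝ => orthoHalf q a b c (circleMap 0 1 θ)
      * orthoHalf q a b c (circleMap 0 1 θ)⁻¹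
      * (F n * dualHahn q a b c (circleMap 0 1 θ + 1 / circleMap 0 1 θ) n) := fun n => by
    refine (hW.comp_continuous (continuous_circleMap 0 1) fun θ =>
      circleMap_mem_sphere' 0 1 θ).mul (continuous_const.mul ?_)
    refine (differentiable_dualHahn n).continuous.comp ((continuous_circleMap 0 1).add
      (continuous_const.div (continuous_circleMap 0 1) fun θ => circleMap_ne_center one_ne_zero))
  have hs : HasSum (fun n => circleAverage (fun z => orthoHalf q a b c z * orthoHalf q a b c z⁻¹
      * (F n * dualHahn q a b c (z + 1 / z) n)) 0 1) (circleAverage (fun z => orthoHalf q a b c z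
        * orthoHalf q a b c z⁻¹ * dualSeries q a b c e Y z) 0 1) := by
    simp only [Real.circleAverage_def]
    refine HasSum.const_smul _ (intervalIntegral.hasSum_integral_of_dominated_convergence
      (fun n _ => C * v n) (fun n => (hcont n).aestronglyMeasurable) (fun n => .of_forall
        fun θ _ => ?_) (.of_forall fun θ _ => hv.mul_left C) intervalIntegrable_const
        (.of_forall fun θ _ => ?_))
    · rw [norm_mul]
      have h1 := hC _ (circleMap_mem_sphere' 0 1 θ)
      exact mul_le_mul h1 (hb' e Y _ hρ1.le le_rfl (hcm θ).ge (by rw [hcm, mul_one]) n)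
        (norm_nonneg _) ((norm_nonneg _).trans h1)
    · exact ((summable_dualSeries hq0 hq1 ha hb hc (by rwa [hcm]) (by rwa [hcm, mul_one])).hasSum).mul_left _
  refine hs.unique ?_
  convert hasSum_single (f := fun n => circleAverage (fun z => orthoHalf q a b c z
    * orthoHalf q a b c z⁻¹ * (F n * dualHahn q a b c (z + 1 / z) n)) 0 1) 0 fun n hn => ?_ using 1
  · simp [F, dualHahn]
  · have := circleAverage_ortho_mul_dualHahn hq0 hq1 ha hb hc hn
    refine Eq.trans ?_ ((Real.circleAverage_fun_smul (a := F n)).trans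
      ((congrArg (F n • ·) this).trans (smul_zero _)))
    congr 1
    funext z
    rw [smul_eq_mul]
    ring

theorem ConjInvariant.conj_orthoHalf (hq0 : 0 < q) (hq1 : q < 1) (h : ConjInvariant a b c) (z : ℂ) :
    starRingEnd ℂ (orthoHalf q a b c z) = orthoHalf q a b c (starRingEnd ℂ z) := by
  simp only [orthoHalf, map_div₀, map_mul, conj_qPochInf hq0 hq1, map_pow]
  congr 1
  exact h.map_conj (fun a b c => qPochInf q (a * starRingEnd ℂ z) * qPochInf q (b * starRingEnd ℂ z)
    * qPochInf q (c * starRingEnd ℂ z)) (fun _ _ _ => by ring) (fun _ _ _ => by ring)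

theorem conj_eq_inv_of_norm_eq_one {z : ℂ} (hz : ‖z‖ = 1) : starRingEnd ℂ z = z⁻¹ := by
  rw [inv_def, normSq_eq_norm_sq, hz]
  simp

theorem qPochInf_neg_one_ne_zero (hq0 : 0 < q) (hq1 : q < 1) : qPochInf q (-1) ≠ 0 := by
  refine qPochInf_ne_zero hq0 hq1 fun k h => ?_
  have h1 : -1 * q ^ k = 1 := by exact_mod_cast h
  have := pow_pos hq0 k
  linarith

/-- Against the positive weight of the polynomials the series has the same mean as 1, which is
positive; hence it cannot vanish on the circle away from ±1. The points ±1 are excluded because the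
weight vanishes there. -/
theorem exists_dualSeries_ne_zero (hq0 : 0 < q) (hq1 : q < 1) (ha : ‖a‖ < 1)
    (hb : ‖b‖ < 1) (hc : ‖c‖ < 1) (h : ConjInvariant a b c) {e : ℂ} (he : ‖e‖ < 1) (Y : ℂ) :
    ∃ z : ℂ, ‖z‖ = 1 ∧ z ^ 2 ≠ 1 ∧ dualSeries q a b c e Y z ≠ 0 := by
  by_contra! hne
  have h1 := circleAverage_ortho_mul_dualSeries hq0 hq1 ha hb hc he Y
  have h2 : circleAverage (fun z => orthoHalf q a b c z * orthoHalf q a b c z⁻¹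
      * dualSeries q a b c e Y z) 0 1 = 0 := by
    refine circleAverage_eq_zero_of_sphere one_pos.le fun z hz => ?_
    by_cases hz2 : z ^ 2 = 1
    · simp only [orthoHalf_eq_zero hq0 hq1 a b c hz2, zero_mul]
    · simp only [hne z hz hz2, mul_zero]
  have hcont : ContinuousOn (fun z => ‖orthoHalf q a b c z‖ ^ 2) (Metric.sphere 0 |(1 : ℝ)|) :=
    (continuousOn_sphere_of_differentiableAt one_pos.le fun z hz =>
      differentiableAt_orthoHalf hq0 hq1 ha hb hc hz.le).norm.pow 2
  have h3 : circleAverage (fun z => orthoHalf q a b c z * orthoHalf q a b c z⁻¹) 0 1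
      = (circleAverage (fun z => ‖orthoHalf q a b c z‖ ^ 2) 0 1 : ℝ) := by
    rw [← circleAverage_ofReal hcont]
    refine Real.circleAverage_congr_sphere fun z hz => ?_
    rw [mem_sphere_zero_iff_norm, abs_one] at hz
    rw [← conj_eq_inv_of_norm_eq_one hz, ← h.conj_orthoHalf hq0 hq1, mul_conj, normSq_eq_norm_sq]
  rw [h2, h3] at h1
  have hI : orthoHalf q a b c I ≠ 0 := by
    have hn := fun x (hx : ‖x‖ < 1) => qPochInf_mul_ne_zero (z := I) hq0 hq1 hx (by simp)
    rw [orthoHalf, I_sq]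
    exact div_ne_zero (qPochInf_neg_one_ne_zero hq0 hq1)
      (mul_ne_zero (mul_ne_zero (hn a ha) (hn b hb)) (hn c hc))
  have := circleAverage_pos hcont (fun z _ => by positivity) (z := I) (by simp)
    (by have := norm_pos_iff.mpr hI; positivity)
  exact this.ne (by exact_mod_cast h1)

end Orthogonality

/-! ### Positivity of the dual series for non-positive spectral parameter -/

section Positivity
open scoped ComplexOrder

variable {q : ℝ} {a b c : ℂ}

theorem one_sub_mul_pos {x : ℝ} (hx : |x| ≤ 1) {a : ℂ} (ha : ‖a‖ < 1) (him : a.im = 0) :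
    0 < 1 - a * x := by
  rw [pos_iff]
  have h1 : |a.re * x| < 1 := by
    rw [abs_mul]
    nlinarith [abs_re_le_norm a, abs_nonneg a.re, abs_nonneg x]
  simp only [sub_re, one_re, mul_re, ofReal_re, ofReal_im, mul_zero, sub_zero, sub_im, one_im,
    mul_im, him, zero_mul, add_zero, sub_pos, and_true]
  exact lt_of_abs_lt h1

theorem one_sub_mul_mul_conj_pos {x : ℝ} (hx : |x| ≤ 1) {a : ℂ} (ha : ‖a‖ < 1) :
    0 < (1 - a * x) * (1 - starRingEnd ℂ a * x) := by
  have : (1 - starRingEnd ℂ a * x) = starRingEnd ℂ (1 - a * x) := by simp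
  rw [this, mul_conj, zero_lt_real, normSq_pos, sub_ne_zero]
  intro h
  have := congrArg norm h
  rw [norm_one, norm_mul, norm_real, Real.norm_eq_abs] at this
  nlinarith [norm_nonneg a, abs_nonneg x]

theorem ConjInvariant.prod_one_sub_pos (h : ConjInvariant a b c) (ha : ‖a‖ < 1) (hb : ‖b‖ < 1)
    (hc : ‖c‖ < 1) {x : ℝ} (hx : |x| ≤ 1) : 0 < (1 - a * x) * (1 - b * x) * (1 - c * x) := by
  rcases h with ⟨h1, h2, h3⟩ | ⟨rfl, h3⟩ | ⟨rfl, h3⟩ | ⟨rfl, h3⟩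
  · exact mul_pos (mul_pos (one_sub_mul_pos hx ha h1) (one_sub_mul_pos hx hb h2))
      (one_sub_mul_pos hx hc h3)
  · exact mul_pos (one_sub_mul_mul_conj_pos hx ha) (one_sub_mul_pos hx hc h3)
  · rw [mul_right_comm]
    exact mul_pos (one_sub_mul_mul_conj_pos hx ha) (one_sub_mul_pos hx hb h3)
  · rw [mul_assoc]
    exact mul_pos (one_sub_mul_pos hx ha h3) (one_sub_mul_mul_conj_pos hx hb)

theorem ConjInvariant.prod_qPoch_pos (hq0 : 0 < q) (hq1 : q < 1) (h : ConjInvariant a b c)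
    (ha : ‖a‖ < 1) (hb : ‖b‖ < 1) (hc : ‖c‖ < 1) {x : ℝ} (hx : |x| ≤ 1) (m : ℕ) :
    0 < qPoch q (a * x) m * qPoch q (b * x) m * qPoch q (c * x) m := by
  unfold qPoch
  rw [← Finset.prod_mul_distrib, ← Finset.prod_mul_distrib]
  refine Finset.prod_pos fun k _ => ?_
  have := h.prod_one_sub_pos ha hb hc (x := x * q ^ k) (by
    rw [abs_mul, abs_of_pos (pow_pos hq0 k)]
    have := pow_le_one₀ (n := k) hq0.le hq1.le
    have := pow_pos hq0 k
    nlinarith [abs_nonneg x])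
  push_cast at this
  simpa only [mul_assoc] using this

theorem qPoch_ofReal_pos (hq0 : 0 < q) (hq1 : q < 1) {x : ℝ} (hx : x < 1) (m : ℕ) :
    0 < qPoch q (x : ℂ) m := by
  unfold qPoch
  refine Finset.prod_pos fun k _ => ?_
  have h1 := pow_le_one₀ (n := k) hq0.le hq1.le
  have h2 := pow_pos hq0 k
  have : 0 < 1 - x * q ^ k := by
    rcases le_or_gt x 0 with h | h <;> nlinarith
  exact_mod_cast this

theorem ConjInvariant.pairs (h : ConjInvariant a b c) : ConjInvariant (a * b) (a * c) (b * c) := by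
  rcases h with ⟨h1, h2, h3⟩ | ⟨rfl, h3⟩ | ⟨rfl, h3⟩ | ⟨rfl, h3⟩
  · exact .inl (by simp [h1, h2, h3])
  · refine .inr (.inr (.inr ⟨?_, by simp [mul_conj]⟩))
    rw [map_mul, conj_eq_iff_im.mpr h3]
  · refine .inr (.inr (.inl ⟨?_, by simp [mul_conj]⟩))
    rw [map_mul, conj_eq_iff_im.mpr h3, mul_comm]
  · refine .inr (.inl ⟨?_, by simp [mul_conj]⟩)
    rw [map_mul, conj_eq_iff_im.mpr h3]

theorem ConjInvariant.vwpCoeff_inv_pos (hq0 : 0 < q) (hq1 : q < 1) (h : ConjInvariant a b c)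
    (ha : ‖a‖ < 1) (hb : ‖b‖ < 1) (hc : ‖c‖ < 1) {κ α : ℝ} (hκ : a * b * c = κ) (hκ1 : |κ| < 1)
    (hα0 : 0 < α) (hα1 : α < 1) (m : ℕ) : 0 < vwpCoeff q a b c ((α : ℂ)⁻¹) m := by
  have hκα : κ * α < 1 := by nlinarith [le_abs_self κ, abs_nonneg κ]
  have h1 := h.prod_qPoch_pos hq0 hq1 ha hb hc (x := α) (by rw [abs_of_pos hα0]; exact hα1.le) m
  have h2 := h.pairs.prod_qPoch_pos hq0 hq1 (norm_mul_lt_one ha hb) (norm_mul_lt_one ha hc)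
    (norm_mul_lt_one hb hc) (x := 1) (by simp) m
  simp only [ofReal_one, mul_one] at h2
  have h3 := qPoch_ofReal_pos hq0 hq1 hq1 m
  rw [vwpCoeff, hκ]
  simp only [div_inv_eq_mul]
  refine div_pos (mul_pos ?_ h1) (by rw [mul_assoc, mul_assoc, ← mul_assoc (qPoch q (a * b) m)]; exact mul_pos h3 h2)
  rcases m with _ | m
  · rw [vwpFactor_zero]; exact one_pos
  · rw [vwpFactor_succ]
    have h4 := qPoch_ofReal_pos hq0 hq1 hκα m
    have h5 : 0 < 1 - κ * α * q ^ (2 * m + 1) := by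
      have h1 := pow_le_one₀ (n := 2 * m + 1) hq0.le hq1.le
      have h2 := pow_pos hq0 (2 * m + 1)
      rcases le_or_gt (κ * α) 0 with h | h <;> nlinarith
    push_cast at h4
    exact mul_pos (by exact_mod_cast h5) h4

/-- The explicit sum is evaluated at 1/α, where a/z = aα and its companions have modulus less than
1. All terms are then positive; at α itself this could fail. -/
theorem ConjInvariant.dualHahn_pos (hq0 : 0 < q) (hq1 : q < 1) (h : ConjInvariant a b c)
    (ha : ‖a‖ < 1) (hb : ‖b‖ < 1) (hc : ‖c‖ < 1) {κ α : ℝ} (hκ : a * b * c = κ)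
    (hα0 : 0 < α) (hα1 : α < 1) (n : ℕ) : 0 < dualHahn q a b c (α + 1 / α) n := by
  have hκ1 : |κ| < 1 := by
    have := norm_mul_lt_one (norm_mul_lt_one ha hb) hc
    rwa [hκ, norm_real] at this
  have hκα : κ * α < 1 := by nlinarith [le_abs_self κ, abs_nonneg κ]
  have hαc : (α : ℂ) ≠ 0 := by exact_mod_cast hα0.ne'
  have hα' : 0 < (α : ℂ) := by exact_mod_cast hα0
  have hdef : ∀ k : ℕ, a * b * c / (α : ℂ)⁻¹ * (q : ℂ) ^ k ≠ 1 := by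
    rw [div_inv_eq_mul, hκ]
    refine mul_pow_ne_one_of_norm_lt_one hq0 hq1 ?_
    rw [norm_mul, norm_real, norm_real, Real.norm_eq_abs, Real.norm_of_nonneg hα0.le]
    nlinarith [abs_nonneg κ]
  have hs := vwpSum_eq hq0 hq1 ha hb hc (inv_ne_zero hαc) hdef n
  rw [add_one_div_inv, inv_pow, eq_comm, inv_mul_eq_iff_eq_mul₀ (pow_ne_zero n hαc)] at hs
  rw [hs]
  refine mul_pos (pow_pos hα' n) (Finset.sum_pos (fun m _ => ?_) ⟨0, by simp⟩)
  rw [vwpTerm, div_inv_eq_mul, hκ]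
  have h1 := h.vwpCoeff_inv_pos hq0 hq1 ha hb hc hκ hκ1 hα0 hα1 m
  have h2 := qPoch_ofReal_pos hq0 hq1 hq1 (n - m)
  have h3 := qPoch_ofReal_pos hq0 hq1 hκα (2 * m + (n - m))
  push_cast at h3
  exact div_pos (mul_pos h1 (pow_pos (by rw [← ofReal_inv]; exact_mod_cast inv_pos.mpr hα0) _))
    (mul_pos h2 h3)

/-- For Y ≤ 0 and e ≥ q every term of the series is nonnegative, and the term n = 0 equals 1. -/
theorem ConjInvariant.dualSeries_ne_zero_of_nonpos (hq0 : 0 < q) (hq1 : q < 1)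
    (h : ConjInvariant a b c) (ha : ‖a‖ < 1) (hb : ‖b‖ < 1) (hc : ‖c‖ < 1) {κ e α Y : ℝ}
    (hκ : a * b * c = κ) (hqe : q ≤ e) (heα : e < α) (hα1 : α < 1) (hY : Y ≤ 0) :
    dualSeries q a b c e Y α ≠ 0 := by
  have hκ1 : |κ| < 1 := by
    have := norm_mul_lt_one (norm_mul_lt_one ha hb) hc
    rwa [hκ, norm_real] at this
  have he0 : 0 < e := hq0.trans_le hqe
  have hα0 : 0 < α := he0.trans heα
  have hs := summable_dualSeries hq0 hq1 ha hb hc (e := e) (Y := Y) (z := α)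
    (by rwa [norm_real, norm_real, Real.norm_of_nonneg he0.le, Real.norm_of_nonneg hα0.le])
    (by rw [norm_real, norm_real, Real.norm_of_nonneg he0.le, Real.norm_of_nonneg hα0.le]; nlinarith)
  have hnn : ∀ n, 0 ≤ (∏ k ∈ Finset.range n, numFactor q (e : ℂ) (a * b * c) Y k)
      * dualHahn q a b c (α + 1 / α) n := fun n => by
    refine mul_nonneg (Finset.prod_nonneg fun k _ => ?_)
      (h.dualHahn_pos hq0 hq1 ha hb hc hκ hα0 hα1 n).le
    have : 0 ≤ (1 - q ^ k) * (e - κ * q ^ k) - q ^ k * Y := by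
      have h1 := pow_le_one₀ (n := k) hq0.le hq1.le
      have h2 := pow_pos hq0 k
      have h3 : 0 ≤ (1 - q ^ k) * (e - κ * q ^ k) := by
        rcases k with _ | k
        · simp
        -- The factor k = 0 is harmless since 1 - q^0 = 0; from k = 1 on, κ q^k ≤ q ≤ e.
        · have h4 : q ^ (k + 1) ≤ q := pow_le_of_le_one hq0.le hq1.le (by omega)
          refine mul_nonneg (by linarith) ?_
          nlinarith [le_abs_self κ, abs_nonneg κ]
      nlinarith
    rw [numFactor, hκ]
    exact_mod_cast this
  have h1 := hs.le_tsum 0 fun n _ => hnn n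
  rw [Finset.range_zero, Finset.prod_empty, one_mul, dualHahn] at h1
  exact (zero_lt_one.trans_le h1).ne'

end Positivity

/-! ### The zeros of the dual series are real, positive and simple -/

section Zeros
open Real (circleAverage)

variable {q : ℝ} {a b c : ℂ} {e α : ℝ}

theorem ConjInvariant.conj_weightHalf (hq0 : 0 < q) (hq1 : q < 1) (h : ConjInvariant a b c)
    (e α : ℝ) (z : ℂ) : starRingEnd ℂ (weightHalf q a b c e α z)
      = weightHalf q a b c e α (starRingEnd ℂ z) := by
  simp only [weightHalf, map_div₀, map_mul, conj_qPochInf hq0 hq1, map_pow, conj_ofReal]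
  congr 2
  exact h.map_conj (fun a b c => qPochInf q (a * starRingEnd ℂ z) * qPochInf q (b * starRingEnd ℂ z)
    * qPochInf q (c * starRingEnd ℂ z)) (fun _ _ _ => by ring) (fun _ _ _ => by ring)

theorem ConjInvariant.conj_kernelHalf (hq0 : 0 < q) (hq1 : q < 1) (h : ConjInvariant a b c)
    (e α : ℝ) (z : ℂ) : starRingEnd ℂ (kernelHalf q a b c e α z)
      = kernelHalf q a b c e α (starRingEnd ℂ z) := by
  simp only [kernelHalf, map_div₀, map_mul, conj_qPochInf hq0 hq1, map_pow, conj_ofReal]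
  congr 2
  exact h.map_conj (fun a b c => qPochInf q (a * (q * starRingEnd ℂ z))
    * qPochInf q (b * (q * starRingEnd ℂ z)) * qPochInf q (c * (q * starRingEnd ℂ z)))
    (fun _ _ _ => by ring) (fun _ _ _ => by ring)

theorem ConjInvariant.weight_eq (hq0 : 0 < q) (hq1 : q < 1) (h : ConjInvariant a b c)
    (e α : ℝ) {z : ℂ} (hz : ‖z‖ = 1) :
    weight q a b c e α z = (‖weightHalf q a b c e α z‖ ^ 2 : ℝ) := by
  rw [weight, ← conj_eq_inv_of_norm_eq_one hz, ← h.conj_weightHalf hq0 hq1, mul_conj,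
    normSq_eq_norm_sq]

theorem weightHalf_ne_zero (hq0 : 0 < q) (hq1 : q < 1) (ha : ‖a‖ < 1) (hb : ‖b‖ < 1)
    (hc : ‖c‖ < 1) {e α : ℂ} (he : ‖e‖ < 1) (hα1 : ‖α‖ < 1) (hqα : q < ‖α‖) {z : ℂ} (hz : ‖z‖ = 1)
    (hz2 : z ^ 2 ≠ 1) : weightHalf q a b c e α z ≠ 0 := by
  have := qPochInf_mul_div_ne_zero (α := α) (z := z) hq0 hq1 (by rwa [hz, mul_one])
  have hn := fun x (hx : ‖x‖ < 1) => qPochInf_mul_ne_zero hq0 hq1 hx hz.le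
  have hz3 : qPochInf q (z ^ 2) ≠ 0 := by
    refine qPochInf_ne_zero hq0 hq1 fun k hk => ?_
    rcases k with _ | k
    · exact hz2 (by simpa using hk)
    · have := congrArg norm hk
      rw [norm_mul, norm_pow, hz, one_pow, one_mul, norm_ofReal_pow hq0, norm_one] at this
      exact (pow_lt_one₀ hq0.le hq1 (Nat.succ_ne_zero k)).ne this
  simp [weightHalf, hz3, hn e he, hn a ha, hn b hb, hn c hc, hn α hα1, this]

theorem ConjInvariant.conj_dualSeries_sphere (h : ConjInvariant a b c) (e : ℝ) (Y : ℂ) {z : ℂ} (hz : ‖z‖ = 1) :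
    starRingEnd ℂ (dualSeries q a b c e Y z) = dualSeries q a b c e (starRingEnd ℂ Y) z := by
  rw [h.conj_dualSeries, conj_eq_inv_of_norm_eq_one hz, dualSeries_inv]

variable (hq0 : 0 < q) (hq1 : q < 1) (ha : ‖a‖ < 1) (hb : ‖b‖ < 1) (hc : ‖c‖ < 1)
  (h : ConjInvariant a b c) (he0 : 0 < e) (heα : e < α) (hqα : √q < α) (hα1 : α < 1)

include hq0 hq1 ha hb hc h he0 heα hqα hα1

/-- W is a squared modulus on the unit circle, nonzero off ±1, and the series is nonzero at some
such point, so this weighted squared norm is strictly positive. -/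
theorem ConjInvariant.weighted_norm_average (Y : ℂ) : ∃ P : ℝ, 0 < P ∧
    circleAverage (fun z => weight q a b c e α z * (dualSeries q a b c e Y z
      * starRingEnd ℂ (dualSeries q a b c e Y z))) 0 1 = P := by
  have hα0 : 0 < α := he0.trans heα
  have hs0 : 0 < √q := Real.sqrt_pos.mpr hq0
  have hss : √q * √q = q := Real.mul_self_sqrt hq0.le
  have hqα' : q < ‖(α : ℂ)‖ := by
    rw [norm_real, Real.norm_of_nonneg hα0.le]; nlinarith
  have hα1' : ‖(α : ℂ)‖ < 1 := by rwa [norm_real, Real.norm_of_nonneg hα0.le]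
  have he1 : ‖(e : ℂ)‖ < 1 := by rw [norm_real, Real.norm_of_nonneg he0.le]; linarith
  have hu : ContinuousOn (dualSeries q a b c e Y) (Metric.sphere 0 |(1 : ℝ)|) :=
    continuousOn_sphere_of_differentiableAt one_pos.le fun z hz =>
      differentiableAt_dualSeries hq0 hq1 ha hb hc Y (by rwa [hz]) (by rwa [hz, mul_one])
  have hw : ContinuousOn (weight q a b c e α) (Metric.sphere 0 |(1 : ℝ)|) := by
    rw [abs_one]; exact continuousOn_weight hq0 hq1 ha hb hc hα1' hqα'
  have heq : Set.EqOn (fun z => weight q a b c e α z * (dualSeries q a b c e Y z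
      * starRingEnd ℂ (dualSeries q a b c e Y z))) (fun z => (((weight q a b c e α z).re
        * ‖dualSeries q a b c e Y z‖ ^ 2 : ℝ) : ℂ)) (Metric.sphere 0 |(1 : ℝ)|) := fun z hz => by
    rw [mem_sphere_zero_iff_norm, abs_one] at hz
    simp only [h.weight_eq hq0 hq1 e α hz, mul_conj, normSq_eq_norm_sq, ofReal_re]
    push_cast
    rfl
  have hcont : ContinuousOn (fun z => (weight q a b c e α z).re * ‖dualSeries q a b c e Y z‖ ^ 2)
      (Metric.sphere 0 |(1 : ℝ)|) :=
    (continuous_re.comp_continuousOn hw).mul (hu.norm.pow 2)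
  obtain ⟨z, hz, hz2, hne⟩ := exists_dualSeries_ne_zero hq0 hq1 ha hb hc h he1 Y
  refine ⟨_, circleAverage_pos hcont (fun z hz => ?_) (z := z)
    (by rwa [mem_sphere_zero_iff_norm, abs_one]) ?_,
    (Real.circleAverage_congr_sphere heq).trans (circleAverage_ofReal hcont)⟩
  · rw [mem_sphere_zero_iff_norm, abs_one] at hz
    rw [h.weight_eq hq0 hq1 e α hz, ofReal_re]
    positivity
  · rw [h.weight_eq hq0 hq1 e α hz, ofReal_re]
    have h1 := norm_pos_iff.mpr hne
    have h2 := norm_pos_iff.mpr (weightHalf_ne_zero hq0 hq1 ha hb hc he1 hα1' hqα' hz hz2)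
    positivity

/-- If Y is a zero, so is its conjugate, and the symmetry relation for this pair becomes Y P =
conj(Y) P with P the positive squared norm. -/
theorem ConjInvariant.dualSeries_zero_real {Y : ℂ} (hY : dualSeries q a b c e Y α = 0) :
    starRingEnd ℂ Y = Y := by
  have hα0 : 0 < α := he0.trans heα
  have hY' : dualSeries q a b c e (starRingEnd ℂ Y) α = 0 := by
    have := congrArg (starRingEnd ℂ) hY
    rwa [h.conj_dualSeries, conj_ofReal, map_zero] at this
  have hG := dualSeries_symmetry (e := e) (α := α) hq0 hq1 ha hb hc
    (by rwa [norm_real, Real.norm_of_nonneg hα0.le])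
    (by rwa [norm_real, Real.norm_of_nonneg hα0.le])
    (by rwa [norm_real, norm_real, Real.norm_of_nonneg hα0.le, Real.norm_of_nonneg he0.le])
    Y (starRingEnd ℂ Y)
  obtain ⟨P, hP, hP'⟩ := h.weighted_norm_average hq0 hq1 ha hb hc he0 heα hqα hα1 Y
  have e1 : circleAverage (fun z => weight q a b c e α z * dualSeries q a b c e Y z
      * (dualSeries q a b c e (starRingEnd ℂ Y) z - dualSeries q a b c e (starRingEnd ℂ Y) α)) 0 1
      = P := by
    rw [← hP']
    refine Real.circleAverage_congr_sphere fun z hz => ?_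
    rw [mem_sphere_zero_iff_norm, abs_one] at hz
    simp only [hY', sub_zero, h.conj_dualSeries_sphere e Y hz]
    ring
  have e2 : circleAverage (fun z => weight q a b c e α z * dualSeries q a b c e (starRingEnd ℂ Y) z
      * (dualSeries q a b c e Y z - dualSeries q a b c e Y α)) 0 1 = P := by
    rw [← hP']
    refine Real.circleAverage_congr_sphere fun z hz => ?_
    rw [mem_sphere_zero_iff_norm, abs_one] at hz
    simp only [hY, sub_zero, h.conj_dualSeries_sphere e Y hz]
    ring
  rw [e1, e2] at hG
  exact (mul_right_cancel₀ (by exact_mod_cast hP.ne') hG).symm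

/-- Symmetry between X and the zero Y gives (X - Y) A(X) = -Y B U(X), with U(X) the value at α and
A(Y) = P > 0. Differentiating at Y yields P = -Y B U'(Y), so the zero is simple. -/
theorem ConjInvariant.deriv_dualSeries_ne_zero {Y : ℂ} (hY : dualSeries q a b c e Y α = 0) :
    deriv (fun Y => dualSeries q a b c e Y α) Y ≠ 0 := by
  have hα0 : 0 < α := he0.trans heα
  have hs0 : 0 < √q := Real.sqrt_pos.mpr hq0
  have hss : √q * √q = q := Real.mul_self_sqrt hq0.le
  have hnα : ‖(α : ℂ)‖ = α := by rw [norm_real, Real.norm_of_nonneg hα0.le]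
  have hne : ‖(e : ℂ)‖ = e := by rw [norm_real, Real.norm_of_nonneg he0.le]
  have hreal := h.dualSeries_zero_real hq0 hq1 ha hb hc he0 heα hqα hα1 hY
  obtain ⟨P, hP, hP'⟩ := h.weighted_norm_average hq0 hq1 ha hb hc he0 heα hqα hα1 Y
  set w := dualSeries q a b c e Y with hw
  have hwc : ContinuousOn w (Metric.sphere 0 |(1 : ℝ)|) :=
    continuousOn_sphere_of_differentiableAt one_pos.le fun z hz =>
      differentiableAt_dualSeries hq0 hq1 ha hb hc Y (by rw [hz, hne]; linarith)
        (by rw [hz, mul_one, hne]; linarith)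
  have hWc : ContinuousOn (weight q a b c e α) (Metric.sphere 0 |(1 : ℝ)|) := by
    rw [abs_one]
    exact continuousOn_weight hq0 hq1 ha hb hc (by rwa [hnα]) (by rw [hnα]; nlinarith)
  set A : ℂ → ℂ := fun X => circleAverage (fun z => weight q a b c e α z
    * dualSeries q a b c e X z * w z) 0 1 with hA
  set B : ℂ := circleAverage (fun z => weight q a b c e α z * w z) 0 1 with hB
  set U : ℂ → ℂ := fun X => dualSeries q a b c e X α with hU
  have hUd : Differentiable ℂ U := by
    rw [← differentiableOn_univ]
    exact differentiableOn_dualSeries_comp hq0 hq1 ha hb hc isOpen_univ (E := fun _ => (e : ℂ))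
      (Y := fun X => X) (Z := fun _ => (α : ℂ)) (by fun_prop) (by fun_prop) (by fun_prop)
      (fun _ _ => by rwa [hnα, hne]) fun _ _ => by rw [hnα, hne]; nlinarith
  have hAd : Differentiable ℂ A := by
    rw [← differentiableOn_univ]
    refine differentiableOn_circleAverage isOpen_univ ?_ fun z hz => ?_
    · have h2 : Set.MapsTo (Prod.snd : ℂ × ℂ → ℂ) (Set.univ ×ˢ Metric.sphere (0 : ℂ) |(1 : ℝ)|)
          (Metric.sphere (0 : ℂ) |(1 : ℝ)|) := fun p hp => hp.2
      have hz1 : ∀ p ∈ (Set.univ : Set ℂ) ×ˢ Metric.sphere (0 : ℂ) |(1 : ℝ)|, ‖p.2‖ = 1 :=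
        fun p hp => by
          have := hp.2
          rwa [mem_sphere_zero_iff_norm, abs_one] at this
      refine ((hWc.comp continuousOn_snd h2).mul (continuousOn_dualSeries_comp hq0 hq1 ha hb hc
        (E := fun _ : ℂ × ℂ => (e : ℂ)) continuousOn_const continuousOn_fst continuousOn_snd ?_ ?_)).mul
          (hwc.comp continuousOn_snd h2)
      · intro p hp
        rw [hz1 p hp, hne]; linarith
      · intro p hp
        rw [hz1 p hp, hne]; linarith
    · rw [mem_sphere_zero_iff_norm, abs_one] at hz
      exact ((differentiableOn_dualSeries_comp hq0 hq1 ha hb hc isOpen_univ (E := fun _ => (e : ℂ))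
        (Y := fun X => X) (Z := fun _ => z) (by fun_prop) (by fun_prop) (by fun_prop)
        (fun _ _ => by rw [hne, hz]; linarith)
        fun _ _ => by rw [hne, hz]; linarith).const_mul _).mul_const _
  have hrel : ∀ X, (X - Y) * A X = -(Y * B) * U X := by
    intro X
    have hG := dualSeries_symmetry (e := e) (α := α) hq0 hq1 ha hb hc (by rwa [hnα]) (by rwa [hnα])
      (by rwa [hnα, hne]) X Y
    rw [show dualSeries q a b c e Y α = 0 from hY] at hG
    simp only [sub_zero] at hG
    have hXc : ContinuousOn (dualSeries q a b c e X) (Metric.sphere 0 |(1 : ℝ)|) :=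
      continuousOn_sphere_of_differentiableAt one_pos.le fun z hz =>
        differentiableAt_dualSeries hq0 hq1 ha hb hc X (by rw [hz, hne]; linarith)
          (by rw [hz, mul_one, hne]; linarith)
    have e1 : circleAverage (fun z => weight q a b c e α z * w z
        * (dualSeries q a b c e X z - U X)) 0 1 = A X - U X * B := by
      have c1 : ContinuousOn (fun z => weight q a b c e α z * dualSeries q a b c e X z * w z)
          (Metric.sphere 0 |(1 : ℝ)|) := (hWc.mul hXc).mul hwc
      have c2 : ContinuousOn (fun z => U X • (weight q a b c e α z * w z))
          (Metric.sphere 0 |(1 : ℝ)|) := (hWc.mul hwc).const_smul (U X)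
      have hsub := Real.circleAverage_fun_sub c1.circleIntegrable' c2.circleIntegrable'
      rw [Real.circleAverage_fun_smul] at hsub
      rw [← smul_eq_mul (U X) B]
      refine Eq.trans ?_ hsub
      congr 1
      funext z
      simp only [smul_eq_mul]
      ring
    change X * A X = Y * circleAverage (fun z => weight q a b c e α z * w z
        * (dualSeries q a b c e X z - U X)) 0 1 at hG
    rw [e1] at hG
    linear_combination hG
  intro hd
  have d1 : HasDerivAt (fun X => (X - Y) * A X) (1 * A Y + (Y - Y) * deriv A Y) Y :=
    ((hasDerivAt_id Y).sub_const Y).mul (hAd Y).hasDerivAt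
  have d2 : HasDerivAt (fun X => -(Y * B) * U X) (-(Y * B) * 0) Y := by
    have := (hUd Y).hasDerivAt.const_mul (-(Y * B))
    rwa [hd] at this
  rw [funext hrel] at d1
  have h0 := d1.unique d2
  rw [sub_self, zero_mul, add_zero, one_mul, mul_zero] at h0
  have h1 : A Y = P := by
    rw [← hP']
    refine Real.circleAverage_congr_sphere fun z hz => ?_
    rw [mem_sphere_zero_iff_norm, abs_one] at hz
    simp only [hw, h.conj_dualSeries_sphere e Y hz, hreal, mul_assoc]
  rw [h1] at h0
  exact hP.ne' (by exact_mod_cast h0)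

/-- For e ≥ q all terms are nonnegative when Y ≤ 0. For e < q, Y times the squared norm equals a
Dirichlet form, which is nonnegative on the circle |z| = q^{-1/2}. -/
theorem ConjInvariant.dualSeries_zero_pos {Y : ℝ} (hY : dualSeries q a b c e Y α = 0) : 0 < Y := by
  have hα0 : 0 < α := he0.trans heα
  have hs0 : 0 < √q := Real.sqrt_pos.mpr hq0
  have hss : √q * √q = q := Real.mul_self_sqrt hq0.le
  have hs1 : √q < 1 := hqα.trans hα1
  have hnα : ‖(α : ℂ)‖ = α := by rw [norm_real, Real.norm_of_nonneg hα0.le]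
  have hne : ‖(e : ℂ)‖ = e := by rw [norm_real, Real.norm_of_nonneg he0.le]
  obtain ⟨κ, hκ⟩ := conj_eq_iff_real.mp h.conj_mul
  have hY0 : Y ≠ 0 := by
    rintro rfl
    rw [ofReal_zero, dualSeries_zero] at hY
    exact one_ne_zero hY
  rcases le_or_gt q e with hqe | heq
  · by_contra hneg
    exact h.dualSeries_ne_zero_of_nonpos hq0 hq1 ha hb hc hκ hqe heα hα1 (not_lt.mp hneg) hY
  refine lt_of_le_of_ne ?_ hY0.symm
  obtain ⟨P, hP, hP'⟩ := h.weighted_norm_average hq0 hq1 ha hb hc he0 heα hqα hα1 Y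
  have hF := dualSeries_bilinear_form (e := e) (α := α) hq0 hq1 ha hb hc (by rwa [hnα])
    (by rwa [hnα]) (by rwa [hne]) Y Y
  set w := dualSeries q a b c e Y with hw
  set R : ℝ := (√q)⁻¹ with hR
  have hR0 : 0 < R := inv_pos.mpr hs0
  have hqR : q * R = √q := by rw [hR, ← div_eq_mul_inv, div_eq_iff hs0.ne', hss]
  have e1 : circleAverage (fun z => weight q a b c e α z * w z * (w z - w α)) 0 1 = P := by
    rw [← hP']
    refine Real.circleAverage_congr_sphere fun z hz => ?_
    rw [mem_sphere_zero_iff_norm, abs_one] at hz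
    simp only [hY, sub_zero]
    rw [h.conj_dualSeries_sphere e Y hz, conj_ofReal, mul_assoc]
  have hcont : ContinuousOn (fun z => q / α * ‖kernelHalf q a b c e α z‖ ^ 2 * (4 * (w z).im ^ 2))
      (Metric.sphere 0 |R|) := by
    have h1 : ContinuousOn w (Metric.sphere 0 |R|) :=
      continuousOn_sphere_of_differentiableAt hR0.le fun z hz =>
        differentiableAt_dualSeries hq0 hq1 ha hb hc Y
          (by rw [hz, hne, hR]; exact (heα.trans hα1).trans (one_lt_inv₀ hs0 |>.mpr hs1))
          (by rw [hz, hne]; nlinarith)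
    have h2 : ContinuousOn (kernelHalf q a b c e α) (Metric.sphere 0 |R|) :=
      continuousOn_sphere_of_differentiableAt hR0.le fun z hz =>
        differentiableAt_kernelHalf hq0 hq1 ha hb hc (by rwa [hnα]) (by rwa [hz, hqR, hnα])
    exact (continuousOn_const.mul (h2.norm.pow 2)).mul
      (continuousOn_const.mul ((continuous_im.comp_continuousOn h1).pow 2))
  -- On this circle 1/(qz) is the conjugate of z, so w(qz) is the conjugate of w(z) and the kernel
  -- is q/α times a squared modulus. The squared difference is -4 (Im w)², and the two signs cancel.
  have e2 : -circleAverage (fun z => kernel q a b c e α z * (w z - w (q * z)) * (w z - w (q * z)))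
      0 R = (circleAverage (fun z => q / α * ‖kernelHalf q a b c e α z‖ ^ 2 * (4 * (w z).im ^ 2)) 0 R
        : ℝ) := by
    rw [← circleAverage_ofReal hcont, ← neg_one_mul, ← smul_eq_mul, ← Real.circleAverage_fun_smul]
    refine Real.circleAverage_congr_sphere fun z hz => ?_
    rw [mem_sphere_zero_iff_norm, abs_of_pos hR0] at hz
    have hqc : (q : ℂ) ≠ 0 := by exact_mod_cast hq0.ne'
    have hz0 : z ≠ 0 := norm_pos_iff.mp (by rw [hz]; exact hR0)
    have hzc : ((q : ℂ) * z)⁻¹ = starRingEnd ℂ z := by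
      rw [inv_eq_iff_eq_inv, ← div_eq_one_iff_eq (inv_ne_zero ((map_ne_zero _).mpr hz0)), div_inv_eq_mul,
        mul_assoc, mul_conj, normSq_eq_norm_sq, hz, hR, inv_pow, Real.sq_sqrt hq0.le, ofReal_inv,
        mul_inv_cancel₀ hqc]
    have hwq : w (q * z) = starRingEnd ℂ (w z) := by
      rw [hw, h.conj_dualSeries, conj_ofReal, ← dualSeries_inv, hzc]
    have hsub : w z - w (q * z) = 2 * (w z).im * I := by
      rw [hwq, sub_conj]
      push_cast
      ring
    simp only [smul_eq_mul, hsub]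
    rw [kernel, hzc, ← h.conj_kernelHalf hq0 hq1, mul_conj, normSq_eq_norm_sq]
    push_cast
    linear_combination (-1) * ((q : ℂ) / α * (‖kernelHalf q a b c e α z‖ : ℂ) ^ 2 * 4 * ((w z).im : ℂ) ^ 2) * I_sq
  rw [e1, e2] at hF
  have hF' : Y * P = circleAverage (fun z => q / α * ‖kernelHalf q a b c e α z‖ ^ 2
    * (4 * (w z).im ^ 2)) 0 R := by exact_mod_cast hF
  have hnn : 0 ≤ Y * P := by
    rw [hF']
    exact Real.circleAverage_nonneg_of_nonneg fun z _ => by positivity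
  exact nonneg_of_mul_nonneg_left hnn hP

end Zeros

/-! ### Counting zeros by Jensen's formula -/

section Counting
open Real (circleAverage)

/-- Jensen's formula with every multiplicity equal to 1. -/
theorem circleAverage_log_norm_eq_sum_of_simple_zeros {f : ℂ → ℂ} (hf : Differentiable ℂ f)
    (hf0 : f 0 ≠ 0) {y : ℕ → ℝ} (hy : StrictMono y) (hpos : ∀ n, 0 < y n)
    (hz : ∀ x, f x = 0 ↔ ∃ n, x = y n) (hd : ∀ n, deriv f (y n) ≠ 0) {R : ℝ} (hR : 0 < R) {M : ℕ}
    (hM : ∀ n, y n ≤ R ↔ n < M) :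
    circleAverage (fun x => Real.log ‖f x‖) 0 R
      = ∑ n ∈ Finset.range M, (Real.log R - Real.log (y n)) + Real.log ‖f 0‖ := by
  have hA : AnalyticOnNhd ℂ f (Metric.closedBall 0 |R|) := fun x _ => hf.analyticAt x
  rw [hA.circleAverage_log_norm hR.ne' hf0]
  congr 1
  have hinj : Function.Injective fun n => (y n : ℂ) := fun m n hmn =>
    hy.injective (ofReal_injective hmn)
  rw [finsum_eq_sum_of_support_subset (s := (Finset.range M).image fun n => (y n : ℂ)),
    Finset.sum_image hinj.injOn]
  · refine Finset.sum_congr rfl fun n hn => ?_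
    have hyR : (y n : ℂ) ∈ Metric.closedBall (0 : ℂ) |R| := by
      rw [mem_closedBall_zero_iff, norm_real, Real.norm_of_nonneg (hpos n).le, abs_of_pos hR]
      exact (hM n).mpr (Finset.mem_range.mp hn)
    rw [MeromorphicOn.AnalyticOnNhd.divisor_apply hA hyR, (hf.analyticAt _).analyticOrderAt_eq_one_of_zero_deriv_ne_zero
      ((hz _).mpr ⟨n, rfl⟩) (hd n), zero_sub, norm_neg, norm_real, Real.norm_of_nonneg (hpos n).le,
      ← div_eq_mul_inv, Real.log_div hR.ne' (hpos n).ne']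
    simp
  · intro u hu
    rw [Function.mem_support] at hu
    have hu1 : u ∈ Metric.closedBall (0 : ℂ) |R| := by
      by_contra hn
      rw [Function.locallyFinsuppWithin.apply_eq_zero_of_notMem _ hn] at hu
      simp at hu
    have hu2 : f u = 0 := by
      by_contra hn
      rw [MeromorphicOn.AnalyticOnNhd.divisor_apply hA hu1, (hf.analyticAt u).analyticOrderAt_eq_zero.mpr hn] at hu
      simp at hu
    obtain ⟨n, rfl⟩ := (hz u).mp hu2
    rw [mem_closedBall_zero_iff, norm_real, Real.norm_of_nonneg (hpos n).le, abs_of_pos hR] at hu1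
    simp only [Finset.coe_image, Finset.coe_range]
    exact ⟨n, (hM n).mp hu1, rfl⟩

theorem sum_range_natCast_mul (M : ℕ) : ∑ n ∈ Finset.range M, (n : ℝ) = M * (M - 1) / 2 := by
  induction M with
  | zero => simp
  | succ M ih => rw [Finset.sum_range_succ, ih]; push_cast; ring

/-- With M = N + 1 - k points below the level A + (N + 1/2) L, the sum is L M²/2 up to the errors
r_n, while N²/2 + N = ((M + k)² - 1)/2. The difference contains L k M; dividing by M and using
Cesàro means of r_n → 0 forces k = 0. -/
theorem index_eq_zero_of_counting {L A C : ℝ} (hL : 0 < L) {l : ℕ → ℝ} (hl : StrictMono l) {k : ℤ}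
    (hk : Tendsto (fun n : ℕ => l n - (A + (n + k) * L)) atTop (𝓝 0))
    (hC : ∀ᶠ N : ℕ in atTop, ∀ M : ℕ, (∀ n, l n ≤ A + (N + 1 / 2) * L ↔ n < M) →
      |∑ n ∈ Finset.range M, (A + (N + 1 / 2) * L - l n) - L * (N ^ 2 / 2 + N)| ≤ C) : k = 0 := by
  set r : ℕ → ℝ := fun n => l n - (A + (n + k) * L) with hr
  have hN : Tendsto (fun M : ℕ => ((M : ℤ) + k - 1).toNat) atTop atTop := by
    rw [tendsto_atTop_atTop]
    exact fun B => ⟨B + 1 + k.natAbs, fun M hM => by omega⟩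
  have hsmall : ∀ᶠ n in atTop, |r n| < L / 2 := by
    have := hk.abs
    rw [abs_zero] at this
    exact this.eventually_lt_const (by positivity)
  obtain ⟨n₀, hn₀⟩ := eventually_atTop.mp hsmall
  have hb : ∀ᶠ M : ℕ in atTop, |L * k * M + ∑ n ∈ Finset.range M, r n|
      ≤ C + L * k ^ 2 / 2 + L / 2 := by
    -- M is large enough for the last point below the level and the first one above it to be within
    -- L/2 of their predicted places, and for M + k - 1 to be a natural number.
    filter_upwards [hN.eventually hC, eventually_ge_atTop (n₀ + 1 + k.natAbs)] with M h1 h2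
    have hNM : ((((M : ℤ) + k - 1).toNat : ℕ) : ℝ) = M + k - 1 := by
      have : (((M : ℤ) + k - 1).toNat : ℤ) = M + k - 1 := Int.toNat_of_nonneg (by omega)
      exact_mod_cast congrArg (Int.cast (R := ℝ)) this
    have h3 := h1 M fun n => by
      rw [hNM]
      constructor
      · intro hn
        by_contra! hMn
        have e1 := hl.monotone hMn
        have e2 := (abs_lt.mp (hn₀ M (by omega))).1
        simp only [hr] at e2
        nlinarith
      · intro hn
        have e1 : l n ≤ l (M - 1) := hl.monotone (by omega)
        have e2 := (abs_lt.mp (hn₀ (M - 1) (by omega))).2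
        simp only [hr] at e2
        rw [Nat.cast_sub (by omega), Nat.cast_one] at e2
        nlinarith
    rw [hNM] at h3
    have h4 : ∑ n ∈ Finset.range M, (A + ((M : ℝ) + k - 1 + 1 / 2) * L - l n)
        = L * (M ^ 2 / 2) - ∑ n ∈ Finset.range M, r n := by
      have : ∀ n ∈ Finset.range M, A + ((M : ℝ) + k - 1 + 1 / 2) * L - l n
          = ((M : ℝ) - 1 / 2) * L - n * L - r n := fun n _ => by simp only [hr]; ring
      rw [Finset.sum_congr rfl this, Finset.sum_sub_distrib, Finset.sum_sub_distrib,
        ← Finset.sum_mul, ← Finset.sum_mul, sum_range_natCast_mul, Finset.sum_const,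
        Finset.card_range, nsmul_eq_mul]
      ring
    rw [h4, abs_le] at h3
    rw [abs_le]
    have h5 : 0 ≤ L * (k : ℝ) ^ 2 / 2 := by positivity
    constructor <;> nlinarith [h3.1, h3.2]
  have hlim : Tendsto (fun M : ℕ => (M : ℝ)⁻¹ * (L * k * M + ∑ n ∈ Finset.range M, r n)) atTop
      (𝓝 (L * k)) := by
    have h1 := hk.cesaro.const_add (L * k)
    rw [add_zero] at h1
    refine h1.congr' ?_
    filter_upwards [eventually_gt_atTop 0] with M hM
    have : (M : ℝ) ≠ 0 := by exact_mod_cast hM.ne'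
    field_simp
  have hlim0 : Tendsto (fun M : ℕ => (M : ℝ)⁻¹ * (L * k * M + ∑ n ∈ Finset.range M, r n)) atTop
      (𝓝 0) := by
    have h1 := (tendsto_inv_atTop_zero.comp (tendsto_natCast_atTop_atTop (R := ℝ))).mul_const
      (C + L * k ^ 2 / 2 + L / 2)
    rw [zero_mul] at h1
    refine squeeze_zero_norm' ?_ h1
    filter_upwards [hb] with M hM
    rw [norm_mul, norm_inv, Real.norm_natCast]
    exact mul_le_mul_of_nonneg_left hM (by positivity)
  have h0 := tendsto_nhds_unique hlim hlim0
  exact_mod_cast (mul_eq_zero.mp h0).resolve_left hL.ne'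

theorem log_norm_prod_scaleFactor {q : ℝ} (hq0 : 0 < q) {α : ℝ} (hα0 : 0 < α) {s : ℂ}
    (hs : ‖s‖ = α / √q) (N : ℕ) :
    Real.log ‖∏ k ∈ Finset.range N, scaleFactor q α s N k‖ = -Real.log q * (N ^ 2 / 2 + N) := by
  have hs0 : 0 < √q := Real.sqrt_pos.mpr hq0
  have hterm : ∀ k ∈ Finset.range N, Real.log ‖scaleFactor q α s N k‖
      = -Real.log q * (N + 1 / 2 - k) := by
    intro k hk
    have e1 : ‖scaleFactor q α s N k‖ = q ^ k / (√q * q ^ N) := by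
      rw [scaleFactor, if_pos (Finset.mem_range.mp hk), norm_div, norm_neg, norm_mul, norm_div,
        norm_ofReal_pow hq0, norm_ofReal_pow hq0, norm_real, Real.norm_of_nonneg hα0.le, hs]
      have := pow_pos hq0 N
      field_simp
    rw [e1, Real.log_div (by positivity) (by positivity), Real.log_mul (by positivity) (by positivity),
      Real.log_pow, Real.log_pow, Real.log_sqrt hq0.le]
    ring
  have hne : ∀ k ∈ Finset.range N, ‖scaleFactor q α s N k‖ ≠ 0 := fun k _ => by
    refine norm_ne_zero_iff.mpr (scaleFactor_ne_zero hq0 (by exact_mod_cast hα0.ne') (fun _ => ?_) k)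
    rw [← norm_pos_iff, hs]
    positivity
  rw [norm_prod, Real.log_prod hne, Finset.sum_congr rfl hterm, ← Finset.mul_sum,
    Finset.sum_sub_distrib, sum_range_natCast_mul, Finset.sum_const, Finset.card_range, nsmul_eq_mul]
  ring

/-- The radius α q^{-N-1/2} runs midway between consecutive zeros. There the limit of the scaled
function has no zeros, so its logarithm stays bounded and the main term comes from the scale factors
alone. -/
theorem exists_bound_circleAverage_log_spectralFun {q : ℝ} (hq0 : 0 < q) (hq1 : q < 1)
    {a b c e : ℂ} (ha : ‖a‖ < 1) (hb : ‖b‖ < 1) (hc : ‖c‖ < 1) (he : ‖e‖ < 1) {α : ℝ} (hα0 : 0 < α)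
    (hα1 : α < 1) (hdef : ∀ k : ℕ, a * b * c / α * (q : ℂ) ^ k ≠ 1) :
    ∃ C, ∀ᶠ N : ℕ in atTop, |circleAverage (fun x => Real.log ‖spectralFun q a b c e α x‖) 0
      (α / √q / q ^ N) - -Real.log q * (N ^ 2 / 2 + N)| ≤ C := by
  obtain ⟨-, -, -, i4, i5⟩ := sqrt_interval hq0 hq1 hα0
  set ρ : ℝ := α / √q with hρ
  have hρ0 : 0 < ρ := hα0.trans i4
  have hαc : (α : ℂ) ≠ 0 := by exact_mod_cast hα0.ne'
  have hnα : ‖(α : ℂ)‖ = α := by rw [norm_real, Real.norm_of_nonneg hα0.le]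
  have hα1' : ‖(α : ℂ)‖ < 1 := by rwa [hnα]
  set K := Metric.sphere (0 : ℂ) |ρ| with hK
  have hKn : ∀ s ∈ K, ‖s‖ = ρ := fun s hs => by
    rwa [mem_sphere_zero_iff_norm, abs_of_pos hρ0] at hs
  have hK0 : K ⊆ {0}ᶜ := fun s hs => norm_pos_iff.mp (by rw [hKn s hs]; exact hρ0)
  have hKc : IsCompact K := isCompact_sphere _ _
  set G : ℂ → ℂ := fun s => sixPhiFive q a b c α * qTheta q α s with hG
  have hGc : ContinuousOn G K :=
    continuousOn_const.mul ((differentiableOn_qTheta hq0 hq1 α).continuousOn.mono hK0)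
  have hG0 : ∀ s ∈ K, G s ≠ 0 := fun s hs => by
    refine mul_ne_zero (sixPhiFive_ne_zero hq0 hq1 ha hb hc hαc hα1' hdef)
      (qTheta_ne_zero hq0 hq1 hαc ?_ ?_ ?_)
    · rw [hnα, hKn s hs]; nlinarith
    · rwa [hnα, hKn s hs]
    · rintro rfl
      have := hKn _ hs
      rw [hnα] at this
      exact i4.ne this
  obtain ⟨s₁, hs₁, hmin⟩ := hKc.exists_isMinOn (NormedSpace.sphere_nonempty.mpr (abs_nonneg ρ)) hGc.norm
  obtain ⟨B, hB⟩ := hKc.exists_bound_of_continuousOn hGc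
  set m := ‖G s₁‖ with hm
  have hm0 : 0 < m := norm_pos_iff.mpr (hG0 s₁ hs₁)
  have hunif := (tendstoLocallyUniformlyOn_iff_tendstoUniformlyOn_of_compact hKc).mp
    ((tendstoLocallyUniformlyOn_scaledSpectralFun hq0 hq1 ha hb hc he hαc hα1').mono hK0)
  refine ⟨|Real.log (m / 2)| + |Real.log (B + m / 2)|, ?_⟩
  filter_upwards [Metric.tendstoUniformlyOn_iff.mp hunif (m / 2) (by positivity)] with N hN
  have hlow : ∀ s ∈ K, m / 2 ≤ ‖scaledSpectralFun q a b c e α N s‖ := fun s hs => by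
    have h1 := hN s hs
    have h2 : m ≤ ‖G s‖ := hmin hs
    rw [dist_eq_norm] at h1
    have h3 := norm_sub_norm_le (G s) (scaledSpectralFun q a b c e α N s)
    linarith
  have hupp : ∀ s ∈ K, ‖scaledSpectralFun q a b c e α N s‖ ≤ B + m / 2 := fun s hs => by
    have h1 := hN s hs
    have h2 := hB s hs
    rw [dist_comm, dist_eq_norm] at h1
    have h3 := norm_sub_norm_le (scaledSpectralFun q a b c e α N s) (G s)
    linarith
  have hcont : ContinuousOn (fun s => Real.log ‖scaledSpectralFun q a b c e α N s‖) K :=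
    (((differentiableOn_scaledSpectralFun hq0 hq1 ha hb hc he hαc hα1' N).continuousOn.mono
      hK0).norm).log fun s hs => by have := hlow s hs; exact ((half_pos hm0).trans_le this).ne'
  have hqN : (0 : ℝ) < q ^ N := pow_pos hq0 N
  have e1 : circleAverage (fun x => Real.log ‖spectralFun q a b c e α x‖) 0 (ρ / q ^ N)
      = circleAverage (fun s => Real.log ‖scaledSpectralFun q a b c e α N s‖
        + -Real.log q * (N ^ 2 / 2 + N)) 0 ρ := by
    have e2 : circleAverage (fun x => Real.log ‖spectralFun q a b c e α x‖) 0 (ρ / q ^ N)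
        = circleAverage (fun s => Real.log ‖spectralFun q a b c e α (s / (q : ℂ) ^ N)‖) 0 ρ := by
      rw [Real.circleAverage_eq_circleAverage_zero_one,
        Real.circleAverage_eq_circleAverage_zero_one (R := ρ)]
      congr 1
      funext s
      rw [add_zero, add_zero]
      push_cast
      rw [div_mul_eq_mul_div]
    rw [e2]
    refine Real.circleAverage_congr_sphere fun s hs => ?_
    have hp : ∏ k ∈ Finset.range N, scaleFactor q α s N k ≠ 0 := Finset.prod_ne_zero_iff.mpr
      fun k _ => scaleFactor_ne_zero hq0 hαc (fun _ => hK0 hs) k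
    have hsc : ‖scaledSpectralFun q a b c e α N s‖ ≠ 0 := by have := hlow s hs; exact ((half_pos hm0).trans_le this).ne'
    have e3 : spectralFun q a b c e α (s / (q : ℂ) ^ N) = scaledSpectralFun q a b c e α N s
        * ∏ k ∈ Finset.range N, scaleFactor q α s N k := by
      rw [scaledSpectralFun, div_mul_cancel₀ _ hp]
    rw [e3, norm_mul, Real.log_mul hsc (norm_ne_zero_iff.mpr hp),
      log_norm_prod_scaleFactor hq0 hα0 (hKn s hs) N]
  rw [e1, Real.circleAverage_fun_add hcont.circleIntegrable'
    (continuousOn_const (s := K)).circleIntegrable', Real.circleAverage_const, add_sub_cancel_right]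
  have l1 : ∀ s ∈ K, Real.log (m / 2) ≤ Real.log ‖scaledSpectralFun q a b c e α N s‖ := fun s hs =>
    Real.log_le_log (by positivity) (hlow s hs)
  have l2 : ∀ s ∈ K, Real.log ‖scaledSpectralFun q a b c e α N s‖ ≤ Real.log (B + m / 2) :=
    fun s hs => Real.log_le_log ((by positivity : 0 < m / 2).trans_le (hlow s hs)) (hupp s hs)
  have m1 := Real.circleAverage_mono (continuousOn_const (s := K)
    (c := Real.log (m / 2))).circleIntegrable' hcont.circleIntegrable' l1
  have m2 := Real.circleAverage_mono_on_of_le_circle hcont.circleIntegrable' l2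
  rw [Real.circleAverage_const] at m1
  rw [abs_le]
  constructor
  · linarith [neg_abs_le (Real.log (m / 2)), abs_nonneg (Real.log (B + m / 2))]
  · linarith [le_abs_self (Real.log (B + m / 2)), abs_nonneg (Real.log (m / 2))]

end Counting

/-! ### The index shift in the asymptotics of the zeros -/

/-- Positivity at μ means e t_μ > κ, and this persists for larger ν. So Y may be negative at first,
but it increases once it is positive. -/
theorem specParam_lt_specParam {q e κ : ℝ} (hq0 : 0 < q) (hq1 : q < 1) {μ ν : ℝ} (hμ0 : 0 < μ)
    (hμν : μ < ν) (he : 0 < e) (hμ : 0 < specParam q e κ μ) :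
    specParam q e κ μ < specParam q e κ ν := by
  have ht : ∀ x : ℝ, 0 < x → 1 < q ^ (-x) := fun x hx => by
    have := strictMono_rpow_neg hq0 hq1 hx
    simpa using this
  have hlt : q ^ (-μ) < q ^ (-ν) := strictMono_rpow_neg hq0 hq1 hμν
  have h1 := ht μ hμ0
  have h2 := ht ν (hμ0.trans hμν)
  rw [← sub_pos, specParam_sub hq0]
  refine mul_pos (sub_pos.mpr hlt) ?_
  rw [specParam, mul_pos_iff_of_pos_left (sub_pos.mpr h1), sub_pos, div_lt_iff₀ (by linarith)] at hμ
  rw [sub_pos, div_lt_iff₀ (by positivity)]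
  have : 0 < e * q ^ (-μ) := by positivity
  nlinarith

theorem exists_specParam_eq {q e κ : ℝ} (hq0 : 0 < q) (hq1 : q < 1) (he : 0 < e) {Y : ℝ}
    (hY : 0 < Y) : ∃ ν, 0 < ν ∧ specParam q e κ ν = Y := by
  have h0 : specParam q e κ 0 = 0 := by simp [specParam]
  obtain ⟨B, hB, hB0⟩ := (((tendsto_specParam_atTop (κ := κ) hq0 hq1 he).eventually_ge_atTop Y).and
    (eventually_ge_atTop 0)).exists
  obtain ⟨ν, hν, hνY⟩ := intermediate_value_Icc hB0
    (continuous_specParam (e := e) (κ := κ) hq0).continuousOn (show Y ∈ Set.Icc _ _ from ⟨by rw [h0]; exact hY.le, hB⟩)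
  refine ⟨ν, lt_of_le_of_ne hν.1 ?_, hνY⟩
  rintro rfl
  rw [h0] at hνY
  exact hY.ne hνY

theorem tendsto_log_specParam_sub {q e κ : ℝ} (hq0 : 0 < q) (hq1 : q < 1) (he : 0 < e) {α : ℝ}
    (hα : 0 < α) {z : ℕ → ℝ} {k : ℤ}
    (hk : Tendsto (fun n : ℕ => z n - ((n : ℝ) + k + -(Real.log (α / e) / Real.log q)))
        atTop (𝓝 0)) :
    Tendsto (fun n : ℕ => Real.log (specParam q e κ (z n))
      - (Real.log α + (n + k) * -Real.log q)) atTop (𝓝 0) := by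
  have hlq : Real.log q ≠ 0 := (Real.log_neg hq0 hq1).ne
  have hz : Tendsto z atTop atTop := by
    have h1 : Tendsto (fun n : ℕ => (n : ℝ) + (k + -(Real.log (α / e) / Real.log q))) atTop atTop :=
      tendsto_atTop_add_const_right _ _ tendsto_natCast_atTop_atTop
    refine (h1.atTop_add hk).congr fun n => ?_
    ring
  have h1 := ((tendsto_specParam_div (e := e) (κ := κ) hq0 hq1).comp hz).log he.ne'
  have h2 := (h1.sub_const (Real.log e)).sub (hk.mul_const (Real.log q))
  rw [sub_self, zero_mul, sub_zero] at h2
  refine h2.congr' ?_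
  filter_upwards [hz.eventually ((tendsto_specParam_atTop (κ := κ) hq0 hq1 he).eventually_gt_atTop 0)]
    with n hn
  rw [Function.comp_apply, Real.log_div hn.ne' (Real.rpow_pos_of_pos hq0 _).ne', Real.log_rpow hq0,
    Real.log_div hα.ne' he.ne']
  field_simp
  ring

/-- All complex zeros of H are positive and simple, and each positive Y is attained at a positive ν.
The images of the enumerated ν thus exhaust the zeros in increasing order, and the counting argument
applies. -/
theorem enumeration_index_eq_zero {q : ℝ} (hq0 : 0 < q) (hq1 : q < 1) {a b c : ℂ} (ha : ‖a‖ < 1)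
    (hb : ‖b‖ < 1) (hc : ‖c‖ < 1) (hreal : ConjInvariant a b c) {κ e α : ℝ}
    (he0 : 0 < e) (heα : e < α) (hqα : √q < α) (hα1 : α < 1)
    (hdef : ∀ k : ℕ, a * b * c / α * (q : ℂ) ^ k ≠ 1) {z : ℕ → ℝ} {k : ℤ} (hz : StrictMono z)
    (hr : Set.range z = {ν : ℝ | 0 < ν ∧ spectralFun q a b c e α (specParam q e κ ν) = 0})
    (hk : Tendsto (fun n : ℕ => z n - ((n : ℝ) + k + -(Real.log (α / e) / Real.log q)))
        atTop (𝓝 0)) : k = 0 := by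
  have hα0 : 0 < α := he0.trans heα
  have hαc : (α : ℂ) ≠ 0 := by exact_mod_cast hα0.ne'
  have hec : (e : ℂ) ≠ 0 := by exact_mod_cast he0.ne'
  have hnα : ‖(α : ℂ)‖ = α := by rw [norm_real, Real.norm_of_nonneg hα0.le]
  have hne : ‖(e : ℂ)‖ = e := by rw [norm_real, Real.norm_of_nonneg he0.le]
  have hα1' : ‖(α : ℂ)‖ < 1 := by rwa [hnα]
  have he1 : ‖(e : ℂ)‖ < 1 := by rw [hne]; exact heα.trans hα1
  have hlq : 0 < -Real.log q := neg_pos.mpr (Real.log_neg hq0 hq1)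
  set f := spectralFun q a b c e α with hf
  set A : ℂ := qPochInf q (e / α) * qPochInf q (a * b * c / α) with hA
  have hfU : f = fun Y => A * dualSeries q a b c e Y α := funext fun Y =>
    spectralFun_eq_dualSeries hq0 hq1 ha hb hc hec hαc hα1' (by rwa [hne, hnα]) hdef Y
  have hA0 : A ≠ 0 := mul_ne_zero (qPochInf_ne_zero_of_norm_lt_one hq0 hq1 (by
    rw [norm_div, hne, hnα]; exact (div_lt_one hα0).mpr heα)) (qPochInf_ne_zero hq0 hq1 hdef)
  have hfd : Differentiable ℂ f := differentiable_spectralFun hq0 hq1 ha hb hc he1 hαc hα1'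
  have hUz : ∀ Y, f Y = 0 → dualSeries q a b c e Y α = 0 := fun Y hY => by
    rw [hfU] at hY
    exact (mul_eq_zero.mp hY).resolve_left hA0
  have hf0 : f 0 ≠ 0 := fun h0 => by
    have := hUz 0 h0
    rw [dualSeries_zero] at this
    exact one_ne_zero this
  have hpos : ∀ Y : ℝ, f Y = 0 → 0 < Y := fun Y hY =>
    hreal.dualSeries_zero_pos hq0 hq1 ha hb hc he0 heα hqα hα1 (hUz Y hY)
  have hderiv : ∀ Y, f Y = 0 → deriv f Y ≠ 0 := fun Y hY => by
    have h1 := hreal.deriv_dualSeries_ne_zero hq0 hq1 ha hb hc he0 heα hqα hα1 (hUz Y hY)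
    rw [hfU, deriv_const_mul_field]
    exact mul_ne_zero hA0 h1
  have hmem : ∀ n, 0 < z n ∧ f (specParam q e κ (z n)) = 0 := fun n => by
    have : z n ∈ Set.range z := ⟨n, rfl⟩
    rwa [hr] at this
  set y : ℕ → ℝ := fun n => specParam q e κ (z n) with hy
  have hypos : ∀ n, 0 < y n := fun n => hpos _ (hmem n).2
  have hymono : StrictMono y := fun m n hmn =>
    specParam_lt_specParam hq0 hq1 (hmem m).1 (hz hmn) he0 (hypos m)
  have hyz : ∀ x, f x = 0 ↔ ∃ n, x = y n := fun x => by
    constructor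
    · intro hx
      obtain ⟨Y, rfl⟩ := conj_eq_iff_real.mp
        (hreal.dualSeries_zero_real hq0 hq1 ha hb hc he0 heα hqα hα1 (hUz x hx))
      obtain ⟨ν, hν0, hν⟩ := exists_specParam_eq (κ := κ) hq0 hq1 he0 (hpos Y hx)
      have : ν ∈ Set.range z := by
        rw [hr]
        exact ⟨hν0, by rwa [hν]⟩
      obtain ⟨n, rfl⟩ := this
      exact ⟨n, by rw [hy, ← hν]⟩
    · rintro ⟨n, rfl⟩
      exact (hmem n).2
  obtain ⟨C, hC⟩ := exists_bound_circleAverage_log_spectralFun hq0 hq1 ha hb hc he1 hα0 hα1 hdef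
  refine index_eq_zero_of_counting (A := Real.log α) (C := C + |Real.log ‖f 0‖|) hlq
    (l := fun n => Real.log (y n)) (fun m n hmn => Real.log_lt_log (hypos m) (hymono hmn))
    (tendsto_log_specParam_sub hq0 hq1 he0 hα0 hk) ?_
  filter_upwards [hC] with N hN M hM
  have hR : 0 < α / √q / q ^ N := by
    have := Real.sqrt_pos.mpr hq0
    positivity
  have hlR : Real.log (α / √q / q ^ N) = Real.log α + (N + 1 / 2) * -Real.log q := by
    have := Real.sqrt_pos.mpr hq0
    rw [Real.log_div (by positivity) (by positivity), Real.log_div (by positivity) (by positivity),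
      Real.log_sqrt hq0.le, Real.log_pow]
    ring
  have hJ := circleAverage_log_norm_eq_sum_of_simple_zeros hfd hf0 hymono hypos hyz
    (fun n => hderiv _ ((hyz _).mpr ⟨n, rfl⟩)) hR (M := M) fun n => by
      rw [← hM n, ← hlR, Real.log_le_log_iff (hypos n) hR]
  rw [hJ, hlR] at hN
  have h1 := abs_sub_abs_le_abs_sub (∑ n ∈ Finset.range M, (Real.log α + (N + 1 / 2) * -Real.log q
    - Real.log (y n)) - -Real.log q * (N ^ 2 / 2 + N)) (-Real.log ‖f 0‖)
  rw [abs_neg, sub_neg_eq_add] at h1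
  rw [add_sub_right_comm] at hN
  linarith

/-! ### Return to the boundary function and reduction to positive α and d -/

theorem boundaryFun_neg (q : ℝ) (a b c : ℂ) (d α ν : ℝ) :
    boundaryFun q (-a) (-b) (-c) (-d) (-α) ν = boundaryFun q a b c d α ν := by
  unfold boundaryFun
  have e1 : -a * -b * -c / ((-α : ℝ) : ℂ) = a * b * c / α := by
    push_cast
    rw [show -a * -b * -c = -(a * b * c) by ring, neg_div_neg_eq]
  have e2 : q * -α / -d = q * α / d := by rw [mul_neg, neg_div_neg_eq]
  have e3 : ∀ x : ℂ, -x / ((-α : ℝ) : ℂ) = x / α := fun x => by push_cast; rw [neg_div_neg_eq]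
  have e4 : -a * -b * -c * ((-d : ℝ) : ℂ) = a * b * c * d := by push_cast; ring
  rw [e1, e2, e4, neg_mul_neg, e3, e3, e3]
  simp only [neg_mul_neg]

theorem ConjInvariant.neg {a b c : ℂ} (h : ConjInvariant a b c) : ConjInvariant (-a) (-b) (-c) := by
  unfold ConjInvariant at *
  simpa only [map_neg, neg_im, neg_eq_zero, neg_inj] using h

theorem exists_boundaryFun_zero_enumeration {q : ℝ} (hq0 : 0 < q) (hq1 : q < 1) {a b c : ℂ}
    {d α : ℝ} (ha : ‖a‖ < 1) (hb : ‖b‖ < 1) (hc : ‖c‖ < 1) (hd : q < d) (hα0 : 0 < α) (hα1 : α < 1)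
    (hreal : ConjInvariant a b c) (hdef : ∀ k : ℕ, a * b * c / α * (q : ℂ) ^ k ≠ 1) :
    ∃ z : ℕ → ℝ, StrictMono z ∧
      Set.range z = {ν : ℝ | 0 < ν ∧ boundaryFun q a b c d α ν = 0} ∧
      (∃ k : ℤ, Tendsto
        (fun n : ℕ => z n - (((n : ℝ) + 1 + k) - Real.log (α * d) / Real.log q))
        atTop (𝓝 0)) ∧
      (Real.sqrt q < α → q < α * d → Tendsto
        (fun n : ℕ => z n - (((n : ℝ) + 1) - Real.log (α * d) / Real.log q))
        atTop (𝓝 0)) := by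
  have hd0 : 0 < d := hq0.trans hd
  obtain ⟨κ, hκ⟩ := conj_eq_iff_real.mp hreal.conj_mul
  have he0 : 0 < q / d := div_pos hq0 hd0
  have he1 : q / d < 1 := (div_lt_one hd0).mpr hd
  obtain ⟨z, k, hz, hr, hk⟩ := exists_zero_enumeration (κ := κ) hq0 hq1 ha hb hc hreal he0 he1
    hα0 hα1 hdef
  have hlq : Real.log q ≠ 0 := (Real.log_neg hq0 hq1).ne
  -- Since e = q/d, log(α/e) = log(αd) - log q. This produces the summand 1 that matches an
  -- enumeration starting at 0, where z n is the (n+1)-st zero.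
  have hlog : -(Real.log (α / (q / d)) / Real.log q) = 1 - Real.log (α * d) / Real.log q := by
    rw [← div_mul, mul_comm, ← mul_div_assoc, mul_comm d, Real.log_div (by positivity) hq0.ne']
    field_simp
    ring
  have hset : {ν : ℝ | 0 < ν ∧ spectralFun q a b c ((q / d : ℝ) : ℂ) α (specParam q (q / d) κ ν) = 0}
      = {ν : ℝ | 0 < ν ∧ boundaryFun q a b c d α ν = 0} := by
    ext ν
    refine and_congr_right fun _ => ?_
    rw [boundaryFun_eq_spectralFun hq0 hq1 a b c hd0.ne' hα0.ne', mul_eq_zero, or_iff_right]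
    · have : ((specParam q (q / d) κ ν : ℝ) : ℂ) = (((q ^ (-ν) : ℝ) : ℂ) - 1)
          * (((q / d : ℝ) : ℂ) - a * b * c / ((q ^ (-ν) : ℝ) : ℂ)) := by
        rw [specParam, hκ]
        push_cast
        rfl
      rw [this]
    · refine div_ne_zero (qPochInf_ne_zero_of_norm_lt_one hq0 hq1 ?_)
        (qPochInf_ne_zero hq0 hq1 hdef)
      rw [norm_real, Real.norm_of_nonneg (by positivity), div_lt_one hd0]
      nlinarith
  refine ⟨z, hz, hr.trans hset, ⟨k, hk.congr fun n => ?_⟩, fun h1 h2 => ?_⟩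
  · rw [hlog]; ring
  · have h0 : k = 0 := enumeration_index_eq_zero hq0 hq1 ha hb hc hreal he0
      (by rwa [div_lt_iff₀ hd0]) h1 hα1 hdef hz hr hk
    refine hk.congr fun n => ?_
    rw [hlog, h0]
    push_cast
    ring

open Filter Topology in
theorem theorem5p5 (q : ℝ) (hq0 : 0 < q) (hq1 : q < 1) (a b c : ℂ) (d α : ℝ)
    (ha : ‖a‖ < 1) (hb : ‖b‖ < 1) (hc : ‖c‖ < 1) (hd : q < |d|)
    (hα : α ^ 2 < 1) (hαd : 0 < α * d)
    (hreal : (a.im = 0 ∧ b.im = 0 ∧ c.im = 0) ∨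
      (b = starRingEnd ℂ a ∧ c.im = 0) ∨
      (c = starRingEnd ℂ a ∧ b.im = 0) ∨
      (c = starRingEnd ℂ b ∧ a.im = 0))
    (hdef : ∀ k : ℕ, a * b * c / α * (q : ℂ) ^ k ≠ 1) :
    ∃ z : ℕ → ℝ, StrictMono z ∧
      Set.range z = {ν : ℝ | 0 < ν ∧ boundaryFun q a b c d α ν = 0} ∧
      (∃ k : ℤ, Tendsto
        (fun n : ℕ => z n - (((n : ℝ) + 1 + k) - Real.log (α * d) / Real.log q))
        atTop (𝓝 0)) ∧
      (Real.sqrt q < |α| → q < α * d → Tendsto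
        (fun n : ℕ => z n - (((n : ℝ) + 1) - Real.log (α * d) / Real.log q))
        atTop (𝓝 0)) := by
  have hα1 : |α| < 1 := (sq_lt_one_iff_abs_lt_one α).mp hα
  have hreal' : ConjInvariant a b c := hreal
  rcases pos_and_pos_or_neg_and_neg_of_mul_pos hαd with ⟨h1, h2⟩ | ⟨h1, h2⟩
  · rw [abs_of_pos h1] at hα1 ⊢
    rw [abs_of_pos h2] at hd
    exact exists_boundaryFun_zero_enumeration hq0 hq1 ha hb hc hd h1 hα1 hreal' hdef
  -- Both α and d are negative here; reversing all five signs preserves the boundary function, αd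
  -- and the nonvanishing condition.
  · rw [abs_of_neg h1] at hα1 ⊢
    rw [abs_of_neg h2] at hd
    have e1 : -a * -b * -c / ((-α : ℝ) : ℂ) = a * b * c / α := by
      push_cast
      rw [show -a * -b * -c = -(a * b * c) by ring, neg_div_neg_eq]
    have h := exists_boundaryFun_zero_enumeration (a := -a) (b := -b) (c := -c) (α := -α) (d := -d)
      hq0 hq1 (by rwa [norm_neg]) (by rwa [norm_neg]) (by rwa [norm_neg]) hd (by linarith) hα1
      hreal'.neg (by rwa [e1])
    simpa only [boundaryFun_neg, neg_mul_neg] using h
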